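/- Let $(X_i)_{i\ge1}$ be i.i.d. $\mathbb Z$-valued random variables with $\mathbf E[X_1]=0$, let $S_n=X_1+\cdots+X_n$ ($S_0=0$), and assume that the walk is aperiodic, i.e. the law of $X_1$ is not supported by a coset $c+h\mathbb Z$ with $h\in\{0,2,3,\dots\}$, $c\in\mathbb Z$. Assume Cramér's condition: there is $t_0>0$ with $\mathbf E[e^{tX_1}]<\infty$ for all $|t|<t_0$. For $\lambda>0$, $a\ge 0$, $N\in\mathbb N$ let $\mathbf P^a_{N,\lambda}$ be the probability measure $$\frac{d\mathbf P^a_{N,\lambda}}{d\mathbf P}=\frac{1}{Z^a_{N,\lambda}}\,\lambda^{H_N^a}\,\mathbf 1_{\{S_n\ge-\lfloor aN\rfloor \text{ for } 1\le n\le N\}}\mathbf 1_{\{S_N=0\}},\qquad H_N^a=\sum_{n=1}^N\mathbf 1_{\{S_n=-\lfloor aN\rfloor\}},$$ with normalizing constant $Z^a_{N,\lambda}$. Let $f(\lambda,a)=\lim_{N\to\infty}\frac1N\log Z^a_{N,\lambda}$, $f(\lambda)=f(\lambda,0)$ and $\lambda_c(a)=\inf\{\lambda>0: f(\lambda,a)>0\}\in(0,\infty]$.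 Let $L_N$ and $R_N$ be the smallest and the largest $n\in\{0,\dots,N\}$ with $S_n=-\lfloor aN\rfloor$ ($+\infty$ if there is none). For $t\ge0$ let $\Lambda_\pm(t)=\log\mathbf E[e^{\pm tX_1}]\in[0,\infty]$, $t_0^\pm=\sup\{t\ge0:\Lambda_\pm(t)<\infty\}$, and for $x\ge0$ let $I_\pm(x)=\sup_{t\ge0}\{tx-\Lambda_\pm(t)\}$; let $\Lambda_\pm^{-1}$ be the left-continuous inverse of $\Lambda_\pm$ on $[0,\infty)$. Let $\lambda_\pm$ be the solution of $f(\lambda_\pm)=\Lambda_\pm(t_0^\pm)$ if $t_0^\pm<\infty$ and $\Lambda_\pm(t_0^\pm)<\infty$, and $\lambda_\pm=+\infty$ otherwise. **Theorem.** Let $a>0$ and $\lambda_c(a)\le\lambda<\min\{\lambda_+,\lambda_-\}$, and set $$u^*=\frac{a}{\Lambda_-'(\Lambda_-^{-1}(f(\lambda)))},\qquad v^*=1-\frac{a}{\Lambda_+'(\Lambda_+^{-1}(f(\lambda)))}.$$ (i) There are constants $c_0,c_1>0$ (depending on $a$, $\lambda$ and the law of $X_1$) such that, with $\{aN\}=aN-\lfloor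 aN\rfloor$, $$Z^a_{N,\lambda}\sim c_1\,e^{f(\lambda,a)N+c_0\{aN\}}\qquad\text{as }N\to\infty .$$ (ii) Let $\sigma_1,\sigma_2>0$ be given by $$\sigma_1^2=\frac{(u^*)^3}{a^2 I_-''(a/u^*)},\qquad \sigma_2^2=\frac{(1-v^*)^3}{a^2 I_+''(a/(1-v^*))}$$ (both right-hand sides are positive). For every sequence $\varepsilon_N\to0$, uniformly over integers $\ell,r\ge0$ with $\delta_\ell:=|\frac{\ell}{N}-u^*|\le\varepsilon_N$ and $\delta_r:=|\frac rN-v^*|\le\varepsilon_N$, as $N\to\infty$, $$\mathbf P^a_{N,\lambda}(L_N=\ell,R_N=r)=\frac{1+o(1)}{2\pi N\sigma_1\sigma_2}\,e^{-\frac{(\ell-u^*N)^2}{2\sigma_1^2N}(1+\delta_\ell O(1))}\,e^{-\frac{(r-v^*N)^2}{2\sigma_2^2N}(1+\delta_rO(1))}.$$ Moreover, as $N\to\infty$, under $\mathbf P^a_{N,\lambda}$ the pair $\big(\frac{L_N-u^*N}{\sqrt N},\frac{R_N-v^*N}{\sqrt N}\big)$ converges weakly to $(Z_1,Z_2)$,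 with $Z_1\sim\mathcal N(0,\sigma_1^2)$ and $Z_2\sim\mathcal N(0,\sigma_2^2)$ independent. -/

import Mathlib

open MeasureTheory ProbabilityTheory Filter Topology
open scoped ENNReal NNReal BoundedContinuousFunction

namespace WettingWell

noncomputable section

/-! ### Log-moment generating functions of a real random variable `Y`

The `+` objects are obtained with `Y = X₁`, the `-` objects with `Y = -X₁`.
The function `Λ(t) = log E[exp (t Y)] ∈ (-∞, ∞]` is Mathlib's `cgf Y P t` where
`exp (t Y)` is integrable, and is `+∞` elsewhere. -/

variable {Ω : Type*} [MeasurableSpace Ω]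

/-- `Λ(t) < ∞`. -/
def FiniteExpMoment (Y : Ω → ℝ) (P : Measure Ω) (t : ℝ) : Prop :=
  Integrable (fun ω => Real.exp (t * Y ω)) P

/-- The radius of convergence `t₀ = sup {t ≥ 0 : Λ(t) < ∞} ∈ [0, ∞]`. -/
def expRadius (Y : Ω → ℝ) (P : Measure Ω) : EReal :=
  sSup ((fun t : ℝ => (t : EReal)) '' {t | 0 ≤ t ∧ FiniteExpMoment Y P t})

/-- The left-continuous inverse `Λ⁻¹(y) = inf {t ≥ 0 : Λ(t) ≥ y}`, for `y ≥ 0`. -/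
def cgfInv (Y : Ω → ℝ) (P : Measure Ω) (y : ℝ) : ℝ :=
  sInf {t : ℝ | 0 ≤ t ∧ (FiniteExpMoment Y P t → y ≤ cgf Y P t)}

/-- The rate function `I(x) = sup_{t ≥ 0} (t x - Λ(t))` (values of `t` with `Λ(t) = ∞` do not
contribute), as a real number at the points where it is finite. -/
def rateFn (Y : Ω → ℝ) (P : Measure Ω) (x : ℝ) : ℝ :=
  sSup {y : ℝ | ∃ t : ℝ, 0 ≤ t ∧ FiniteExpMoment Y P t ∧ y = t * x - cgf Y P t}

/-- The second derivative `I''`. -/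
def rateFnSecondDeriv (Y : Ω → ℝ) (P : Measure Ω) (x : ℝ) : ℝ :=
  deriv (deriv (rateFn Y P)) x

/-- `w* = a / Λ'(Λ⁻¹(y))`. -/
def wStar (Y : Ω → ℝ) (P : Measure Ω) (a y : ℝ) : ℝ :=
  a / deriv (cgf Y P) (cgfInv Y P y)

/-! ### The random walk and the wetting model in a square well -/

/-- The walk `S_n = X_1 + ... + X_n`; the increment `X_{i+1}` is `X i`. -/
def walk (X : ℕ → Ω → ℤ) (n : ℕ) (ω : Ω) : ℤ := ∑ i ∈ Finset.range n, X i ω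

/-- The `ℤ`-valued walk is aperiodic: the increments are not supported by a coset `c + hℤ` of a
proper subgroup of `ℤ` (`h = 0` is the case of constant increments). -/
def Aperiodic (X : ℕ → Ω → ℤ) (P : Measure Ω) : Prop :=
  ∀ (h : ℕ) (c : ℤ), (∀ᵐ ω ∂P, (h : ℤ) ∣ X 0 ω - c) → h = 1

/-- The upward increment `X₁`, as a real random variable. -/
def upStep (X : ℕ → Ω → ℤ) (ω : Ω) : ℝ := (X 0 ω : ℝ)

/-- The downward increment `-X₁`, as a real random variable. -/
def downStep (X : ℕ → Ω → ℤ) (ω : Ω) : ℝ := -(X 0 ω : ℝ)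

/-- The depth `⌊aN⌋` of the well. -/
def depth (a : ℝ) (N : ℕ) : ℤ := ⌊a * N⌋

/-- The number of contacts `H_N^a`: the number of `1 ≤ n ≤ N` with `S_n = -⌊aN⌋`. -/
def contacts (X : ℕ → Ω → ℤ) (a : ℝ) (N : ℕ) (ω : Ω) : ℕ :=
  ((Finset.Icc 1 N).filter fun n => walk X n ω = -depth a N).card

/-- The event that the walk stays above the bottom of the well and that `S_N = 0`. -/
def wellEvent (X : ℕ → Ω → ℤ) (a : ℝ) (N : ℕ) : Set Ω :=
  {ω | (∀ n ∈ Finset.Icc 1 N, -depth a N ≤ walk X n ω) ∧ walk X N ω = 0}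

/-- The unnormalized weight of a trajectory. -/
def weight (X : ℕ → Ω → ℤ) (lam a : ℝ) (N : ℕ) : Ω → ℝ :=
  (wellEvent X a N).indicator fun ω => lam ^ contacts X a N ω

/-- The partition function `Z_{N,λ}^a`. -/
def partitionFn (X : ℕ → Ω → ℤ) (P : Measure Ω) (lam a : ℝ) (N : ℕ) : ℝ :=
  ∫ ω, weight X lam a N ω ∂P

/-- The Gibbs measure `P_{N,λ}^a` (a probability measure as soon as `Z_{N,λ}^a > 0`). -/
def gibbs (X : ℕ → Ω → ℤ) (P : Measure Ω) (lam a : ℝ) (N : ℕ) : Measure Ω :=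
  P.withDensity fun ω => ENNReal.ofReal (weight X lam a N ω / partitionFn X P lam a N)

/-- The free energy `f(λ, a) = lim (1/N) log Z_{N,λ}^a`; the free energy `f(λ)` of the standard
wetting model is `f(λ, 0)`. -/
def freeEnergy (X : ℕ → Ω → ℤ) (P : Measure Ω) (lam a : ℝ) : ℝ :=
  limUnder atTop fun N : ℕ => (1 / (N : ℝ)) * Real.log (partitionFn X P lam a N)

/-- The critical point `λ_c(a) = inf {λ > 0 : f(λ, a) > 0}`, with `inf ∅ = ∞`. -/
def criticalPoint (X : ℕ → Ω → ℤ) (P : Measure Ω) (a : ℝ) : EReal :=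
  sInf ((fun l : ℝ => (l : EReal)) '' {l | 0 < l ∧ 0 < freeEnergy X P l a})

/-- The saturation point associated with `Y = X₁` or `Y = -X₁` (that is `λ_+` or `λ_-`): the
solution `λ` of `f(λ) = Λ(t₀)` if `0 < t₀ < ∞` and `Λ(t₀) < ∞`, and `∞` otherwise. -/
def saturationPoint (X : ℕ → Ω → ℤ) (P : Measure Ω) (Y : Ω → ℝ) : EReal :=
  sInf ((fun l : ℝ => (l : EReal)) '' {l | 0 < l ∧ ∃ t : ℝ, 0 < t ∧ (t : EReal) = expRadius Y P ∧
    FiniteExpMoment Y P t ∧ freeEnergy X P l 0 = cgf Y P t})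

/-- The set of times `0 ≤ n ≤ N` at which the walk is at the bottom of the well. -/
def contactTimes (X : ℕ → Ω → ℤ) (a : ℝ) (N : ℕ) (ω : Ω) : Finset ℕ :=
  (Finset.range (N + 1)).filter fun n => depth a N + walk X n ω = 0

open Classical in
/-- The left-most contact point `L_N`, equal to `∞` if there is no contact. -/
def leftContact (X : ℕ → Ω → ℤ) (a : ℝ) (N : ℕ) (ω : Ω) : ℕ∞ :=
  if h : (contactTimes X a N ω).Nonempty then (((contactTimes X a N ω).min' h : ℕ) : ℕ∞) else ⊤

open Classical in
/-- The right-most contact point `R_N`, equal to `∞` if there is no contact. -/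
def rightContact (X : ℕ → Ω → ℤ) (a : ℝ) (N : ℕ) (ω : Ω) : ℕ∞ :=
  if h : (contactTimes X a N ω).Nonempty then (((contactTimes X a N ω).max' h : ℕ) : ℕ∞) else ⊤

/-- `(M - cN) / √N`, for a possibly infinite `M`. -/
def rescale (c : ℝ) (N : ℕ) (M : ℕ∞) : EReal :=
  (((M : ℝ≥0∞) : EReal) - ((c * N : ℝ) : EReal)) / ((Real.sqrt N : ℝ) : EReal)

/-- `u* = a / Λ_-'(Λ_-⁻¹(f(λ)))`. -/
def uStar (X : ℕ → Ω → ℤ) (P : Measure Ω) (lam a : ℝ) : ℝ :=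
  wStar (downStep X) P a (freeEnergy X P lam 0)

/-- `v* = 1 - a / Λ_+'(Λ_+⁻¹(f(λ)))`. -/
def vStar (X : ℕ → Ω → ℤ) (P : Measure Ω) (lam a : ℝ) : ℝ :=
  1 - wStar (upStep X) P a (freeEnergy X P lam 0)

end

end WettingWell

/-! Put d = ⌊aN⌋ and cut a path at its first contact l and its last contact r with the level -d.
Between l and r the path is a wetting path of length r - l at height zero. The part before l, read
backwards, is a walk with steps -X that stays positive and ends at d; the part after r is a walk
with steps X that stays positive and ends at d. So, apart from the paths without contact, the
partition function is the sum over l ≤ r of λ P⁻_l(d) Z_{r-l} P⁺_{N-r}(d), where Z is the wetting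
partition function and P^±_n(d) are the probabilities of these positive walks
(`lintegral_weight_contactEvent`).

The middle stretch is a renewal process: with q_j the probability of a first return to zero at time
j through positive heights, Z satisfies the renewal equation with weights λ q_j. If y > 0 solves λ Σ
q_j e^{-yj} = 1, the renewal theorem gives Z_n ~ C₀ e^{yn} (`exists_tendsto_wettingZ`), and y =
f(λ).

The two legs are treated by exponential tilting at t_± with Λ_±(t_±) = y. A leg of length n has
weight e^{yn - t_± d} times the probability that the tilted walk, which has positive drift
Λ_±'(t_±), is at d at time n after staying positive. By the local limit theorem for positive walks
(`tendsto_sqrt_mul_tiltPos`) this is the local Gaussian density times the probability of staying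
positive forever. That theorem holds along converging tilts, so the tilt can be adjusted to have
drift exactly d/n. This covers the whole window n/N → u; the price of changing the tilt is governed
by the rate function, and its expansion gives the Gaussian exponent with its relative error.

The exponential factors of the three stretches multiply to e^{yN - (t₋+t₊)d}, whatever l and r are
(`contactZ_eq`). What remains is a product of two Gaussian profiles on the scale √N, in the
variables l and N - r, and the sum is a planar Riemann sum (`GaussianProfile.tendsto_sum`). Hence
f(λ,a) = y - a(t₋+t₊), c₀ = t₋+t₊, and the two fluctuations are independent.

The inequality a(t₋+t₊) ≤ y, with equality allowed, makes all this work. Since Λ'(t) > Λ(t)/t, it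
implies that the legs take a total fraction of time less than 1, so the middle stretch is long. It
also makes the common exponential at least 1, while the paths without contact weigh at most P(S_N =
0) → 0.

`exists_localizedRegime` derives this inequality and the existence of y, t₋, t₊ from the hypotheses
on λ. Below saturation Λ_± exceeds y somewhere on its domain, so t_± exists in the interior. For
criticality: if a solution y satisfies y ≤ a(Λ₋⁻¹(y) + Λ₊⁻¹(y)), or if there is no solution, every
contact term is bounded, the partition function grows at most polynomially and the free energy is
zero. So parameters with positive free energy satisfy the reverse strict inequality; there are such
parameters below every m > λ, and monotonicity and concavity of Λ_±⁻¹ carry the inequality over to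
λ. -/

namespace WettingWell

section

/-! ### Path sums -/

/-- The operator `h ↦ (x ↦ ∑ₖ μ(k) w(x + k) h(x + k))`. -/
noncomputable def step (μ w : ℤ → ℝ≥0∞) : Module.End ℝ≥0∞ (ℤ → ℝ≥0∞) where
  toFun h x := ∑' k, μ k * (w (x + k) * h (x + k))
  map_add' f g := by
    funext x
    simp only [Pi.add_apply, mul_add, ENNReal.tsum_add]
  map_smul' c f := by
    funext x
    simp only [Pi.smul_apply, smul_eq_mul, RingHom.id_apply, ← ENNReal.tsum_mul_left]
    exact tsum_congr fun k => by ring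

lemma step_apply (μ w h : ℤ → ℝ≥0∞) (x : ℤ) :
    step μ w h x = ∑' k, μ k * (w (x + k) * h (x + k)) := rfl

lemma step_add (μ v w : ℤ → ℝ≥0∞) : step μ (v + w) = step μ v + step μ w := by
  refine LinearMap.ext fun h => funext fun x => ?_
  simp only [step_apply, LinearMap.add_apply, Pi.add_apply, add_mul, mul_add, ENNReal.tsum_add]

lemma step_congr {μ w h w' h' : ℤ → ℝ≥0∞} (H : ∀ x, w x * h x = w' x * h' x) :
    step μ w h = step μ w' h' := by
  funext x
  simp only [step_apply, H]

/-- A site weight concentrated at one point cuts the path there: the value of the remaining path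
factors out. This splits paths at contacts and at returns to zero. -/
lemma step_single (μ w h : ℤ → ℝ≥0∞) (z : ℤ) :
    step μ (fun x => if x = z then w x else 0) h = (w z * h z) • step μ 1 (Pi.single z 1) := by
  funext x
  rw [Pi.smul_apply, step_apply, step_apply, smul_eq_mul, ← ENNReal.tsum_mul_left]
  refine tsum_congr fun k => ?_
  by_cases hk : x + k = z
  · simp [hk, mul_comm]
  · simp [hk]

/-- Expansion of a power of a sum according to the first occurrence of the second term. -/
lemma add_pow_eq_first_occurrence {R : Type*} [Semiring R] (A B : R) (n : ℕ) :
    (A + B) ^ n = A ^ n + ∑ j ∈ Finset.range n, A ^ j * B * (A + B) ^ (n - 1 - j) := by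
  induction n with
  | zero => simp
  | succ n ih =>
    rw [Finset.sum_range_succ', pow_succ' (A + B), add_mul]
    nth_rewrite 1 [ih]
    rw [mul_add, Finset.mul_sum, pow_succ' A, add_assoc]
    congr 1
    simp only [pow_zero, one_mul, add_tsub_cancel_right, tsub_zero]
    congr 1
    refine Finset.sum_congr rfl fun j hj => ?_
    have : n - (j + 1) = n - 1 - j := by omega
    rw [this, pow_succ' A]
    simp only [mul_assoc]

/-- Path sums with time-dependent weights `W 0, W 1, …` and terminal weight `h`. -/
noncomputable def pathSum (μ : ℤ → ℝ≥0∞) :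
    ℕ → (ℕ → ℤ → ℝ≥0∞) → (ℤ → ℝ≥0∞) → ℤ → ℝ≥0∞
  | 0, _, h => h
  | n + 1, W, h => step μ (W 0) (pathSum μ n (fun i => W (i + 1)) h)

lemma pathSum_const (μ w : ℤ → ℝ≥0∞) (n : ℕ) (h : ℤ → ℝ≥0∞) :
    pathSum μ n (fun _ => w) h = (step μ w ^ n) h := by
  induction n with
  | zero => rfl
  | succ n ih => rw [pow_succ', Module.End.mul_apply, ← ih]; rfl

lemma pathSum_congr (μ : ℤ → ℝ≥0∞) (n : ℕ) {W W' : ℕ → ℤ → ℝ≥0∞} (h : ℤ → ℝ≥0∞)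
    (H : ∀ i < n, W i = W' i) : pathSum μ n W h = pathSum μ n W' h := by
  induction n generalizing W W' with
  | zero => rfl
  | succ n ih =>
    simp only [pathSum]
    rw [H 0 n.succ_pos, ih fun i hi => H (i + 1) (by omega)]

/-- The Markov property at time `m`: the sum over the later steps becomes the terminal weight of the
earlier ones. -/
lemma pathSum_add (μ : ℤ → ℝ≥0∞) (m n : ℕ) (W : ℕ → ℤ → ℝ≥0∞) (h : ℤ → ℝ≥0∞) :
    pathSum μ (m + n) W h = pathSum μ m W (pathSum μ n (fun i => W (m + i)) h) := by
  induction m generalizing W with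
  | zero => simp [pathSum]
  | succ m ih =>
    rw [Nat.succ_add]
    simp only [pathSum]
    rw [ih]
    simp only [Nat.succ_add]

lemma step_translate (μ w h : ℤ → ℝ≥0∞) (c x : ℤ) :
    step μ (fun y => w (y + c)) (fun y => h (y + c)) x = step μ w h (x + c) := by
  simp only [step_apply, add_right_comm x _ c]

lemma step_pow_translate (μ w h : ℤ → ℝ≥0∞) (c : ℤ) (n : ℕ) (x : ℤ) :
    (step μ (fun y => w (y + c)) ^ n) (fun y => h (y + c)) x = (step μ w ^ n) h (x + c) := by
  induction n generalizing x with
  | zero => rfl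
  | succ n ih =>
    rw [pow_succ', pow_succ', Module.End.mul_apply, Module.End.mul_apply, ← step_translate]
    exact congrArg (fun g => step μ (fun y => w (y + c)) g x) (funext ih)

/-! ### I.i.d. integer steps -/

lemma walk_succ {Ω : Type*} (X : ℕ → Ω → ℤ) (n : ℕ) (ω : Ω) : walk X (n + 1) ω = walk X n ω + X n ω :=
  Finset.sum_range_succ _ _

lemma walk_succ' {Ω : Type*} (X : ℕ → Ω → ℤ) (n : ℕ) (ω : Ω) :
    walk X (n + 1) ω = X 0 ω + walk (fun i => X (i + 1)) n ω := by
  rw [walk, Finset.sum_range_succ', add_comm]; rfl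

lemma walk_neg {Ω : Type*} (X : ℕ → Ω → ℤ) (n : ℕ) (ω : Ω) :
    walk (fun i ω => -X i ω) n ω = -walk X n ω := by
  simp [walk]

@[simp] lemma walk_zero {Ω : Type*} (X : ℕ → Ω → ℤ) (ω : Ω) : walk X 0 ω = 0 := by simp [walk]

variable {Ω : Type*} [MeasurableSpace Ω]

/-- Independent identically distributed integer-valued random variables. -/
structure IIDSteps (X : ℕ → Ω → ℤ) (P : Measure Ω) : Prop where
  meas : ∀ i, Measurable (X i)
  indep : iIndepFun X P
  ident : ∀ i, IdentDistrib (X i) (X 0) P P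

/-- The probability mass function of the step distribution. -/
noncomputable def stepLaw (X : ℕ → Ω → ℤ) (P : Measure Ω) (k : ℤ) : ℝ≥0∞ := P {ω | X 0 ω = k}

namespace IIDSteps

variable {X : ℕ → Ω → ℤ} {P : Measure Ω}

/-- Applied to the shift by one step and to the reversal of an initial block of steps. -/
lemma precomp (hX : IIDSteps X P) {σ : ℕ → ℕ} (hσ : σ.Injective) :
    IIDSteps (fun i => X (σ i)) P where
  meas _ := hX.meas _
  indep := hX.indep.precomp hσ
  ident _ := (hX.ident _).trans (hX.ident _).symm

lemma stepLaw_precomp (hX : IIDSteps X P) (σ : ℕ → ℕ) :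
    stepLaw (fun i => X (σ i)) P = stepLaw X P := by
  funext k
  exact (hX.ident (σ 0)).measure_mem_eq (measurableSet_singleton k)

lemma neg (hX : IIDSteps X P) : IIDSteps (fun i ω => -X i ω) P where
  meas i := (hX.meas i).neg
  indep := hX.indep.comp (fun _ k => -k) fun _ => measurable_neg
  ident i := (hX.ident i).comp measurable_neg

lemma measurable_walk (hX : IIDSteps X P) (n : ℕ) : Measurable (walk X n) :=
  Finset.measurable_fun_sum _ fun i _ => hX.meas i

end IIDSteps

/-- A function of the first step and of the later steps integrates by conditioning on the first
step. -/
lemma IIDSteps.lintegral_first_step {X : ℕ → Ω → ℤ} {P : Measure Ω} (hX : IIDSteps X P)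
    (F : ℤ → (ℕ → ℤ) → ℝ≥0∞) (hF : ∀ k, Measurable (F k)) :
    ∫⁻ ω, F (X 0 ω) (fun i => X (i + 1) ω) ∂P =
      ∑' k, stepLaw X P k * ∫⁻ ω, F k (fun i => X (i + 1) ω) ∂P := by
  have hset : ∀ k, MeasurableSet {ω | X 0 ω = k} := fun k => hX.meas 0 (measurableSet_singleton k)
  have hY : Measurable fun ω i => X (i + 1) ω := measurable_pi_lambda _ fun i => hX.meas _
  have h1 : ∀ ω, F (X 0 ω) (fun i => X (i + 1) ω) =
      ∑' k, {ω | X 0 ω = k}.indicator (fun _ => (1 : ℝ≥0∞)) ω * F k (fun i => X (i + 1) ω) := by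
    intro ω
    rw [tsum_eq_single (X 0 ω)]
    · simp
    · intro k hk
      simp [Ne.symm hk]
  simp_rw [h1]
  have hm : ∀ k, Measurable fun ω => {ω | X 0 ω = k}.indicator (fun _ => (1 : ℝ≥0∞)) ω *
      F k (fun i => X (i + 1) ω) := fun k =>
    Measurable.mul (measurable_const.indicator (hset k)) ((hF k).comp hY)
  rw [lintegral_tsum fun k => (hm k).aemeasurable]
  refine tsum_congr fun k => ?_
  -- The first step and the later steps generate independent σ-algebras, being indexed by disjoint
  -- sets of times.
  let m : ℕ → MeasurableSpace Ω := fun i => MeasurableSpace.comap (X i) inferInstance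
  have hle : ∀ i, m i ≤ ‹MeasurableSpace Ω› := fun i => (hX.meas i).comap_le
  have hind : Indep (⨆ i ∈ ({0} : Set ℕ), m i) (⨆ i ∈ ({0}ᶜ : Set ℕ), m i) P :=
    indep_iSup_of_disjoint hle hX.indep.iIndep disjoint_compl_right
  rw [lintegral_mul_eq_lintegral_mul_lintegral_of_independent_measurableSpace
    (iSup₂_le fun i _ => hle i) (iSup₂_le fun i _ => hle i) hind]
  · rw [lintegral_indicator_const (hset k), one_mul]; rfl
  · refine Measurable.indicator measurable_const ?_
    exact (le_iSup₂_of_le (f := fun i (_ : i ∈ ({0} : Set ℕ)) => m i) 0 rfl le_rfl) _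
      ⟨{k}, measurableSet_singleton k, rfl⟩
  · refine (hF k).comp (@measurable_pi_lambda _ _ _ (⨆ i ∈ ({0}ᶜ : Set ℕ), m i) _ _ fun i => ?_)
    refine Measurable.mono (comap_measurable (X (i + 1))) ?_ le_rfl
    exact le_iSup₂_of_le (f := fun i (_ : i ∈ ({0}ᶜ : Set ℕ)) => m i) (i + 1) (by simp) le_rfl

/-- Expectations of multiplicative functionals of the walk are path sums. -/
theorem IIDSteps.lintegral_prod_walk {X : ℕ → Ω → ℤ} {P : Measure Ω} [IsProbabilityMeasure P]
    (hX : IIDSteps X P) (n : ℕ) (W : ℕ → ℤ → ℝ≥0∞) (h : ℤ → ℝ≥0∞) (x : ℤ) :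
    ∫⁻ ω, (∏ i ∈ Finset.range n, W i (x + walk X (i + 1) ω)) * h (x + walk X n ω) ∂P =
      pathSum (stepLaw X P) n W h x := by
  induction n generalizing X W x with
  | zero => simp [pathSum]
  | succ n ih =>
    have hX' := hX.precomp (σ := fun i => i + 1) (add_left_injective 1)
    let F : ℤ → (ℕ → ℤ) → ℝ≥0∞ := fun k y => W 0 (x + k) *
      ((∏ i ∈ Finset.range n, W (i + 1) ((x + k) + ∑ j ∈ Finset.range (i + 1), y j)) *
        h ((x + k) + ∑ j ∈ Finset.range n, y j))
    have hF : ∀ k, Measurable (F k) := fun k => by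
      have hW : ∀ w : ℤ → ℝ≥0∞, ∀ c : ℤ, ∀ m : ℕ,
          Measurable fun y : ℕ → ℤ => w (c + ∑ j ∈ Finset.range m, y j) := fun w c m =>
        (measurable_of_countable w).comp (measurable_const.add
          (Finset.measurable_fun_sum _ fun j _ => measurable_pi_apply j))
      exact measurable_const.mul ((Finset.measurable_fun_prod _ fun i _ => hW _ _ _).mul (hW _ _ _))
    have h1 := hX.lintegral_first_step F hF
    have h2 : ∀ ω, (∏ i ∈ Finset.range (n + 1), W i (x + walk X (i + 1) ω)) *
        h (x + walk X (n + 1) ω) = F (X 0 ω) (fun i => X (i + 1) ω) := by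
      intro ω
      rw [Finset.prod_range_succ']
      simp only [F, walk_succ' X, ← add_assoc]
      rw [walk_zero, add_zero, mul_comm _ (W 0 _), mul_assoc]
      rfl
    simp_rw [h2, h1]
    simp only [pathSum, step_apply]
    refine tsum_congr fun k => ?_
    congr 1
    have h3 := ih hX' (fun i => W (i + 1)) (x + k)
    rw [hX.stepLaw_precomp] at h3
    have hW : ∀ w : ℤ → ℝ≥0∞, ∀ c : ℤ, ∀ m : ℕ,
        Measurable fun ω => w (c + walk (fun i => X (i + 1)) m ω) := fun w c m =>
      (measurable_of_countable w).comp (measurable_const.add (hX'.measurable_walk m))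
    have hm : Measurable fun ω => (∏ i ∈ Finset.range n,
        W (i + 1) (x + k + walk (fun i => X (i + 1)) (i + 1) ω)) *
        h (x + k + walk (fun i => X (i + 1)) n ω) :=
      Measurable.mul (Finset.measurable_fun_prod _ fun i _ => hW _ _ _) (hW _ _ _)
    rw [← h3, ← lintegral_const_mul _ hm]
    rfl

end

section

/-! ### The renewal theorem for geometrically decaying waiting times -/

section Renewal

variable {p u : ℕ → ℝ}

/-- The recursion averages earlier values with weights of total mass at most one. -/
lemma renewal_mem_Icc (hp : ∀ j, 0 ≤ p j) (hp0 : p 0 = 0) (hsum : HasSum p 1) (hu0 : u 0 = 1)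
    (hu : ∀ n, u (n + 1) = ∑ j ∈ Finset.range (n + 1), p (j + 1) * u (n - j)) (n : ℕ) :
    u n ∈ Set.Icc (0 : ℝ) 1 := by
  induction n using Nat.strong_induction_on with
  | _ n ih =>
    cases n with
    | zero => simp [hu0]
    | succ n =>
      rw [hu]
      refine ⟨Finset.sum_nonneg fun j _ => mul_nonneg (hp _) (ih _ (by omega)).1, ?_⟩
      calc ∑ j ∈ Finset.range (n + 1), p (j + 1) * u (n - j)
          ≤ ∑ j ∈ Finset.range (n + 1), p (j + 1) :=
            Finset.sum_le_sum fun j _ => mul_le_of_le_one_right (hp _) (ih _ (by omega)).2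
        _ ≤ ∑ j ∈ Finset.range (n + 1 + 1), p j := by
            rw [Finset.sum_range_succ' p, hp0, add_zero]
        _ ≤ 1 := sum_le_hasSum _ (fun j _ => hp j) hsum

/-- The probability that the last renewal before time `n` is followed by a longer wait. -/
lemma renewal_tail_identity (hp0 : p 0 = 0) (hu0 : u 0 = 1)
    (hu : ∀ n, u (n + 1) = ∑ j ∈ Finset.range (n + 1), p (j + 1) * u (n - j)) (n : ℕ) :
    ∑ j ∈ Finset.range (n + 1), (1 - ∑ i ∈ Finset.range (j + 1), p i) * u (n - j) = 1 := by
  induction n with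
  | zero => simp [hu0, hp0]
  | succ n ih =>
    rw [Finset.sum_range_succ']
    have h1 : ∀ j ∈ Finset.range (n + 1),
        (1 - ∑ i ∈ Finset.range (j + 1 + 1), p i) * u (n + 1 - (j + 1)) =
          (1 - ∑ i ∈ Finset.range (j + 1), p i) * u (n - j) - p (j + 1) * u (n - j) := by
      intro j _
      rw [Finset.sum_range_succ _ (j + 1), Nat.add_sub_add_right]
      ring
    rw [Finset.sum_congr rfl h1, Finset.sum_sub_distrib, ih, ← hu]
    simp [hp0]

/-- Along an ultrafilter, the limits of the shifted renewal sequence are stationary. -/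
lemma renewal_shift_convolution {q : ℕ → ℝ} (hq : ∀ j, 0 ≤ q j) (hqs : Summable q)
    (hmem : ∀ n, u n ∈ Set.Icc (0 : ℝ) 1) {F : Filter ℕ} (hF : F ≤ atTop) {a : ℕ → ℝ}
    (ha : ∀ k, Tendsto (fun n => u (n - k)) F (𝓝 (a k))) (i : ℕ) :
    Tendsto (fun n => ∑ j ∈ Finset.range (n - i + 1), q j * u (n - i - j)) F
      (𝓝 (∑' j, q j * a (i + j))) := by
  have h1 : ∀ n, ∑ j ∈ Finset.range (n - i + 1), q j * u (n - i - j) =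
      ∑' j, if j < n - i + 1 then q j * u (n - i - j) else 0 := by
    intro n
    rw [tsum_eq_sum (s := Finset.range (n - i + 1))]
    · exact Finset.sum_congr rfl fun j hj => by rw [if_pos (Finset.mem_range.1 hj)]
    · intro j hj
      rw [if_neg (by simpa using hj)]
  simp_rw [h1]
  refine tendsto_tsum_of_dominated_convergence hqs (fun j => ?_) (Eventually.of_forall fun n j => ?_)
  · refine ((ha (i + j)).const_mul (q j)).congr' ?_
    filter_upwards [hF (eventually_gt_atTop (i + j))] with n hn
    rw [if_pos (by omega), Nat.sub_sub]
  · split_ifs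
    · rw [Real.norm_eq_abs, abs_mul, abs_of_nonneg (hq j), abs_of_nonneg (hmem _).1]
      exact mul_le_of_le_one_right (hq j) (hmem _).2
    · simpa using hq j

/-- A maximum principle. Along an ultrafilter realizing an extremal cluster value L (the largest for
s = 1, the smallest for s = -1), every shifted sequence has a limit a_k, and a_i is the p-average of
the later a_k. Being extremal, the value L at index 0 spreads to all indices reachable by renewals,
hence to all large ones. The tail identity then becomes L times the mean waiting time equals 1,
which determines L. -/
lemma renewal_extremal (hp : ∀ j, 0 ≤ p j) (hp0 : p 0 = 0) (hsum : HasSum p 1)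
    (htail : Summable fun j => 1 - ∑ i ∈ Finset.range (j + 1), p i) (hu0 : u 0 = 1)
    (hu : ∀ n, u (n + 1) = ∑ j ∈ Finset.range (n + 1), p (j + 1) * u (n - j))
    (hpos : ∀ᶠ n in atTop, 0 < u n) {L s : ℝ} (hs : s ≠ 0) (hL : MapClusterPt L atTop u)
    (hext : ∀ x, MapClusterPt x atTop u → s * x ≤ s * L) :
    L * ∑' j, (1 - ∑ i ∈ Finset.range (j + 1), p i) = 1 := by
  have hmem := renewal_mem_Icc hp hp0 hsum hu0 hu
  obtain ⟨F, hF, hFL⟩ := mapClusterPt_iff_ultrafilter.1 hL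
  have hshift : ∀ k, Tendsto (fun n : ℕ => n - k) F atTop := fun k =>
    (tendsto_sub_atTop_nat k).mono_left hF
  have hex : ∀ k, ∃ x, Tendsto (fun n => u (n - k)) F (𝓝 x) := by
    intro k
    obtain ⟨x, -, hx⟩ := (isCompact_Icc (a := (0 : ℝ)) (b := 1)).ultrafilter_le_nhds
      (F.map fun n => u (n - k)) (by
        exact le_principal_iff.2 (mem_map.2 (Eventually.of_forall fun n => hmem (n - k))))
    exact ⟨x, hx⟩
  choose a ha using hex
  have ha0 : a 0 = L := tendsto_nhds_unique (ha 0) (by simpa using hFL)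
  have hale : ∀ k, s * a k ≤ s * L := fun k =>
    hext _ (((ha k).mapClusterPt).of_comp (hshift k))
  have hamem : ∀ k, a k ∈ Set.Icc (0 : ℝ) 1 := fun k =>
    isClosed_Icc.mem_of_tendsto (ha k) (Eventually.of_forall fun n => hmem _)
  have hstat : ∀ i, a i = ∑' j, p (j + 1) * a (i + 1 + j) := by
    intro i
    have h1 := renewal_shift_convolution (q := fun j => p (j + 1)) (fun j => hp _)
      ((summable_nat_add_iff 1).2 hsum.summable) hmem hF ha (i + 1)
    refine tendsto_nhds_unique (ha i) (h1.congr' ?_)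
    filter_upwards [hF (eventually_gt_atTop i)] with n hn
    obtain ⟨m, rfl⟩ : ∃ m, n = i + m + 1 := ⟨n - i - 1, by omega⟩
    have e : i + m + 1 - i = m + 1 := by omega
    have e' : i + m + 1 - (i + 1) = m := by omega
    rw [e, hu, e']
  have hsum' : HasSum (fun j => p (j + 1)) 1 := by
    simpa [hp0] using (hasSum_nat_add_iff' 1).2 hsum
  -- An average of values on one side of L equals L only if every value with positive weight is L.
  have hstep : ∀ i j, a i = L → 0 < p (j + 1) → a (i + 1 + j) = L := by
    intro i j hi hj
    have hsa : Summable fun j => p (j + 1) * a (i + 1 + j) :=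
      Summable.of_nonneg_of_le (fun j => mul_nonneg (hp _) (hamem _).1)
        (fun j => mul_le_of_le_one_right (hp _) (hamem _).2) hsum'.summable
    have h1 : HasSum (fun j => p (j + 1) * (s * L - s * a (i + 1 + j))) 0 := by
      have h2 := ((hsum'.mul_left (s * L)).sub (hsa.hasSum.mul_left s))
      rw [← hstat, hi, mul_one, sub_self] at h2
      refine h2.congr_fun ?_
      intro j
      ring
    have h3 := (hasSum_zero_iff_of_nonneg fun j =>
      mul_nonneg (hp _) (sub_nonneg.2 (hale _))).1 h1
    have h4 := congrFun h3 j
    simp only [Pi.zero_apply, mul_eq_zero, hj.ne', false_or, ← mul_sub, hs] at h4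
    linarith
  -- If u_n > 0 then n is a sum of waiting times of positive probability, so L propagates by n.
  have hreach : ∀ n, 0 < u n → ∀ i, a i = L → a (i + n) = L := by
    intro n
    induction n using Nat.strong_induction_on with
    | _ n ih =>
      intro hn i hi
      cases n with
      | zero => simpa using hi
      | succ n =>
        rw [hu] at hn
        obtain ⟨j, hj, hj'⟩ := Finset.exists_lt_of_sum_lt (s := Finset.range (n + 1))
          (f := fun _ => (0 : ℝ)) (by simpa using hn)
        rw [Finset.mem_range] at hj
        have hpj : 0 < p (j + 1) := (hp _).lt_of_ne fun h => by simp [← h] at hj'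
        have huj : 0 < u (n - j) := pos_of_mul_pos_right hj' (hp _)
        have := ih (n - j) (by omega) huj _ (hstep i j hi hpj)
        rwa [show i + 1 + j + (n - j) = i + (n + 1) by omega] at this
  obtain ⟨J, hJ⟩ := eventually_atTop.1 hpos
  -- The tail identity is used at time n - J, so that only the limits a_{J+j}, all equal to L,
  -- appear.
  have h1 := renewal_shift_convolution (q := fun j => 1 - ∑ i ∈ Finset.range (j + 1), p i)
    (fun j => sub_nonneg.2 (sum_le_hasSum _ (fun j _ => hp j) hsum)) htail hmem hF ha J
  simp only [renewal_tail_identity hp0 hu0 hu] at h1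
  have h2 := tendsto_nhds_unique h1 tendsto_const_nhds
  have h3 : ∀ j, a (J + j) = L := fun j => by
    simpa using hreach (J + j) (hJ _ (by omega)) 0 ha0
  simp only [h3, tsum_mul_right] at h2
  rw [mul_comm]
  exact h2

/-- The renewal theorem, with a positive limit. -/
theorem renewal_tendsto (hp : ∀ j, 0 ≤ p j) (hp0 : p 0 = 0) (hsum : HasSum p 1)
    (htail : Summable fun j => 1 - ∑ i ∈ Finset.range (j + 1), p i) (hu0 : u 0 = 1)
    (hu : ∀ n, u (n + 1) = ∑ j ∈ Finset.range (n + 1), p (j + 1) * u (n - j))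
    (hpos : ∀ᶠ n in atTop, 0 < u n) :
    ∃ c, 0 < c ∧ Tendsto u atTop (𝓝 c) := by
  have hmem := renewal_mem_Icc hp hp0 hsum hu0 hu
  have hK : IsCompact {x | MapClusterPt x atTop u} := by
    refine (isCompact_Icc (a := (0 : ℝ)) (b := 1)).of_isClosed_subset
      isClosed_setOfPred_clusterPt fun x hx => ?_
    exact isClosed_Icc.mem_of_mapClusterPt hx (Eventually.of_forall hmem)
  have hne : {x | MapClusterPt x atTop u}.Nonempty := by
    obtain ⟨x, -, hx⟩ := (isCompact_Icc (a := (0 : ℝ)) (b := 1)).exists_mapClusterPt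
      (f := atTop) (u := u) (by
        exact le_principal_iff.2 (mem_map.2 (Eventually.of_forall fun n => hmem n)))
    exact ⟨x, hx⟩
  obtain ⟨b, hb, hbmax⟩ := hK.exists_isGreatest hne
  obtain ⟨c, hc, hcmin⟩ := hK.exists_isLeast hne
  have h1 := renewal_extremal hp hp0 hsum htail hu0 hu hpos (s := 1) one_ne_zero hb
    fun x hx => by simpa using hbmax hx
  have h2 := renewal_extremal hp hp0 hsum htail hu0 hu hpos (s := -1) (by norm_num) hc
    fun x hx => by simpa using hcmin hx
  set r := ∑' j, (1 - ∑ i ∈ Finset.range (j + 1), p i)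
  have hr : r ≠ 0 := fun h => by simp [h] at h1
  have hbc : b = c := mul_right_cancel₀ hr (h1.trans h2.symm)
  have hc0 : 0 ≤ c := (isClosed_Icc.mem_of_mapClusterPt hc (Eventually.of_forall hmem)).1
  refine ⟨c, hc0.lt_of_ne fun h => by simp [← h] at h2, ?_⟩
  refine isCompact_Icc.tendsto_nhds_of_unique_mapClusterPt (Eventually.of_forall hmem) ?_
  intro x _ hx
  exact le_antisymm (hbc ▸ hbmax hx) (hcmin hx)

end Renewal

end

section

variable {Ω : Type*} [MeasurableSpace Ω] {X : ℕ → Ω → ℤ} {P : Measure Ω}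

/-! ### The characteristic function of the tilted step -/

lemma IIDSteps.measurable_upStep (hX : IIDSteps X P) : Measurable (upStep X) :=
  (measurable_of_countable (fun k : ℤ => (k : ℝ))).comp (hX.meas 0)

/-- With c a unit vector in the direction of Z, the expectation of e^{sY}|e^{iθY} - c|² is exactly
2(M - |Z|), where M is the moment generating function at s. The atom at j contributes at most the
whole. -/
lemma exists_phase [IsProbabilityMeasure P] (hX : IIDSteps X P) {s : ℝ}
    (hs : s ∈ integrableExpSet (upStep X) P) (θ : ℝ) :
    ∃ c : ℂ, ∀ j : ℤ, (stepLaw X P j).toReal * Real.exp (s * j) *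
      ‖Complex.exp (Complex.I * ((θ * j : ℝ) : ℂ)) - c‖ ^ 2 ≤
        2 * (mgf (upStep X) P s - ‖complexMGF (upStep X) P (s + θ * Complex.I)‖) := by
  set Y := upStep X
  set Z := complexMGF Y P (s + θ * Complex.I) with hZ
  have hY : Measurable Y := hX.measurable_upStep
  obtain ⟨c, hc, hcZ⟩ : ∃ c : ℂ, ‖c‖ = 1 ∧ (Z * (starRingEnd ℂ) c).re = ‖Z‖ := by
    by_cases h0 : Z = 0
    · exact ⟨1, by simp, by simp [h0]⟩
    · have hn : (‖Z‖ : ℂ) ≠ 0 := by simpa using h0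
      refine ⟨Z / ‖Z‖, by simp [h0], ?_⟩
      rw [map_div₀, ← mul_div_assoc, Complex.mul_conj, Complex.conj_ofReal, Complex.normSq_eq_norm_sq]
      rw [← Complex.ofReal_div, Complex.ofReal_re]
      field_simp
  refine ⟨c, fun j => ?_⟩
  have hint1 : Integrable (fun ω => Real.exp (s * Y ω)) P := hs
  have hint2 : Integrable (fun ω => Complex.exp ((s + θ * Complex.I) * Y ω)) P :=
    integrable_cexp_mul_of_re_mem_integrableExpSet hY.aemeasurable (by simpa using hs)
  have hpt : ∀ ω, Real.exp (s * Y ω) * ‖Complex.exp (Complex.I * ((θ * Y ω : ℝ) : ℂ)) - c‖ ^ 2 =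
      2 * Real.exp (s * Y ω) -
        2 * (Complex.exp ((s + θ * Complex.I) * Y ω) * (starRingEnd ℂ) c).re := by
    intro ω
    have h1 : Complex.exp ((s + θ * Complex.I) * Y ω) =
        (Real.exp (s * Y ω) : ℂ) * Complex.exp (Complex.I * ((θ * Y ω : ℝ) : ℂ)) := by
      rw [Complex.ofReal_exp, ← Complex.exp_add]
      congr 1
      push_cast
      ring
    rw [h1, mul_assoc, Complex.re_ofReal_mul]
    have h2 : ‖Complex.exp (Complex.I * ((θ * Y ω : ℝ) : ℂ))‖ = 1 := by
      rw [mul_comm]; exact Complex.norm_exp_ofReal_mul_I _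
    have h3 := Complex.sq_norm_sub_sq_re
    have h4 : ‖Complex.exp (Complex.I * ((θ * Y ω : ℝ) : ℂ)) - c‖ ^ 2 =
        1 + 1 - 2 * (Complex.exp (Complex.I * ((θ * Y ω : ℝ) : ℂ)) * (starRingEnd ℂ) c).re := by
      rw [← Complex.normSq_eq_norm_sq, Complex.normSq_sub, Complex.normSq_eq_norm_sq,
        Complex.normSq_eq_norm_sq, h2, hc]
      norm_num
    rw [h4]
    ring
  have hintR : Integrable (fun ω => (Complex.exp ((s + θ * Complex.I) * Y ω) *
      (starRingEnd ℂ) c).re) P := (hint2.mul_const _).re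
  have hintF : Integrable (fun ω => Real.exp (s * Y ω) *
      ‖Complex.exp (Complex.I * ((θ * Y ω : ℝ) : ℂ)) - c‖ ^ 2) P := by
    simp_rw [hpt]
    exact (hint1.const_mul 2).sub (hintR.const_mul 2)
  have htotal : ∫ ω, Real.exp (s * Y ω) *
      ‖Complex.exp (Complex.I * ((θ * Y ω : ℝ) : ℂ)) - c‖ ^ 2 ∂P = 2 * (mgf Y P s - ‖Z‖) := by
    simp_rw [hpt]
    rw [integral_sub (hint1.const_mul 2) (hintR.const_mul 2), integral_const_mul,
      integral_const_mul]
    have h5 : ∫ ω, (Complex.exp ((s + θ * Complex.I) * Y ω) * (starRingEnd ℂ) c).re ∂P = ‖Z‖ := by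
      rw [← hcZ, hZ, complexMGF, ← integral_mul_const]
      exact integral_re (hint2.mul_const _)
    rw [h5, mgf]
    ring
  rw [← htotal]
  have hset : MeasurableSet {ω | X 0 ω = j} := hX.meas 0 (measurableSet_singleton j)
  calc _ = ∫ ω in {ω | X 0 ω = j}, Real.exp (s * Y ω) *
        ‖Complex.exp (Complex.I * ((θ * Y ω : ℝ) : ℂ)) - c‖ ^ 2 ∂P := by
        rw [setIntegral_congr_fun hset (g := fun _ => Real.exp (s * j) *
          ‖Complex.exp (Complex.I * ((θ * j : ℝ) : ℂ)) - c‖ ^ 2)]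
        · rw [setIntegral_const, smul_eq_mul, mul_assoc]; rfl
        · intro ω hω
          have : Y ω = (j : ℝ) := by
            simp only [Y, upStep]; exact_mod_cast hω
          simp only [this]
    _ ≤ _ := setIntegral_le_integral hintF (Eventually.of_forall fun ω => by positivity)

/-- Frequencies `m` at which the characteristic functions of the tilted steps, for tilts in
`[a, b]`, are uniformly bounded away from being trivial. -/
def frequencyGroup (X : ℕ → Ω → ℤ) (P : Measure Ω) (a b : ℝ) : AddSubgroup ℤ where
  carrier := {m | ∃ C : ℝ, 0 ≤ C ∧ ∀ s ∈ Set.Icc a b, ∀ θ : ℝ,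
    ‖Complex.exp (Complex.I * ((θ * m : ℝ) : ℂ)) - 1‖ ^ 2 ≤
      C * (mgf (upStep X) P s - ‖complexMGF (upStep X) P (s + θ * Complex.I)‖)}
  zero_mem' := ⟨0, le_rfl, fun s _ θ => by simp⟩
  add_mem' := by
    rintro x y ⟨C, hC, hx⟩ ⟨D, hD, hy⟩
    refine ⟨2 * (C + D), by positivity, fun s hs θ => ?_⟩
    have h1 : Complex.exp (Complex.I * ((θ * (x + y : ℤ) : ℝ) : ℂ)) - 1 =
        Complex.exp (Complex.I * ((θ * x : ℝ) : ℂ)) *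
          (Complex.exp (Complex.I * ((θ * y : ℝ) : ℂ)) - 1) +
          (Complex.exp (Complex.I * ((θ * x : ℝ) : ℂ)) - 1) := by
      rw [mul_sub, ← Complex.exp_add]
      push_cast
      ring_nf
    have h2 : ‖Complex.exp (Complex.I * ((θ * x : ℝ) : ℂ))‖ = 1 := by
      rw [mul_comm]; exact Complex.norm_exp_ofReal_mul_I _
    have h3 := norm_add_le (Complex.exp (Complex.I * ((θ * x : ℝ) : ℂ)) *
          (Complex.exp (Complex.I * ((θ * y : ℝ) : ℂ)) - 1))
          (Complex.exp (Complex.I * ((θ * x : ℝ) : ℂ)) - 1)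
    rw [← h1, norm_mul, h2, one_mul] at h3
    have h4 := hx s hs θ
    have h5 := hy s hs θ
    have h6 := pow_le_pow_left₀ (norm_nonneg _) h3 2
    nlinarith [sq_nonneg (‖Complex.exp (Complex.I * ((θ * y : ℝ) : ℂ)) - 1‖ -
      ‖Complex.exp (Complex.I * ((θ * x : ℝ) : ℂ)) - 1‖)]
  neg_mem' := by
    rintro x ⟨C, hC, hx⟩
    refine ⟨C, hC, fun s hs θ => ?_⟩
    have h1 : ‖Complex.exp (Complex.I * ((θ * (-x : ℤ) : ℝ) : ℂ)) - 1‖ =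
        ‖Complex.exp (Complex.I * ((θ * x : ℝ) : ℂ)) - 1‖ := by
      rw [Complex.norm_exp_I_mul_ofReal_sub_one, Complex.norm_exp_I_mul_ofReal_sub_one]
      push_cast
      rw [mul_neg, neg_div, Real.sin_neg, mul_neg, norm_neg]
    rw [h1]
    exact hx s hs θ

/-- If i and j are atoms of the step, e^{iθi} and e^{iθj} are both close to the same phase c when
the characteristic function is nearly trivial, so i - j belongs to the subgroup. The subgroup is gℤ
for some g, and the step is then supported by j + gℤ; aperiodicity forces |g| = 1. -/
lemma frequencyGroup_eq_top [IsProbabilityMeasure P] (hX : IIDSteps X P) (hap : Aperiodic X P)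
    {a b : ℝ} (hab : Set.Icc a b ⊆ integrableExpSet (upStep X) P) :
    frequencyGroup X P a b = ⊤ := by
  -- Bounds the tilted mass of an atom from below uniformly in the tilt, so the constants do not
  -- depend on s.
  have hlow : ∀ j : ℤ, ∀ s ∈ Set.Icc a b, Real.exp (-(max |a| |b| * |(j : ℝ)|)) ≤ Real.exp (s * j) := by
    intro j s hs
    refine Real.exp_le_exp.2 ?_
    have h1 : |s| ≤ max |a| |b| := abs_le_max_abs_abs hs.1 hs.2
    have h2 := neg_abs_le (s * j)
    rw [abs_mul] at h2
    nlinarith [mul_le_mul_of_nonneg_right h1 (abs_nonneg (j : ℝ))]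
  have hdiff : ∀ i j : ℤ, stepLaw X P i ≠ 0 → stepLaw X P j ≠ 0 →
      i - j ∈ frequencyGroup X P a b := by
    intro i j hi hj
    have hpos : ∀ k : ℤ, stepLaw X P k ≠ 0 → 0 < (stepLaw X P k).toReal *
        Real.exp (-(max |a| |b| * |(k : ℝ)|)) := fun k hk =>
      mul_pos (ENNReal.toReal_pos hk (measure_ne_top _ _)) (Real.exp_pos _)
    set ci := (stepLaw X P i).toReal * Real.exp (-(max |a| |b| * |(i : ℝ)|))
    set cj := (stepLaw X P j).toReal * Real.exp (-(max |a| |b| * |(j : ℝ)|))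
    have hci : 0 < ci := hpos i hi
    have hcj : 0 < cj := hpos j hj
    refine ⟨2 * (2 / ci + 2 / cj), by positivity, fun s hs θ => ?_⟩
    obtain ⟨c, hc⟩ := exists_phase hX (hab hs) θ
    set D := mgf (upStep X) P s - ‖complexMGF (upStep X) P (s + θ * Complex.I)‖
    have hb : ∀ k : ℤ, stepLaw X P k ≠ 0 →
        ‖Complex.exp (Complex.I * ((θ * k : ℝ) : ℂ)) - c‖ ^ 2 ≤
          2 / ((stepLaw X P k).toReal * Real.exp (-(max |a| |b| * |(k : ℝ)|))) * D := by
      intro k hk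
      rw [div_mul_eq_mul_div, le_div_iff₀ (hpos k hk), mul_comm]
      refine le_trans ?_ (hc k)
      have := hlow k s hs
      gcongr
    have hbi := hb i hi
    have hbj := hb j hj
    have h1 : Complex.exp (Complex.I * ((θ * i : ℝ) : ℂ)) =
        Complex.exp (Complex.I * ((θ * (i - j : ℤ) : ℝ) : ℂ)) *
          Complex.exp (Complex.I * ((θ * j : ℝ) : ℂ)) := by
      rw [← Complex.exp_add]
      push_cast
      ring_nf
    have h2 : ‖Complex.exp (Complex.I * ((θ * j : ℝ) : ℂ))‖ = 1 := by
      rw [mul_comm]; exact Complex.norm_exp_ofReal_mul_I _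
    have h3 : ‖Complex.exp (Complex.I * ((θ * (i - j : ℤ) : ℝ) : ℂ)) - 1‖ ≤
        ‖Complex.exp (Complex.I * ((θ * i : ℝ) : ℂ)) - c‖ +
          ‖Complex.exp (Complex.I * ((θ * j : ℝ) : ℂ)) - c‖ := by
      rw [← mul_one ‖Complex.exp (Complex.I * ((θ * (i - j : ℤ) : ℝ) : ℂ)) - 1‖, ← h2, ← norm_mul,
        sub_mul, one_mul, ← h1]
      have := norm_sub_le (Complex.exp (Complex.I * ((θ * i : ℝ) : ℂ)) - c)
        (Complex.exp (Complex.I * ((θ * j : ℝ) : ℂ)) - c)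
      simpa using this
    have h6 := pow_le_pow_left₀ (norm_nonneg _) h3 2
    nlinarith [sq_nonneg (‖Complex.exp (Complex.I * ((θ * i : ℝ) : ℂ)) - c‖ -
      ‖Complex.exp (Complex.I * ((θ * j : ℝ) : ℂ)) - c‖)]
  obtain ⟨g, hg⟩ := Int.subgroup_cyclic (frequencyGroup X P a b)
  obtain ⟨j, hj⟩ : ∃ j, stepLaw X P j ≠ 0 := by
    by_contra! h
    have : ∀ᵐ ω ∂P, ∀ k : ℤ, X 0 ω ≠ k := ae_all_iff.2 fun k => by
      rw [ae_iff]; simpa [stepLaw] using h k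
    obtain ⟨ω, hω⟩ := this.exists
    exact hω _ rfl
  have hsupp : ∀ᵐ ω ∂P, stepLaw X P (X 0 ω) ≠ 0 := by
    have : ∀ᵐ ω ∂P, ∀ k : ℤ, stepLaw X P k = 0 → X 0 ω ≠ k := ae_all_iff.2 fun k => by
      by_cases hk : stepLaw X P k = 0
      · simp only [hk, forall_const]
        rw [ae_iff]
        simpa [stepLaw] using hk
      · simp [hk]
    filter_upwards [this] with ω hω h0
    exact hω _ h0 rfl
  have h1 := hap g.natAbs j (by
    filter_upwards [hsupp] with ω hω
    have h2 := hdiff _ j hω hj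
    rw [hg, AddSubgroup.mem_closure_singleton] at h2
    obtain ⟨n, hn⟩ := h2
    rw [Int.natAbs_dvd, ← hn]
    exact ⟨n, by simp [mul_comm]⟩)
  rw [eq_top_iff]
  intro x _
  rw [hg, AddSubgroup.mem_closure_singleton]
  rcases Int.natAbs_eq g with h | h
  · exact ⟨x, by rw [h, h1]; simp⟩
  · exact ⟨-x, by rw [h, h1]; simp⟩

/-- Uniform quadratic bound for the characteristic functions of the tilted steps. -/
lemma exists_norm_complexMGF_le [IsProbabilityMeasure P] (hX : IIDSteps X P) (hap : Aperiodic X P)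
    {a b : ℝ} (hab : Set.Icc a b ⊆ integrableExpSet (upStep X) P) :
    ∃ c : ℝ, 0 < c ∧ ∀ s ∈ Set.Icc a b, ∀ θ : ℝ, |θ| ≤ Real.pi →
      ‖complexMGF (upStep X) P (s + θ * Complex.I)‖ ≤
        mgf (upStep X) P s * Real.exp (-(c * θ ^ 2)) := by
  have h1 : (1 : ℤ) ∈ frequencyGroup X P a b := by
    rw [frequencyGroup_eq_top hX hap hab]; trivial
  obtain ⟨C, hC, h⟩ := h1
  set B := mgf (upStep X) P a + mgf (upStep X) P b + 1
  have hB0 : 0 < B := by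
    have := mgf_nonneg (X := upStep X) (μ := P) (t := a)
    have := mgf_nonneg (X := upStep X) (μ := P) (t := b)
    positivity
  have hB : ∀ s ∈ Set.Icc a b, mgf (upStep X) P s ≤ B := by
    intro s hs
    have ha := hab (Set.left_mem_Icc.2 (hs.1.trans hs.2))
    have hb := hab (Set.right_mem_Icc.2 (hs.1.trans hs.2))
    have : mgf (upStep X) P s ≤ mgf (upStep X) P a + mgf (upStep X) P b := by
      rw [mgf, mgf, mgf, ← integral_add ha hb]
      refine integral_mono (hab hs) (Integrable.add ha hb) fun ω => ?_
      rcases le_total 0 (upStep X ω) with h0 | h0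
      · have : Real.exp (s * upStep X ω) ≤ Real.exp (b * upStep X ω) :=
          Real.exp_le_exp.2 (mul_le_mul_of_nonneg_right hs.2 h0)
        beta_reduce
        linarith [Real.exp_pos (a * upStep X ω)]
      · have : Real.exp (s * upStep X ω) ≤ Real.exp (a * upStep X ω) :=
          Real.exp_le_exp.2 (mul_le_mul_of_nonpos_right hs.1 h0)
        beta_reduce
        linarith [Real.exp_pos (b * upStep X ω)]
    linarith
  -- B bounds the moment generating function over the interval of tilts; C + 1 replaces C because C
  -- may vanish and is divided by below.
  set K := (C + 1) * B
  have hK : 0 < K := by positivity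
  refine ⟨4 / (Real.pi ^ 2 * K), by positivity, fun s hs θ hθ => ?_⟩
  have hM : 0 < mgf (upStep X) P s := mgf_pos (hab hs)
  set M := mgf (upStep X) P s
  set D := M - ‖complexMGF (upStep X) P (s + θ * Complex.I)‖ with hD
  have hD0 : 0 ≤ D := by
    have := norm_complexMGF_le_mgf (X := upStep X) (μ := P) (z := s + θ * Complex.I)
    simp only [Complex.add_re, Complex.ofReal_re, Complex.mul_re, Complex.I_re, mul_zero,
      Complex.ofReal_im, Complex.I_im, mul_one, sub_self, add_zero] at this
    linarith
  have h2 := h s hs θ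
  rw [Int.cast_one, mul_one, Complex.norm_exp_I_mul_ofReal_sub_one] at h2
  have h3 : 2 / Real.pi * |θ| ≤ ‖2 * Real.sin (θ / 2)‖ := by
    have := Real.mul_abs_le_abs_sin (x := θ / 2) (by rw [abs_div, abs_two]; linarith)
    rw [abs_div, abs_two] at this
    rw [norm_mul, Real.norm_eq_abs, Real.norm_eq_abs, abs_two]
    linarith
  have h4 : 4 / Real.pi ^ 2 * θ ^ 2 ≤ (C + 1) * D := by
    have h5 := pow_le_pow_left₀ (by positivity) h3 2
    rw [mul_pow, div_pow, sq_abs] at h5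
    nlinarith
  have h6 : 4 / (Real.pi ^ 2 * K) * θ ^ 2 ≤ D / B := by
    rw [le_div_iff₀ hB0]
    calc 4 / (Real.pi ^ 2 * K) * θ ^ 2 * B = (4 / Real.pi ^ 2 * θ ^ 2) / (C + 1) := by
          simp only [K]; field_simp
      _ ≤ D := by rw [div_le_iff₀ (by positivity)]; linarith
  have h7 : D / B ≤ D / M := div_le_div_of_nonneg_left hD0 hM (hB s hs)
  have h8 := Real.add_one_le_exp (-(4 / (Real.pi ^ 2 * K) * θ ^ 2))
  have h9 : 1 - D / M ≤ Real.exp (-(4 / (Real.pi ^ 2 * K) * θ ^ 2)) := by linarith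
  calc ‖complexMGF (upStep X) P (s + θ * Complex.I)‖ = M * (1 - D / M) := by
        rw [mul_sub, mul_one, mul_div_cancel₀ _ hM.ne', hD]; ring
    _ ≤ _ := by gcongr

end

section

variable {Ω : Type*} [MeasurableSpace Ω] {X : ℕ → Ω → ℤ} {P : Measure Ω}

/-! ### Fourier inversion -/

lemma complexMGF_walk [IsProbabilityMeasure P] (hX : IIDSteps X P) (z : ℂ) (n : ℕ) :
    complexMGF (fun ω => (walk X n ω : ℝ)) P z = complexMGF (upStep X) P z ^ n := by
  induction n with
  | zero => simp [complexMGF]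
  | succ n ih =>
    have hind : IndepFun (walk X n) (X n) P := by
      have := hX.indep.indepFun_sum_range_succ hX.meas n
      refine this.congr (Eventually.of_forall fun ω => ?_) (Eventually.of_forall fun ω => rfl)
      simp [walk]
    have hm : ∀ k : ℤ → ℂ, Measurable k := fun k => measurable_of_countable k
    have hind' := hind.comp (hm fun k => Complex.exp (z * ((k : ℝ) : ℂ)))
      (hm fun k => Complex.exp (z * ((k : ℝ) : ℂ)))
    have h1 := hind'.integral_fun_mul_eq_mul_integral
      ((hm _).comp (hX.measurable_walk n)).aestronglyMeasurable
      ((hm _).comp (hX.meas n)).aestronglyMeasurable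
    have h2 : complexMGF (fun ω => (X n ω : ℝ)) P z = complexMGF (upStep X) P z :=
      ((hX.ident n).comp (hm fun k => Complex.exp (z * ((k : ℝ) : ℂ)))).integral_eq
    rw [pow_succ, ← ih, ← h2]
    simp only [complexMGF]
    refine Eq.trans ?_ h1
    refine integral_congr_ae (Eventually.of_forall fun ω => ?_)
    simp only [Function.comp, walk_succ, ← Complex.exp_add]
    push_cast
    ring_nf

lemma integrable_exp_walk [IsProbabilityMeasure P] (hX : IIDSteps X P) {s : ℝ}
    (hs : s ∈ integrableExpSet (upStep X) P) (n : ℕ) :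
    Integrable (fun ω => Real.exp (s * (walk X n ω : ℝ))) P := by
  have hm : Measurable fun k : ℤ => Real.exp (s * (k : ℝ)) := measurable_of_countable _
  have h1 : ∀ i, Integrable (fun ω => Real.exp (s * (X i ω : ℝ))) P := fun i =>
    (((hX.ident i).comp hm).integrable_iff).2 hs
  have hind : iIndepFun (fun i ω => (X i ω : ℝ)) P :=
    hX.indep.comp (fun _ (k : ℤ) => (k : ℝ)) fun _ => measurable_of_countable _
  have h2 := hind.integrable_exp_mul_sum (s := Finset.range n) (t := s)
    (fun i => (measurable_of_countable (fun k : ℤ => (k : ℝ))).comp (hX.meas i)) fun i _ => h1 i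
  refine h2.congr (Eventually.of_forall fun ω => ?_)
  simp [walk]

lemma mgf_walk [IsProbabilityMeasure P] (hX : IIDSteps X P) (s : ℝ) (n : ℕ) :
    mgf (fun ω => (walk X n ω : ℝ)) P s = mgf (upStep X) P s ^ n := by
  have h := complexMGF_walk hX (s : ℂ) n
  rw [complexMGF_ofReal, complexMGF_ofReal] at h
  exact_mod_cast h

lemma integral_exp_int_mul_I (m : ℤ) :
    ∫ θ in (-Real.pi)..Real.pi, Complex.exp (Complex.I * m * (θ : ℂ)) =
      if m = 0 then (2 * Real.pi : ℂ) else 0 := by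
  split_ifs with h
  · simp [h]; ring
  · have hc : Complex.I * (m : ℂ) ≠ 0 := mul_ne_zero Complex.I_ne_zero (by exact_mod_cast h)
    rw [integral_exp_mul_complex hc, div_eq_zero_iff]
    left
    rw [sub_eq_zero, Complex.exp_eq_exp_iff_exists_int]
    exact ⟨m, by push_cast; ring⟩

/-- Fourier inversion on the line of real part s: write the n-th power as an expectation over the
walk, exchange the integrals and use the orthogonality of characters. -/
lemma exp_mul_prob_walk_eq [IsProbabilityMeasure P] (hX : IIDSteps X P) {s : ℝ}
    (hs : s ∈ integrableExpSet (upStep X) P) (n : ℕ) (k : ℤ) :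
    ((2 * Real.pi * (Real.exp (s * k) * P.real {ω | walk X n ω = k}) : ℝ) : ℂ) =
      ∫ θ in (-Real.pi)..Real.pi, complexMGF (upStep X) P (s + θ * Complex.I) ^ n *
        Complex.exp (-(Complex.I * k * (θ : ℂ))) := by
  have hS : Measurable fun ω => (walk X n ω : ℝ) :=
    (measurable_of_countable (fun k : ℤ => (k : ℝ))).comp (hX.measurable_walk n)
  have h1 : ∀ θ : ℝ, complexMGF (upStep X) P (s + θ * Complex.I) ^ n *
      Complex.exp (-(Complex.I * k * (θ : ℂ))) =
      ∫ ω, (Real.exp (s * (walk X n ω : ℝ)) : ℂ) *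
        Complex.exp (Complex.I * ((walk X n ω - k : ℤ) : ℂ) * (θ : ℂ)) ∂P := by
    intro θ
    rw [← complexMGF_walk hX, complexMGF, ← integral_mul_const]
    refine integral_congr_ae (Eventually.of_forall fun ω => ?_)
    beta_reduce
    rw [Complex.ofReal_exp, ← Complex.exp_add, ← Complex.exp_add]
    push_cast
    ring_nf
  simp_rw [h1]
  rw [intervalIntegral_integral_swap]
  · have h2 : ∀ ω, ∫ θ in (-Real.pi)..Real.pi, (Real.exp (s * (walk X n ω : ℝ)) : ℂ) *
        Complex.exp (Complex.I * ((walk X n ω - k : ℤ) : ℂ) * (θ : ℂ)) =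
        {ω | walk X n ω = k}.indicator
          (fun _ => ((2 * Real.pi * Real.exp (s * k) : ℝ) : ℂ)) ω := by
      intro ω
      rw [intervalIntegral.integral_const_mul, integral_exp_int_mul_I]
      by_cases h : walk X n ω = k
      · simp [h]; ring
      · simp [h, sub_eq_zero]
    simp_rw [h2]
    have hset : MeasurableSet {ω | walk X n ω = k} :=
      hX.measurable_walk n (measurableSet_singleton k)
    rw [integral_indicator_const _ hset, Complex.real_smul]
    push_cast
    ring
  · have : IsFiniteMeasure ((volume : Measure ℝ).restrict (Set.uIoc (-Real.pi) Real.pi)) := by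
      rw [Set.uIoc_of_le (by linarith [Real.pi_pos])]
      infer_instance
    have h3 := (integrable_exp_walk hX hs n).comp_snd
      ((volume : Measure ℝ).restrict (Set.uIoc (-Real.pi) Real.pi))
    refine h3.mono (Measurable.aestronglyMeasurable ?_) (Eventually.of_forall fun x => ?_)
    · have hwk : Measurable fun x : ℝ × Ω => ((walk X n x.2 - k : ℤ) : ℂ) :=
        (measurable_of_countable (fun j : ℤ => ((j - k : ℤ) : ℂ))).comp
          ((hX.measurable_walk n).comp measurable_snd)
      have hwk' : Measurable fun x : ℝ × Ω => (walk X n x.2 : ℝ) := hS.comp measurable_snd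
      have e1 : Measurable fun x : ℝ × Ω => ((Real.exp (s * (walk X n x.2 : ℝ)) : ℝ) : ℂ) :=
        Complex.measurable_ofReal.comp (Real.measurable_exp.comp (hwk'.const_mul s))
      have e2 : Measurable fun x : ℝ × Ω =>
          Complex.exp (Complex.I * ((walk X n x.2 - k : ℤ) : ℂ) * (x.1 : ℂ)) :=
        Complex.measurable_exp.comp ((hwk.const_mul _).mul
          (Complex.measurable_ofReal.comp measurable_fst))
      exact e1.mul e2
    · simp only [Function.uncurry, norm_mul, Complex.norm_real]
      have : ‖Complex.exp (Complex.I * ((walk X n x.2 - k : ℤ) : ℂ) * (x.1 : ℂ))‖ = 1 := by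
        have e : Complex.I * ((walk X n x.2 - k : ℤ) : ℂ) * (x.1 : ℂ) =
          (((walk X n x.2 - k : ℤ) * x.1 : ℝ) : ℂ) * Complex.I := by push_cast; ring
        rw [e, Complex.norm_exp_ofReal_mul_I]
      rw [this, mul_one]

/-- The probability that the tilted walk is at `k` at time `n`. -/
noncomputable def tiltProb (X : ℕ → Ω → ℤ) (P : Measure Ω) (s : ℝ) (n : ℕ) (k : ℤ) : ℝ :=
  Real.exp (s * k) / mgf (upStep X) P s ^ n * P.real {ω | walk X n ω = k}

lemma tiltProb_nonneg (s : ℝ) (n : ℕ) (k : ℤ) : 0 ≤ tiltProb X P s n k :=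
  mul_nonneg (div_nonneg (Real.exp_pos _).le (pow_nonneg mgf_nonneg _)) measureReal_nonneg

/-- Rescaled Fourier inversion. -/
lemma sqrt_mul_tiltProb_eq [IsProbabilityMeasure P] (hX : IIDSteps X P) {s : ℝ}
    (hs : s ∈ integrableExpSet (upStep X) P) {n : ℕ} (hn : 0 < n) (k : ℤ) :
    ((2 * Real.pi * (√n * tiltProb X P s n k) : ℝ) : ℂ) =
      ∫ u : ℝ, (Set.Ioc (-Real.pi) Real.pi).indicator (fun θ : ℝ =>
        (complexMGF (upStep X) P (s + θ * Complex.I) / mgf (upStep X) P s) ^ n *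
        Complex.exp (-(Complex.I * k * (θ : ℂ)))) (u / √n) := by
  have hsq : 0 < √(n : ℝ) := Real.sqrt_pos.2 (by exact_mod_cast hn)
  have hM : 0 < mgf (upStep X) P s := mgf_pos hs
  rw [Measure.integral_comp_div, abs_of_pos hsq, integral_indicator measurableSet_Ioc,
    ← intervalIntegral.integral_of_le (by linarith [Real.pi_pos])]
  have h := exp_mul_prob_walk_eq hX hs n k
  have h1 : ∫ θ in (-Real.pi)..Real.pi,
      (complexMGF (upStep X) P (s + θ * Complex.I) / mgf (upStep X) P s) ^ n *
        Complex.exp (-(Complex.I * k * (θ : ℂ))) =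
      ((mgf (upStep X) P s : ℂ) ^ n)⁻¹ *
        ((2 * Real.pi * (Real.exp (s * k) * P.real {ω | walk X n ω = k}) : ℝ) : ℂ) := by
    rw [h, ← intervalIntegral.integral_const_mul]
    refine intervalIntegral.integral_congr fun θ _ => ?_
    rw [div_pow]
    ring
  rw [h1, Complex.real_smul, tiltProb]
  push_cast
  field_simp

/-- After the rescaling θ = u/√n, the n-th power of the bound e^{-cθ²} is e^{-cu²}. This majorant is
free of n, s and k and serves for both the uniform local bound and dominated convergence. -/
lemma norm_inversion_integrand_le {s c : ℝ} (hs : s ∈ integrableExpSet (upStep X) P)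
    [IsProbabilityMeasure P]
    (hbound : ∀ θ : ℝ, |θ| ≤ Real.pi → ‖complexMGF (upStep X) P (s + θ * Complex.I)‖ ≤
        mgf (upStep X) P s * Real.exp (-(c * θ ^ 2))) {n : ℕ} (hn : 0 < n) (k : ℤ) (u : ℝ) :
    ‖(Set.Ioc (-Real.pi) Real.pi).indicator (fun θ : ℝ =>
        (complexMGF (upStep X) P (s + θ * Complex.I) / mgf (upStep X) P s) ^ n *
        Complex.exp (-(Complex.I * k * (θ : ℂ)))) (u / √n)‖ ≤ Real.exp (-c * u ^ 2) := by
  have hM : 0 < mgf (upStep X) P s := mgf_pos hs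
  have hnr : (0 : ℝ) < n := by exact_mod_cast hn
  by_cases hu : u / √n ∈ Set.Ioc (-Real.pi) Real.pi
  · rw [Set.indicator_of_mem hu, norm_mul, norm_pow, norm_div, Complex.norm_real, Real.norm_eq_abs,
      abs_of_pos hM]
    have e : -(Complex.I * k * ((u / √n : ℝ) : ℂ)) = ((-(k * (u / √n)) : ℝ) : ℂ) * Complex.I := by
      push_cast; ring
    rw [e, Complex.norm_exp_ofReal_mul_I, mul_one]
    have h1 : ‖complexMGF (upStep X) P (s + ((u / √n : ℝ) : ℂ) * Complex.I)‖ / mgf (upStep X) P s ≤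
        Real.exp (-(c * (u / √n) ^ 2)) := by
      rw [div_le_iff₀' hM]
      exact hbound (u / √n) (abs_le.2 ⟨hu.1.le, hu.2⟩)
    refine (pow_le_pow_left₀ (by positivity) h1 n).trans_eq ?_
    rw [← Real.exp_nat_mul, div_pow, Real.sq_sqrt hnr.le]
    congr 1
    field_simp
  · rw [Set.indicator_of_notMem hu, norm_zero]
    positivity

/-- The local limit bound, uniformly over compact sets of tilts. -/
lemma exists_tiltProb_le [IsProbabilityMeasure P] (hX : IIDSteps X P) (hap : Aperiodic X P)
    {a b : ℝ} (hab : Set.Icc a b ⊆ integrableExpSet (upStep X) P) :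
    ∃ C : ℝ, 0 < C ∧ ∀ s ∈ Set.Icc a b, ∀ n : ℕ, 0 < n → ∀ k : ℤ,
      √n * tiltProb X P s n k ≤ C := by
  obtain ⟨c, hc, hbound⟩ := exists_norm_complexMGF_le hX hap hab
  refine ⟨√(Real.pi / c), by positivity, fun s hs n hn k => ?_⟩
  have hM : 0 < mgf (upStep X) P s := mgf_pos (hab hs)
  have hnr : (0 : ℝ) < n := by exact_mod_cast hn
  have h := sqrt_mul_tiltProb_eq hX (hab hs) hn k
  have h1 : ‖((2 * Real.pi * (√n * tiltProb X P s n k) : ℝ) : ℂ)‖ ≤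
      ∫ u : ℝ, Real.exp (-c * u ^ 2) := by
    rw [h]
    refine norm_integral_le_of_norm_le (integrable_exp_neg_mul_sq hc)
      (Eventually.of_forall fun u => ?_)
    exact norm_inversion_integrand_le (hab hs) (hbound s hs) hn k u
  rw [integral_gaussian, Complex.norm_real, Real.norm_eq_abs, abs_of_nonneg
    (mul_nonneg (by positivity) (mul_nonneg (Real.sqrt_nonneg _) (tiltProb_nonneg _ _ _)))] at h1
  have h2 : 0 ≤ √n * tiltProb X P s n k := mul_nonneg (Real.sqrt_nonneg _) (tiltProb_nonneg _ _ _)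
  nlinarith [Real.pi_gt_three]

/-! ### The local central limit theorem -/

/-- Here z^n = exp(n log z), and log z differs from z - 1 by O(|z - 1|²), which is negligible after
multiplication by n. -/
lemma tendsto_pow_of_mul_sub_one {ι : Type*} {l : Filter ι} {z : ι → ℂ} {n : ι → ℕ} {c : ℂ}
    (hn : Tendsto n l atTop) (h : Tendsto (fun i => (n i : ℂ) * (z i - 1)) l (𝓝 c)) :
    Tendsto (fun i => z i ^ n i) l (𝓝 (Complex.exp c)) := by
  have hn' : Tendsto (fun i => ((n i : ℝ))⁻¹) l (𝓝 0) :=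
    tendsto_inv_atTop_zero.comp (tendsto_natCast_atTop_atTop.comp hn)
  have hg : Tendsto (fun i => z i - 1) l (𝓝 0) := by
    have h1 := (Complex.continuous_ofReal.tendsto 0).comp hn' |>.mul h
    simp only [Complex.ofReal_zero, zero_mul] at h1
    refine h1.congr' ?_
    filter_upwards [hn.eventually_ge_atTop 1] with i hi
    have : (n i : ℂ) ≠ 0 := by
      have : n i ≠ 0 := by omega
      exact_mod_cast this
    simp only [Function.comp]
    push_cast
    field_simp
  have hgn : ∀ᶠ i in l, ‖z i - 1‖ < 1 / 2 := by
    have := hg.norm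
    rw [norm_zero] at this
    exact this.eventually_lt_const (by norm_num)
  have hlog : Tendsto (fun i => (n i : ℂ) * Complex.log (z i)) l (𝓝 c) := by
    have h2 : Tendsto (fun i => (n i : ℂ) * Complex.log (z i) - (n i : ℂ) * (z i - 1)) l (𝓝 0) := by
      have h3 := h.norm.mul hg.norm
      rw [norm_zero, mul_zero] at h3
      refine squeeze_zero_norm' ?_ h3
      filter_upwards [hgn] with i hi
      have h4 := Complex.norm_log_one_add_sub_self_le (z := z i - 1) (by linarith)
      rw [add_sub_cancel] at h4
      have h5 : (1 - ‖z i - 1‖)⁻¹ ≤ 2 := by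
        rw [inv_le_comm₀ (by linarith) (by norm_num)]
        linarith
      rw [← mul_sub, norm_mul, norm_mul, mul_assoc]
      gcongr
      nlinarith [norm_nonneg (z i - 1), sq_nonneg ‖z i - 1‖,
        mul_le_mul_of_nonneg_left h5 (sq_nonneg ‖z i - 1‖)]
    simpa using h2.add h
  refine ((Complex.continuous_exp.tendsto c).comp hlog).congr' ?_
  filter_upwards [hgn] with i hi
  have hz : z i ≠ 0 := by
    intro h0
    rw [h0, zero_sub, norm_neg, norm_one] at hi
    norm_num at hi
  rw [Function.comp, Complex.exp_nat_mul, Complex.exp_log hz]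

/-- Valid for all x, not only small ones, since it has to dominate the integrand over the whole step
distribution; for |x| > 1 it only says 2 + |x| ≤ 3x². -/
lemma norm_cexp_mul_I_sub_le (x : ℝ) :
    ‖Complex.exp (x * Complex.I) - 1 - x * Complex.I‖ ≤ 3 * x ^ 2 := by
  have hx : ‖(x : ℂ) * Complex.I‖ = |x| := by simp
  rcases le_or_gt |x| 1 with h | h
  · have := Complex.norm_exp_sub_one_sub_id_le (x := x * Complex.I) (by rwa [hx])
    rw [hx, sq_abs] at this
    nlinarith [sq_nonneg x]
  · have h1 := norm_sub_le (Complex.exp (x * Complex.I) - 1) (x * Complex.I)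
    have h2 := norm_sub_le (Complex.exp (x * Complex.I)) 1
    rw [Complex.norm_exp_ofReal_mul_I, norm_one] at h2
    rw [hx] at h1
    nlinarith [sq_abs x]

lemma tendsto_mul_cexp_sub {ι : Type*} {l : Filter ι} {n : ι → ℕ} {w : ι → ℝ} {w₀ : ℝ}
    (hn : Tendsto n l atTop) (hw : Tendsto w l (𝓝 w₀)) :
    Tendsto (fun i => (n i : ℂ) * (Complex.exp ((w i / √(n i) : ℝ) * Complex.I) - 1 -
      (w i / √(n i) : ℝ) * Complex.I)) l (𝓝 ((-(w₀ ^ 2 / 2) : ℝ) : ℂ)) := by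
  have hsq : Tendsto (fun i => √(n i : ℝ)) l atTop :=
    Real.tendsto_sqrt_atTop.comp (tendsto_natCast_atTop_atTop.comp hn)
  have hx : Tendsto (fun i => w i / √(n i)) l (𝓝 0) := hw.div_atTop hsq
  have h1 : Tendsto (fun i => (n i : ℂ) * (Complex.exp ((w i / √(n i) : ℝ) * Complex.I) - 1 -
      (w i / √(n i) : ℝ) * Complex.I) - ((-(w i ^ 2 / 2) : ℝ) : ℂ)) l (𝓝 0) := by
    have h2 : Tendsto (fun i => w i ^ 2 * |w i / √(n i)|) l (𝓝 0) := by
      simpa using (hw.pow 2).mul hx.abs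
    refine squeeze_zero_norm' ?_ h2
    filter_upwards [hn.eventually_ge_atTop 1, hx.abs.eventually_lt_const (u := 1) (by simp)]
      with i hi hxi
    have hn0 : (0 : ℝ) < n i := by exact_mod_cast hi
    set x := w i / √(n i) with hxdef
    have hwx : w i ^ 2 = n i * x ^ 2 := by
      rw [hxdef, div_pow, Real.sq_sqrt hn0.le]
      field_simp
    have h3 := Complex.exp_bound (x := x * Complex.I) (by simpa using hxi.le) (n := 3) (by norm_num)
    have h4 : Complex.exp (x * Complex.I) - ∑ m ∈ Finset.range 3, (x * Complex.I) ^ m / m.factorial =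
        Complex.exp (x * Complex.I) - 1 - x * Complex.I + x ^ 2 / 2 := by
      simp [Finset.sum_range_succ, mul_pow]
      ring
    have h5 : ‖(x : ℂ) * Complex.I‖ = |x| := by simp
    rw [h4, h5] at h3
    have h6 : (n i : ℂ) * (Complex.exp (x * Complex.I) - 1 - x * Complex.I) -
        ((-(w i ^ 2 / 2) : ℝ) : ℂ) =
        n i * (Complex.exp (x * Complex.I) - 1 - x * Complex.I + x ^ 2 / 2) := by
      rw [hwx]; push_cast; ring
    rw [h6, norm_mul, Complex.norm_natCast, hwx, mul_assoc]
    gcongr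
    refine h3.trans ?_
    have : |x| ^ 3 * (((Nat.succ 3 : ℕ) : ℝ) * (((3 : ℕ).factorial : ℝ) * ((3 : ℕ) : ℝ))⁻¹) =
        |x| ^ 2 * |x| * (2 / 9) := by
      have : (((Nat.succ 3 : ℕ) : ℝ) * (((3 : ℕ).factorial : ℝ) * ((3 : ℕ) : ℝ))⁻¹) = 2 / 9 := by
        norm_num [Nat.factorial]
      rw [this]
      ring
    rw [this, sq_abs]
    nlinarith [mul_nonneg (sq_nonneg x) (abs_nonneg x)]
  have h7 : Tendsto (fun i => ((-(w i ^ 2 / 2) : ℝ) : ℂ)) l (𝓝 ((-(w₀ ^ 2 / 2) : ℝ) : ℂ)) :=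
    (Complex.continuous_ofReal.tendsto _).comp ((hw.pow 2).div_const 2).neg
  simpa using h1.add h7

end

/-! ### The local central limit theorem along converging tilts. -/

section

variable {Ω : Type*} [MeasurableSpace Ω] {X : ℕ → Ω → ℤ} {P : Measure Ω}

lemma exists_Icc_subset_interior {S : Set ℝ} {t : ℝ} (ht : t ∈ interior S) :
    ∃ ε : ℝ, 0 < ε ∧ Set.Icc (t - ε) (t + ε) ⊆ interior S := by
  obtain ⟨ε, hε, h⟩ := Metric.isOpen_iff.1 isOpen_interior t ht
  refine ⟨ε / 2, by positivity, fun x hx => h ?_⟩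
  rw [Metric.mem_ball, Real.dist_eq, abs_lt]
  constructor <;> linarith [hx.1, hx.2]

lemma integrable_exp_of_mem_interior {Y : Ω → ℝ} {s : ℝ}
    (hs : s ∈ interior (integrableExpSet Y P)) : Integrable (fun ω => Real.exp (s * Y ω)) P :=
  integrable_of_mem_integrableExpSet (interior_subset hs)

lemma continuousAt_mgf {Y : Ω → ℝ} {t : ℝ} (ht : t ∈ interior (integrableExpSet Y P)) :
    ContinuousAt (mgf Y P) t := (analyticAt_mgf ht).continuousAt

lemma continuousAt_deriv_cgf {Y : Ω → ℝ} {t : ℝ} (ht : t ∈ interior (integrableExpSet Y P)) :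
    ContinuousAt (deriv (cgf Y P)) t := (analyticAt_cgf ht).deriv.continuousAt

lemma exp_mul_le_add {a b s : ℝ} (hs : s ∈ Set.Icc a b) (x : ℝ) :
    Real.exp (s * x) ≤ Real.exp (a * x) + Real.exp (b * x) := by
  rcases le_total 0 x with h0 | h0
  · have := Real.exp_le_exp.2 (mul_le_mul_of_nonneg_right hs.2 h0)
    linarith [Real.exp_pos (a * x)]
  · have := Real.exp_le_exp.2 (mul_le_mul_of_nonpos_right hs.1 h0)
    linarith [Real.exp_pos (b * x)]

/-- Λ'(s) is the mean of Y under the law tilted by s. -/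
lemma integral_exp_mul_sub_deriv_cgf {Y : Ω → ℝ} {s : ℝ} [IsProbabilityMeasure P]
    (hs : s ∈ interior (integrableExpSet Y P)) :
    ∫ ω, Real.exp (s * Y ω) * (Y ω - deriv (cgf Y P) s) ∂P = 0 := by
  have hM : 0 < mgf Y P s := mgf_pos (integrable_exp_of_mem_interior hs)
  have h1 : Integrable (fun ω => Y ω * Real.exp (s * Y ω)) P := by
    simpa using integrable_pow_mul_exp_of_mem_interior_integrableExpSet hs 1
  have h2 : Integrable (fun ω => Real.exp (s * Y ω)) P := integrable_exp_of_mem_interior hs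
  have h3 : ∀ ω, Real.exp (s * Y ω) * (Y ω - deriv (cgf Y P) s) =
      Y ω * Real.exp (s * Y ω) - deriv (cgf Y P) s * Real.exp (s * Y ω) := fun ω => by ring
  simp_rw [h3]
  rw [integral_sub h1 (h2.const_mul _), integral_const_mul, deriv_cgf hs]
  change _ - _ * mgf Y P s = 0
  rw [div_mul_cancel₀ _ hM.ne', sub_self]

/-- The centred tilted characteristic function has the Gaussian second order behaviour. -/
lemma tendsto_mul_charfun_sub_one [IsProbabilityMeasure P] (hX : IIDSteps X P) {t : ℝ}
    (ht : t ∈ interior (integrableExpSet (upStep X) P)) {ι : Type*} {l : Filter ι}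
    [l.IsCountablyGenerated] {n : ι → ℕ} {s : ι → ℝ} (hn : Tendsto n l atTop)
    (hs : Tendsto s l (𝓝 t)) (u : ℝ) :
    Tendsto (fun i => (n i : ℂ) *
      (complexMGF (upStep X) P (s i + ((u / √(n i) : ℝ) : ℂ) * Complex.I) /
          mgf (upStep X) P (s i) *
        Complex.exp ((-(u / √(n i) * deriv (cgf (upStep X) P) (s i)) : ℝ) * Complex.I) - 1)) l
      (𝓝 ((-(iteratedDeriv 2 (cgf (upStep X) P) t * u ^ 2 / 2) : ℝ) : ℂ)) := by
  set Y := upStep X with hYdef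
  have hY : Measurable Y := hX.measurable_upStep
  set m : ℝ → ℝ := deriv (cgf Y P)
  obtain ⟨ε, hε, hsub⟩ := exists_Icc_subset_interior ht
  have hmem : ∀ᶠ i in l, s i ∈ Set.Icc (t - ε) (t + ε) :=
    hs.eventually (Icc_mem_nhds (by linarith) (by linarith))
  have hm : Tendsto (fun i => m (s i)) l (𝓝 (m t)) := (continuousAt_deriv_cgf ht).tendsto.comp hs
  have hmb : ∀ᶠ i in l, |m (s i)| ≤ |m t| + 1 :=
    (hm.abs.eventually_lt_const (lt_add_one _)).mono fun i hi => hi.le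
  have hMt : Tendsto (fun i => mgf Y P (s i)) l (𝓝 (mgf Y P t)) :=
    (continuousAt_mgf ht).tendsto.comp hs
  have hM0 : 0 < mgf Y P t := mgf_pos (integrable_exp_of_mem_interior ht)
  -- The first-order term may be subtracted inside the expectation because the tilted step is
  -- centred at m (s i). What is left is of second order and is dominated by a square times
  -- exponentials at the two ends of the interval of tilts.
  let G : ι → Ω → ℂ := fun i ω => (Real.exp (s i * Y ω) : ℂ) * ((n i : ℂ) *
    (Complex.exp ((u * (Y ω - m (s i)) / √(n i) : ℝ) * Complex.I) - 1 -
      (u * (Y ω - m (s i)) / √(n i) : ℝ) * Complex.I))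
  have hG : Tendsto (fun i => ∫ ω, G i ω ∂P) l
      (𝓝 (∫ ω, (Real.exp (t * Y ω) : ℂ) * ((-((u * (Y ω - m t)) ^ 2 / 2) : ℝ) : ℂ) ∂P)) := by
    refine tendsto_integral_filter_of_dominated_convergence (fun ω => 3 * u ^ 2 *
      ((2 * (Y ω ^ 2 * Real.exp ((t - ε) * Y ω)) +
        2 * (|m t| + 1) ^ 2 * Real.exp ((t - ε) * Y ω)) +
      (2 * (Y ω ^ 2 * Real.exp ((t + ε) * Y ω)) +
        2 * (|m t| + 1) ^ 2 * Real.exp ((t + ε) * Y ω)))) ?_ ?_ ?_ ?_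
    · refine Eventually.of_forall fun i => Measurable.aestronglyMeasurable ?_
      have e1 : Measurable fun ω => (Y ω - m (s i)) := hY.sub_const _
      have e2 : Measurable fun ω => ((u * (Y ω - m (s i)) / √(n i) : ℝ) : ℂ) * Complex.I :=
        (Complex.measurable_ofReal.comp ((e1.const_mul _).div_const _)).mul_const _
      exact (Complex.measurable_ofReal.comp (Real.measurable_exp.comp (hY.const_mul _))).mul
        ((((Complex.measurable_exp.comp e2).sub_const _).sub e2).const_mul _)
    · filter_upwards [hmem, hmb, hn.eventually_ge_atTop 1] with i hi hi' hni
      refine Eventually.of_forall fun ω => ?_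
      have hn0 : (0 : ℝ) < n i := by exact_mod_cast hni
      simp only [G]
      rw [norm_mul, norm_mul, Complex.norm_natCast, Complex.norm_real, Real.norm_eq_abs,
        abs_of_pos (Real.exp_pos _)]
      have h1 := norm_cexp_mul_I_sub_le (u * (Y ω - m (s i)) / √(n i))
      rw [div_pow, Real.sq_sqrt hn0.le] at h1
      have h2 : (n i : ℝ) * ‖Complex.exp ((u * (Y ω - m (s i)) / √(n i) : ℝ) * Complex.I) - 1 -
          (u * (Y ω - m (s i)) / √(n i) : ℝ) * Complex.I‖ ≤ 3 * u ^ 2 * (Y ω - m (s i)) ^ 2 := by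
        calc _ ≤ (n i : ℝ) * (3 * ((u * (Y ω - m (s i))) ^ 2 / n i)) := by gcongr
          _ = _ := by field_simp
      have h3 : (Y ω - m (s i)) ^ 2 ≤ 2 * Y ω ^ 2 + 2 * (|m t| + 1) ^ 2 := by
        have : m (s i) ^ 2 ≤ (|m t| + 1) ^ 2 := by rw [← sq_abs]; gcongr
        nlinarith [sq_nonneg (Y ω + m (s i))]
      calc _ ≤ (Real.exp ((t - ε) * Y ω) + Real.exp ((t + ε) * Y ω)) *
            (3 * u ^ 2 * (2 * Y ω ^ 2 + 2 * (|m t| + 1) ^ 2)) := by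
            refine mul_le_mul (exp_mul_le_add hi _) (h2.trans ?_) (by positivity) (by positivity)
            gcongr
        _ = _ := by ring
    · have hl : t - ε ∈ interior (integrableExpSet Y P) := hsub ⟨le_rfl, by linarith⟩
      have hr : t + ε ∈ interior (integrableExpSet Y P) := hsub ⟨by linarith, le_rfl⟩
      have hint : ∀ r ∈ interior (integrableExpSet Y P), Integrable (fun ω =>
          2 * (Y ω ^ 2 * Real.exp (r * Y ω)) + 2 * (|m t| + 1) ^ 2 * Real.exp (r * Y ω)) P :=
        fun r hr => ((integrable_pow_mul_exp_of_mem_interior_integrableExpSet hr 2).const_mul 2).add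
          (Integrable.const_mul (integrable_exp_of_mem_interior hr) _)
      exact ((hint _ hl).add (hint _ hr)).const_mul _
    · refine Eventually.of_forall fun ω => ?_
      have h1 : Tendsto (fun i => Real.exp (s i * Y ω)) l (𝓝 (Real.exp (t * Y ω))) :=
        (Real.continuous_exp.tendsto _).comp (hs.mul_const _)
      exact ((Complex.continuous_ofReal.tendsto _).comp h1).mul
        (tendsto_mul_cexp_sub hn ((tendsto_const_nhds.sub hm).const_mul u))
  have hlim : (∫ ω, (Real.exp (t * Y ω) : ℂ) * ((-((u * (Y ω - m t)) ^ 2 / 2) : ℝ) : ℂ) ∂P) /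
      (mgf Y P t : ℂ) = ((-(iteratedDeriv 2 (cgf Y P) t * u ^ 2 / 2) : ℝ) : ℂ) := by
    rw [iteratedDeriv_two_cgf_eq_integral ht]
    have h1 : ∀ ω, (Real.exp (t * Y ω) : ℂ) * ((-((u * (Y ω - m t)) ^ 2 / 2) : ℝ) : ℂ) =
        ((-(u ^ 2 / 2) * ((Y ω - m t) ^ 2 * Real.exp (t * Y ω)) : ℝ) : ℂ) := fun ω => by
      push_cast; ring
    simp_rw [h1]
    rw [integral_complex_ofReal, integral_const_mul, ← Complex.ofReal_div]
    congr 1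
    ring
  rw [← hlim]
  refine (hG.div ((Complex.continuous_ofReal.tendsto _).comp hMt)
    (by exact_mod_cast hM0.ne')).congr' ?_
  filter_upwards [hmem, hn.eventually_ge_atTop 1] with i hi hni
  have hsi := hsub hi
  have hMi : 0 < mgf Y P (s i) := mgf_pos (integrable_exp_of_mem_interior hsi)
  have hMi' : (mgf Y P (s i) : ℂ) ≠ 0 := by exact_mod_cast hMi.ne'
  set θ := u / √(n i) with hθ
  have hint1 : Integrable (fun ω => (Real.exp (s i * Y ω) : ℂ) *
      Complex.exp ((θ * (Y ω - m (s i)) : ℝ) * Complex.I)) P := by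
    have := (integrable_cexp_mul_of_re_mem_integrableExpSet (z := s i + θ * Complex.I)
      hY.aemeasurable (by simpa using interior_subset hsi)).mul_const
        (Complex.exp ((-(θ * m (s i)) : ℝ) * Complex.I))
    refine this.congr (Eventually.of_forall fun ω => ?_)
    beta_reduce
    rw [Complex.ofReal_exp, ← Complex.exp_add, ← Complex.exp_add]
    push_cast
    ring_nf
  have hint2 : Integrable (fun ω => (Real.exp (s i * Y ω) : ℂ)) P :=
    (integrable_exp_of_mem_interior hsi).ofReal
  have hint3 : Integrable (fun ω => Real.exp (s i * Y ω) * (Y ω - m (s i))) P := by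
    have h1 : Integrable (fun ω => Y ω * Real.exp (s i * Y ω)) P := by
      simpa using integrable_pow_mul_exp_of_mem_interior_integrableExpSet hsi 1
    refine (h1.sub (Integrable.const_mul (integrable_exp_of_mem_interior hsi) (m (s i)))).congr
      (Eventually.of_forall fun ω => ?_)
    simp only [Pi.sub_apply]
    ring
  have hGi : ∫ ω, G i ω ∂P = (n i : ℂ) * (complexMGF Y P (s i + (θ : ℂ) * Complex.I) *
      Complex.exp ((-(θ * m (s i)) : ℝ) * Complex.I) - mgf Y P (s i)) := by
    have h1 : ∀ ω, G i ω = (n i : ℂ) * (((Real.exp (s i * Y ω) : ℂ) *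
        Complex.exp ((θ * (Y ω - m (s i)) : ℝ) * Complex.I) - (Real.exp (s i * Y ω) : ℂ)) -
        (θ * Complex.I) * ((Real.exp (s i * Y ω) * (Y ω - m (s i)) : ℝ) : ℂ)) := by
      intro ω
      have e : u * (Y ω - m (s i)) / √(n i) = θ * (Y ω - m (s i)) := by rw [hθ]; ring
      simp only [G, e]
      push_cast
      ring
    simp_rw [h1]
    have hint12 : Integrable (fun ω => (Real.exp (s i * Y ω) : ℂ) *
        Complex.exp ((θ * (Y ω - m (s i)) : ℝ) * Complex.I) - (Real.exp (s i * Y ω) : ℂ)) P :=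
      hint1.sub hint2
    have hint3' : Integrable (fun ω =>
        (θ * Complex.I) * ((Real.exp (s i * Y ω) * (Y ω - m (s i)) : ℝ) : ℂ)) P :=
      Integrable.const_mul hint3.ofReal _
    rw [integral_const_mul, integral_sub hint12 hint3',
      integral_sub hint1 hint2, integral_const_mul, integral_complex_ofReal, integral_complex_ofReal,
      integral_exp_mul_sub_deriv_cgf hsi, complexMGF, ← integral_mul_const]
    rw [Complex.ofReal_zero, mul_zero, sub_zero]
    congr 2
    refine integral_congr_ae (Eventually.of_forall fun ω => ?_)
    beta_reduce
    rw [Complex.ofReal_exp, ← Complex.exp_add, ← Complex.exp_add]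
    push_cast
    ring_nf
  simp only [Pi.div_apply, Function.comp]
  rw [hGi]
  field_simp

/-- It is the variance of the tilted step; if it vanished the step would be constant, which the case
h = 0 of aperiodicity excludes. -/
lemma iteratedDeriv_two_cgf_pos [IsProbabilityMeasure P] (hap : Aperiodic X P)
    {t : ℝ} (ht : t ∈ interior (integrableExpSet (upStep X) P)) :
    0 < iteratedDeriv 2 (cgf (upStep X) P) t := by
  rw [iteratedDeriv_two_cgf_eq_integral ht]
  set Y := upStep X with hYdef
  set m := deriv (cgf Y P) t
  refine div_pos ?_ (mgf_pos (integrable_exp_of_mem_interior ht))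
  have hint : Integrable (fun ω => (Y ω - m) ^ 2 * Real.exp (t * Y ω)) P := by
    have h1 := integrable_pow_mul_exp_of_mem_interior_integrableExpSet ht 2
    have h2 := integrable_pow_mul_exp_of_mem_interior_integrableExpSet ht 1
    have h3 : Integrable (fun ω => Real.exp (t * Y ω)) P := integrable_exp_of_mem_interior ht
    refine ((h1.sub (h2.const_mul (2 * m))).add (h3.const_mul (m ^ 2))).congr
      (Eventually.of_forall fun ω => ?_)
    simp only [Pi.sub_apply, Pi.add_apply]
    ring
  refine (integral_nonneg fun ω => by positivity).lt_of_ne fun h0 => ?_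
  have h1 := (integral_eq_zero_iff_of_nonneg (fun ω => by positivity) hint).1 h0.symm
  have h2 : ∀ᵐ ω ∂P, Y ω = m := by
    filter_upwards [h1] with ω hω
    have : (Y ω - m) ^ 2 = 0 := by
      simpa [Real.exp_ne_zero] using hω
    exact sub_eq_zero.1 (pow_eq_zero_iff two_ne_zero |>.1 this)
  obtain ⟨ω₀, hω₀⟩ := h2.exists
  have := hap 0 (X 0 ω₀) (by
    filter_upwards [h2] with ω hω
    have : (X 0 ω : ℝ) = X 0 ω₀ := hω.trans hω₀.symm
    have : X 0 ω = X 0 ω₀ := by exact_mod_cast this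
    simp [this])
  exact absurd this (by norm_num)

/-- The local central limit theorem for the tilted walk, along converging tilts. -/
theorem tendsto_sqrt_mul_tiltProb [IsProbabilityMeasure P] (hX : IIDSteps X P)
    (hap : Aperiodic X P) {t : ℝ}
    (ht : t ∈ interior (integrableExpSet (upStep X) P)) {ι : Type*} {l : Filter ι}
    [l.IsCountablyGenerated] {n : ι → ℕ} {s : ι → ℝ} {k : ι → ℤ} (hn : Tendsto n l atTop)
    (hs : Tendsto s l (𝓝 t))
    (hk : Tendsto (fun i => (k i - n i * deriv (cgf (upStep X) P) (s i)) / √(n i)) l (𝓝 0)) :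
    Tendsto (fun i => √(n i) * tiltProb X P (s i) (n i) (k i)) l
      (𝓝 (1 / √(2 * Real.pi * iteratedDeriv 2 (cgf (upStep X) P) t))) := by
  set Y := upStep X with hYdef
  set v := iteratedDeriv 2 (cgf Y P) t with hv
  have hv0 : 0 < v := iteratedDeriv_two_cgf_pos hap ht
  obtain ⟨ε, hε, hsub⟩ := exists_Icc_subset_interior ht
  have hmem : ∀ᶠ i in l, s i ∈ Set.Icc (t - ε) (t + ε) :=
    hs.eventually (Icc_mem_nhds (by linarith) (by linarith))
  obtain ⟨c, hc, hbound⟩ := exists_norm_complexMGF_le hX hap (hsub.trans interior_subset)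
  have hsq : Tendsto (fun i => √(n i : ℝ)) l atTop :=
    Real.tendsto_sqrt_atTop.comp (tendsto_natCast_atTop_atTop.comp hn)
  have hmain : Tendsto (fun i => ((2 * Real.pi * (√(n i) * tiltProb X P (s i) (n i) (k i)) : ℝ) : ℂ))
      l (𝓝 (∫ u : ℝ, ((Real.exp (-(v / 2) * u ^ 2) : ℝ) : ℂ))) := by
    have hD := tendsto_integral_filter_of_dominated_convergence (μ := volume) (l := l)
      (F := fun i u => (Set.Ioc (-Real.pi) Real.pi).indicator (fun θ : ℝ =>
        (complexMGF Y P (s i + θ * Complex.I) / mgf Y P (s i)) ^ n i *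
        Complex.exp (-(Complex.I * k i * (θ : ℂ)))) (u / √(n i)))
      (f := fun u : ℝ => ((Real.exp (-(v / 2) * u ^ 2) : ℝ) : ℂ))
      (fun u => Real.exp (-c * u ^ 2)) ?_ ?_ (integrable_exp_neg_mul_sq hc) ?_
    · refine hD.congr' ?_
      filter_upwards [hmem, hn.eventually_ge_atTop 1] with i hi hni
      exact (sqrt_mul_tiltProb_eq hX (interior_subset (hsub hi)) hni (k i)).symm
    · filter_upwards [hmem] with i hi
      have hcont : Continuous fun θ : ℝ => complexMGF Y P (s i + θ * Complex.I) := by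
        rw [continuous_iff_continuousAt]
        intro θ
        have := (analyticAt_complexMGF (X := Y) (μ := P) (z := s i + θ * Complex.I)
          (by simpa using hsub hi)).continuousAt
        exact this.comp (f := fun θ : ℝ => (s i + θ * Complex.I : ℂ)) (by fun_prop)
      refine Measurable.aestronglyMeasurable ?_
      refine Measurable.comp (g := (Set.Ioc (-Real.pi) Real.pi).indicator _)
        (Measurable.indicator (Continuous.measurable ?_) measurableSet_Ioc)
        (measurable_id.div_const _)
      fun_prop
    · filter_upwards [hmem, hn.eventually_ge_atTop 1] with i hi hni
      exact Eventually.of_forall fun u => norm_inversion_integrand_le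
        (interior_subset (hsub hi)) (hbound _ hi) hni (k i) u
    · refine Eventually.of_forall fun u => ?_
      have h1 := tendsto_pow_of_mul_sub_one hn (tendsto_mul_charfun_sub_one hX ht hn hs u)
      -- The phase left over after centring: it tends to 1 because the target is within o(√n) of the
      -- tilted mean.
      have h2 : Tendsto (fun i => Complex.exp ((-(u * ((k i - n i * deriv (cgf Y P) (s i)) /
          √(n i))) : ℝ) * Complex.I)) l (𝓝 1) := by
        have : Tendsto (fun i => (((-(u * ((k i - n i * deriv (cgf Y P) (s i)) /
          √(n i))) : ℝ) : ℂ) * Complex.I)) l (𝓝 ((((-(u * 0) : ℝ) : ℂ)) * Complex.I)) :=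
          ((Complex.continuous_ofReal.tendsto _).comp (hk.const_mul u).neg).mul_const _
        have h3 := (Complex.continuous_exp.tendsto _).comp this
        simpa [Function.comp_def] using h3
      have h3 := h1.mul h2
      rw [mul_one] at h3
      have h4 : Complex.exp ((-(v * u ^ 2 / 2) : ℝ) : ℂ) =
          ((Real.exp (-(v / 2) * u ^ 2) : ℝ) : ℂ) := by
        rw [Complex.ofReal_exp]; congr 2; ring
      rw [h4] at h3
      refine h3.congr' ?_
      have hu : Tendsto (fun i => u / √(n i)) l (𝓝 0) := hsq.const_div_atTop u
      filter_upwards [hu.eventually (Ioc_mem_nhds (a := -Real.pi) (b := Real.pi)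
        (by linarith [Real.pi_pos]) Real.pi_pos), hn.eventually_ge_atTop 1] with i hi hni
      have hn0 : (0 : ℝ) < n i := by exact_mod_cast hni
      rw [Set.indicator_of_mem (show u / √(n i) ∈ Set.Ioc (-Real.pi) Real.pi from hi), mul_pow, mul_assoc, ← Complex.exp_nat_mul, ← Complex.exp_add]
      congr 2
      have e : (n i : ℂ) = ((√(n i) : ℝ) : ℂ) * ((√(n i) : ℝ) : ℂ) := by
        rw [← Complex.ofReal_mul, Real.mul_self_sqrt hn0.le, Complex.ofReal_natCast]
      have e0 : ((√(n i) : ℝ) : ℂ) ≠ 0 := by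
        exact_mod_cast (Real.sqrt_pos.2 hn0).ne'
      push_cast
      field_simp
      ring
  rw [integral_complex_ofReal, integral_gaussian] at hmain
  have h1 := (Complex.continuous_re.tendsto _).comp hmain
  simp only [Function.comp_def, Complex.ofReal_re] at h1
  have h2 := h1.const_mul (1 / (2 * Real.pi))
  have e1 : 1 / (2 * Real.pi) * √(Real.pi / (v / 2)) = 1 / √(2 * Real.pi * v) := by
    rw [show Real.pi / (v / 2) = (2 * Real.pi) ^ 2 / (2 * Real.pi * v) by field_simp]
    rw [Real.sqrt_div (by positivity), Real.sqrt_sq (by positivity)]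
    field_simp
  rw [e1] at h2
  refine h2.congr fun i => ?_
  field_simp

end

section

/-! ### Kernel operators and first passage decompositions -/

/-- Operators on functions that are given by a kernel. -/
def IsKernelOp (T : Module.End ℝ≥0∞ (ℤ → ℝ≥0∞)) : Prop :=
  ∀ g x, T g x = ∑' z, T (Pi.single z 1) x * g z

lemma isKernelOp_one : IsKernelOp 1 := by
  intro g x
  rw [tsum_eq_single x]
  · simp
  · intro z hz
    simp [Ne.symm hz]

lemma isKernelOp_step (μ w : ℤ → ℝ≥0∞) : IsKernelOp (step μ w) := by
  intro g x
  have h1 : ∀ z, step μ w (Pi.single z 1) x = μ (z - x) * w z := by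
    intro z
    rw [step_apply, tsum_eq_single (z - x)]
    · simp
    · intro k hk
      rw [Pi.single_eq_of_ne (by omega), mul_zero, mul_zero]
  simp only [h1]
  rw [step_apply, ← (Equiv.addLeft x).tsum_eq (fun z => μ (z - x) * w z * g z)]
  refine tsum_congr fun k => ?_
  simp [mul_assoc]

lemma IsKernelOp.mul {S T : Module.End ℝ≥0∞ (ℤ → ℝ≥0∞)} (hS : IsKernelOp S) (hT : IsKernelOp T) :
    IsKernelOp (S * T) := by
  intro g x
  have h1 : ∀ z, (S * T) (Pi.single z 1) x = ∑' y, S (Pi.single y 1) x * T (Pi.single z 1) y :=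
    fun z => hS _ _
  simp only [h1]
  rw [Module.End.mul_apply, hS]
  simp_rw [hT g, ← ENNReal.tsum_mul_left, ← ENNReal.tsum_mul_right]
  rw [ENNReal.tsum_comm]
  simp only [mul_assoc]

lemma IsKernelOp.pow {S : Module.End ℝ≥0∞ (ℤ → ℝ≥0∞)} (hS : IsKernelOp S) (n : ℕ) :
    IsKernelOp (S ^ n) := by
  induction n with
  | zero => exact isKernelOp_one
  | succ n ih => rw [pow_succ]; exact ih.mul hS

/-- The weight `1` on positive integers. -/
noncomputable def posWeight (x : ℤ) : ℝ≥0∞ := if 0 < x then 1 else 0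

/-- The weight `1` on nonpositive integers. -/
noncomputable def nonposWeight (x : ℤ) : ℝ≥0∞ := if 0 < x then 0 else 1

lemma posWeight_add_nonposWeight : posWeight + nonposWeight = 1 := by
  funext x
  by_cases h : 0 < x <;> simp [posWeight, nonposWeight, h]

/-- The weight of the paths that enter the nonpositive integers for the first time at time `j + 1`,
at the point `z`. -/
noncomputable def firstPassage (μ : ℤ → ℝ≥0∞) (j : ℕ) (z : ℤ) : ℝ≥0∞ :=
  (step μ posWeight ^ j * step μ nonposWeight) (Pi.single z 1) 0

lemma firstPassage_eq_zero (μ : ℤ → ℝ≥0∞) (j : ℕ) {z : ℤ} (hz : 0 < z) :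
    firstPassage μ j z = 0 := by
  have h1 : step μ nonposWeight (Pi.single z 1) = 0 := by
    funext x
    rw [step_apply, Pi.zero_apply, ENNReal.tsum_eq_zero]
    intro k
    by_cases h : x + k = z
    · simp [nonposWeight, h, hz]
    · simp [h]
  rw [firstPassage, Module.End.mul_apply, h1, map_zero, Pi.zero_apply]

/-- Write the site weight 1 as positive part plus nonpositive part and expand at the first
occurrence of the latter. -/
lemma step_one_pow_eq (μ : ℤ → ℝ≥0∞) (n : ℕ) (h : ℤ → ℝ≥0∞) :
    (step μ 1 ^ n) h 0 = (step μ posWeight ^ n) h 0 +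
      ∑ j ∈ Finset.range n, ∑' z, firstPassage μ j z * (step μ 1 ^ (n - 1 - j)) h z := by
  nth_rewrite 1 [← posWeight_add_nonposWeight]
  rw [step_add, add_pow_eq_first_occurrence, LinearMap.add_apply, Pi.add_apply,
    LinearMap.sum_apply, Finset.sum_apply]
  congr 1
  refine Finset.sum_congr rfl fun j _ => ?_
  rw [Module.End.mul_apply, ← step_add, posWeight_add_nonposWeight]
  exact ((isKernelOp_step μ _).pow j).mul (isKernelOp_step μ _) _ _

/-- `x ↦ exp (t x)` as an extended nonnegative function. -/
noncomputable def expWeight (t : ℝ) (x : ℤ) : ℝ≥0∞ := ENNReal.ofReal (Real.exp (t * x))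

lemma expWeight_add (t : ℝ) (x y : ℤ) : expWeight t (x + y) = expWeight t x * expWeight t y := by
  rw [expWeight, expWeight, expWeight, ← ENNReal.ofReal_mul (Real.exp_pos _).le, ← Real.exp_add]
  push_cast
  ring_nf

/-- Exponentials are eigenfunctions of the free step, the eigenvalue being the moment generating
function. -/
lemma step_one_pow_expWeight (μ : ℤ → ℝ≥0∞) (t : ℝ) (n : ℕ) :
    (step μ 1 ^ n) (expWeight t) = (∑' k, μ k * expWeight t k) ^ n • expWeight t := by
  induction n with
  | zero => simp
  | succ n ih =>
    rw [pow_succ', Module.End.mul_apply, ih, map_smul]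
    have : step μ 1 (expWeight t) = (∑' k, μ k * expWeight t k) • expWeight t := by
      funext x
      rw [step_apply, Pi.smul_apply, smul_eq_mul, ← ENNReal.tsum_mul_right]
      refine tsum_congr fun k => ?_
      rw [Pi.one_apply, one_mul, expWeight_add]
      ring
    rw [this, smul_smul, ← pow_succ]

/-- The function e^{tx} - 1 is nonpositive off the positive integers, so killing there only helps.
One free step sends it to Me^{tx} - 1 ≥ M(e^{tx} - 1), because M ≥ 1. Iterating bounds the tilted
mass that survives from below. -/
lemma le_step_posWeight_pow_expWeight {μ : ℤ → ℝ≥0∞} (hμ : ∑' k, μ k = 1) {t M : ℝ} (ht : 0 ≤ t)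
    (hM : ∑' k, μ k * expWeight t k = ENNReal.ofReal M) (hM1 : 1 ≤ M) (n : ℕ) (x : ℤ) :
    ENNReal.ofReal (M ^ n * (Real.exp (t * x) - 1)) ≤ (step μ posWeight ^ n) (expWeight t) x := by
  induction n generalizing x with
  | zero =>
    simp only [pow_zero, one_mul, Module.End.one_apply, expWeight]
    exact ENNReal.ofReal_le_ofReal (by linarith)
  | succ n ih =>
    rw [pow_succ' (step μ posWeight), Module.End.mul_apply, step_apply]
    have h1 : ∀ k, μ k * ENNReal.ofReal (M ^ n * (Real.exp (t * (x + k : ℤ)) - 1)) ≤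
        μ k * (posWeight (x + k) * (step μ posWeight ^ n) (expWeight t) (x + k)) := by
      intro k
      gcongr
      by_cases h : 0 < x + k
      · simpa [posWeight, h] using ih (x + k)
      · have : M ^ n * (Real.exp (t * (x + k : ℤ)) - 1) ≤ 0 := by
          refine mul_nonpos_of_nonneg_of_nonpos (by positivity) ?_
          have h2 : ((x + k : ℤ) : ℝ) ≤ 0 := by exact_mod_cast not_lt.1 h
          have := Real.exp_le_one_iff.2 (mul_nonpos_of_nonneg_of_nonpos ht h2)
          linarith
        rw [ENNReal.ofReal_of_nonpos this]
        positivity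
    refine le_trans ?_ (ENNReal.tsum_le_tsum h1)
    have hMn : 0 ≤ M ^ n := by positivity
    simp_rw [ENNReal.ofReal_mul hMn, mul_left_comm (μ _)]
    rw [ENNReal.tsum_mul_left, pow_succ, mul_assoc, ENNReal.ofReal_mul hMn]
    gcongr
    have h3 : ENNReal.ofReal (M * Real.exp (t * x)) ≤
        ∑' k, μ k * ENNReal.ofReal (Real.exp (t * (x + k : ℤ)) - 1) + 1 := by
      rw [← hμ, ← ENNReal.tsum_add, ENNReal.ofReal_mul (by linarith), ← hM,
        ← ENNReal.tsum_mul_right]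
      refine ENNReal.tsum_le_tsum fun k => ?_
      rw [mul_assoc, ← mul_add_one]
      gcongr
      change expWeight t k * expWeight t x ≤ _
      rw [mul_comm, ← expWeight_add, expWeight, ← ENNReal.ofReal_one]
      refine le_trans ?_ ENNReal.ofReal_add_le
      simp
    have h4 := tsub_le_iff_right.2 h3
    refine le_trans ?_ h4
    rw [← ENNReal.ofReal_one, ← ENNReal.ofReal_sub _ zero_le_one]
    exact ENNReal.ofReal_le_ofReal (by linarith)

variable {Ω : Type*} [MeasurableSpace Ω] {X : ℕ → Ω → ℤ} {P : Measure Ω}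

lemma IIDSteps.lintegral_comp_step [IsProbabilityMeasure P] (hX : IIDSteps X P) (g : ℤ → ℝ≥0∞) :
    ∫⁻ ω, g (X 0 ω) ∂P = ∑' k, stepLaw X P k * g k := by
  have := hX.lintegral_first_step (fun k _ => g k) fun k => measurable_const
  simpa using this

lemma IIDSteps.tsum_stepLaw [IsProbabilityMeasure P] (hX : IIDSteps X P) :
    ∑' k, stepLaw X P k = 1 := by
  have := hX.lintegral_comp_step 1
  simpa using this.symm

lemma IIDSteps.tsum_stepLaw_mul_expWeight [IsProbabilityMeasure P] (hX : IIDSteps X P) {t : ℝ}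
    (ht : t ∈ integrableExpSet (upStep X) P) :
    ∑' k, stepLaw X P k * expWeight t k = ENNReal.ofReal (mgf (upStep X) P t) := by
  rw [← hX.lintegral_comp_step, mgf, ofReal_integral_eq_lintegral_ofReal ht
    (Eventually.of_forall fun ω => (Real.exp_pos _).le)]
  rfl

open Classical in
lemma IIDSteps.measure_walk_eq [IsProbabilityMeasure P] (hX : IIDSteps X P) (n : ℕ)
    (A : ℕ → ℤ → Prop) (B : ℤ → Prop) :
    P {ω | (∀ i < n, A i (walk X (i + 1) ω)) ∧ B (walk X n ω)} =
      pathSum (stepLaw X P) n (fun i x => if A i x then 1 else 0) (fun x => if B x then 1 else 0) 0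
      := by
  rw [← hX.lintegral_prod_walk]
  set S := {ω | (∀ i < n, A i (walk X (i + 1) ω)) ∧ B (walk X n ω)} with hS
  have hset : MeasurableSet S := by
    have h1 : ∀ m, ∀ C : ℤ → Prop, MeasurableSet {ω | C (walk X m ω)} := fun m C =>
      hX.measurable_walk m (MeasurableSet.of_discrete (s := {x | C x}))
    simp only [hS, Set.ofPred_and, Set.ofPred_forall]
    exact (MeasurableSet.iInter fun i => MeasurableSet.iInter fun _ => h1 _ _).inter (h1 _ _)
  rw [← lintegral_indicator_one hset]
  refine lintegral_congr fun ω => ?_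
  simp only [zero_add]
  by_cases h : ∀ i < n, A i (walk X (i + 1) ω)
  · rw [Finset.prod_eq_one fun i hi => if_pos (h i (Finset.mem_range.1 hi))]
    by_cases hB : B (walk X n ω)
    · rw [hS, Set.indicator_of_mem (Set.mem_ofPred.2 ⟨h, hB⟩)]
      simp [hB]
    · rw [hS, Set.indicator_of_notMem fun h' => hB (Set.mem_ofPred.1 h').2]
      simp [hB]
  · rw [hS, Set.indicator_of_notMem fun h' => h (Set.mem_ofPred.1 h').1]
    push Not at h
    obtain ⟨i, hi, hi'⟩ := h
    rw [Finset.prod_eq_zero (Finset.mem_range.2 hi) (if_neg hi'), zero_mul]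

lemma IIDSteps.measure_walk_eq_step [IsProbabilityMeasure P] (hX : IIDSteps X P) (n : ℕ) (d : ℤ) :
    P {ω | walk X n ω = d} = (step (stepLaw X P) 1 ^ n) (Pi.single d 1) 0 := by
  classical
  have h := hX.measure_walk_eq n (fun _ _ => True) (fun x => x = d)
  simp only [implies_true, true_and, if_true] at h
  rw [h, ← pathSum_const]
  congr 1
  funext x
  simp [Pi.single_apply]

/-- The probability that the walk stays positive up to time `n` and ends at `d`. -/
noncomputable def posProb (X : ℕ → Ω → ℤ) (P : Measure Ω) (n : ℕ) (d : ℤ) : ℝ :=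
  P.real {ω | (∀ i < n, 0 < walk X (i + 1) ω) ∧ walk X n ω = d}

lemma IIDSteps.measure_pos_walk_eq_step [IsProbabilityMeasure P] (hX : IIDSteps X P) (n : ℕ)
    (d : ℤ) : P {ω | (∀ i < n, 0 < walk X (i + 1) ω) ∧ walk X n ω = d} =
      (step (stepLaw X P) posWeight ^ n) (Pi.single d 1) 0 := by
  classical
  rw [hX.measure_walk_eq n (fun _ x => 0 < x) (fun x => x = d), ← pathSum_const]
  refine congrArg₂ (fun a b => pathSum (stepLaw X P) n a b 0) ?_ ?_
  · funext _ x
    simp [posWeight]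
  · funext x
    simp [Pi.single_apply]

/-- First passage decomposition of the law of the walk. -/
lemma IIDSteps.measure_walk_decomposition [IsProbabilityMeasure P] (hX : IIDSteps X P) (n : ℕ)
    (d : ℤ) : P {ω | walk X n ω = d} =
      P {ω | (∀ i < n, 0 < walk X (i + 1) ω) ∧ walk X n ω = d} +
        ∑' p : ℕ × ℤ, if p.1 < n then firstPassage (stepLaw X P) p.1 p.2 *
          P {ω | walk X (n - 1 - p.1) ω = d - p.2} else 0 := by
  rw [hX.measure_walk_eq_step, hX.measure_pos_walk_eq_step, step_one_pow_eq,
    ENNReal.tsum_prod (f := fun j z => if j < n then firstPassage (stepLaw X P) j z *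
      P {ω | walk X (n - 1 - j) ω = d - z} else 0)]
  congr 1
  rw [tsum_eq_sum (s := Finset.range n)]
  · refine Finset.sum_congr rfl fun j hj => tsum_congr fun z => ?_
    rw [if_pos (Finset.mem_range.1 hj), hX.measure_walk_eq_step]
    congr 1
    have := step_pow_translate (stepLaw X P) 1 (Pi.single d 1) z (n - 1 - j) 0
    rw [zero_add] at this
    rw [← this]
    have e : (fun y => (Pi.single d 1 : ℤ → ℝ≥0∞) (y + z)) = Pi.single (d - z) 1 := by
      funext y
      by_cases h : y = d - z
      · simp [h]
      · rw [Pi.single_eq_of_ne (by omega), Pi.single_eq_of_ne h]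
    rw [e]
    rfl
  · intro j hj
    simp [show ¬ j < n by simpa using hj]

/-- The free walk preserves the constant 1, and the passage at time j + 1 is one of the nonnegative
terms of its decomposition. -/
lemma tsum_firstPassage_le [IsProbabilityMeasure P] (hX : IIDSteps X P) (j : ℕ) :
    ∑' z, firstPassage (stepLaw X P) j z ≤ 1 := by
  have h := step_one_pow_eq (stepLaw X P) (j + 1) 1
  have h1 : ∀ n, (step (stepLaw X P) 1 ^ n) 1 = 1 := by
    intro n
    have := step_one_pow_expWeight (stepLaw X P) 0 n
    have e : expWeight 0 = 1 := by funext x; simp [expWeight]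
    rw [e] at this
    simpa [hX.tsum_stepLaw] using this
  simp only [h1, Pi.one_apply, mul_one] at h
  rw [h, Finset.sum_range_succ]
  exact le_add_left (le_add_left le_rfl)

end

section

variable {Ω : Type*} [MeasurableSpace Ω] {X : ℕ → Ω → ℤ} {P : Measure Ω}

/-! ### The local limit theorem for walks that stay positive -/

/-- The probability that the tilted walk enters the nonpositive integers for the first time at
time `p.1 + 1`, at the point `p.2`. -/
noncomputable def tiltPassage (X : ℕ → Ω → ℤ) (P : Measure Ω) (s : ℝ) (p : ℕ × ℤ) : ℝ :=
  (firstPassage (stepLaw X P) p.1 p.2).toReal * Real.exp (s * p.2) /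
    mgf (upStep X) P s ^ (p.1 + 1)

/-- The probability that the tilted walk stays positive forever. -/
noncomputable def escapeProb (X : ℕ → Ω → ℤ) (P : Measure Ω) (t : ℝ) : ℝ :=
  1 - ∑' p, tiltPassage X P t p

/-- The probability that the tilted walk stays positive up to time `n` and ends at `d`. -/
noncomputable def tiltPos (X : ℕ → Ω → ℤ) (P : Measure Ω) (s : ℝ) (n : ℕ) (d : ℤ) : ℝ :=
  Real.exp (s * d) / mgf (upStep X) P s ^ n * posProb X P n d

lemma firstPassage_ne_top [IsProbabilityMeasure P] (hX : IIDSteps X P) (j : ℕ) (z : ℤ) :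
    firstPassage (stepLaw X P) j z ≠ ⊤ :=
  ((ENNReal.le_tsum z).trans (tsum_firstPassage_le hX j)).trans_lt ENNReal.one_lt_top |>.ne

lemma tiltPassage_nonneg (s : ℝ) (p : ℕ × ℤ) : 0 ≤ tiltPassage X P s p :=
  div_nonneg (mul_nonneg ENNReal.toReal_nonneg (Real.exp_pos _).le) (pow_nonneg mgf_nonneg _)

/-- Test the first passage decomposition against e^{tx} and divide by M^{n+1}: the tilted passage
probabilities up to time n + 1 and the survival probability add up to 1. Survival contains the paths
with first step k, and from k `le_step_posWeight_pow_expWeight` keeps a share that does not shrink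
with n. -/
lemma tsum_ofReal_tiltPassage_add_le [IsProbabilityMeasure P] (hX : IIDSteps X P) {t : ℝ}
    (ht : t ∈ integrableExpSet (upStep X) P) (ht0 : 0 ≤ t) (hM1 : 1 ≤ mgf (upStep X) P t)
    {k : ℤ} (hk : 0 < k) :
    ∑' p, ENNReal.ofReal (tiltPassage X P t p) +
      stepLaw X P k * ENNReal.ofReal ((Real.exp (t * k) - 1) / mgf (upStep X) P t) ≤ 1 := by
  set M := mgf (upStep X) P t with hMdef
  set μ := stepLaw X P
  have hM0 : 0 < M := by linarith
  have hME : ∑' k, μ k * expWeight t k = ENNReal.ofReal M := hX.tsum_stepLaw_mul_expWeight ht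
  have hMtop : ∀ m : ℕ, ENNReal.ofReal M ^ m ≠ ⊤ := fun m => ENNReal.pow_ne_top ENNReal.ofReal_ne_top
  have hMne : ∀ m : ℕ, ENNReal.ofReal M ^ m ≠ 0 := fun m =>
    pow_ne_zero _ (ENNReal.ofReal_pos.2 hM0).ne'
  have hf : ∀ j z, ENNReal.ofReal (tiltPassage X P t (j, z)) =
      firstPassage μ j z * expWeight t z * (ENNReal.ofReal M ^ (j + 1))⁻¹ := by
    intro j z
    rw [tiltPassage, ENNReal.ofReal_div_of_pos (by positivity), ENNReal.ofReal_pow hM0.le,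
      ENNReal.ofReal_mul ENNReal.toReal_nonneg, ENNReal.ofReal_toReal (firstPassage_ne_top hX j z)]
    rfl
  rw [ENNReal.tsum_prod']
  have hpart : ∀ n, ∑ j ∈ Finset.range (n + 1), ∑' z, ENNReal.ofReal (tiltPassage X P t (j, z)) +
      μ k * ENNReal.ofReal ((Real.exp (t * k) - 1) / M) ≤ 1 := by
    intro n
    have h1 := step_one_pow_eq μ (n + 1) (expWeight t)
    simp only [step_one_pow_expWeight, hME, Pi.smul_apply, smul_eq_mul] at h1
    rw [show expWeight t 0 = 1 by simp [expWeight], mul_one] at h1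
    have h2 : (∑ j ∈ Finset.range (n + 1), ∑' z, ENNReal.ofReal (tiltPassage X P t (j, z))) *
        ENNReal.ofReal M ^ (n + 1) = ∑ j ∈ Finset.range (n + 1), ∑' z, firstPassage μ j z *
          (ENNReal.ofReal M ^ (n + 1 - 1 - j) * expWeight t z) := by
      rw [Finset.sum_mul]
      refine Finset.sum_congr rfl fun j hj => ?_
      rw [← ENNReal.tsum_mul_right]
      refine tsum_congr fun z => ?_
      have hj' : n + 1 = (j + 1) + (n + 1 - 1 - j) := by
        have := Finset.mem_range.1 hj; omega
      have e : ENNReal.ofReal M ^ (n + 1) =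
          ENNReal.ofReal M ^ (j + 1) * ENNReal.ofReal M ^ (n + 1 - 1 - j) := by
        rw [← pow_add, ← hj']
      rw [hf, e, mul_assoc, ← mul_assoc (_)⁻¹, ENNReal.inv_mul_cancel (hMne _) (hMtop _), one_mul]
      ring
    have h3 : μ k * ENNReal.ofReal ((Real.exp (t * k) - 1) / M) * ENNReal.ofReal M ^ (n + 1) ≤
        (step μ posWeight ^ (n + 1)) (expWeight t) 0 := by
      rw [pow_succ' (step μ posWeight), Module.End.mul_apply, step_apply]
      refine le_trans ?_ (ENNReal.le_tsum k)
      have h := le_step_posWeight_pow_expWeight hX.tsum_stepLaw ht0 hME hM1 n k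
      have e : ENNReal.ofReal ((Real.exp (t * k) - 1) / M) * ENNReal.ofReal M ^ (n + 1) =
          ENNReal.ofReal (M ^ n * (Real.exp (t * k) - 1)) := by
        rw [← ENNReal.ofReal_pow hM0.le, ← ENNReal.ofReal_mul' (by positivity)]
        congr 1
        rw [pow_succ]
        field_simp
      rw [mul_assoc, e, zero_add, show posWeight k = 1 from if_pos hk, one_mul]
      gcongr
    have h4 : (∑ j ∈ Finset.range (n + 1), ∑' z, ENNReal.ofReal (tiltPassage X P t (j, z)) +
        μ k * ENNReal.ofReal ((Real.exp (t * k) - 1) / M)) * ENNReal.ofReal M ^ (n + 1) ≤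
        1 * ENNReal.ofReal M ^ (n + 1) := by
      rw [add_mul, h2, one_mul]
      nth_rewrite 2 [h1]
      rw [add_comm]
      gcongr
    exact (ENNReal.mul_le_mul_iff_left (hMne _) (hMtop _)).1 h4
  have hlim : Tendsto (fun n => ∑ j ∈ Finset.range (n + 1),
      ∑' z, ENNReal.ofReal (tiltPassage X P t (j, z))) atTop
      (𝓝 (∑' j, ∑' z, ENNReal.ofReal (tiltPassage X P t (j, z)))) :=
    (ENNReal.tendsto_nat_tsum _).comp (tendsto_add_atTop_nat 1)
  exact le_of_tendsto (hlim.add tendsto_const_nhds) (Eventually.of_forall hpart)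

lemma summable_tiltPassage [IsProbabilityMeasure P] (hX : IIDSteps X P) {t : ℝ}
    (ht : t ∈ integrableExpSet (upStep X) P) (ht0 : 0 ≤ t) (hM1 : 1 ≤ mgf (upStep X) P t) :
    Summable (tiltPassage X P t) := by
  have h := tsum_ofReal_tiltPassage_add_le hX ht ht0 hM1 one_pos
  have h1 : ∑' p, ENNReal.ofReal (tiltPassage X P t p) ≠ ⊤ :=
    ((le_add_right le_rfl).trans h).trans_lt ENNReal.one_lt_top |>.ne
  have h2 := ENNReal.summable_toReal h1
  simpa only [ENNReal.toReal_ofReal (tiltPassage_nonneg _ _)] using h2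

lemma escapeProb_pos [IsProbabilityMeasure P] (hX : IIDSteps X P) {t : ℝ}
    (ht : t ∈ integrableExpSet (upStep X) P) (ht0 : 0 < t) (hM1 : 1 ≤ mgf (upStep X) P t)
    {k : ℤ} (hk : 0 < k) (hk' : stepLaw X P k ≠ 0) : 0 < escapeProb X P t := by
  have h := tsum_ofReal_tiltPassage_add_le hX ht ht0.le hM1 hk
  have hs := summable_tiltPassage hX ht ht0.le hM1
  rw [← ENNReal.ofReal_tsum_of_nonneg (tiltPassage_nonneg _) hs] at h
  have hpos : 0 < stepLaw X P k *
      ENNReal.ofReal ((Real.exp (t * k) - 1) / mgf (upStep X) P t) := by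
    refine ENNReal.mul_pos hk' (ENNReal.ofReal_pos.2 (div_pos ?_ (by linarith))).ne'
    rw [sub_pos, Real.one_lt_exp_iff]
    exact mul_pos ht0 (by exact_mod_cast hk)
  have h1 : ENNReal.ofReal (∑' p, tiltPassage X P t p) < 1 :=
    (ENNReal.lt_add_right ENNReal.ofReal_ne_top hpos.ne').trans_le h
  rw [escapeProb, sub_pos]
  rwa [ENNReal.ofReal_lt_one] at h1

/-- Staying positive is everything minus the first passages; the tilting factors are multiplicative
in time and space, so they split along the decomposition. -/
lemma tiltPos_eq [IsProbabilityMeasure P] (hX : IIDSteps X P) {s : ℝ}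
    (hs : s ∈ integrableExpSet (upStep X) P) (n : ℕ) (d : ℤ) :
    tiltPos X P s n d = tiltProb X P s n d - ∑' p : ℕ × ℤ, if p.1 < n then
      tiltPassage X P s p * tiltProb X P s (n - 1 - p.1) (d - p.2) else 0 := by
  have hM : 0 < mgf (upStep X) P s := mgf_pos hs
  set M := mgf (upStep X) P s with hMdef
  have h := hX.measure_walk_decomposition n d
  have hfin := measure_ne_top P {ω | walk X n ω = d}
  rw [h] at hfin
  have h2 := (ENNReal.add_ne_top.1 hfin).2
  have h1 := congrArg ENNReal.toReal h
  rw [ENNReal.toReal_add (measure_ne_top _ _) h2, ENNReal.tsum_toReal_eq fun p =>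
    ENNReal.ne_top_of_tsum_ne_top h2 p] at h1
  have h3 : ∑' p : ℕ × ℤ, (if p.1 < n then
      tiltPassage X P s p * tiltProb X P s (n - 1 - p.1) (d - p.2) else 0) =
      Real.exp (s * d) / M ^ n * ∑' p : ℕ × ℤ, (if p.1 < n then firstPassage (stepLaw X P) p.1 p.2 *
          P {ω | walk X (n - 1 - p.1) ω = d - p.2} else 0).toReal := by
    rw [← tsum_mul_left]
    refine tsum_congr fun p => ?_
    split_ifs with hp
    · rw [ENNReal.toReal_mul, tiltPassage, tiltProb, ← hMdef]
      have e1 : Real.exp (s * d) = Real.exp (s * p.2) * Real.exp (s * (d - p.2 : ℤ)) := by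
        rw [← Real.exp_add]; push_cast; ring_nf
      have e2 : M ^ n = M ^ (p.1 + 1) * M ^ (n - 1 - p.1) := by
        rw [← pow_add]; congr 1; omega
      rw [e1, e2]
      simp only [Measure.real]
      field_simp
    · simp
  rw [h3, tiltPos, tiltProb, posProb, ← hMdef]
  simp only [Measure.real]
  rw [h1]
  ring

lemma tiltProb_zero_le [IsProbabilityMeasure P] (s : ℝ) (k : ℤ) : tiltProb X P s 0 k ≤ 1 := by
  simp only [tiltProb, pow_zero, div_one, walk_zero]
  by_cases hk : k = 0
  · simp [hk]
  · simp [Ne.symm hk]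

lemma summable_mul_of_tsum_le_one {f : ℕ → ℤ → ℝ} {b : ℕ → ℝ} (hf : ∀ j z, 0 ≤ f j z)
    (hb0 : ∀ j, 0 ≤ b j) (hfs : ∀ j, Summable (f j)) (hf1 : ∀ j, ∑' z, f j z ≤ 1)
    (hb : Summable b) : Summable fun p : ℕ × ℤ => f p.1 p.2 * b p.1 := by
  rw [summable_prod_of_nonneg fun p => mul_nonneg (hf _ _) (hb0 _)]
  refine ⟨fun j => (hfs j).mul_right (b j), ?_⟩
  simp only [tsum_mul_right]
  exact Summable.of_nonneg_of_le (fun j => mul_nonneg (tsum_nonneg (hf j)) (hb0 j))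
    (fun j => mul_le_of_le_one_left (hb0 j) (hf1 j)) hb

lemma summable_add_two_div_pow {M₁ : ℝ} (hM₁ : 1 < M₁) :
    Summable fun j : ℕ => ((j : ℝ) + 2) / M₁ ^ (j + 1) := by
  have h1 : ‖M₁⁻¹‖ < 1 := by
    rw [norm_inv, Real.norm_eq_abs, abs_of_pos (by linarith)]
    exact inv_lt_one_of_one_lt₀ hM₁
  have h2 := (summable_pow_mul_geometric_of_norm_lt_one 1 h1).add
    ((summable_geometric_of_norm_lt_one h1).mul_left 2)
  refine (h2.mul_right M₁⁻¹).congr fun j => ?_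
  rw [pow_succ M₁, inv_pow, pow_one]
  field_simp

/-- The majorant for the first passage sum: j + 2 comes from comparing √n with the square root of
the remaining time, the geometric factor from tilts with moment generating function above M₁ > 1. -/
lemma summable_firstPassage_mul [IsProbabilityMeasure P] (hX : IIDSteps X P) {M₁ : ℝ}
    (hM₁ : 1 < M₁) {C : ℝ} (hC : 0 < C) :
    Summable fun p : ℕ × ℤ => (firstPassage (stepLaw X P) p.1 p.2).toReal *
      (((p.1 : ℝ) + 2) / M₁ ^ (p.1 + 1) * C) := by
  have hM0 : 0 < M₁ := by linarith
  refine summable_mul_of_tsum_le_one (b := fun j => ((j : ℝ) + 2) / M₁ ^ (j + 1) * C)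
    (f := fun j z => (firstPassage (stepLaw X P) j z).toReal) (fun j z => ENNReal.toReal_nonneg)
    (fun j => by positivity) (fun j => ?_) (fun j => ?_) ((summable_add_two_div_pow hM₁).mul_right C)
  · exact ENNReal.summable_toReal ((tsum_firstPassage_le hX j).trans_lt ENNReal.one_lt_top).ne
  · rw [← ENNReal.tsum_toReal_eq fun z => firstPassage_ne_top hX j z]
    exact ENNReal.toReal_le_of_le_ofReal zero_le_one (by simpa using tsum_firstPassage_le hX j)

lemma tendsto_sqrt_div_sqrt_sub (j : ℕ) :
    Tendsto (fun m : ℕ => √(m : ℝ) / √((m - 1 - j : ℕ) : ℝ)) atTop (𝓝 1) := by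
  have h2 : Tendsto (fun m : ℕ => ((m + (1 + j) : ℕ) : ℝ) / (m : ℝ)) atTop (𝓝 1) := by
    have h3 : Tendsto (fun m : ℕ => 1 + ((1 + j : ℕ) : ℝ) / (m : ℝ)) atTop (𝓝 (1 + 0)) :=
      tendsto_const_nhds.add (tendsto_const_div_atTop_nhds_zero_nat _)
    rw [add_zero] at h3
    refine h3.congr' ?_
    filter_upwards [eventually_gt_atTop 0] with m hm
    have : (m : ℝ) ≠ 0 := by positivity
    push_cast
    field_simp
  have h4 := (Real.continuous_sqrt.tendsto 1).comp h2
  rw [Real.sqrt_one] at h4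
  refine (tendsto_add_atTop_iff_nat (1 + j)).1 (h4.congr fun m => ?_)
  simp only [Function.comp]
  rw [Real.sqrt_div (by positivity)]
  congr 3
  omega

/-- Removing a fixed number of steps and a fixed displacement is invisible on the scale √n. -/
lemma tendsto_sqrt_mul_tiltProb_sub [IsProbabilityMeasure P] (hX : IIDSteps X P)
    (hap : Aperiodic X P) {t : ℝ} (ht : t ∈ interior (integrableExpSet (upStep X) P))
    {ι : Type*} {l : Filter ι} [l.IsCountablyGenerated] {n : ι → ℕ} {s : ι → ℝ} {d : ι → ℤ}
    (hn : Tendsto n l atTop) (hs : Tendsto s l (𝓝 t))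
    (hd : Tendsto (fun i => (d i - n i * deriv (cgf (upStep X) P) (s i)) / √(n i)) l (𝓝 0))
    (j : ℕ) (z : ℤ) :
    Tendsto (fun i => √(n i) * tiltProb X P (s i) (n i - 1 - j) (d i - z)) l
      (𝓝 (1 / √(2 * Real.pi * iteratedDeriv 2 (cgf (upStep X) P) t))) := by
  have hm : Tendsto (fun i => deriv (cgf (upStep X) P) (s i)) l
      (𝓝 (deriv (cgf (upStep X) P) t)) := (continuousAt_deriv_cgf ht).tendsto.comp hs
  have hn' : Tendsto (fun i => n i - 1 - j) l atTop := by
    have : Tendsto (fun m : ℕ => m - 1 - j) atTop atTop :=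
      (tendsto_sub_atTop_nat j).comp (tendsto_sub_atTop_nat 1)
    exact this.comp hn
  have hr : Tendsto (fun i => √(n i : ℝ) / √((n i - 1 - j : ℕ) : ℝ)) l (𝓝 1) :=
    (tendsto_sqrt_div_sqrt_sub j).comp hn
  have hk' : Tendsto (fun i => (((d i - z : ℤ) : ℝ) - ((n i - 1 - j : ℕ) : ℝ) *
      deriv (cgf (upStep X) P) (s i)) / √((n i - 1 - j : ℕ) : ℝ)) l (𝓝 0) := by
    have hsq' : Tendsto (fun i => √((n i - 1 - j : ℕ) : ℝ)) l atTop :=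
      Real.tendsto_sqrt_atTop.comp (tendsto_natCast_atTop_atTop.comp hn')
    have h1 := (((hm.const_mul ((1 : ℝ) + j)).sub_const (z : ℝ))).div_atTop hsq'
    have h2 := (hd.mul hr).add h1
    rw [zero_mul, zero_add] at h2
    refine h2.congr' ?_
    filter_upwards [hn.eventually_gt_atTop (j + 1)] with i hi
    obtain ⟨m, hm⟩ : ∃ m, n i = m + 1 + j := ⟨n i - 1 - j, by omega⟩
    have hm0 : 0 < m := by omega
    have e : n i - 1 - j = m := by omega
    have hsm : √(m : ℝ) ≠ 0 := (Real.sqrt_pos.2 (by exact_mod_cast hm0)).ne'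
    have hsn : √(n i : ℝ) ≠ 0 := (Real.sqrt_pos.2 (by exact_mod_cast (by omega : 0 < n i))).ne'
    rw [e]
    have e2 : (n i : ℝ) = m + 1 + j := by rw [hm]; push_cast; ring
    field_simp
    rw [e2]
    push_cast
    ring
  have h1 := hr.mul (tendsto_sqrt_mul_tiltProb hX hap ht hn' hs hk')
  rw [one_mul] at h1
  refine h1.congr' ?_
  filter_upwards [hn.eventually_gt_atTop (j + 1)] with i hi
  have hsm : √((n i - 1 - j : ℕ) : ℝ) ≠ 0 :=
    (Real.sqrt_pos.2 (by exact_mod_cast (by omega : 0 < n i - 1 - j))).ne'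
  field_simp

/-- With n = m + 1 + j one has √n ≤ √m (j + 2) for m ≥ 1. For m = 0 the local bound says nothing and
the trivial bound by 1 is used, whence C + 1. -/
lemma sqrt_mul_tiltProb_sub_le [IsProbabilityMeasure P] {s C : ℝ} (hC : 0 < C)
    (hb : ∀ n : ℕ, 0 < n → ∀ k, √(n : ℝ) * tiltProb X P s n k ≤ C) {n j : ℕ} (hj : j < n) (k : ℤ) :
    √(n : ℝ) * tiltProb X P s (n - 1 - j) k ≤ ((j : ℝ) + 2) * (C + 1) := by
  have hj0 : (0 : ℝ) ≤ j := j.cast_nonneg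
  have hle : ∀ x : ℝ, 1 ≤ x → √x ≤ x := fun x hx => by
    rw [Real.sqrt_le_left (by linarith)]; nlinarith
  obtain ⟨m, rfl⟩ : ∃ m, n = m + 1 + j := ⟨n - 1 - j, by omega⟩
  rw [show m + 1 + j - 1 - j = m by omega]
  rcases Nat.eq_zero_or_pos m with rfl | hm
  · have h1 := tiltProb_zero_le (X := X) (P := P) s k
    have h2 := hle (((0 + 1 + j : ℕ) : ℝ)) (by push_cast; linarith)
    calc _ ≤ ((0 + 1 + j : ℕ) : ℝ) * 1 :=
          mul_le_mul h2 h1 (tiltProb_nonneg _ _ _) (by positivity)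
      _ ≤ _ := by push_cast; nlinarith
  · have hm1 : (1 : ℝ) ≤ m := by exact_mod_cast hm
    have h1 : √((m + 1 + j : ℕ) : ℝ) ≤ √(m : ℝ) * ((j : ℝ) + 2) := by
      calc √((m + 1 + j : ℕ) : ℝ) ≤ √((m : ℝ) * ((j : ℝ) + 2)) := by
            apply Real.sqrt_le_sqrt; push_cast; nlinarith
        _ = √(m : ℝ) * √((j : ℝ) + 2) := Real.sqrt_mul (by positivity) _
        _ ≤ _ := by gcongr; exact hle _ (by linarith)
    calc _ ≤ √(m : ℝ) * ((j : ℝ) + 2) * tiltProb X P s m k :=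
          mul_le_mul_of_nonneg_right h1 (tiltProb_nonneg _ _ _)
      _ = ((j : ℝ) + 2) * (√(m : ℝ) * tiltProb X P s m k) := by ring
      _ ≤ _ := by gcongr; linarith [hb m hm k]

/-- A first passage lands at some z ≤ 0, where e^{sz} ≤ 1. -/
lemma tiltPassage_le {s M₁ : ℝ} (hs : 0 ≤ s) (hM₁ : 0 < M₁) (hM : M₁ ≤ mgf (upStep X) P s)
    (j : ℕ) (z : ℤ) : tiltPassage X P s (j, z) ≤
      (firstPassage (stepLaw X P) j z).toReal / M₁ ^ (j + 1) := by
  rw [tiltPassage]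
  rcases lt_or_ge 0 z with hz | hz
  · simp [firstPassage_eq_zero _ _ hz]
  · have h2 : Real.exp (s * z) ≤ 1 :=
      Real.exp_le_one_iff.2 (mul_nonpos_of_nonneg_of_nonpos hs (by exact_mod_cast hz))
    exact div_le_div₀ ENNReal.toReal_nonneg
      (mul_le_of_le_one_right ENNReal.toReal_nonneg h2) (by positivity)
      (pow_le_pow_left₀ hM₁.le hM _)

/-- The local limit theorem for walks conditioned to stay positive, along converging tilts. -/
theorem tendsto_sqrt_mul_tiltPos [IsProbabilityMeasure P] (hX : IIDSteps X P)
    (hap : Aperiodic X P) {t : ℝ} (ht0 : 0 < t)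
    (ht : t ∈ interior (integrableExpSet (upStep X) P)) (hM1 : 1 < mgf (upStep X) P t)
    {ι : Type*} {l : Filter ι} [l.IsCountablyGenerated] {n : ι → ℕ} {s : ι → ℝ} {d : ι → ℤ}
    (hn : Tendsto n l atTop) (hs : Tendsto s l (𝓝 t))
    (hd : Tendsto (fun i => (d i - n i * deriv (cgf (upStep X) P) (s i)) / √(n i)) l (𝓝 0)) :
    Tendsto (fun i => √(n i) * tiltPos X P (s i) (n i) (d i)) l
      (𝓝 (escapeProb X P t / √(2 * Real.pi * iteratedDeriv 2 (cgf (upStep X) P) t))) := by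
  set M := mgf (upStep X) P with hMdef
  set L := 1 / √(2 * Real.pi * iteratedDeriv 2 (cgf (upStep X) P) t) with hL
  -- M₁ gives a geometric decay of the passage times valid for all tilts near t.
  obtain ⟨M₁, hM₁, hM₁t⟩ := exists_between hM1
  obtain ⟨ε, hε, hsub⟩ := exists_Icc_subset_interior ht
  have hmem : ∀ᶠ i in l, s i ∈ Set.Icc (t - ε) (t + ε) :=
    hs.eventually (Icc_mem_nhds (by linarith) (by linarith))
  have hspos : ∀ᶠ i in l, 0 < s i := hs.eventually_const_lt ht0
  have hMs : Tendsto (fun i => M (s i)) l (𝓝 (M t)) := (continuousAt_mgf ht).tendsto.comp hs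
  have hMl : ∀ᶠ i in l, M₁ < M (s i) := hMs.eventually_const_lt hM₁t
  obtain ⟨C, hC, hCb⟩ := exists_tiltProb_le hX hap (hsub.trans interior_subset)
  have hfree := tendsto_sqrt_mul_tiltProb hX hap ht hn hs hd
  have hsum : Tendsto (fun i => ∑' p : ℕ × ℤ, √(n i) * (if p.1 < n i then
      tiltPassage X P (s i) p * tiltProb X P (s i) (n i - 1 - p.1) (d i - p.2) else 0)) l
      (𝓝 (∑' p, tiltPassage X P t p * L)) := by
    refine tendsto_tsum_of_dominated_convergence
      (summable_firstPassage_mul hX hM₁ (by linarith : 0 < C + 1)) ?_ ?_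
    · rintro ⟨j, z⟩
      have h2 : Tendsto (fun i => tiltPassage X P (s i) (j, z)) l (𝓝 (tiltPassage X P t (j, z))) :=
        Tendsto.div (tendsto_const_nhds.mul ((Real.continuous_exp.tendsto _).comp
          (hs.mul_const _))) (hMs.pow _) (pow_ne_zero _ (by linarith))
      have h3 := h2.mul (tendsto_sqrt_mul_tiltProb_sub hX hap ht hn hs hd j z)
      refine h3.congr' ?_
      filter_upwards [hn.eventually_gt_atTop (j + 1)] with i hi
      rw [if_pos (show j < n i by omega)]
      ring
    · filter_upwards [hmem, hspos, hMl] with i hi hsi hMi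
      rintro ⟨j, z⟩
      have hM0 : 0 < M₁ := by linarith
      split_ifs with hj
      · have h1 := tiltPassage_le (X := X) (P := P) hsi.le hM0 hMi.le j z
        have h2 := sqrt_mul_tiltProb_sub_le hC (hCb (s i) hi) (n := n i) (j := j) hj (d i - z)
        rw [Real.norm_of_nonneg (mul_nonneg (Real.sqrt_nonneg _) (mul_nonneg
          (tiltPassage_nonneg _ _) (tiltProb_nonneg _ _ _)))]
        calc _ = tiltPassage X P (s i) (j, z) *
              (√(n i : ℝ) * tiltProb X P (s i) (n i - 1 - j) (d i - z)) := by ring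
          _ ≤ (firstPassage (stepLaw X P) j z).toReal / M₁ ^ (j + 1) * (((j : ℝ) + 2) * (C + 1)) :=
              mul_le_mul h1 h2 (mul_nonneg (Real.sqrt_nonneg _) (tiltProb_nonneg _ _ _))
                (div_nonneg ENNReal.toReal_nonneg (by positivity))
          _ = _ := by ring
      · rw [mul_zero, norm_zero]
        exact mul_nonneg ENNReal.toReal_nonneg (by positivity)
  rw [tsum_mul_right] at hsum
  have h := hfree.sub hsum
  have e : L - (∑' p, tiltPassage X P t p) * L =
      escapeProb X P t / √(2 * Real.pi * iteratedDeriv 2 (cgf (upStep X) P) t) := by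
    rw [escapeProb, hL]; ring
  rw [← hL, e] at h
  refine h.congr' ?_
  filter_upwards [hmem] with i hi
  rw [tiltPos_eq hX (interior_subset (hsub hi)), mul_sub, tsum_mul_left]

end

section

variable {Ω : Type*} [MeasurableSpace Ω] {X : ℕ → Ω → ℤ} {P : Measure Ω}

/-! ### Convexity of the log-moment generating function and the rate function -/

/-- The tangent inequality for the log-moment generating function. -/
lemma cgf_add_deriv_mul_le [IsProbabilityMeasure P] {Y : Ω → ℝ} {t r : ℝ}
    (ht : t ∈ interior (integrableExpSet Y P)) (hr : r ∈ integrableExpSet Y P) :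
    cgf Y P t + deriv (cgf Y P) t * (r - t) ≤ cgf Y P r := by
  set m := deriv (cgf Y P) t with hm
  have hint := integrable_exp_of_mem_interior ht
  have hY : Integrable (fun ω => Real.exp (t * Y ω) * (Y ω - m)) P := by
    have h1 : Integrable (fun ω => Y ω * Real.exp (t * Y ω)) P := by
      simpa using integrable_pow_mul_exp_of_mem_interior_integrableExpSet ht 1
    refine (h1.sub (hint.const_mul m)).congr (ae_of_all _ fun ω => ?_)
    simp only [Pi.sub_apply]; ring
  -- Jensen for the tilted law: integrate e^x ≥ 1 + x at x = (r - t)(Y - m), whose linear term has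
  -- tilted mean zero.
  have key : Real.exp ((r - t) * m) * mgf Y P t ≤ mgf Y P r := by
    have h0 : ∫ ω, Real.exp ((r - t) * m) * (Real.exp (t * Y ω) +
        (r - t) * (Real.exp (t * Y ω) * (Y ω - m))) ∂P = Real.exp ((r - t) * m) * mgf Y P t := by
      rw [integral_const_mul, integral_add hint (hY.const_mul _), integral_const_mul,
        integral_exp_mul_sub_deriv_cgf ht, mul_zero, add_zero]
      rfl
    rw [← h0]
    refine integral_mono ((hint.add (hY.const_mul _)).const_mul _) hr fun ω => ?_
    have h1 := Real.add_one_le_exp ((r - t) * (Y ω - m))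
    calc Real.exp ((r - t) * m) * (Real.exp (t * Y ω) + (r - t) * (Real.exp (t * Y ω) * (Y ω - m)))
        = Real.exp ((r - t) * m) * Real.exp (t * Y ω) * ((r - t) * (Y ω - m) + 1) := by ring
      _ ≤ Real.exp ((r - t) * m) * Real.exp (t * Y ω) * Real.exp ((r - t) * (Y ω - m)) := by gcongr
      _ = Real.exp (r * Y ω) := by rw [← Real.exp_add, ← Real.exp_add]; ring_nf
  have hpos := mgf_pos hint
  have h := Real.log_le_log (by positivity) key
  rw [Real.log_mul (Real.exp_pos _).ne' hpos.ne', Real.log_exp] at h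
  change _ + _ ≤ cgf Y P r at h
  change Real.log (mgf Y P t) + _ ≤ _
  linarith

lemma mem_interior_of_lt {Y : Ω → ℝ} {t r : ℝ} (h0 : 0 ∈ interior (integrableExpSet Y P))
    (hr : r ∈ integrableExpSet Y P) (ht0 : 0 ≤ t) (htr : t < r) :
    t ∈ interior (integrableExpSet Y P) := by
  rcases ht0.eq_or_lt with rfl | ht0
  · exact h0
  refine (convex_integrableExpSet (X := Y) (μ := P)).openSegment_interior_self_subset_interior
    h0 hr ?_
  rw [openSegment_eq_Ioo (ht0.trans htr)]
  exact ⟨ht0, htr⟩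

/-- Convexity together with Λ(0) = 0, obtained by evaluating the tangent at t at the points 0 and r.
-/
lemma cgf_le_div_mul_cgf [IsProbabilityMeasure P] {Y : Ω → ℝ} {t r : ℝ}
    (h0 : 0 ∈ interior (integrableExpSet Y P)) (hr : r ∈ integrableExpSet Y P)
    (ht0 : 0 ≤ t) (htr : t < r) : cgf Y P t ≤ t / r * cgf Y P r := by
  have ht := mem_interior_of_lt h0 hr ht0 htr
  have h1 := cgf_add_deriv_mul_le ht hr
  have h2 := cgf_add_deriv_mul_le ht (interior_subset h0)
  rw [cgf_zero] at h2
  have hr0 : 0 < r := ht0.trans_lt htr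
  rw [div_mul_eq_mul_div, le_div_iff₀ hr0]
  nlinarith [mul_le_mul_of_nonneg_left h1 ht0, mul_le_mul_of_nonneg_left h2 (sub_nonneg.2 htr.le)]

lemma cgf_nonneg [IsProbabilityMeasure P] {Y : Ω → ℝ} {t : ℝ}
    (h0 : 0 ∈ interior (integrableExpSet Y P)) (hmean : ∫ ω, Y ω ∂P = 0)
    (ht : t ∈ integrableExpSet Y P) : 0 ≤ cgf Y P t := by
  have h := cgf_add_deriv_mul_le h0 ht
  rwa [deriv_cgf_zero h0, hmean, zero_div, zero_mul, cgf_zero, add_zero] at h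

/-- For 0 ≤ r < t the value Λ(r) is finite and at most (r/t)Λ(t) < Λ(t), so no smaller point
competes in the infimum. -/
lemma cgfInv_cgf [IsProbabilityMeasure P] {Y : Ω → ℝ} {t : ℝ}
    (h0 : 0 ∈ interior (integrableExpSet Y P)) (ht : t ∈ integrableExpSet Y P) (ht0 : 0 < t)
    (hpos : 0 < cgf Y P t) : cgfInv Y P (cgf Y P t) = t := by
  refine IsLeast.csInf_eq ⟨⟨ht0.le, fun _ => le_rfl⟩, fun r hr => ?_⟩
  by_contra! hlt
  have h1 := cgf_le_div_mul_cgf h0 ht hr.1 hlt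
  have h2 := hr.2 (integrable_exp_of_mem_interior (mem_interior_of_lt h0 ht hr.1 hlt))
  have h3 : r / t < 1 := (div_lt_one ht0).2 hlt
  nlinarith

lemma cgf_div_le_deriv_cgf [IsProbabilityMeasure P] {Y : Ω → ℝ} {t : ℝ}
    (h0 : 0 ∈ interior (integrableExpSet Y P)) (ht : t ∈ interior (integrableExpSet Y P))
    (ht0 : 0 < t) : cgf Y P t / t ≤ deriv (cgf Y P) t := by
  have h2 := cgf_add_deriv_mul_le ht (interior_subset h0)
  rw [cgf_zero] at h2
  rw [div_le_iff₀ ht0]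
  linarith

/-- By the tangent inequality the supremum is attained at s. -/
lemma rateFn_deriv_cgf [IsProbabilityMeasure P] {Y : Ω → ℝ} {s : ℝ} (hs0 : 0 ≤ s)
    (hs : s ∈ interior (integrableExpSet Y P)) :
    rateFn Y P (deriv (cgf Y P) s) = s * deriv (cgf Y P) s - cgf Y P s := by
  refine IsGreatest.csSup_eq ⟨⟨s, hs0, integrable_exp_of_mem_interior hs, rfl⟩, ?_⟩
  rintro _ ⟨r, -, hr, rfl⟩
  have := cgf_add_deriv_mul_le hs hr
  linarith

/-- The right end r may be a boundary point of the domain, where analyticity is not available;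
dominated convergence with bound 1 + e^{rY} works there too. -/
lemma continuousOn_cgf_Icc [IsProbabilityMeasure P] {Y : Ω → ℝ} {r : ℝ}
    (hr : r ∈ integrableExpSet Y P) : ContinuousOn (cgf Y P) (Set.Icc 0 r) := by
  have hmem : ∀ t ∈ Set.Icc 0 r, t ∈ integrableExpSet Y P := fun t ht =>
    (convex_integrableExpSet (X := Y) (μ := P)).ordConnected.out (by simp [integrableExpSet]) hr ht
  have h : ContinuousOn (mgf Y P) (Set.Icc 0 r) := by
    refine continuousOn_of_dominated (bound := fun ω => 1 + Real.exp (r * Y ω))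
      (fun t ht => (hmem t ht).aestronglyMeasurable) (fun t ht => ae_of_all _ fun ω => ?_)
      ((integrable_const 1).add hr) (ae_of_all _ fun ω => by fun_prop)
    rw [Real.norm_of_nonneg (Real.exp_pos _).le]
    simpa using exp_mul_le_add ht (Y ω)
  exact h.log fun t ht => (mgf_pos (hmem t ht)).ne'

/-- Below a value that is exceeded by the log-moment generating function, the latter is solved by
an interior point. -/
lemma exists_interior_cgf_eq [IsProbabilityMeasure P] {Y : Ω → ℝ} {r y : ℝ}
    (h0 : 0 ∈ interior (integrableExpSet Y P)) (hr : r ∈ integrableExpSet Y P) (hr0 : 0 < r)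
    (hy : 0 < y) (hyr : y < cgf Y P r) :
    ∃ t, 0 < t ∧ t ∈ interior (integrableExpSet Y P) ∧ cgf Y P t = y := by
  obtain ⟨t, ht, rfl⟩ := intermediate_value_Ioo hr0.le (continuousOn_cgf_Icc hr)
    (show y ∈ Set.Ioo (cgf Y P 0) (cgf Y P r) from ⟨by rwa [cgf_zero], hyr⟩)
  exact ⟨t, ht.1, mem_interior_of_lt h0 hr ht.1.le ht.2, rfl⟩

/-- Markov's inequality at level 1: Λ grows at least linearly once Y ≥ 1 has positive probability.
-/
lemma mul_add_log_le_cgf [IsProbabilityMeasure P] {Y : Ω → ℝ} {t : ℝ} (ht0 : 0 ≤ t)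
    (ht : t ∈ integrableExpSet Y P) (hpos : 0 < P.real {ω | 1 ≤ Y ω}) :
    t + Real.log (P.real {ω | 1 ≤ Y ω}) ≤ cgf Y P t := by
  have h := measure_ge_le_exp_mul_mgf (μ := P) (X := Y) 1 ht0 ht
  have h1 := Real.log_le_log hpos h
  rw [mul_one, Real.log_mul (Real.exp_pos _).ne' (mgf_pos ht).ne', Real.log_exp] at h1
  change _ ≤ -t + cgf Y P t at h1
  linarith

/-- Unless `y` is at least the value of `Λ` at the end of its domain, `Λ` exceeds `y`. -/
lemma exists_lt_cgf [IsProbabilityMeasure P] {Y : Ω → ℝ}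
    (h0 : 0 ∈ interior (integrableExpSet Y P)) (hpos : 0 < P.real {ω | 1 ≤ Y ω}) {y : ℝ}
    (hy : ∀ t : ℝ, 0 < t → (t : EReal) = expRadius Y P → FiniteExpMoment Y P t → y < cgf Y P t) :
    ∃ r, 0 < r ∧ r ∈ integrableExpSet Y P ∧ y < cgf Y P r := by
  by_contra! hcon
  obtain ⟨ε, hε, hsub⟩ := exists_Icc_subset_interior h0
  have hεm : ε ∈ integrableExpSet Y P := interior_subset (hsub ⟨by linarith, by linarith⟩)
  set S := {t : ℝ | 0 ≤ t ∧ FiniteExpMoment Y P t} with hS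
  -- If Λ stayed below y on its domain, its linear growth would bound the domain.
  have hbdd : BddAbove S := by
    refine ⟨max 0 (y - Real.log (P.real {ω | 1 ≤ Y ω})), fun t ht => ?_⟩
    rcases ht.1.eq_or_lt with h | h
    · exact h ▸ le_max_left _ _
    · have h1 := mul_add_log_le_cgf ht.1 ht.2 hpos
      have h2 := hcon t h ht.2
      exact le_max_of_le_right (by linarith)
  have hne : S.Nonempty := ⟨ε, hε.le, hεm⟩
  set τ := sSup S with hτ
  have hετ : ε ≤ τ := le_csSup hbdd ⟨hε.le, hεm⟩
  have hτ0 : 0 < τ := hε.trans_le hετ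
  have hrad : (τ : EReal) = expRadius Y P := by
    refine le_antisymm ?_ ?_
    · refine le_of_forall_lt fun c hc => ?_
      induction c with
      | bot =>
        exact lt_of_lt_of_le (EReal.bot_lt_coe ε) (le_sSup ⟨ε, ⟨hε.le, hεm⟩, rfl⟩)
      | top => exact absurd hc (not_lt.2 le_top)
      | coe c =>
        obtain ⟨b, hb, hcb⟩ := exists_lt_of_lt_csSup hne (EReal.coe_lt_coe_iff.1 hc)
        exact lt_of_lt_of_le (EReal.coe_lt_coe_iff.2 hcb) (le_sSup ⟨b, hb, rfl⟩)
    · refine sSup_le ?_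
      rintro _ ⟨t, ht, rfl⟩
      exact EReal.coe_le_coe_iff.2 (le_csSup hbdd ht)
  have hmem : ∀ t, 0 < t → t < τ → t ∈ integrableExpSet Y P := fun t ht htτ => by
    obtain ⟨b, hb, htb⟩ := exists_lt_of_lt_csSup hne htτ
    exact interior_subset (mem_interior_of_lt h0 hb.2 ht.le htb)
  -- By Fatou along points increasing to τ, where the moments are at most e^y, the end of the domain
  -- belongs to it; the hypothesis on y then gives a contradiction.
  have hτm : τ ∈ integrableExpSet Y P := by
    have hlim : Tendsto (fun n : ℕ => τ * (1 - 1 / ((n : ℝ) + 2))) atTop (𝓝 (τ * (1 - 0))) := by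
      refine (tendsto_const_nhds.sub ?_).const_mul τ
      exact_mod_cast (tendsto_add_atTop_iff_nat 2).2 (tendsto_one_div_atTop_nhds_zero_nat (𝕜 := ℝ))
    rw [sub_zero, mul_one] at hlim
    have hn : ∀ n : ℕ, 0 < τ * (1 - 1 / ((n : ℝ) + 2)) ∧ τ * (1 - 1 / ((n : ℝ) + 2)) < τ := by
      intro n
      have h1 : 0 < 1 / ((n : ℝ) + 2) := by positivity
      have h2 : 1 / ((n : ℝ) + 2) < 1 := by
        rw [div_lt_one (by positivity)]; linarith [n.cast_nonneg (α := ℝ)]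
      exact ⟨mul_pos hτ0 (by linarith), by nlinarith⟩
    have hl : ∀ ω, Tendsto (fun n : ℕ => Real.exp (τ * (1 - 1 / ((n : ℝ) + 2)) * Y ω)) atTop
        (𝓝 (Real.exp (τ * Y ω))) := fun ω =>
      (Real.continuous_exp.tendsto _).comp (hlim.mul_const (Y ω))
    have hms : ∀ n : ℕ, AEStronglyMeasurable
        (fun ω => Real.exp (τ * (1 - 1 / ((n : ℝ) + 2)) * Y ω)) P := fun n =>
      (hmem _ (hn n).1 (hn n).2).aestronglyMeasurable
    refine ⟨aestronglyMeasurable_of_tendsto_ae _ hms (ae_of_all _ hl), ?_⟩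
    have hfat := lintegral_liminf_le' (μ := P) (u := atTop) fun n => (hms n).aemeasurable.enorm
    simp_rw [fun ω => (hl ω).enorm.liminf_eq] at hfat
    refine hfat.trans_lt (lt_top_iff_ne_top.2 ?_)
    refine ne_top_of_le_ne_top (b := ENNReal.ofReal (Real.exp y)) ENNReal.ofReal_ne_top ?_
    refine liminf_le_of_frequently_le' (Frequently.of_forall fun n => ?_)
    have hi := hmem _ (hn n).1 (hn n).2
    have h1 := hcon _ (hn n).1 hi
    rw [← ofReal_integral_norm_eq_lintegral_enorm hi]
    simp only [Real.norm_eq_abs, Real.abs_exp]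
    refine ENNReal.ofReal_le_ofReal ?_
    change mgf Y P _ ≤ _
    rw [← exp_cgf hi]
    exact Real.exp_le_exp.2 h1
  exact absurd (hcon τ hτ0 hτm) (not_le.2 (hy τ hτ0 hrad hτm))

/-- The mean value inequality on the segment from m to x, where the derivative is at most C|x -
m|^k. Used to integrate Taylor estimates one order at a time. -/
lemma isBigO_pow_succ_of_deriv {f f' : ℝ → ℝ} {m : ℝ} {k : ℕ}
    (hf : ∀ᶠ x in 𝓝 m, HasDerivAt f (f' x) x) (h0 : f m = 0)
    (hf' : f' =O[𝓝 m] fun x => (x - m) ^ k) : f =O[𝓝 m] fun x => (x - m) ^ (k + 1) := by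
  obtain ⟨C, hC⟩ := hf'.bound
  obtain ⟨ε, hε, h⟩ := Metric.eventually_nhds_iff_ball.1 (hf.and hC)
  refine Asymptotics.IsBigO.of_bound C (Filter.eventually_of_mem (Metric.ball_mem_nhds m hε) ?_)
  intro x hx
  have hseg : ∀ z ∈ segment ℝ m x, z ∈ Metric.ball m ε ∧ |z - m| ≤ |x - m| := fun z hz => by
    have h1 : |z - m| ≤ |x - m| := by
      rw [segment_eq_uIcc] at hz
      exact Set.abs_sub_left_of_mem_uIcc hz
    refine ⟨?_, h1⟩
    rw [Metric.mem_ball, Real.dist_eq] at hx ⊢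
    exact h1.trans_lt hx
  have hC0 : ∀ z ∈ segment ℝ m x, ‖f' z‖ ≤ C * |x - m| ^ k := fun z hz => by
    have h1 := (h z (hseg z hz).1).2
    rw [norm_pow, Real.norm_eq_abs (z - m)] at h1
    rcases le_or_gt 0 C with hC | hC
    · exact h1.trans (mul_le_mul_of_nonneg_left
        (pow_le_pow_left₀ (abs_nonneg _) (hseg z hz).2 k) hC)
    · have h2 : C * |z - m| ^ k = 0 := le_antisymm
        (mul_nonpos_of_nonpos_of_nonneg hC.le (by positivity)) ((norm_nonneg _).trans h1)
      have h3 : |z - m| ^ k = 0 := (mul_eq_zero.1 h2).resolve_left hC.ne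
      exfalso
      have h4 := (h x (hseg x (right_mem_segment ℝ m x)).1).2
      have h5 := (h ((m + ε / 2)) (by simp [Real.norm_eq_abs, abs_of_pos hε, hε])).2
      have h6 : C * ‖(m + ε / 2 - m) ^ k‖ < 0 := mul_neg_of_neg_of_pos hC (norm_pos_iff.2
        (pow_ne_zero _ (by simp [hε.ne'])))
      linarith [norm_nonneg (f' (m + ε / 2))]
  have := (convex_segment m x).norm_image_sub_le_of_norm_hasDerivWithin_le
    (fun z hz => ((h z (hseg z hz).1).1).hasDerivWithinAt) hC0
    (left_mem_segment ℝ m x) (right_mem_segment ℝ m x)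
  rw [h0, sub_zero] at this
  rw [norm_pow, pow_succ, Real.norm_eq_abs (x - m)]
  refine this.trans (le_of_eq ?_)
  rw [Real.norm_eq_abs (x - m)]
  ring

/-- Near `Λ'(t)` the derivative `Λ'` has a continuous inverse, which gives the rate function, its
second derivative and its second order expansion. -/
lemma exists_deriv_cgf_inverse [IsProbabilityMeasure P] {Y : Ω → ℝ} {t : ℝ} (ht0 : 0 < t)
    (ht : t ∈ interior (integrableExpSet Y P)) (hv : 0 < iteratedDeriv 2 (cgf Y P) t) :
    (∃ s : ℝ → ℝ, Tendsto s (𝓝 (deriv (cgf Y P) t)) (𝓝 t) ∧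
      (∀ᶠ x in 𝓝 (deriv (cgf Y P) t), 0 < s x ∧ s x ∈ interior (integrableExpSet Y P) ∧
        deriv (cgf Y P) (s x) = x ∧ rateFn Y P x = s x * x - cgf Y P (s x))) ∧
    rateFnSecondDeriv Y P (deriv (cgf Y P) t) = 1 / iteratedDeriv 2 (cgf Y P) t ∧
    (fun x => cgf Y P t - t * x + rateFn Y P x -
        (x - deriv (cgf Y P) t) ^ 2 / (2 * iteratedDeriv 2 (cgf Y P) t))
      =O[𝓝 (deriv (cgf Y P) t)] fun x => (x - deriv (cgf Y P) t) ^ 3 := by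
  set g := deriv (cgf Y P) with hg
  set v := iteratedDeriv 2 (cgf Y P) t with hvdef
  set m := g t with hm
  have han : AnalyticAt ℝ g t := (analyticAt_cgf ht).deriv
  have hgd : HasDerivAt g v t := by
    have := han.differentiableAt.hasDerivAt
    rwa [show deriv g t = v by rw [hvdef, iteratedDeriv_succ, iteratedDeriv_one]] at this
  have hcd : ContDiffAt ℝ ⊤ g t := han.contDiffAt
  have hgd' : HasFDerivAt g
      (ContinuousLinearEquiv.unitsEquivAut ℝ (Units.mk0 v hv.ne') : ℝ →L[ℝ] ℝ) t := by
    refine hgd.hasFDerivAt.congr_fderiv ?_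
    ext; simp
  set s := hcd.localInverse hgd' (by simp) with hs
  have hst : s m = t := hcd.localInverse_apply_image hgd' _
  have hsan : AnalyticAt ℝ s m := (hcd.to_localInverse hgd' (by simp)).analyticAt
  have hsr : ∀ᶠ x in 𝓝 m, g (s x) = x :=
    (hcd.hasStrictFDerivAt' hgd' (by simp)).eventually_right_inverse
  have hstend : Tendsto s (𝓝 m) (𝓝 t) := by
    have := hsan.continuousAt.tendsto
    rwa [hst] at this
  have hgood : ∀ᶠ x in 𝓝 m, 0 < s x ∧ s x ∈ interior (integrableExpSet Y P) ∧ g (s x) = x ∧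
      rateFn Y P x = s x * x - cgf Y P (s x) := by
    filter_upwards [hsr, hstend.eventually_const_lt ht0,
      hstend.eventually (isOpen_interior.mem_nhds ht)] with x h1 h2 h3
    refine ⟨h2, h3, h1, ?_⟩
    have := rateFn_deriv_cgf h2.le h3
    rwa [← hg, h1] at this
  have hsd : ∀ᶠ x in 𝓝 m, HasDerivAt s (deriv s x) x :=
    hsan.eventually_analyticAt.mono fun x hx => hx.differentiableAt.hasDerivAt
  -- In differentiating s(x)x - Λ(s(x)) the terms with s'(x) cancel, since Λ'(s(x)) = x.
  have hId : ∀ᶠ x in 𝓝 m, HasDerivAt (rateFn Y P) (s x) x := by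
    filter_upwards [hgood.eventually_nhds, hsd] with x hx hsx
    obtain ⟨-, hxi, hgx, -⟩ := hx.self_of_nhds
    have h1 : HasDerivAt (cgf Y P) x (s x) := by
      have := (analyticAt_cgf hxi).differentiableAt.hasDerivAt
      rwa [← hg, hgx] at this
    have h2 := (hsx.mul (hasDerivAt_id x)).sub (h1.comp x hsx)
    refine (h2.congr_of_eventuallyEq (hx.mono fun z hz => ?_)).congr_deriv ?_
    · simpa using hz.2.2.2
    · simp only [id]; ring
  have hsm : deriv s m = 1 / v := by
    have h1 : HasDerivAt (fun x => g (s x)) (v * deriv s m) m := by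
      have h2 := hsd.self_of_nhds
      rw [← hst] at hgd
      exact hgd.comp m h2
    have h3 := h1.unique ((hasDerivAt_id m).congr_of_eventuallyEq hsr)
    field_simp
    linarith
  refine ⟨⟨s, hstend, hgood⟩, ?_, ?_⟩
  · rw [rateFnSecondDeriv, ← hsm]
    exact Filter.EventuallyEq.deriv_eq (hId.mono fun x hx => hx.deriv)
  -- The error in s' is O(x - m); integrating twice gives the cubic remainder of the rate function.
  · have h1 : (fun x => deriv s x - 1 / v) =O[𝓝 m] fun x => (x - m) ^ 1 := by
      have := hsan.deriv.differentiableAt.isBigO_sub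
      simpa [hsm] using this
    have h2 : (fun x => s x - t - (x - m) / v) =O[𝓝 m] fun x => (x - m) ^ 2 := by
      refine isBigO_pow_succ_of_deriv (hsd.mono fun x hx => ?_) (by simp [hst]) h1
      exact (hx.sub_const t).sub (((hasDerivAt_id x).sub_const m).div_const v)
    refine isBigO_pow_succ_of_deriv (hId.mono fun x hx => ?_) ?_ h2
    · have h3 := ((((hasDerivAt_id x).const_mul t).const_sub (cgf Y P t)).add hx).sub
        ((((hasDerivAt_id x).sub_const m).pow 2).div_const (2 * v))
      refine h3.congr_deriv ?_
      simp only [id]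
      field_simp
      ring
    · have h3 := (hgood.self_of_nhds).2.2.2
      rw [hst] at h3
      rw [h3]; ring

end

section

variable {Ω : Type*} [MeasurableSpace Ω] {X : ℕ → Ω → ℤ} {P : Measure Ω}

/-! ### One-sided asymptotics: the path between the boundary of the well and its bottom -/

/-- The tilted probability to go from height zero to height `depth a N` in `l` steps, staying
positive. -/
noncomputable def legWeight (X : ℕ → Ω → ℤ) (P : Measure Ω) (t a : ℝ) (N l : ℕ) : ℝ :=
  Real.exp (t * depth a N - cgf (upStep X) P t * l) * posProb X P l (depth a N)

/-- The exponential rate of `legWeight` as a function of the slope. -/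
noncomputable def legRate (Y : Ω → ℝ) (P : Measure Ω) (t x : ℝ) : ℝ :=
  cgf Y P t - t * x + rateFn Y P x

lemma legWeight_nonneg (t a : ℝ) (N l : ℕ) : 0 ≤ legWeight X P t a N l :=
  mul_nonneg (Real.exp_pos _).le measureReal_nonneg

lemma depth_le {a : ℝ} (N : ℕ) : (depth a N : ℝ) ≤ a * N := Int.floor_le _

lemma lt_depth_add_one {a : ℝ} (N : ℕ) : a * N < depth a N + 1 := Int.lt_floor_add_one _

lemma depth_eq {a : ℝ} (N : ℕ) : (depth a N : ℝ) = a * N - Int.fract (a * N) := by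
  rw [depth, ← Int.self_sub_fract]

lemma tendsto_depth_div {a : ℝ} {ι : Type*} {F : Filter ι} {N : ι → ℕ} (hN : Tendsto N F atTop) :
    Tendsto (fun i => (depth a (N i) : ℝ) / N i) F (𝓝 a) := by
  have h : Tendsto (fun n : ℕ => (depth a n : ℝ) / n) atTop (𝓝 a) := by
    have h1 : Tendsto (fun n : ℕ => Int.fract (a * n) / (n : ℝ)) atTop (𝓝 0) := by
      refine squeeze_zero (fun n => by positivity) (fun n => ?_)
        (tendsto_one_div_atTop_nhds_zero_nat (𝕜 := ℝ))
      gcongr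
      exact (Int.fract_lt_one _).le
    have h2 := (tendsto_const_nhds (x := a)).sub h1
    rw [sub_zero] at h2
    refine h2.congr' ?_
    filter_upwards [eventually_gt_atTop 0] with n hn
    rw [depth_eq]
    field_simp
  exact h.comp hN

lemma tendsto_atTop_of_div {ι : Type*} {F : Filter ι} {N l : ι → ℕ} {u : ℝ} (hu : 0 < u)
    (hN : Tendsto N F atTop) (hl : Tendsto (fun i => (l i : ℝ) / N i) F (𝓝 u)) :
    Tendsto l F atTop := by
  have h1 := hl.pos_mul_atTop hu (tendsto_natCast_atTop_atTop.comp hN)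
  rw [← tendsto_natCast_atTop_iff (R := ℝ)]
  refine h1.congr' ?_
  filter_upwards [hN.eventually_gt_atTop 0] with i hi
  have : (N i : ℝ) ≠ 0 := by positivity
  simp only [Function.comp]
  field_simp

/-- Sharp asymptotics of `legWeight` when `l / N` converges to the typical slope. -/
theorem tendsto_sqrt_mul_legWeight [IsProbabilityMeasure P] (hX : IIDSteps X P)
    (hap : Aperiodic X P) {t : ℝ} (ht0 : 0 < t)
    (ht : t ∈ interior (integrableExpSet (upStep X) P)) (hM1 : 0 < cgf (upStep X) P t)
    {a u : ℝ} (hu : 0 < u) (hua : u * deriv (cgf (upStep X) P) t = a)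
    {ι : Type*} {F : Filter ι} [F.IsCountablyGenerated] {N l : ι → ℕ} (hN : Tendsto N F atTop)
    (hl : Tendsto (fun i => (l i : ℝ) / N i) F (𝓝 u)) :
    Tendsto (fun i => √(N i) * legWeight X P t a (N i) (l i) *
      Real.exp (l i * legRate (upStep X) P t (depth a (N i) / l i))) F
      (𝓝 (escapeProb X P t / √(2 * Real.pi * iteratedDeriv 2 (cgf (upStep X) P) t) / √u)) := by
  set Y := upStep X with hYdef
  have hM : 1 < mgf Y P t := by
    rw [← exp_cgf (integrable_exp_of_mem_interior ht)]
    exact Real.one_lt_exp_iff.2 hM1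
  have hl' := tendsto_atTop_of_div hu hN hl
  have hx : Tendsto (fun i => (depth a (N i) : ℝ) / l i) F (𝓝 (deriv (cgf Y P) t)) := by
    have h1 := (tendsto_depth_div (a := a) hN).div hl hu.ne'
    rw [← hua, mul_div_cancel_left₀ _ hu.ne'] at h1
    refine h1.congr' ?_
    filter_upwards [hN.eventually_gt_atTop 0] with i hi
    have : (N i : ℝ) ≠ 0 := by positivity
    simp only [Pi.div_apply]
    rw [div_div_div_cancel_right₀ this, hua]
  obtain ⟨⟨s, hs, hgood⟩, -, -⟩ :=
    exists_deriv_cgf_inverse ht0 ht (iteratedDeriv_two_cgf_pos hap ht)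
  have hsx := hs.comp hx
  -- The tilt s(x) has mean exactly x = depth / l, so the centring condition holds with error zero
  -- however slowly l / N converges.
  have hmain := tendsto_sqrt_mul_tiltPos hX hap ht0 ht hM (n := l)
    (d := fun i => depth a (N i)) hl' hsx ?_
  · have hr : Tendsto (fun i => √(((l i : ℝ) / N i)⁻¹)) F (𝓝 (√u⁻¹)) :=
      (Real.continuous_sqrt.tendsto _).comp (hl.inv₀ hu.ne')
    have h := hmain.mul hr
    rw [Real.sqrt_inv, ← div_eq_mul_inv] at h
    refine h.congr' ?_
    filter_upwards [hx.eventually hgood, hl'.eventually_gt_atTop 0, hN.eventually_gt_atTop 0]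
      with i hi hli hNi
    obtain ⟨-, hsi, -, hI⟩ := hi
    have hl0 : (0 : ℝ) < l i := by exact_mod_cast hli
    have hN0 : (0 : ℝ) < N i := by exact_mod_cast hNi
    set x : ℝ := (depth a (N i) : ℝ) / l i with hxdef
    have hd : (depth a (N i) : ℝ) = x * l i := by rw [hxdef]; field_simp
    have hMs : mgf Y P (s x) = Real.exp (cgf Y P (s x)) :=
      (exp_cgf (integrable_exp_of_mem_interior hsi)).symm
    rw [inv_div, Real.sqrt_div' _ hl0.le, legWeight, legRate, tiltPos]
    simp only [Function.comp]
    rw [← hYdef, hMs, hI, ← Real.exp_nat_mul, ← Real.exp_sub, hd,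
      mul_div_cancel_right₀ _ hl0.ne']
    -- Passing from the tilt s(x) to the fixed tilt t costs exactly exp(l · `legRate`).
    have e : Real.exp (s x * (x * l i) - l i * cgf Y P (s x)) =
        Real.exp (t * (x * l i) - cgf Y P t * l i) *
        Real.exp (l i * (cgf Y P t - t * x + (s x * x - cgf Y P (s x)))) := by
      rw [← Real.exp_add]; ring_nf
    rw [e]
    have : √(l i : ℝ) ≠ 0 := (Real.sqrt_pos.2 hl0).ne'
    field_simp
  · refine tendsto_const_nhds.congr' ?_
    filter_upwards [hx.eventually hgood, hl'.eventually_gt_atTop 0] with i hi hli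
    have hl0 : (0 : ℝ) < l i := by exact_mod_cast hli
    simp only [Function.comp]
    rw [hi.2.2.1, mul_div_cancel₀ _ hl0.ne', sub_self, zero_div]

/-- In the notation of `exists_legRate_bound`: δ = l/N - u, b = 1/N and f is the fractional part of
aN, so that x - m = -(mδ + fb)/(u + δ). This bounds the error of replacing the quadratic term in x -
m by (mδ)²/u, dropping both the fractional part and the δ in the denominator. -/
lemma abs_quotient_expansion_le {N b u v m δ f K : ℝ} (hN0 : 0 < N) (hb0 : 0 < b)
    (hNb : N * b = 1) (hu : 0 < u) (hv : 0 < v) (hmK : |m| ≤ K) (hK1 : 1 ≤ K) (hf0 : 0 ≤ f)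
    (hf1 : f ≤ 1) (hp1 : u / 2 ≤ u + δ) :
    |N / (2 * v) * (((m * δ + f * b) ^ 2 - (m * δ) ^ 2) / (u + δ) -
      (m * δ) ^ 2 * δ / ((u + δ) * u))| ≤
      (2 * K + 1) / (v * u) * (|δ| + b) + K ^ 2 / (v * u ^ 2) * (N * |δ| ^ 3) := by
  have hK0 : 0 < K := by linarith
  set p := u + δ with hp
  have hp0 : 0 < p := by linarith
  set w := m * δ + f * b with hw
  have h3 : |w ^ 2 - (m * δ) ^ 2| ≤ (2 * K + 1) * (|δ| + b) * b := by
    have e : w ^ 2 - (m * δ) ^ 2 = f * b * (2 * (m * δ) + f * b) := by rw [hw]; ring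
    rw [e, abs_mul, abs_of_nonneg (by positivity : 0 ≤ f * b)]
    have h4 : |2 * (m * δ) + f * b| ≤ 2 * K * |δ| + b := by
      calc _ ≤ |2 * (m * δ)| + |f * b| := abs_add_le _ _
        _ = 2 * |m| * |δ| + f * b := by
          rw [abs_mul, abs_mul, abs_of_nonneg (by positivity : 0 ≤ f * b)]
          norm_num; ring
        _ ≤ 2 * K * |δ| + 1 * b := by gcongr
        _ = _ := by ring
    calc f * b * |2 * (m * δ) + f * b| ≤ 1 * b * (2 * K * |δ| + b) := by gcongr
      _ ≤ _ := by
          linear_combination mul_nonneg hb0.le (abs_nonneg δ) +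
            2 * mul_nonneg hK0.le (mul_nonneg hb0.le hb0.le)
  have h5 : |(m * δ) ^ 2 * δ| ≤ K ^ 2 * |δ| ^ 3 := by
    rw [abs_mul, abs_pow, abs_mul]
    calc (|m| * |δ|) ^ 2 * |δ| = |m| ^ 2 * |δ| ^ 3 := by ring
      _ ≤ _ := by gcongr
  rw [abs_mul, abs_of_pos (by positivity : 0 < (N : ℝ) / (2 * v))]
  calc N / (2 * v) * |(w ^ 2 - (m * δ) ^ 2) / p - (m * δ) ^ 2 * δ / (p * u)|
      ≤ N / (2 * v) * (|(w ^ 2 - (m * δ) ^ 2) / p| + |(m * δ) ^ 2 * δ / (p * u)|) := by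
        gcongr; exact abs_sub _ _
    _ = N / (2 * v) * (|w ^ 2 - (m * δ) ^ 2| / p + |(m * δ) ^ 2 * δ| / (p * u)) := by
        rw [abs_div, abs_div _ (p * u), abs_of_pos hp0, abs_of_pos (mul_pos hp0 hu)]
    _ ≤ N / (2 * v) * ((2 * K + 1) * (|δ| + b) * b / (u / 2) +
          K ^ 2 * |δ| ^ 3 / (u / 2 * u)) := by gcongr
    _ = (2 * K + 1) / (v * u) * (|δ| + b) * (N * b) + K ^ 2 / (v * u ^ 2) * (N * |δ| ^ 3) := by
        field_simp
    _ = _ := by rw [hNb, mul_one]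

/-- Adds the cubic Taylor remainder E of the rate to the previous error; since N b = 1, both fit
into N|δ|³ + |δ| + b. -/
lemma abs_rate_expansion_le {N b u v m δ f K C₀ E : ℝ} (hN0 : 0 < N) (hb0 : 0 < b)
    (hNb : N * b = 1) (hb1 : b ≤ 1) (hu : 0 < u) (hv : 0 < v) (hmK : |m| ≤ K) (hK1 : 1 ≤ K)
    (hf0 : 0 ≤ f) (hf1 : f ≤ 1) (hp1 : u / 2 ≤ u + δ) (hp2 : u + δ ≤ 3 * u / 2) (hC₀ : 0 < C₀)
    (hEb : |E| ≤ C₀ * (2 * K / u * (|δ| + b)) ^ 3) :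
    |N * (u + δ) * E + N / (2 * v) * (((m * δ + f * b) ^ 2 - (m * δ) ^ 2) / (u + δ) -
      (m * δ) ^ 2 * δ / ((u + δ) * u))| ≤
      (48 * C₀ * K ^ 3 / u ^ 2 + (2 * K + 1) / (v * u) + K ^ 2 / (v * u ^ 2)) *
        (N * |δ| ^ 3 + |δ| + b) := by
  have hK0 : 0 < K := by linarith
  have hp0 : 0 < u + δ := by linarith
  set p := u + δ with hp
  set w := m * δ + f * b with hw
  have hcube : (|δ| + b) ^ 3 ≤ 4 * (|δ| ^ 3 + b ^ 3) := by
    linear_combination 3 * mul_nonneg (add_nonneg (abs_nonneg δ) hb0.le) (sq_nonneg (|δ| - b))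
  have hNb3 : N * b ^ 3 ≤ b := by
    calc N * b ^ 3 = (N * b) * (b * b) := by ring
      _ ≤ b := by rw [hNb, one_mul]; exact mul_le_of_le_one_left hb0.le hb1
  have h1 : |N * p * E| ≤ 48 * C₀ * K ^ 3 / u ^ 2 * (N * |δ| ^ 3 + b) := by
    rw [abs_mul, abs_of_pos (by positivity : 0 < N * p)]
    calc N * p * |E| ≤ N * (3 * u / 2) * (C₀ * (2 * K / u * (|δ| + b)) ^ 3) := by gcongr
      _ = 12 * C₀ * K ^ 3 / u ^ 2 * (N * (|δ| + b) ^ 3) := by field_simp; ring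
      _ ≤ 12 * C₀ * K ^ 3 / u ^ 2 * (N * (4 * (|δ| ^ 3 + b ^ 3))) := by gcongr
      _ = 48 * C₀ * K ^ 3 / u ^ 2 * (N * |δ| ^ 3 + N * b ^ 3) := by ring
      _ ≤ _ := by gcongr
  have h2 : |N / (2 * v) * ((w ^ 2 - (m * δ) ^ 2) / p - (m * δ) ^ 2 * δ / (p * u))| ≤
      (2 * K + 1) / (v * u) * (|δ| + b) + K ^ 2 / (v * u ^ 2) * (N * |δ| ^ 3) :=
    abs_quotient_expansion_le hN0 hb0 hNb hu hv hmK hK1 hf0 hf1 hp1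
  refine (abs_add_le _ _).trans ((add_le_add h1 h2).trans ?_)
  have hA : 0 ≤ 48 * C₀ * K ^ 3 / u ^ 2 := by positivity
  have hB : 0 ≤ (2 * K + 1) / (v * u) := by positivity
  have hD : 0 ≤ K ^ 2 / (v * u ^ 2) := by positivity
  have hδ0 := abs_nonneg δ
  have hNδ : 0 ≤ N * |δ| ^ 3 := by positivity
  linear_combination mul_nonneg hA hδ0 + mul_nonneg hB hNδ + mul_nonneg hD hδ0 +
    mul_nonneg hD hb0.le

/-- The second order expansion of the rate of `legWeight`. -/
lemma exists_legRate_bound [IsProbabilityMeasure P] (hap : Aperiodic X P) {t : ℝ} (ht0 : 0 < t)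
    (ht : t ∈ interior (integrableExpSet (upStep X) P))
    {a u : ℝ} (hu : 0 < u) (hua : u * deriv (cgf (upStep X) P) t = a) :
    ∃ C ε : ℝ, 0 < C ∧ 0 < ε ∧ ∀ᶠ N : ℕ in atTop, ∀ l : ℕ, |(l : ℝ) / N - u| ≤ ε →
      |l * legRate (upStep X) P t (depth a N / l) - N * ((l : ℝ) / N - u) ^ 2 *
        (deriv (cgf (upStep X) P) t ^ 2 / (2 * iteratedDeriv 2 (cgf (upStep X) P) t * u))| ≤
      C * (N * |(l : ℝ) / N - u| ^ 3 + |(l : ℝ) / N - u| + 1 / N) := by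
  set v := iteratedDeriv 2 (cgf (upStep X) P) t with hvdef
  have hv : 0 < v := iteratedDeriv_two_cgf_pos hap ht
  obtain ⟨-, -, hO⟩ := exists_deriv_cgf_inverse ht0 ht hv
  set m := deriv (cgf (upStep X) P) t with hm
  obtain ⟨C₀, hC₀, hO⟩ := hO.exists_pos
  obtain ⟨r, hr, hb⟩ := Metric.eventually_nhds_iff_ball.1 hO.bound
  set K := |m| + 1 with hK
  have hK0 : 0 < K := by positivity
  -- The first bound keeps l / N between u/2 and 3u/2; the last one puts the slope depth / l inside
  -- the ball where the Taylor estimate holds.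
  set ε := min (u / 2) (min 1 (r * u / (8 * K))) with hε
  have hε0 : 0 < ε := by positivity
  refine ⟨48 * C₀ * K ^ 3 / u ^ 2 + (2 * K + 1) / (v * u) + K ^ 2 / (v * u ^ 2), ε, by positivity,
    hε0, ?_⟩
  filter_upwards [eventually_ge_atTop 1, (tendsto_one_div_atTop_nhds_zero_nat (𝕜 := ℝ)).eventually
    (ge_mem_nhds (show 0 < ε from hε0))] with N hN hNε l hl
  have hN0 : (0 : ℝ) < N := by exact_mod_cast hN
  set b : ℝ := 1 / N with hb'
  have hNb : (N : ℝ) * b = 1 := by rw [hb']; field_simp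
  have hb0 : 0 < b := by positivity
  set δ : ℝ := (l : ℝ) / N - u with hδ
  set f := Int.fract (a * N) with hf
  have hf0 : 0 ≤ f := Int.fract_nonneg _
  have hf1 : f ≤ 1 := (Int.fract_lt_one _).le
  set p := u + δ with hp
  have hεu : ε ≤ u / 2 := min_le_left _ _
  have hε1 : ε ≤ 1 := (min_le_right _ _).trans (min_le_left _ _)
  have hεr : ε * (8 * K) ≤ r * u := by
    rw [← le_div_iff₀ (by positivity)]
    exact (min_le_right _ _).trans (min_le_right _ _)
  have hδu := abs_le.1 (hl.trans hεu)
  have hp1 : u / 2 ≤ p := by rw [hp]; linarith [hδu.1]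
  have hp2 : p ≤ 3 * u / 2 := by rw [hp]; linarith [hδu.2]
  have hp0 : 0 < p := by linarith
  have hlp : (l : ℝ) = N * p := by rw [hp, hδ]; field_simp; ring
  set w := m * δ + f * b with hw
  have hmK : |m| ≤ K := by rw [hK]; linarith
  have hwK : |w| ≤ K * (|δ| + b) := by
    calc |w| ≤ |m * δ| + |f * b| := abs_add_le _ _
      _ = |m| * |δ| + f * b := by rw [abs_mul, abs_of_nonneg (by positivity : 0 ≤ f * b)]
      _ ≤ K * |δ| + K * b := by
          gcongr
          rw [hK]; linarith [abs_nonneg m]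
      _ = _ := by ring
  set x : ℝ := (depth a N : ℝ) / l with hx
  -- Uses depth = aN - f with a = um and l = N(u + δ).
  have hxm : x - m = -w / p := by
    rw [hx, hlp, depth_eq, ← hf, ← hua, hw, hp]
    have : u + δ ≠ 0 := hp0.ne'
    field_simp
    linear_combination f * hNb
  have hxb : |x - m| ≤ 2 * K / u * (|δ| + b) := by
    rw [hxm, abs_div, abs_neg, abs_of_pos hp0, div_le_iff₀ hp0]
    calc |w| ≤ K * (|δ| + b) := hwK
      _ = 2 * K / u * (|δ| + b) * (u / 2) := by field_simp
      _ ≤ _ := by gcongr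
  have hxr : x ∈ Metric.ball m r := by
    rw [Metric.mem_ball, Real.dist_eq]
    calc |x - m| ≤ 2 * K / u * (|δ| + b) := hxb
      _ ≤ 2 * K / u * (ε + ε) := by gcongr
      _ = ε * (8 * K) / (2 * u) := by field_simp; ring
      _ ≤ r * u / (2 * u) := by gcongr
      _ = r / 2 := by field_simp
      _ < r := by linarith
  set E := legRate (upStep X) P t x - (x - m) ^ 2 / (2 * v) with hE
  have hEb : |E| ≤ C₀ * (2 * K / u * (|δ| + b)) ^ 3 := by
    have h := hb x hxr
    rw [norm_pow, Real.norm_eq_abs, Real.norm_eq_abs] at h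
    exact h.trans (by gcongr)
  have key : l * legRate (upStep X) P t x - N * δ ^ 2 * (m ^ 2 / (2 * v * u)) =
      N * p * E + N / (2 * v) * ((w ^ 2 - (m * δ) ^ 2) / p - (m * δ) ^ 2 * δ / (p * u)) := by
    have e : legRate (upStep X) P t x = E + (w / p) ^ 2 / (2 * v) := by
      rw [hE, hxm]; ring
    rw [e, hlp]
    have hδp : δ = p - u := by rw [hp]; ring
    field_simp
    rw [hδp]
    ring
  rw [key]
  exact abs_rate_expansion_le hN0 hb0 hNb (hNε.trans hε1) hu hv hmK
    (by rw [hK]; linarith [abs_nonneg m]) hf0 hf1 hp1 hp2 hC₀ hEb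

lemma exists_cgf_sub_le [IsProbabilityMeasure P] {Y : Ω → ℝ} {t : ℝ}
    (ht : t ∈ interior (integrableExpSet Y P)) :
    ∃ K ε : ℝ, 0 < K ∧ 0 < ε ∧ Set.Icc (t - ε) (t + ε) ⊆ interior (integrableExpSet Y P) ∧
      ∀ δ, |δ| ≤ ε → cgf Y P (t + δ) - cgf Y P t ≤ deriv (cgf Y P) t * δ + K * δ ^ 2 := by
  have han := analyticAt_cgf ht
  have hO : (fun x => cgf Y P x - cgf Y P t - deriv (cgf Y P) t * (x - t)) =O[𝓝 t]
      fun x => (x - t) ^ 2 := by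
    refine isBigO_pow_succ_of_deriv (f' := fun x => deriv (cgf Y P) x - deriv (cgf Y P) t) (k := 1)
      (han.eventually_analyticAt.mono fun x hx => ?_) (by simp) ?_
    · have := (hx.differentiableAt.hasDerivAt.sub_const (cgf Y P t)).sub
        (((hasDerivAt_id x).sub_const t).const_mul (deriv (cgf Y P) t))
      exact this.congr_deriv (by simp)
    · simpa using han.deriv.differentiableAt.isBigO_sub
  obtain ⟨K, hK, hO⟩ := hO.exists_pos
  obtain ⟨r, hr, hb⟩ := Metric.eventually_nhds_iff_ball.1 hO.bound
  obtain ⟨ε, hε, hsub⟩ := exists_Icc_subset_interior ht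
  refine ⟨K, min ε (r / 2), hK, by positivity, fun x hx => hsub ?_, fun δ hδ => ?_⟩
  · have := min_le_left ε (r / 2)
    exact ⟨by linarith [hx.1], by linarith [hx.2]⟩
  · have h := hb (t + δ) (by
      rw [Metric.mem_ball, Real.dist_eq, add_sub_cancel_left]
      have := min_le_right ε (r / 2)
      linarith)
    rw [add_sub_cancel_left, Real.norm_eq_abs, Real.norm_of_nonneg (sq_nonneg δ)] at h
    linarith [le_abs_self (cgf Y P (t + δ) - cgf Y P t - deriv (cgf Y P) t * δ)]

/-- The local bound provides √l where √N is wanted. For l ≥ uN/2 they are comparable; otherwise |l -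
uN|/√N is at least (u/2)√N and pays for the difference. -/
lemma sqrt_le_sqrt_mul_add {u N l : ℝ} (hu : 0 < u) (hN : 1 ≤ N) (hl : 1 ≤ l) :
    √N ≤ √l * (√(2 / u) + 2 / u * (|l - u * N| / √N)) := by
  have hl1 : 1 ≤ √l := Real.one_le_sqrt.2 hl
  have hsN : 0 < √N := Real.sqrt_pos.2 (by linarith)
  have hss : √N * √N = N := Real.mul_self_sqrt (by linarith)
  rcases le_total (u * N / 2) l with h2 | h2
  · have h3 : √N ≤ √l * √(2 / u) := by
      rw [← Real.sqrt_mul (by linarith)]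
      apply Real.sqrt_le_sqrt
      rw [mul_div_assoc', le_div_iff₀ hu]; linarith
    refine h3.trans ?_
    gcongr
    exact le_add_of_nonneg_right (by positivity)
  · have hneg : l - u * N ≤ 0 := by
      have : 0 ≤ u * N := mul_nonneg hu.le (by linarith)
      linarith
    have h3 : √N ≤ 2 / u * (|l - u * N| / √N) := by
      rw [abs_of_nonpos hneg, div_mul_eq_mul_div, le_div_iff₀ hu, mul_div_assoc',
        le_div_iff₀ hsN, mul_right_comm, hss]
      linarith
    exact (h3.trans (le_add_of_nonneg_left (Real.sqrt_nonneg _))).trans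
      (le_mul_of_one_le_left (by positivity) hl1)

lemma add_mul_le_mul_exp (A B : ℝ) {c D : ℝ} (hc : 0 < c) (hA : 0 ≤ A) (hB : 0 ≤ B) (hD : 0 ≤ D) :
    A + B * D ≤ (A + B / c) * Real.exp (c * D) := by
  have h1 := Real.add_one_le_exp (c * D)
  have h2 : A * 1 ≤ A * Real.exp (c * D) :=
    mul_le_mul_of_nonneg_left (Real.one_le_exp (by positivity)) hA
  have h3 : B * D ≤ B / c * Real.exp (c * D) := by
    calc B * D = B / c * (c * D) := by field_simp
      _ ≤ _ := by gcongr; linarith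
  linarith

/-- Exponential tails of `legWeight` on the scale `√N`. -/
theorem exists_sqrt_mul_legWeight_le [IsProbabilityMeasure P] (hX : IIDSteps X P)
    (hap : Aperiodic X P) {t : ℝ} (ht : t ∈ interior (integrableExpSet (upStep X) P))
    {a u : ℝ} (hu : 0 < u) (hm : 0 < deriv (cgf (upStep X) P) t)
    (hua : u * deriv (cgf (upStep X) P) t = a) :
    ∃ C c : ℝ, 0 < C ∧ 0 < c ∧ ∀ᶠ N : ℕ in atTop, ∀ l : ℕ, 0 < l →
      √N * legWeight X P t a N l ≤ C * Real.exp (-(c * (|(l : ℝ) - u * N| / √N))) := by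
  set Y := upStep X with hYdef
  set m := deriv (cgf Y P) t with hmdef
  obtain ⟨K, ε, hK, hε, hsub, hcgf⟩ := exists_cgf_sub_le ht
  obtain ⟨C₀, hC₀, hCb⟩ := exists_tiltProb_le hX hap (hsub.trans interior_subset)
  set η := min 1 (m / (2 * K)) with hη
  have hη0 : 0 < η := by positivity
  have hη1 : η ≤ 1 := min_le_left _ _
  have hηK : K * η ≤ m / 2 := by
    have h : η ≤ m / (2 * K) := min_le_right _ _
    rw [le_div_iff₀ (by positivity)] at h
    linarith
  -- Tilting by a further ±η/√N gains mηD at first order. The second-order cost takes at most half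
  -- of it, leaving 2c; one c absorbs the factor linear in D, and the other is the decay rate.
  set c := m * η / 4 with hc
  have hc0 : 0 < c := by positivity
  refine ⟨C₀ * (√(2 / u) + 2 / u / c) * Real.exp (1 + K * u), c, by positivity, hc0, ?_⟩
  have hsq : Tendsto (fun N : ℕ => η / √(N : ℝ)) atTop (𝓝 0) :=
    (Real.tendsto_sqrt_atTop.comp tendsto_natCast_atTop_atTop).const_div_atTop η
  filter_upwards [eventually_ge_atTop 1, hsq.eventually (ge_mem_nhds hε)] with N hN hNε l hl
  have hN1 : (1 : ℝ) ≤ N := by exact_mod_cast hN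
  have hN0 : (0 : ℝ) < N := by linarith
  have hl0 : (0 : ℝ) < l := by exact_mod_cast hl
  have hsN : 0 < √(N : ℝ) := Real.sqrt_pos.2 hN0
  have hsN1 : 1 ≤ √(N : ℝ) := Real.one_le_sqrt.2 hN1
  have hss : √(N : ℝ) * √(N : ℝ) = N := Real.mul_self_sqrt hN0.le
  set D := |(l : ℝ) - u * N| / √N with hD
  have hD0 : 0 ≤ D := by positivity
  -- the tilt
  obtain ⟨h, hh, hhD⟩ : ∃ h : ℝ, |h| = η / √N ∧ h * ((l : ℝ) - u * N) = -(η * D) := by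
    rcases le_total 0 ((l : ℝ) - u * N) with h0 | h0
    · refine ⟨-(η / √N), ?_, ?_⟩
      · rw [abs_neg, abs_of_pos (by positivity)]
      · rw [hD, abs_of_nonneg h0]; ring
    · refine ⟨η / √N, abs_of_pos (by positivity), ?_⟩
      rw [hD, abs_of_nonpos h0]; ring
  have hhε : |h| ≤ ε := hh ▸ hNε
  have hsm : t + h ∈ Set.Icc (t - ε) (t + ε) := by
    have := abs_le.1 hhε
    exact ⟨by linarith [this.1], by linarith [this.2]⟩
  set d := depth a N with hd
  have hh1 : |h| ≤ 1 := by
    rw [hh, div_le_one hsN]; linarith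
  have hhsq : h ^ 2 = η ^ 2 / N := by
    rw [← sq_abs, hh, div_pow, Real.sq_sqrt hN0.le]
  have hlN : (l : ℝ) / N ≤ u + D := by
    have h1 : (l : ℝ) ≤ u * N + √N * D := by
      have : √N * D = |(l : ℝ) - u * N| := by rw [hD]; field_simp
      rw [this]; linarith [le_abs_self ((l : ℝ) - u * N)]
    rw [div_le_iff₀ hN0]
    nlinarith [mul_nonneg hD0 (mul_nonneg hsN.le (sub_nonneg.2 hsN1))]
  have hexp : -(h * d) + (cgf Y P (t + h) - cgf Y P t) * l ≤ -(2 * c * D) + (1 + K * u) := by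
    have h1 := hcgf h hhε
    have h2 : -(h * d) ≤ -(h * (m * u * N)) + 1 := by
      have h3 : |(d : ℝ) - m * u * N| ≤ 1 := by
        have h4 := depth_le (a := a) N
        have h5 := lt_depth_add_one (a := a) N
        rw [← hd, ← hua] at h4 h5
        rw [abs_le]; constructor <;> linarith
      have h6 : |h * ((d : ℝ) - m * u * N)| ≤ 1 := by
        rw [abs_mul]; exact mul_le_one₀ hh1 (abs_nonneg _) h3
      have := (abs_le.1 h6).1
      linarith
    have h7 : (cgf Y P (t + h) - cgf Y P t) * l ≤ (m * h + K * h ^ 2) * l := by gcongr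
    have h8 : K * h ^ 2 * l ≤ K * η ^ 2 * (u + D) := by
      rw [hhsq]
      calc K * (η ^ 2 / N) * l = K * η ^ 2 * (l / N) := by ring
        _ ≤ _ := by gcongr
    have h9 : K * η ^ 2 * u ≤ K * u := by
      have : η ^ 2 ≤ 1 := pow_le_one₀ hη0.le hη1
      nlinarith [mul_pos hK hu]
    have h10 : K * η ^ 2 * D ≤ m / 2 * η * D := by
      calc K * η ^ 2 * D = (K * η) * (η * D) := by ring
        _ ≤ m / 2 * (η * D) := by gcongr
        _ = _ := by ring
    have h11 : m * (h * ((l : ℝ) - u * N)) = m * (-(η * D)) := by rw [hhD]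
    have : 2 * c * D = m * η * D / 2 := by rw [hc]; ring
    rw [this]
    nlinarith
  have hpos : posProb X P l d ≤ P.real {ω | walk X l ω = d} :=
    measureReal_mono fun ω hω => hω.2
  have hMt : mgf Y P (t + h) = Real.exp (cgf Y P (t + h)) :=
    (exp_cgf (integrable_exp_of_mem_interior (hsub hsm))).symm
  have hleg : legWeight X P t a N l ≤ tiltProb X P (t + h) l d *
      Real.exp (-(h * d) + (cgf Y P (t + h) - cgf Y P t) * l) := by
    rw [legWeight, tiltProb, ← hYdef, ← hd, hMt, ← Real.exp_nat_mul, ← Real.exp_sub]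
    calc _ ≤ Real.exp (t * d - cgf Y P t * l) * P.real {ω | walk X l ω = d} := by gcongr
      _ = Real.exp ((t + h) * d - l * cgf Y P (t + h)) *
          Real.exp (-(h * d) + (cgf Y P (t + h) - cgf Y P t) * l) *
            P.real {ω | walk X l ω = d} := by
          rw [← Real.exp_add]; ring_nf
      _ = _ := by ring
  have htp : √N * tiltProb X P (t + h) l d ≤ C₀ * (√(2 / u) + 2 / u * D) := by
    have h1 := hCb (t + h) hsm l hl d
    have hq := sqrt_le_sqrt_mul_add hu hN1 (by exact_mod_cast hl : (1 : ℝ) ≤ l)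
    calc √N * tiltProb X P (t + h) l d
        ≤ √(l : ℝ) * (√(2 / u) + 2 / u * D) * tiltProb X P (t + h) l d :=
          mul_le_mul_of_nonneg_right hq (tiltProb_nonneg _ _ _)
      _ = (√(l : ℝ) * tiltProb X P (t + h) l d) * (√(2 / u) + 2 / u * D) := by ring
      _ ≤ _ := by gcongr
  have hDexp := add_mul_le_mul_exp (√(2 / u)) (2 / u) hc0 (Real.sqrt_nonneg _) (by positivity) hD0
  calc √N * legWeight X P t a N l ≤ √N * (tiltProb X P (t + h) l d *
        Real.exp (-(h * d) + (cgf Y P (t + h) - cgf Y P t) * l)) := by gcongr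
    _ = √N * tiltProb X P (t + h) l d *
        Real.exp (-(h * d) + (cgf Y P (t + h) - cgf Y P t) * l) := by ring
    _ ≤ C₀ * ((√(2 / u) + 2 / u / c) * Real.exp (c * D)) *
        Real.exp (-(2 * c * D) + (1 + K * u)) :=
        mul_le_mul (htp.trans (mul_le_mul_of_nonneg_left hDexp hC₀.le))
          (Real.exp_le_exp.2 hexp) (Real.exp_pos _).le (by positivity)
    _ = C₀ * (√(2 / u) + 2 / u / c) * Real.exp (1 + K * u) *
        (Real.exp (c * D) * Real.exp (-(2 * c * D))) := by rw [Real.exp_add]; ring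
    _ = _ := by rw [← Real.exp_add]; ring_nf

end

section

variable {Ω : Type*} [MeasurableSpace Ω] {X : ℕ → Ω → ℤ} {P : Measure Ω}

/-! ### The wetting model without well as a renewal process -/

/-- The weight of a site in the wetting model at height zero. -/
noncomputable def wetWeight (lam : ℝ≥0∞) (x : ℤ) : ℝ≥0∞ :=
  if 0 < x then 1 else if x = 0 then lam else 0

/-- The partition function of the wetting model at height zero. -/
noncomputable def wettingZ (X : ℕ → Ω → ℤ) (P : Measure Ω) (lam : ℝ) (n : ℕ) : ℝ :=
  ((step (stepLaw X P) (wetWeight (ENNReal.ofReal lam)) ^ n) (Pi.single 0 1) 0).toReal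

/-- The probability that the first return to zero of the walk takes place at time `j`, the walk
being positive before. -/
noncomputable def returnProb (X : ℕ → Ω → ℤ) (P : Measure Ω) (j : ℕ) : ℝ :=
  if j = 0 then 0 else (firstPassage (stepLaw X P) (j - 1) 0).toReal

/-- The generating function of the first return time. -/
noncomputable def returnGF (X : ℕ → Ω → ℤ) (P : Measure Ω) (y : ℝ) : ℝ :=
  ∑' j, returnProb X P j * Real.exp (-(y * j))

lemma step_wetWeight (μ : ℤ → ℝ≥0∞) (lam : ℝ≥0∞) : step μ (wetWeight lam) =
    step μ posWeight + step μ (fun x => if x = 0 then (fun _ => lam) x else 0) := by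
  rw [← step_add]
  congr 1
  funext x
  simp only [wetWeight, posWeight, Pi.add_apply]
  rcases lt_trichotomy x 0 with h | h | h
  · simp [h.not_gt, h.ne]
  · simp [h]
  · simp [h, h.ne']

lemma step_posWeight_pow_succ_single (μ : ℤ → ℝ≥0∞) (n : ℕ) :
    (step μ posWeight ^ (n + 1)) (Pi.single 0 1) = 0 := by
  have h1 : step μ posWeight (Pi.single 0 1) = 0 := by
    funext x
    rw [step_apply, Pi.zero_apply, ENNReal.tsum_eq_zero]
    intro k
    by_cases h : x + k = 0
    · simp [posWeight, h]
    · simp [h]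
  rw [pow_succ, Module.End.mul_apply, h1, map_zero]

/-- The renewal equation of the wetting model: cut the path at its first visit to zero. -/
lemma step_wetWeight_pow_succ (μ : ℤ → ℝ≥0∞) (lam : ℝ≥0∞) (n : ℕ) :
    (step μ (wetWeight lam) ^ (n + 1)) (Pi.single 0 1) 0 =
      ∑ j ∈ Finset.range (n + 1), lam * firstPassage μ j 0 *
        (step μ (wetWeight lam) ^ (n - j)) (Pi.single 0 1) 0 := by
  have h1 := add_pow_eq_first_occurrence (step μ posWeight)
    (step μ (fun x => if x = 0 then (fun _ => lam) x else 0)) (n + 1)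
  rw [← step_wetWeight] at h1
  rw [h1, LinearMap.add_apply, Pi.add_apply, step_posWeight_pow_succ_single, Pi.zero_apply,
    zero_add, LinearMap.sum_apply, Finset.sum_apply]
  refine Finset.sum_congr rfl fun j hj => ?_
  rw [mul_assoc, Module.End.mul_apply, Module.End.mul_apply, step_single, map_smul, Pi.smul_apply,
    smul_eq_mul, firstPassage, Module.End.mul_apply]
  have h2 : step μ 1 (Pi.single 0 1) = step μ nonposWeight (Pi.single 0 1) :=
    step_congr fun x => by by_cases hx : x = 0 <;> simp [nonposWeight, hx]
  rw [h2, show n + 1 - 1 - j = n - j by omega]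
  ring

lemma returnProb_nonneg (j : ℕ) : 0 ≤ returnProb X P j := by
  rw [returnProb]; split_ifs <;> simp

lemma returnProb_le_one [IsProbabilityMeasure P] (hX : IIDSteps X P) (j : ℕ) :
    returnProb X P j ≤ 1 := by
  rw [returnProb]; split_ifs
  · simp
  · exact ENNReal.toReal_le_of_le_ofReal zero_le_one
      (by simpa using (ENNReal.le_tsum 0).trans (tsum_firstPassage_le hX (j - 1)))

lemma wettingZ_nonneg (lam : ℝ) (n : ℕ) : 0 ≤ wettingZ X P lam n := ENNReal.toReal_nonneg

lemma wettingZ_zero (lam : ℝ) : wettingZ X P lam 0 = 1 := by simp [wettingZ]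

lemma step_wetWeight_pow_ne_top [IsProbabilityMeasure P] (hX : IIDSteps X P) (lam : ℝ) (n : ℕ) :
    (step (stepLaw X P) (wetWeight (ENNReal.ofReal lam)) ^ n) (Pi.single 0 1) 0 ≠ ⊤ := by
  induction n using Nat.strong_induction_on with
  | _ n ih =>
    rcases n with _ | n
    · simp
    · rw [step_wetWeight_pow_succ]
      refine (ENNReal.sum_ne_top).2 fun j hj => ENNReal.mul_ne_top (ENNReal.mul_ne_top
        ENNReal.ofReal_ne_top (firstPassage_ne_top hX j 0)) (ih _ (by omega))

lemma wettingZ_succ [IsProbabilityMeasure P] (hX : IIDSteps X P) {lam : ℝ} (hlam : 0 ≤ lam)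
    (n : ℕ) : wettingZ X P lam (n + 1) =
      ∑ j ∈ Finset.range (n + 1), lam * returnProb X P (j + 1) * wettingZ X P lam (n - j) := by
  rw [wettingZ, step_wetWeight_pow_succ, ENNReal.toReal_sum]
  · refine Finset.sum_congr rfl fun j _ => ?_
    rw [ENNReal.toReal_mul, ENNReal.toReal_mul, ENNReal.toReal_ofReal hlam, wettingZ, returnProb,
      if_neg (Nat.succ_ne_zero j), Nat.add_sub_cancel]
  · exact fun j _ => ENNReal.mul_ne_top (ENNReal.mul_ne_top
        ENNReal.ofReal_ne_top (firstPassage_ne_top hX j 0)) (step_wetWeight_pow_ne_top hX _ _)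

/-! #### Aperiodicity of the return times -/

/-- Keeps only the path that makes n equal steps k. -/
lemma mul_le_step_posWeight_pow (μ h : ℤ → ℝ≥0∞) (k : ℤ) (n : ℕ) (x : ℤ)
    (hpos : ∀ i : ℕ, 1 ≤ i → i ≤ n → 0 < x + i * k) :
    μ k ^ n * h (x + n * k) ≤ (step μ posWeight ^ n) h x := by
  induction n generalizing x with
  | zero => simp
  | succ n ih =>
    rw [pow_succ' (step μ posWeight), Module.End.mul_apply, step_apply]
    refine le_trans ?_ (ENNReal.le_tsum k)
    have h1 : 0 < x + k := by simpa using hpos 1 le_rfl (by omega)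
    have h2 := ih (x + k) fun i hi hin => by
      have := hpos (i + 1) (by omega) (by omega)
      push_cast at this
      linarith
    rw [show posWeight (x + k) = 1 from if_pos h1, one_mul, pow_succ', mul_assoc]
    refine mul_le_mul_right (le_trans (le_of_eq ?_) h2) _
    congr 2
    push_cast
    ring

/-- Go up by c steps of size b, then down by b steps of size c: the path is positive until it hits
zero at time b + c. -/
lemma firstPassage_zero_ne_zero {μ : ℤ → ℝ≥0∞} {b c : ℕ} (hb : 0 < b) (hc : 0 < c)
    (hμb : μ b ≠ 0) (hμc : μ (-c) ≠ 0) : firstPassage μ (c + (b - 1)) 0 ≠ 0 := by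
  rw [firstPassage, Module.End.mul_apply, pow_add, Module.End.mul_apply]
  set g := step μ nonposWeight (Pi.single 0 1)
  have h1 := mul_le_step_posWeight_pow μ ((step μ posWeight ^ (b - 1)) g) b c 0 (fun i hi _ => by
    have : (0 : ℤ) < i * b := by positivity
    linarith)
  have h2 := mul_le_step_posWeight_pow μ g (-c) (b - 1) (0 + c * b) (fun i hi hib => by
    have h3 : (i : ℤ) < b := by omega
    have h4 : (i : ℤ) * c < b * c := mul_lt_mul_of_pos_right h3 (by exact_mod_cast hc)
    nlinarith)
  have h3 : μ (-c) ≤ g c := by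
    rw [show g c = _ from step_apply _ _ _ _]
    refine le_trans (le_of_eq ?_) (ENNReal.le_tsum (-(c : ℤ)))
    simp [nonposWeight]
  have e : (0 : ℤ) + c * b + ((b - 1 : ℕ) : ℤ) * (-c) = c := by
    rw [Nat.cast_sub hb]; push_cast; ring
  rw [e] at h2
  have h4 : 0 < μ b ^ c * (μ (-c) ^ (b - 1) * μ (-c)) := by
    rw [pos_iff_ne_zero]
    exact mul_ne_zero (pow_ne_zero _ hμb) (mul_ne_zero (pow_ne_zero _ hμc) hμc)
  refine (h4.trans_le ((mul_le_mul_right ((mul_le_mul_right h3 _).trans h2) _).trans h1)).ne'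

lemma Aperiodic.neg (hap : Aperiodic X P) : Aperiodic (fun i ω => -X i ω) P := by
  intro h c hh
  refine hap h (-c) (hh.mono fun ω hω => ?_)
  rw [← dvd_neg, show -(X 0 ω - -c) = -X 0 ω - c by ring]
  exact hω

/-- A centred step that is never positive vanishes almost surely, against aperiodicity with h = 0.
-/
lemma exists_stepLaw_ne_zero [IsProbabilityMeasure P] (hap : Aperiodic X P)
    (hint : Integrable (upStep X) P) (hmean : ∫ ω, upStep X ω ∂P = 0) :
    ∃ b : ℕ, 0 < b ∧ stepLaw X P b ≠ 0 := by
  by_contra! hcon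
  have h1 : ∀ᵐ ω ∂P, X 0 ω ≤ 0 := by
    have h2 : ∀ k : ℕ, ∀ᵐ ω ∂P, X 0 ω ≠ ((k + 1 : ℕ) : ℤ) := fun k => by
      have := hcon (k + 1) k.succ_pos
      rw [ae_iff]
      simpa [stepLaw] using this
    filter_upwards [ae_all_iff.2 h2] with ω hω
    by_contra! hpos
    refine hω (X 0 ω - 1).toNat ?_
    push_cast
    omega
  have h3 : -upStep X =ᵐ[P] 0 := by
    rw [← integral_eq_zero_iff_of_nonneg_ae (h1.mono fun ω hω => ?_) hint.neg]
    · simp only [Pi.neg_apply]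
      rw [integral_neg, hmean, neg_zero]
    · simpa [upStep] using hω
  have h4 := hap 0 0 (h3.mono fun ω hω => by
    have : (X 0 ω : ℝ) = 0 := by simpa [upStep] using hω
    simpa using this)
  exact absurd h4 (by norm_num)

/-- The gcd g divides b + c for every upward atom b and downward atom -c, so all nonzero atoms are
congruent modulo g and aperiodicity gives g = 1. An atom at 0 gives a return at time 1 directly. -/
lemma setGcd_returnProb [IsProbabilityMeasure P] (hX : IIDSteps X P) (hap : Aperiodic X P)
    {b c : ℕ} (hb : 0 < b) (hc : 0 < c) (hμb : stepLaw X P b ≠ 0) (hμc : stepLaw X P (-c) ≠ 0) :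
    Nat.setGcd {j | 0 < returnProb X P j} = 1 := by
  set g := Nat.setGcd {j | 0 < returnProb X P j} with hg
  have hq : ∀ b c : ℕ, 0 < b → 0 < c → stepLaw X P b ≠ 0 → stepLaw X P (-c) ≠ 0 → g ∣ b + c := by
    intro b c hb hc hμb hμc
    refine Nat.setGcd_dvd_of_mem ?_
    show 0 < returnProb X P (b + c)
    rw [returnProb, if_neg (by omega), show b + c - 1 = c + (b - 1) by omega]
    exact ENNReal.toReal_pos (firstPassage_zero_ne_zero hb hc hμb hμc) (firstPassage_ne_top hX _ _)
  have h0 : stepLaw X P 0 ≠ 0 → g = 1 := fun h => by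
    refine Nat.dvd_one.1 (Nat.setGcd_dvd_of_mem ?_)
    show 0 < returnProb X P 1
    rw [returnProb, if_neg one_ne_zero]
    refine ENNReal.toReal_pos ?_ (firstPassage_ne_top hX _ _)
    simp only [firstPassage, Nat.sub_self, pow_zero, one_mul, step_apply]
    rw [Ne, ENNReal.tsum_eq_zero]
    intro h'
    have := h' 0
    simp [nonposWeight] at this
    exact h this
  by_cases hz : stepLaw X P 0 = 0
  swap
  · exact h0 hz
  refine hap g b ?_
  have hall : ∀ᵐ ω ∂P, ∀ k : ℤ, stepLaw X P k = 0 → X 0 ω ≠ k := by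
    refine ae_all_iff.2 fun k => ?_
    by_cases hk : stepLaw X P k = 0
    · have : ∀ᵐ ω ∂P, X 0 ω ≠ k := by rw [ae_iff]; simpa [stepLaw] using hk
      exact this.mono fun ω hω _ => hω
    · exact ae_of_all _ fun ω h => absurd h hk
  filter_upwards [hall] with ω hω
  have hk : stepLaw X P (X 0 ω) ≠ 0 := fun h => hω _ h rfl
  have hbc := hq b c hb hc hμb hμc
  rcases lt_trichotomy (X 0 ω) 0 with hneg | hzero | hpos
  · obtain ⟨m, hm⟩ := Int.eq_ofNat_of_zero_le (show 0 ≤ -X 0 ω by omega)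
    have hX0 : X 0 ω = -(m : ℤ) := by omega
    rw [hX0] at hk ⊢
    have h := hq b m hb (by omega) hμb hk
    have h' : (g : ℤ) ∣ ((b + m : ℕ) : ℤ) := Int.natCast_dvd_natCast.2 h
    rw [← dvd_neg] at h'
    rwa [show -(m : ℤ) - b = -((b + m : ℕ) : ℤ) by push_cast; ring]
  · rw [hzero] at hk; exact absurd hz hk
  · obtain ⟨m, hm⟩ := Int.eq_ofNat_of_zero_le hpos.le
    rw [hm] at hk ⊢
    have h := hq m c (by omega) hc hk hμc
    have h' : (g : ℤ) ∣ ((m + c : ℕ) : ℤ) := Int.natCast_dvd_natCast.2 h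
    have h2 := dvd_sub h' (Int.natCast_dvd_natCast.2 hbc)
    rwa [show (m : ℤ) - b = ((m + c : ℕ) : ℤ) - ((b + c : ℕ) : ℤ) by push_cast; ring]

/-- As the return times have gcd 1, every large n is a sum of return times; concatenate the
corresponding excursions. -/
lemma eventually_wettingZ_pos [IsProbabilityMeasure P] (hX : IIDSteps X P) (hap : Aperiodic X P)
    {b c : ℕ} (hb : 0 < b) (hc : 0 < c) (hμb : stepLaw X P b ≠ 0) (hμc : stepLaw X P (-c) ≠ 0)
    {lam : ℝ} (hlam : 0 < lam) : ∀ᶠ n in atTop, 0 < wettingZ X P lam n := by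
  obtain ⟨n₀, hn₀⟩ := Nat.exists_mem_closure_of_ge {j | 0 < returnProb X P j}
  rw [setGcd_returnProb hX hap hb hc hμb hμc] at hn₀
  have key : ∀ m ∈ AddSubmonoid.closure {j | 0 < returnProb X P j}, ∀ n,
      0 < wettingZ X P lam n → 0 < wettingZ X P lam (n + m) := by
    intro m hm
    induction hm using AddSubmonoid.closure_induction with
    | mem j hj =>
      intro n hn
      have hj : 0 < returnProb X P j := hj
      obtain ⟨i, rfl⟩ : ∃ i, j = i + 1 := ⟨j - 1, by
        rcases j with _ | j
        · simp [returnProb] at hj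
        · omega⟩
      rw [← add_assoc, wettingZ_succ hX hlam.le]
      refine Finset.sum_pos' (fun k _ => mul_nonneg (mul_nonneg hlam.le (returnProb_nonneg _))
        (wettingZ_nonneg _ _)) ⟨i, Finset.mem_range.2 (by omega), ?_⟩
      rw [Nat.add_sub_cancel]
      positivity
    | zero => simp
    | add x y _ _ hx hy => intro n hn; rw [← add_assoc]; exact hy _ (hx n hn)
  filter_upwards [eventually_ge_atTop n₀] with n hn
  have := key n (hn₀ n hn (one_dvd _)) 0 (by rw [wettingZ_zero]; exact one_pos)
  rwa [zero_add] at this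

/-! #### The generating function of the return times -/

lemma returnProb_mul_exp_le [IsProbabilityMeasure P] (hX : IIDSteps X P) (y : ℝ) (j : ℕ) :
    returnProb X P j * Real.exp (-(y * j)) ≤ Real.exp (-y) ^ j := by
  rw [← Real.exp_nat_mul, show (j : ℝ) * -y = -(y * j) by ring]
  exact mul_le_of_le_one_left (Real.exp_pos _).le (returnProb_le_one hX j)

lemma summable_returnProb [IsProbabilityMeasure P] (hX : IIDSteps X P) {y : ℝ} (hy : 0 < y) :
    Summable fun j : ℕ => returnProb X P j * Real.exp (-(y * j)) :=
  Summable.of_nonneg_of_le (fun j => mul_nonneg (returnProb_nonneg j) (Real.exp_pos _).le)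
    (returnProb_mul_exp_le hX y)
    (summable_geometric_of_lt_one (Real.exp_pos _).le (Real.exp_lt_one_iff.2 (by linarith)))

lemma returnGF_anti [IsProbabilityMeasure P] (hX : IIDSteps X P) {y z : ℝ} (hy : 0 < y)
    (hyz : y ≤ z) : returnGF X P z ≤ returnGF X P y := by
  refine (summable_returnProb hX (hy.trans_le hyz)).tsum_le_tsum (fun j => ?_)
    (summable_returnProb hX hy)
  gcongr
  exact returnProb_nonneg j

lemma returnGF_strictAnti [IsProbabilityMeasure P] (hX : IIDSteps X P) {y z : ℝ} (hy : 0 < y)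
    (hyz : y < z) (hpos : ∃ j, 0 < returnProb X P j) : returnGF X P z < returnGF X P y := by
  obtain ⟨j, hj⟩ := hpos
  have hj0 : 0 < j := by
    rcases j with _ | j
    · simp [returnProb] at hj
    · omega
  refine Summable.tsum_lt_tsum (i := j) (fun i => ?_) ?_ (summable_returnProb hX (hy.trans hyz))
    (summable_returnProb hX hy)
  · gcongr
    exact returnProb_nonneg i
  · gcongr

lemma continuousOn_returnGF [IsProbabilityMeasure P] (hX : IIDSteps X P) :
    ContinuousOn (returnGF X P) (Set.Ioi 0) := by
  refine continuousOn_of_forall_continuousAt fun y hy => ?_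
  have hy : 0 < y := hy
  have h : ContinuousOn (returnGF X P) (Set.Ioi (y / 2)) := by
    refine continuousOn_tsum (fun j => by fun_prop) (summable_geometric_of_lt_one
      (Real.exp_pos (-(y / 2))).le (Real.exp_lt_one_iff.2 (by linarith))) fun j z hz => ?_
    have hz : y / 2 < z := hz
    rw [Real.norm_of_nonneg (mul_nonneg (returnProb_nonneg j) (Real.exp_pos _).le)]
    refine (returnProb_mul_exp_le hX z j).trans ?_
    gcongr
  exact h.continuousAt (Ioi_mem_nhds (by linarith))

lemma returnGF_le [IsProbabilityMeasure P] (hX : IIDSteps X P) {y : ℝ} (hy : 0 < y) :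
    returnGF X P y ≤ Real.exp (-y) / (1 - Real.exp (-y)) := by
  have hlt : Real.exp (-y) < 1 := Real.exp_lt_one_iff.2 (by linarith)
  have hs := summable_returnProb hX hy
  rw [returnGF, hs.tsum_eq_zero_add, show returnProb X P 0 = 0 from if_pos rfl, zero_mul, zero_add,
    div_eq_mul_inv, ← tsum_geometric_of_lt_one (Real.exp_pos _).le hlt, ← tsum_mul_left]
  refine ((summable_nat_add_iff 1).2 hs).tsum_le_tsum (fun j => ?_)
    ((summable_geometric_of_lt_one (Real.exp_pos _).le hlt).mul_left _)
  rw [← pow_succ']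
  exact_mod_cast returnProb_mul_exp_le hX y (j + 1)

/-- Intermediate values: the generating function is continuous and is dominated by a geometric
series that tends to 0 at infinity. -/
lemma exists_returnGF_eq [IsProbabilityMeasure P] (hX : IIDSteps X P) {lam y : ℝ} (hlam : 0 < lam)
    (hy : 0 < y) (h : 1 ≤ lam * returnGF X P y) :
    ∃ z, y ≤ z ∧ lam * returnGF X P z = 1 := by
  have hlim : Tendsto (fun z : ℝ => lam * (Real.exp (-z) / (1 - Real.exp (-z)))) atTop
      (𝓝 (lam * (0 / (1 - 0)))) := by
    have h1 : Tendsto (fun z : ℝ => Real.exp (-z)) atTop (𝓝 0) := Real.tendsto_exp_neg_atTop_nhds_zero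
    exact (h1.div (h1.const_sub 1) (by norm_num)).const_mul lam
  rw [zero_div, mul_zero] at hlim
  obtain ⟨w, hw1, hw2⟩ := ((hlim.eventually (gt_mem_nhds one_pos)).and (eventually_ge_atTop y)).exists
  have hw3 : lam * returnGF X P w ≤ 1 :=
    (mul_le_mul_of_nonneg_left (returnGF_le hX (hy.trans_le hw2)) hlam.le).trans hw1.le
  have hc : ContinuousOn (fun z => lam * returnGF X P z) (Set.Icc y w) :=
    continuousOn_const.mul ((continuousOn_returnGF hX).mono fun z hz => hy.trans_le hz.1)
  obtain ⟨z, hz, hz1⟩ := intermediate_value_Icc' hw2 hc ⟨hw3, h⟩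
  exact ⟨z, hz.1, hz1⟩

/-- By induction on the renewal equation Z_n ≤ e^{yn} for each y > 0, and then y decreases to 0.
This is the case of no localization at height zero. -/
lemma wettingZ_le_one [IsProbabilityMeasure P] (hX : IIDSteps X P) {lam : ℝ} (hlam : 0 < lam)
    (h : ∀ y, 0 < y → lam * returnGF X P y ≤ 1) (n : ℕ) : wettingZ X P lam n ≤ 1 := by
  have key : ∀ y, 0 < y → wettingZ X P lam n ≤ Real.exp (y * n) := by
    intro y hy
    induction n using Nat.strong_induction_on with
    | _ n ih =>
      rcases n with _ | n
      · simp [wettingZ_zero]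
      · rw [wettingZ_succ hX hlam.le]
        calc _ ≤ ∑ j ∈ Finset.range (n + 1), lam * returnProb X P (j + 1) *
              Real.exp (y * (n - j : ℕ)) := by
              refine Finset.sum_le_sum fun j _ => mul_le_mul_of_nonneg_left (ih _ (by omega))
                (mul_nonneg hlam.le (returnProb_nonneg _))
          _ = Real.exp (y * (n + 1 : ℕ)) * (lam * ∑ j ∈ Finset.range (n + 1),
                returnProb X P (j + 1) * Real.exp (-(y * (j + 1 : ℕ)))) := by
              rw [Finset.mul_sum, Finset.mul_sum]
              refine Finset.sum_congr rfl fun j hj => ?_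
              have : Real.exp (y * (n - j : ℕ)) =
                  Real.exp (y * (n + 1 : ℕ)) * Real.exp (-(y * (j + 1 : ℕ))) := by
                rw [← Real.exp_add, Nat.cast_sub (Nat.lt_succ_iff.1 (Finset.mem_range.1 hj))]
                push_cast
                ring_nf
              rw [this]; ring
          _ ≤ Real.exp (y * (n + 1 : ℕ)) * 1 := by
              refine mul_le_mul_of_nonneg_left (le_trans ?_ (h y hy)) (Real.exp_pos _).le
              refine mul_le_mul_of_nonneg_left ?_ hlam.le
              have hs := summable_returnProb hX hy
              rw [returnGF, hs.tsum_eq_zero_add, show returnProb X P 0 = 0 from if_pos rfl, zero_mul,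
                zero_add]
              exact ((summable_nat_add_iff 1).2 hs).sum_le_tsum _ fun j _ =>
                mul_nonneg (returnProb_nonneg _) (Real.exp_pos _).le
          _ = _ := mul_one _
  have hlim : Tendsto (fun y : ℝ => Real.exp (y * n)) (𝓝[>] 0) (𝓝 1) := by
    have : Continuous fun y : ℝ => Real.exp (y * n) := by fun_prop
    have := this.tendsto 0
    rw [zero_mul, Real.exp_zero] at this
    exact this.mono_left nhdsWithin_le_nhds
  exact ge_of_tendsto hlim (eventually_nhdsWithin_of_forall fun y hy => key y hy)

/-- Sharp exponential growth of the partition function in the localized regime. -/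
theorem exists_tendsto_wettingZ [IsProbabilityMeasure P] (hX : IIDSteps X P) {lam y : ℝ}
    (hlam : 0 < lam) (hy : 0 < y) (h : lam * returnGF X P y = 1)
    (hpos : ∀ᶠ n in atTop, 0 < wettingZ X P lam n) :
    ∃ C, 0 < C ∧ Tendsto (fun n : ℕ => wettingZ X P lam n * Real.exp (-(y * n))) atTop (𝓝 C) := by
  -- The equation for y makes p a probability law with geometric tails, and Z_n e^{-yn} is its
  -- renewal sequence.
  set p : ℕ → ℝ := fun j => lam * (returnProb X P j * Real.exp (-(y * j))) with hp
  have hp0 : ∀ j, 0 ≤ p j := fun j =>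
    mul_nonneg hlam.le (mul_nonneg (returnProb_nonneg _) (Real.exp_pos _).le)
  have hs : HasSum p 1 := by
    rw [← h]; exact (summable_returnProb hX hy).hasSum.mul_left lam
  set r := Real.exp (-y) with hr
  have hr0 : 0 < r := Real.exp_pos _
  have hr1 : r < 1 := Real.exp_lt_one_iff.2 (by linarith)
  have hpr : ∀ j, p j ≤ lam * r ^ j := fun j =>
    mul_le_mul_of_nonneg_left (returnProb_mul_exp_le hX y j) hlam.le
  have hgeo := summable_geometric_of_lt_one hr0.le hr1
  refine renewal_tendsto hp0 (by simp [hp, returnProb]) hs ?_ ?_ ?_ ?_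
  · have htail : ∀ j, 1 - ∑ i ∈ Finset.range (j + 1), p i = ∑' i, p (i + (j + 1)) := fun j => by
      have := hs.summable.sum_add_tsum_nat_add (j + 1)
      rw [hs.tsum_eq] at this
      linarith
    simp_rw [htail]
    refine Summable.of_nonneg_of_le (fun j => tsum_nonneg fun i => hp0 _) (fun j => ?_)
      ((hgeo.mul_left r).mul_left (lam * (∑' i, r ^ i)))
    calc ∑' i, p (i + (j + 1)) ≤ ∑' i, lam * (r * r ^ j) * r ^ i := by
          refine ((summable_nat_add_iff (j + 1)).2 hs.summable).tsum_le_tsum (fun i => ?_)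
            (hgeo.mul_left _)
          refine (hpr _).trans (le_of_eq ?_)
          rw [pow_add, pow_succ]; ring
      _ = _ := by rw [tsum_mul_left]; ring
  · simp [wettingZ_zero]
  · intro n
    rw [wettingZ_succ hX hlam.le, Finset.sum_mul]
    refine Finset.sum_congr rfl fun j hj => ?_
    have : Real.exp (-(y * (n + 1 : ℕ))) =
        Real.exp (-(y * (j + 1 : ℕ))) * Real.exp (-(y * (n - j : ℕ))) := by
      rw [← Real.exp_add, Nat.cast_sub (Nat.lt_succ_iff.1 (Finset.mem_range.1 hj))]
      push_cast
      ring_nf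
    rw [this, hp]; ring
  · exact hpos.mono fun n hn => mul_pos hn (Real.exp_pos _)

end

section

variable {Ω : Type*} [MeasurableSpace Ω] {X : ℕ → Ω → ℤ} {P : Measure Ω}

/-! ### Decomposition of the partition function at the first and the last contact -/

/-- The downward steps. -/
abbrev negStep (X : ℕ → Ω → ℤ) : ℕ → Ω → ℤ := fun i ω => -X i ω

lemma upStep_negStep {Ω : Type*} (X : ℕ → Ω → ℤ) : upStep (negStep X) = downStep X := by
  funext ω; simp [upStep, downStep]

/-- Time reversal of the part of the path that reaches the bottom for the first time. -/
lemma hitting_eq_posProb [IsProbabilityMeasure P] (hX : IIDSteps X P) (n : ℕ) {d : ℤ}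
    (hd : 0 < d) :
    (step (stepLaw X P) (fun x => posWeight (x + d)) ^ n)
        (step (stepLaw X P) 1 (Pi.single (-d) 1)) 0 =
      ENNReal.ofReal (posProb (negStep X) P (n + 1) d) := by
  classical
  have h1 : P {ω | (∀ i < n + 1, i < n → 0 < walk X (i + 1) ω + d) ∧ walk X (n + 1) ω = -d} =
      pathSum (stepLaw X P) (n + 1) (fun i => if i < n then fun x => posWeight (x + d) else 1)
        (Pi.single (-d) 1) 0 := by
    rw [hX.measure_walk_eq (n + 1) (fun i x => i < n → 0 < x + d) (fun x => x = -d)]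
    refine congrArg₂ (fun a b => pathSum (stepLaw X P) (n + 1) a b 0) ?_ ?_
    · funext i x
      by_cases hi : i < n <;> simp [posWeight, hi]
    · funext x
      simp [Pi.single_apply]
  rw [pathSum_add, pathSum_congr _ n (W' := fun _ x => posWeight (x + d)) _ fun i hi => if_pos hi,
    pathSum_const] at h1
  simp only [pathSum, add_zero, lt_irrefl, if_false] at h1
  rw [← h1]
  -- Reverses the first n + 1 steps and fixes the others. With negated steps, the position at time i
  -- becomes the height above -d of the original path at time n + 1 - i.
  set σ : ℕ → ℕ := fun j => if j < n + 1 then n - j else j with hσ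
  have hσi : σ.Injective := by
    intro i j hij
    simp only [hσ] at hij
    split_ifs at hij <;> omega
  have hY := hX.neg.precomp hσi
  have hwalk : ∀ i ≤ n + 1, ∀ ω, walk (fun j ω => -X (σ j) ω) i ω =
      walk X (n + 1 - i) ω - walk X (n + 1) ω := by
    intro i hi ω
    induction i with
    | zero => simp
    | succ i ih =>
      rw [walk_succ, ih (by omega), show n + 1 - i = (n - i) + 1 by omega, walk_succ X (n - i)]
      simp only [hσ, if_pos (show i < n + 1 by omega), show n + 1 - (i + 1) = n - i by omega]
      ring
  have hset : {ω | (∀ i < n + 1, i < n → 0 < walk X (i + 1) ω + d) ∧ walk X (n + 1) ω = -d} =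
      {ω | (∀ i < n + 1, 0 < walk (fun j ω => -X (σ j) ω) (i + 1) ω) ∧
        walk (fun j ω => -X (σ j) ω) (n + 1) ω = d} := by
    ext ω
    simp only [Set.mem_ofPred]
    constructor
    · rintro ⟨h1, h2⟩
      refine ⟨fun i hi => ?_, ?_⟩
      · rw [hwalk _ (by omega), h2]
        rcases Nat.lt_or_ge i n with hin | hin
        · have := h1 (n - i - 1) (by omega) (by omega)
          rw [show n - i - 1 + 1 = n + 1 - (i + 1) by omega] at this
          linarith
        · rw [show n + 1 - (i + 1) = 0 by omega, walk_zero]; linarith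
      · rw [hwalk _ le_rfl, h2, Nat.sub_self, walk_zero]; ring
    · rintro ⟨h1, h2⟩
      rw [hwalk _ le_rfl, Nat.sub_self, walk_zero] at h2
      have h2' : walk X (n + 1) ω = -d := by linarith
      refine ⟨fun i _ hi => ?_, h2'⟩
      have := h1 (n - 1 - i) (by omega)
      rw [hwalk _ (by omega), h2', show n + 1 - (n - 1 - i + 1) = i + 1 by omega] at this
      linarith
  rw [hset, hY.measure_pos_walk_eq_step, posProb, measureReal_def,
    ENNReal.ofReal_toReal (measure_ne_top _ _), hX.neg.measure_pos_walk_eq_step,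
    hX.neg.stepLaw_precomp σ]

lemma leftContact_eq_iff {Ω : Type*} {X : ℕ → Ω → ℤ} {a : ℝ} {N l : ℕ} {ω : Ω} : leftContact X a N ω = (l : ℕ∞) ↔
    l ∈ contactTimes X a N ω ∧ ∀ n ∈ contactTimes X a N ω, l ≤ n := by
  rw [leftContact]
  split_ifs with h
  · rw [Nat.cast_inj]
    constructor
    · rintro rfl
      exact ⟨Finset.min'_mem _ _, fun n hn => Finset.min'_le _ _ hn⟩
    · rintro ⟨h1, h2⟩
      exact le_antisymm (Finset.min'_le _ _ h1) (h2 _ (Finset.min'_mem _ _))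
  · refine iff_of_false (by simp) fun h' => h ⟨l, h'.1⟩

lemma rightContact_eq_iff {Ω : Type*} {X : ℕ → Ω → ℤ} {a : ℝ} {N r : ℕ} {ω : Ω} : rightContact X a N ω = (r : ℕ∞) ↔
    r ∈ contactTimes X a N ω ∧ ∀ n ∈ contactTimes X a N ω, n ≤ r := by
  rw [rightContact]
  split_ifs with h
  · rw [Nat.cast_inj]
    constructor
    · rintro rfl
      exact ⟨Finset.max'_mem _ _, fun n hn => Finset.le_max' _ _ hn⟩
    · rintro ⟨h1, h2⟩
      exact le_antisymm (h2 _ (Finset.max'_mem _ _)) (Finset.le_max' _ _ h1)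
  · refine iff_of_false (by simp) fun h' => h ⟨r, h'.1⟩

lemma mem_contactTimes {Ω : Type*} {X : ℕ → Ω → ℤ} {a : ℝ} {N n : ℕ} {ω : Ω} :
    n ∈ contactTimes X a N ω ↔ n ≤ N ∧ walk X n ω = -depth a N := by
  rw [contactTimes, Finset.mem_filter, Finset.mem_range, Nat.lt_succ_iff, add_comm,
    add_eq_zero_iff_eq_neg]

/-- The event that `l` is the first and `r` the last contact. -/
def contactEvent (X : ℕ → Ω → ℤ) (a : ℝ) (N l r : ℕ) : Set Ω :=
  {ω | leftContact X a N ω = (l : ℕ∞) ∧ rightContact X a N ω = (r : ℕ∞)}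

lemma mem_contactEvent {Ω : Type*} {X : ℕ → Ω → ℤ} {a : ℝ} {N l r : ℕ} {ω : Ω} : ω ∈ contactEvent X a N l r ↔
    l ≤ N ∧ r ≤ N ∧ walk X l ω = -depth a N ∧ walk X r ω = -depth a N ∧
      ∀ n ≤ N, walk X n ω = -depth a N → l ≤ n ∧ n ≤ r := by
  rw [contactEvent, Set.mem_ofPred, leftContact_eq_iff, rightContact_eq_iff]
  simp only [mem_contactTimes]
  constructor
  · rintro ⟨⟨⟨h1, h2⟩, h3⟩, ⟨h4, h5⟩, h6⟩
    exact ⟨h1, h4, h2, h5, fun n hn h => ⟨h3 n ⟨hn, h⟩, h6 n ⟨hn, h⟩⟩⟩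
  · rintro ⟨h1, h4, h2, h5, h⟩
    exact ⟨⟨⟨h1, h2⟩, fun n hn => (h n hn.1 hn.2).1⟩, ⟨h4, h5⟩, fun n hn => (h n hn.1 hn.2).2⟩

/-- The weight of the site `x` at time `i + 1` for paths with first contact `l` and last
contact `r` with the level `-d`. -/
noncomputable def contactWeight (lam : ℝ≥0∞) (d : ℤ) (l r i : ℕ) (x : ℤ) : ℝ≥0∞ :=
  if i + 1 = l ∨ i + 1 = r then (if x = -d then lam else 0)
  else if l < i + 1 ∧ i + 1 < r then wetWeight lam (x + d) else posWeight (x + d)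

lemma prod_range_contact (c : ℝ≥0∞) (S : ℕ → ℤ) (b : ℤ) (N : ℕ) :
    ∏ i ∈ Finset.range N, (if S (i + 1) = b then c else 1) =
      c ^ ((Finset.Icc 1 N).filter fun n => S n = b).card := by
  rw [← Finset.prod_const, Finset.prod_filter]
  refine Finset.prod_nbij' (· + 1) (· - 1) (fun i hi => ?_) (fun i hi => ?_) (fun i _ => rfl)
    (fun i hi => ?_) fun i _ => rfl
  all_goals simp only [Finset.mem_range, Finset.mem_Icc] at hi ⊢
  all_goals omega

/-- Expresses the weight on a contact event as a product of site weights, so that it becomes a path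
sum. Conversely a nonzero product forces the path into both events; positive depth ensures that time
0 is not a contact. -/
lemma ofReal_weight_indicator {Ω : Type*} {X : ℕ → Ω → ℤ} {lam : ℝ} (hlam : 0 < lam) {a : ℝ} {N l r : ℕ}
    (hd0 : 0 < depth a N) (hl : 0 < l) (hlr : l ≤ r) (hrN : r ≤ N) (ω : Ω) :
    (contactEvent X a N l r).indicator (fun ω => ENNReal.ofReal (weight X lam a N ω)) ω =
      (∏ i ∈ Finset.range N, contactWeight (ENNReal.ofReal lam) (depth a N) l r i
        (0 + walk X (i + 1) ω)) * (Pi.single 0 1 : ℤ → ℝ≥0∞) (0 + walk X N ω) := by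
  set d := depth a N with hd
  have hL : ENNReal.ofReal lam ≠ 0 := (ENNReal.ofReal_pos.2 hlam).ne'
  simp only [zero_add]
  by_cases hω : ω ∈ contactEvent X a N l r ∧ ω ∈ wellEvent X a N
  · obtain ⟨h1, h2⟩ := hω
    rw [Set.indicator_of_mem h1, weight, Set.indicator_of_mem h2, h2.2, Pi.single_eq_same, mul_one,
      ENNReal.ofReal_pow hlam.le, contacts, ← prod_range_contact]
    refine Finset.prod_congr rfl fun i hi => ?_
    obtain ⟨hlN, -, hSl, hSr, hall⟩ := mem_contactEvent.1 h1
    have hiN : i + 1 ≤ N := Finset.mem_range.1 hi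
    have hge : -d ≤ walk X (i + 1) ω := h2.1 (i + 1) (Finset.mem_Icc.2 ⟨by omega, hiN⟩)
    rw [← hd] at hSl hSr hall ⊢
    rw [contactWeight]
    by_cases hS : walk X (i + 1) ω = -d
    · have h3 := hall _ hiN hS
      rw [if_pos hS]
      split_ifs with h4 h5
      · rfl
      · rw [hS]; simp [wetWeight]
      · exfalso; omega
    · have hlt : 0 < walk X (i + 1) ω + d := by
        have := lt_of_le_of_ne hge (Ne.symm hS); linarith
      rw [if_neg hS]
      split_ifs with h4 h5
      · exfalso
        rcases h4 with h4 | h4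
        · rw [h4] at hS; exact hS hSl
        · rw [h4] at hS; exact hS hSr
      · simp [wetWeight, hlt]
      · simp [posWeight, hlt]
  · have h0 : (contactEvent X a N l r).indicator
        (fun ω => ENNReal.ofReal (weight X lam a N ω)) ω = 0 := by
      by_cases h1 : ω ∈ contactEvent X a N l r
      · rw [Set.indicator_of_mem h1, weight, Set.indicator_of_notMem fun h2 => hω ⟨h1, h2⟩,
          ENNReal.ofReal_zero]
      · exact Set.indicator_of_notMem h1 _
    rw [h0]
    symm
    by_contra hne
    obtain ⟨hprod, hend⟩ := mul_ne_zero_iff.1 hne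
    have hfac : ∀ n, 1 ≤ n → n ≤ N → contactWeight (ENNReal.ofReal lam) d l r (n - 1)
        (walk X n ω) ≠ 0 := fun n h1 hn => by
      have := Finset.prod_ne_zero_iff.1 hprod (n - 1) (Finset.mem_range.2 (by omega))
      rwa [show n - 1 + 1 = n by omega] at this
    have hN0 : walk X N ω = 0 := by
      by_contra h; exact hend (by simp [h])
    have hlast : ∀ n, 1 ≤ n → n ≤ N → n = l ∨ n = r → walk X n ω = -d := fun n h1 hn hnl => by
      have := hfac n h1 hn
      rw [contactWeight, show n - 1 + 1 = n by omega, if_pos hnl] at this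
      by_contra h
      exact this (if_neg h)
    have hmid : ∀ n, 1 ≤ n → n ≤ N → -d ≤ walk X n ω := fun n h1 hn => by
      by_cases h2 : n = l ∨ n = r
      · exact (hlast n h1 hn h2).ge
      · have := hfac n h1 hn
        rw [contactWeight, show n - 1 + 1 = n by omega, if_neg h2] at this
        by_contra! h
        refine this ?_
        have h3 : ¬ 0 < walk X n ω + d := by linarith
        have h4 : walk X n ω + d ≠ 0 := by linarith
        split_ifs <;> simp [wetWeight, posWeight, h3, h4]
    have hout : ∀ n, 1 ≤ n → n ≤ N → ¬ (l ≤ n ∧ n ≤ r) → -d < walk X n ω := fun n h1 hn h2 => by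
      have := hfac n h1 hn
      rw [contactWeight, show n - 1 + 1 = n by omega, if_neg (by omega), if_neg (by omega)] at this
      by_contra! h
      exact this (if_neg (by linarith))
    refine hω ⟨mem_contactEvent.2 ⟨hlr.trans hrN, hrN, hlast l hl (by omega) (Or.inl rfl),
      hlast r (by omega) hrN (Or.inr rfl), fun n hn hS => ?_⟩,
      fun n hn => hmid n (Finset.mem_Icc.1 hn).1 (Finset.mem_Icc.1 hn).2, hN0⟩
    by_contra h2
    rcases Nat.eq_zero_or_pos n with rfl | hn0
    · rw [walk_zero] at hS
      linarith
    · exact absurd hS (hout n hn0 hn h2).ne'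

lemma pathSum_contactWeight_right (μ : ℤ → ℝ≥0∞) (lam : ℝ≥0∞) (d : ℤ) {l r : ℕ} (hlr : l ≤ r)
    (k : ℕ) : pathSum μ k (fun i => contactWeight lam d l r (r + i)) (Pi.single 0 1) (-d) =
      (step μ posWeight ^ k) (Pi.single d 1) 0 := by
  rw [pathSum_congr _ k (W' := fun _ x => posWeight (x + d)) _ fun i _ => ?_, pathSum_const]
  · have h := step_pow_translate μ posWeight (Pi.single d 1) d k (-d)
    rw [neg_add_cancel] at h
    rw [← h]
    refine congrArg (fun f => (step μ (fun x => posWeight (x + d)) ^ k) f (-d)) (funext fun y => ?_)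
    by_cases hy : y = 0 <;> simp [hy]
  · funext x
    rw [contactWeight, if_neg (by omega), if_neg (by omega)]

/-- The weight at time r only admits -d, so the terminal function enters through its value there.
For m = 0 the first and last contacts coincide and nothing is added. -/
lemma pathSum_contactWeight_mid (μ : ℤ → ℝ≥0∞) (lam : ℝ≥0∞) (d : ℤ) (l m : ℕ) (g : ℤ → ℝ≥0∞) :
    pathSum μ m (fun i => contactWeight lam d l (l + m) (l + i)) g (-d) =
      g (-d) * (step μ (wetWeight lam) ^ m) (Pi.single 0 1) 0 := by
  rcases m with _ | m
  · simp [pathSum]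
  have h1 : pathSum μ (m + 1) (fun i => contactWeight lam d l (l + (m + 1)) (l + i)) g =
      (step μ (fun x => wetWeight lam (x + d)) ^ (m + 1)) (g (-d) • Pi.single (-d) 1) := by
    rw [pathSum_add, pathSum_congr _ m (W' := fun _ x => wetWeight lam (x + d)) _ fun i hi => ?_,
      pathSum_const, pow_succ, Module.End.mul_apply]
    · congr 1
      simp only [pathSum]
      refine step_congr fun x => ?_
      rw [contactWeight, if_pos (Or.inr (by omega))]
      by_cases hx : x = -d
      · simp [hx, wetWeight]
      · simp [hx]
    · funext x
      rw [contactWeight, if_neg (by omega), if_pos (by omega)]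
  have h := step_pow_translate μ (wetWeight lam) (Pi.single 0 1) d (m + 1) (-d)
  rw [neg_add_cancel] at h
  rw [h1, map_smul, Pi.smul_apply, smul_eq_mul, ← h]
  congr 1
  refine congrArg (fun f => (step μ (fun x => wetWeight lam (x + d)) ^ (m + 1)) f (-d))
    (funext fun y => ?_)
  by_cases hy : y = -d
  · simp [hy]
  · rw [Pi.single_eq_of_ne hy, Pi.single_eq_of_ne (by omega)]

/-- The weight of the paths with given first and last contact. -/
theorem lintegral_weight_contactEvent [IsProbabilityMeasure P] (hX : IIDSteps X P) {lam : ℝ}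
    (hlam : 0 < lam) {a : ℝ} {N l r : ℕ} (hd0 : 0 < depth a N) (hl : 0 < l) (hlr : l ≤ r)
    (hrN : r ≤ N) :
    ∫⁻ ω, (contactEvent X a N l r).indicator (fun ω => ENNReal.ofReal (weight X lam a N ω)) ω ∂P =
      ENNReal.ofReal (lam * posProb (negStep X) P l (depth a N) * wettingZ X P lam (r - l) *
        posProb X P (N - r) (depth a N)) := by
  set d := depth a N with hd
  simp_rw [ofReal_weight_indicator hlam hd0 hl hlr hrN]
  rw [hX.lintegral_prod_walk N (contactWeight (ENNReal.ofReal lam) d l r) (Pi.single 0 1) 0]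
  -- The path is cut at times l - 1, l and r. The contact at l gives the explicit factor `lam`; the
  -- contact at r, when different, is counted in the wetting partition function.
  obtain ⟨n, rfl⟩ : ∃ n, l = n + 1 := ⟨l - 1, by omega⟩
  obtain ⟨m, rfl⟩ : ∃ m, r = n + 1 + m := ⟨r - (n + 1), by omega⟩
  obtain ⟨k, rfl⟩ : ∃ k, N = n + 1 + m + k := ⟨N - (n + 1 + m), by omega⟩
  rw [Nat.add_sub_cancel_left, Nat.add_sub_cancel_left, pathSum_add, pathSum_add, pathSum_add]
  set g₃ := pathSum (stepLaw X P) k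
    (fun i => contactWeight (ENNReal.ofReal lam) d (n + 1) (n + 1 + m) (n + 1 + m + i))
    (Pi.single 0 1) with hg₃
  set g₂ := pathSum (stepLaw X P) m
    (fun i => contactWeight (ENNReal.ofReal lam) d (n + 1) (n + 1 + m) (n + 1 + i)) g₃ with hg₂
  have h3 : g₃ (-d) = ENNReal.ofReal (posProb X P k d) := by
    rw [hg₃, pathSum_contactWeight_right _ _ _ (by omega), posProb, measureReal_def,
      ENNReal.ofReal_toReal (measure_ne_top _ _), hX.measure_pos_walk_eq_step]
  have h2 : g₂ (-d) = g₃ (-d) * ENNReal.ofReal (wettingZ X P lam m) := by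
    rw [hg₂, pathSum_contactWeight_mid, wettingZ,
      ENNReal.ofReal_toReal (step_wetWeight_pow_ne_top hX _ _)]
  have h1 : pathSum (stepLaw X P) 1
      (fun i => contactWeight (ENNReal.ofReal lam) d (n + 1) (n + 1 + m) (n + i)) g₂ =
      (ENNReal.ofReal lam * g₂ (-d)) • step (stepLaw X P) 1 (Pi.single (-d) 1) := by
    simp only [pathSum]
    rw [← step_single _ (fun _ => ENNReal.ofReal lam)]
    refine step_congr fun x => ?_
    rw [contactWeight, if_pos (Or.inl (by omega))]
  rw [h1, pathSum_congr _ n (W' := fun _ x => posWeight (x + d)) _ fun i hi => ?_, pathSum_const,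
    map_smul, Pi.smul_apply, hitting_eq_posProb hX n hd0, h2, h3, smul_eq_mul]
  · have hp : ∀ Y : ℕ → Ω → ℤ, ∀ n, 0 ≤ posProb Y P n d := fun _ _ => measureReal_nonneg
    have hw := wettingZ_nonneg (X := X) (P := P) lam m
    rw [ENNReal.ofReal_mul (mul_nonneg (mul_nonneg hlam.le (hp _ _)) hw),
      ENNReal.ofReal_mul (mul_nonneg hlam.le (hp _ _)), ENNReal.ofReal_mul hlam.le]
    ring
  · funext x
    rw [contactWeight, if_neg (by omega), if_neg (by omega)]

end

section

variable {Ω : Type*} [MeasurableSpace Ω] {X : ℕ → Ω → ℤ} {P : Measure Ω}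

/-! ### Functionals of the first and the last contact -/

/-- A function of the path up to time `N` is measurable. -/
lemma IIDSteps.measurable_of_walk_eq (hX : IIDSteps X P) {β : Type*} [MeasurableSpace β]
    {f : Ω → β} (N : ℕ)
    (h : ∀ ω ω', (∀ n ≤ N, walk X n ω = walk X n ω') → f ω = f ω') : Measurable f := by
  classical
  rcases isEmpty_or_nonempty Ω with hΩ | ⟨⟨ω₀⟩⟩
  · exact measurable_of_empty f
  let T : Ω → (Fin (N + 1) → ℤ) := fun ω i => walk X i ω
  have hT : Measurable T := measurable_pi_lambda _ fun i => hX.measurable_walk i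
  let g : (Fin (N + 1) → ℤ) → β := fun p => if hp : ∃ ω, T ω = p then f hp.choose else f ω₀
  have hg : f = g ∘ T := by
    funext ω
    have hp : ∃ ω', T ω' = T ω := ⟨ω, rfl⟩
    simp only [g, Function.comp, dif_pos hp]
    exact h _ _ fun n hn => (congrFun hp.choose_spec ⟨n, Nat.lt_succ_of_le hn⟩).symm
  rw [hg]
  exact (measurable_of_countable g).comp hT

/-- The event that there is no contact. -/
def noContactEvent {Ω : Type*} (X : ℕ → Ω → ℤ) (a : ℝ) (N : ℕ) : Set Ω := {ω | leftContact X a N ω = ⊤}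

section Congr

variable {Ω : Type*} {X : ℕ → Ω → ℤ} {a : ℝ} {N : ℕ} {ω ω' : Ω}

lemma contactTimes_congr (h : ∀ n ≤ N, walk X n ω = walk X n ω') :
    contactTimes X a N ω = contactTimes X a N ω' := by
  ext n
  rw [mem_contactTimes, mem_contactTimes]
  exact and_congr_right fun hn => by rw [h n hn]

lemma leftContact_congr (h : ∀ n ≤ N, walk X n ω = walk X n ω') :
    leftContact X a N ω = leftContact X a N ω' := by
  rw [leftContact, leftContact]; simp only [contactTimes_congr h]

lemma rightContact_congr (h : ∀ n ≤ N, walk X n ω = walk X n ω') :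
    rightContact X a N ω = rightContact X a N ω' := by
  rw [rightContact, rightContact]; simp only [contactTimes_congr h]

lemma wellEvent_congr (h : ∀ n ≤ N, walk X n ω = walk X n ω') :
    ω ∈ wellEvent X a N ↔ ω' ∈ wellEvent X a N := by
  rw [wellEvent, Set.mem_ofPred, Set.mem_ofPred, h N le_rfl]
  refine and_congr_left fun _ => forall₂_congr fun n hn => ?_
  rw [h n (Finset.mem_Icc.1 hn).2]

lemma contacts_congr (h : ∀ n ≤ N, walk X n ω = walk X n ω') :
    contacts X a N ω = contacts X a N ω' := by
  rw [contacts, contacts]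
  congr 1
  refine Finset.filter_congr fun n hn => ?_
  rw [h n (Finset.mem_Icc.1 hn).2]

lemma weight_congr {lam : ℝ} (h : ∀ n ≤ N, walk X n ω = walk X n ω') :
    weight X lam a N ω = weight X lam a N ω' := by
  classical
  rw [weight, Set.indicator_apply, Set.indicator_apply, contacts_congr h]
  simp only [wellEvent_congr h]

lemma contacts_le (a : ℝ) (N : ℕ) (ω : Ω) : contacts X a N ω ≤ N := by
  have h := Finset.card_filter_le (Finset.Icc 1 N) fun n => walk X n ω = -depth a N
  rwa [Nat.card_Icc, Nat.add_sub_cancel] at h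

lemma weight_nonneg {lam : ℝ} (hlam : 0 ≤ lam) (a : ℝ) (N : ℕ) (ω : Ω) :
    0 ≤ weight X lam a N ω :=
  Set.indicator_nonneg (fun _ _ => pow_nonneg hlam _) ω

lemma weight_le {lam : ℝ} (hlam : 0 ≤ lam) (a : ℝ) (N : ℕ) (ω : Ω) :
    weight X lam a N ω ≤ max 1 lam ^ N := by
  refine Set.indicator_apply_le' (fun _ => ?_) fun _ => by positivity
  exact (pow_le_pow_left₀ hlam (le_max_right _ _) _).trans
    (pow_le_pow_right₀ (le_max_left _ _) (contacts_le a N ω))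

lemma leftContact_eq_top_iff :
    leftContact X a N ω = ⊤ ↔ contactTimes X a N ω = ∅ := by
  rw [leftContact]
  split_ifs with h
  · simp [h.ne_empty]
  · simpa using h

lemma rightContact_eq_top_iff :
    rightContact X a N ω = ⊤ ↔ contactTimes X a N ω = ∅ := by
  rw [rightContact]
  split_ifs with h
  · simp [h.ne_empty]
  · simpa using h

/-- Expansion of a functional of the first and the last contact. -/
lemma functional_eq_sum {lam : ℝ} (hd0 : 0 < depth a N) (F : ℕ∞ → ℕ∞ → ℝ) (ω : Ω) :
    F (leftContact X a N ω) (rightContact X a N ω) * weight X lam a N ω =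
      F ⊤ ⊤ * (noContactEvent X a N).indicator (weight X lam a N) ω +
        ∑ l ∈ Finset.Icc 1 N, ∑ r ∈ Finset.Icc l N,
          F l r * (contactEvent X a N l r).indicator (weight X lam a N) ω := by
  by_cases hne : (contactTimes X a N ω).Nonempty
  · set l := (contactTimes X a N ω).min' hne with hl
    set r := (contactTimes X a N ω).max' hne with hr
    have hL : leftContact X a N ω = (l : ℕ∞) := by rw [leftContact, dif_pos hne]
    have hR : rightContact X a N ω = (r : ℕ∞) := by rw [rightContact, dif_pos hne]
    have hlm := mem_contactTimes.1 (Finset.min'_mem _ hne)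
    have hrm := mem_contactTimes.1 (Finset.max'_mem _ hne)
    have hlr : l ≤ r := Finset.min'_le_max' _ hne
    have hl1 : 1 ≤ l := by
      by_contra! h
      have h0 : l = 0 := by omega
      have h1 := hlm.2
      rw [← hl, h0, walk_zero] at h1
      omega
    have hω : ∀ l' r', ω ∈ contactEvent X a N l' r' ↔ l' = l ∧ r' = r := fun l' r' => by
      rw [contactEvent, Set.mem_ofPred, hL, hR, Nat.cast_inj, Nat.cast_inj]
      exact and_congr eq_comm eq_comm
    have hlN : l ∈ Finset.Icc 1 N := Finset.mem_Icc.2 ⟨hl1, hlm.1⟩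
    have hrN : r ∈ Finset.Icc l N := Finset.mem_Icc.2 ⟨hlr, hrm.1⟩
    rw [Set.indicator_of_notMem (fun h => by
        have h : leftContact X a N ω = ⊤ := h
        rw [hL] at h; exact absurd h (ENat.natCast_ne_top l)),
      mul_zero, zero_add, Finset.sum_eq_single_of_mem l hlN, Finset.sum_eq_single_of_mem r hrN,
      Set.indicator_of_mem ((hω l r).2 ⟨rfl, rfl⟩), hL, hR]
    · intro r' _ hr'
      rw [Set.indicator_of_notMem fun h => hr' ((hω _ _).1 h).2, mul_zero]
    · intro l' _ hl'
      refine Finset.sum_eq_zero fun r' _ => ?_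
      rw [Set.indicator_of_notMem fun h => hl' ((hω _ _).1 h).1, mul_zero]
  · have hemp := Finset.not_nonempty_iff_eq_empty.1 hne
    have hL := leftContact_eq_top_iff.2 hemp
    have hR := rightContact_eq_top_iff.2 hemp
    rw [Set.indicator_of_mem (show ω ∈ noContactEvent X a N from hL), hL, hR, Finset.sum_eq_zero, add_zero]
    intro l _
    refine Finset.sum_eq_zero fun r _ => ?_
    rw [Set.indicator_of_notMem, mul_zero]
    intro h
    have h1 : leftContact X a N ω = (l : ℕ∞) := h.1
    rw [hL] at h1
    exact absurd h1.symm (ENat.natCast_ne_top l)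

end Congr

lemma measurable_weight (hX : IIDSteps X P) (lam a : ℝ) (N : ℕ) :
    Measurable (weight X lam a N) := hX.measurable_of_walk_eq N fun _ _ h => weight_congr h

lemma measurableSet_contactEvent (hX : IIDSteps X P) (a : ℝ) (N l r : ℕ) :
    MeasurableSet (contactEvent X a N l r) := by
  refine measurableSet_setOfPred.2 (hX.measurable_of_walk_eq N fun _ _ h => ?_)
  rw [leftContact_congr h, rightContact_congr h]

lemma measurableSet_noContact (hX : IIDSteps X P) (a : ℝ) (N : ℕ) :
    MeasurableSet (noContactEvent X a N) := by
  refine measurableSet_setOfPred.2 (hX.measurable_of_walk_eq N fun _ _ h => ?_)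
  rw [leftContact_congr h]

lemma integrable_weight [IsProbabilityMeasure P] (hX : IIDSteps X P) {lam : ℝ} (hlam : 0 ≤ lam)
    (a : ℝ) (N : ℕ) : Integrable (weight X lam a N) P := by
  refine Integrable.of_bound (measurable_weight hX lam a N).aestronglyMeasurable (max 1 lam ^ N)
    (ae_of_all _ fun ω => ?_)
  rw [Real.norm_of_nonneg (weight_nonneg hlam a N ω)]
  exact weight_le hlam a N ω

/-- The contribution of the paths without contact. -/
noncomputable def noContactZ (X : ℕ → Ω → ℤ) (P : Measure Ω) (lam a : ℝ) (N : ℕ) : ℝ :=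
  ∫ ω, (noContactEvent X a N).indicator (weight X lam a N) ω ∂P

/-- The contribution of the paths with first contact `l` and last contact `r`. -/
noncomputable def contactZ (X : ℕ → Ω → ℤ) (P : Measure Ω) (lam a : ℝ) (N l r : ℕ) : ℝ :=
  lam * posProb (negStep X) P l (depth a N) * wettingZ X P lam (r - l) *
    posProb X P (N - r) (depth a N)

lemma contactZ_nonneg {lam : ℝ} (hlam : 0 ≤ lam) (a : ℝ) (N l r : ℕ) :
    0 ≤ contactZ X P lam a N l r :=
  mul_nonneg (mul_nonneg (mul_nonneg hlam measureReal_nonneg) (wettingZ_nonneg _ _))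
    measureReal_nonneg

lemma integral_weight_contactEvent [IsProbabilityMeasure P] (hX : IIDSteps X P) {lam : ℝ}
    (hlam : 0 < lam) {a : ℝ} {N l r : ℕ} (hd0 : 0 < depth a N) (hl : 0 < l) (hlr : l ≤ r)
    (hrN : r ≤ N) :
    ∫ ω, (contactEvent X a N l r).indicator (weight X lam a N) ω ∂P =
      contactZ X P lam a N l r := by
  have h := lintegral_weight_contactEvent hX hlam hd0 hl hlr hrN
  rw [integral_eq_lintegral_of_nonneg_ae
    (ae_of_all _ fun ω => Set.indicator_nonneg (fun ω _ => weight_nonneg hlam.le a N ω) ω)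
    ((measurable_weight hX lam a N).indicator
      (measurableSet_contactEvent hX a N l r)).aestronglyMeasurable]
  have e : ∀ ω, ENNReal.ofReal ((contactEvent X a N l r).indicator (weight X lam a N) ω) =
      (contactEvent X a N l r).indicator (fun ω => ENNReal.ofReal (weight X lam a N ω)) ω := by
    intro ω
    by_cases hω : ω ∈ contactEvent X a N l r
    · rw [Set.indicator_of_mem hω, Set.indicator_of_mem hω]
    · rw [Set.indicator_of_notMem hω, Set.indicator_of_notMem hω, ENNReal.ofReal_zero]
  simp_rw [e, h]
  exact ENNReal.toReal_ofReal (contactZ_nonneg hlam.le a N l r)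

theorem integral_functional_mul_weight [IsProbabilityMeasure P] (hX : IIDSteps X P) {lam : ℝ}
    (hlam : 0 < lam) {a : ℝ} {N : ℕ} (hd0 : 0 < depth a N) (F : ℕ∞ → ℕ∞ → ℝ) :
    ∫ ω, F (leftContact X a N ω) (rightContact X a N ω) * weight X lam a N ω ∂P =
      F ⊤ ⊤ * noContactZ X P lam a N + ∑ l ∈ Finset.Icc 1 N, ∑ r ∈ Finset.Icc l N,
        F l r * contactZ X P lam a N l r := by
  simp_rw [functional_eq_sum hd0]
  have hw := integrable_weight hX hlam.le a N
  have h1 : ∀ l r : ℕ, Integrable (fun ω =>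
      F l r * (contactEvent X a N l r).indicator (weight X lam a N) ω) P := fun l r =>
    (hw.indicator (measurableSet_contactEvent hX a N l r)).const_mul _
  rw [integral_add ((hw.indicator (measurableSet_noContact hX a N)).const_mul _)
    (integrable_finsetSum _ fun l _ => integrable_finsetSum _ fun r _ => h1 l r),
    integral_const_mul, integral_finsetSum _ fun l _ => integrable_finsetSum _ fun r _ => h1 l r]
  congr 1
  refine Finset.sum_congr rfl fun l hl => ?_
  rw [integral_finsetSum _ fun r _ => h1 l r]
  refine Finset.sum_congr rfl fun r hr => ?_
  rw [integral_const_mul, integral_weight_contactEvent hX hlam hd0 (Finset.mem_Icc.1 hl).1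
    (Finset.mem_Icc.1 hr).1 (Finset.mem_Icc.1 hr).2]

lemma partitionFn_eq [IsProbabilityMeasure P] (hX : IIDSteps X P) {lam : ℝ}
    (hlam : 0 < lam) {a : ℝ} {N : ℕ} (hd0 : 0 < depth a N) :
    partitionFn X P lam a N = noContactZ X P lam a N +
      ∑ l ∈ Finset.Icc 1 N, ∑ r ∈ Finset.Icc l N, contactZ X P lam a N l r := by
  have := integral_functional_mul_weight hX hlam hd0 fun _ _ => 1
  simpa [partitionFn] using this

lemma noContactZ_nonneg {lam : ℝ} (hlam : 0 ≤ lam) (a : ℝ) (N : ℕ) :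
    0 ≤ noContactZ X P lam a N :=
  integral_nonneg fun ω => Set.indicator_nonneg (fun ω _ => weight_nonneg hlam a N ω) ω

lemma weight_eq_of_noContact {Ω : Type*} {X : ℕ → Ω → ℤ} {lam a : ℝ} {N : ℕ} {ω : Ω}
    (h : leftContact X a N ω = ⊤) (hω : ω ∈ wellEvent X a N) : weight X lam a N ω = 1 := by
  rw [weight, Set.indicator_of_mem hω, contacts, Finset.card_eq_zero.2, pow_zero]
  rw [Finset.filter_eq_empty_iff]
  intro n hn hS
  have h1 : n ∈ contactTimes X a N ω := mem_contactTimes.2 ⟨(Finset.mem_Icc.1 hn).2, hS⟩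
  rw [leftContact_eq_top_iff.1 h] at h1
  simp at h1

/-- Without contact the weight of a path in the well is 1, so only the constraint of ending at zero
matters. -/
lemma noContactZ_le [IsProbabilityMeasure P] (hX : IIDSteps X P) {lam : ℝ} (hlam : 0 ≤ lam)
    (a : ℝ) (N : ℕ) : noContactZ X P lam a N ≤ P.real {ω | walk X N ω = 0} := by
  have hm : MeasurableSet {ω | walk X N ω = 0} := hX.measurable_walk N (measurableSet_singleton 0)
  rw [← integral_indicator_one hm]
  refine integral_mono ((integrable_weight hX hlam a N).indicator (measurableSet_noContact hX a N))
    ((integrable_const 1).indicator hm) fun ω => ?_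
  by_cases h1 : leftContact X a N ω = ⊤
  · rw [Set.indicator_of_mem (show ω ∈ noContactEvent X a N from h1)]
    by_cases h2 : ω ∈ wellEvent X a N
    · rw [weight_eq_of_noContact h1 h2, Set.indicator_of_mem (show ω ∈ {ω | walk X N ω = 0} from h2.2)]
      rfl
    · rw [weight, Set.indicator_of_notMem h2]
      exact Set.indicator_nonneg (fun _ _ => zero_le_one) _
  · rw [Set.indicator_of_notMem (show ω ∉ noContactEvent X a N from h1)]
    exact Set.indicator_nonneg (fun _ _ => zero_le_one) _

/-- Expectations under the Gibbs measure. -/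
lemma integral_gibbs (hX : IIDSteps X P) {lam : ℝ} (hlam : 0 ≤ lam) {a : ℝ} {N : ℕ}
    (F : Ω → ℝ) :
    ∫ ω, F ω ∂(gibbs X P lam a N) =
      (∫ ω, F ω * weight X lam a N ω ∂P) / partitionFn X P lam a N := by
  have hZ : 0 ≤ partitionFn X P lam a N := integral_nonneg fun ω => weight_nonneg hlam a N ω
  rw [gibbs, integral_withDensity_eq_integral_toReal_smul
    ((measurable_weight hX lam a N).div_const _).ennreal_ofReal
    (ae_of_all _ fun ω => ENNReal.ofReal_lt_top), ← integral_div]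
  refine integral_congr_ae (ae_of_all _ fun ω => ?_)
  simp only [smul_eq_mul]
  rw [ENNReal.toReal_ofReal (div_nonneg (weight_nonneg hlam a N ω) hZ)]
  ring

lemma gibbs_contactEvent [IsProbabilityMeasure P] (hX : IIDSteps X P) {lam : ℝ}
    (hlam : 0 < lam) {a : ℝ} {N l r : ℕ} (hd0 : 0 < depth a N) (hl : 0 < l) (hlr : l ≤ r)
    (hrN : r ≤ N) : (gibbs X P lam a N).real (contactEvent X a N l r) =
      contactZ X P lam a N l r / partitionFn X P lam a N := by
  have hm := measurableSet_contactEvent hX a N l r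
  rw [← integral_indicator_one hm, integral_gibbs hX hlam.le,
    ← integral_weight_contactEvent hX hlam hd0 hl hlr hrN]
  congr 2
  funext ω
  by_cases h : ω ∈ contactEvent X a N l r
  · simp [h]
  · simp [h]

end

section

/-! ### Riemann sums over the diffusive scale -/

/-- The lattice site at distance `s x √N` from `b N`. -/
noncomputable def site (b s : ℝ) (N : ℕ) (x : ℝ) : ℕ := ⌊b * N + s * x * √N⌋₊

lemma measurable_site (b s : ℝ) (N : ℕ) : Measurable (site b s N) :=
  Nat.measurable_floor.comp (by fun_prop)

/-- The site is constant on intervals of length 1/√N. Site 0 is excluded because the natural floor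
sends all negative arguments to it. -/
lemma volume_site_eq (b : ℝ) {s : ℝ} (hs : s = 1 ∨ s = -1) {N l : ℕ} (hN : 0 < N) (hl : 0 < l) :
    volume {x | site b s N x = l} = ENNReal.ofReal (1 / √N) := by
  have hsN : 0 < √(N : ℝ) := Real.sqrt_pos.2 (by exact_mod_cast hN)
  have h1 : volume {x | site b 1 N x = l} = ENNReal.ofReal (1 / √N) := by
    have : {x | site b 1 N x = l} = Set.Ico ((l - b * N) / √N) ((l + 1 - b * N) / √N) := by
      ext x
      rw [Set.mem_ofPred, site, Nat.floor_eq_iff' hl.ne', Set.mem_Ico, div_le_iff₀ hsN,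
        lt_div_iff₀ hsN, one_mul]
      constructor <;> rintro ⟨h1, h2⟩ <;> constructor <;> linarith
    rw [this, Real.volume_Ico]
    congr 1
    ring
  rcases hs with rfl | rfl
  · exact h1
  · have : {x | site b (-1) N x = l} = Neg.neg ⁻¹' {x | site b 1 N x = l} := by
      ext x
      simp [site]
    rw [this, Measure.measure_preimage_neg, h1]

/-- Each pair of positive sites is a cell of area 1/N, so the sum is the integral of N times the
step function. -/
lemma sum_eq_integral_site {u w s s' : ℝ} (hs : s = 1 ∨ s = -1) (hs' : s' = 1 ∨ s' = -1) {N : ℕ}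
    (hN : 0 < N) (g : ℕ → ℕ → ℝ)
    (hg : ∀ l k, ¬ (l ∈ Finset.Icc 1 N ∧ k ∈ Finset.Icc 1 N) → g l k = 0) :
    ∑ l ∈ Finset.Icc 1 N, ∑ k ∈ Finset.Icc 1 N, g l k =
      ∫ z : ℝ × ℝ, N * g (site u s N z.1) (site w s' N z.2) := by
  have hN0 : (0 : ℝ) < N := by exact_mod_cast hN
  set A : ℕ → Set ℝ := fun l => {x | site u s N x = l} with hA
  set B : ℕ → Set ℝ := fun k => {x | site w s' N x = k} with hB
  have hAm : ∀ l, MeasurableSet (A l) := fun l => measurable_site u s N (measurableSet_singleton l)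
  have hBm : ∀ k, MeasurableSet (B k) := fun k =>
    measurable_site w s' N (measurableSet_singleton k)
  have hpt : ∀ z : ℝ × ℝ, N * g (site u s N z.1) (site w s' N z.2) =
      ∑ l ∈ Finset.Icc 1 N, ∑ k ∈ Finset.Icc 1 N,
        (A l ×ˢ B k).indicator (fun _ => N * g l k) z := by
    intro z
    have hmem : ∀ l k, z ∈ A l ×ˢ B k ↔ site u s N z.1 = l ∧ site w s' N z.2 = k := fun l k => Iff.rfl
    by_cases h : site u s N z.1 ∈ Finset.Icc 1 N ∧ site w s' N z.2 ∈ Finset.Icc 1 N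
    · rw [Finset.sum_eq_single_of_mem _ h.1, Finset.sum_eq_single_of_mem _ h.2,
        Set.indicator_of_mem ((hmem _ _).2 ⟨rfl, rfl⟩)]
      · intro k _ hk
        exact Set.indicator_of_notMem (fun h' => hk ((hmem _ _).1 h').2.symm) _
      · intro l _ hl
        exact Finset.sum_eq_zero fun k _ =>
          Set.indicator_of_notMem (fun h' => hl ((hmem _ _).1 h').1.symm) _
    · rw [hg _ _ h, mul_zero]
      symm
      refine Finset.sum_eq_zero fun l hl => Finset.sum_eq_zero fun k hk =>
        Set.indicator_of_notMem (fun h' => h ?_) _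
      obtain ⟨h1, h2⟩ := (hmem _ _).1 h'
      exact ⟨h1 ▸ hl, h2 ▸ hk⟩
  have hvol : ∀ l ∈ Finset.Icc 1 N, ∀ k ∈ Finset.Icc 1 N,
      (volume : Measure (ℝ × ℝ)) (A l ×ˢ B k) = ENNReal.ofReal (1 / N) := by
    intro l hl k hk
    rw [Measure.volume_eq_prod, Measure.prod_prod, volume_site_eq u hs hN (Finset.mem_Icc.1 hl).1,
      volume_site_eq w hs' hN (Finset.mem_Icc.1 hk).1, ← ENNReal.ofReal_mul (by positivity)]
    congr 1
    rw [div_mul_div_comm, Real.mul_self_sqrt hN0.le, one_mul]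
  have hint : ∀ l ∈ Finset.Icc 1 N, ∀ k ∈ Finset.Icc 1 N,
      Integrable ((A l ×ˢ B k).indicator fun _ : ℝ × ℝ => N * g l k) := by
    intro l hl k hk
    rw [integrable_indicator_iff ((hAm l).prod (hBm k))]
    refine integrableOn_const ?_
    rw [hvol l hl k hk]
    exact ENNReal.ofReal_ne_top
  simp_rw [hpt]
  rw [integral_finsetSum _ fun l hl => integrable_finsetSum _ fun k hk => hint l hl k hk]
  refine Finset.sum_congr rfl fun l hl => ?_
  rw [integral_finsetSum _ fun k hk => hint l hl k hk]
  refine Finset.sum_congr rfl fun k hk => ?_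
  rw [integral_indicator_const _ ((hAm l).prod (hBm k)), measureReal_def, hvol l hl k hk,
    ENNReal.toReal_ofReal (by positivity), smul_eq_mul]
  field_simp

lemma integrable_exp_neg_mul_abs {c : ℝ} (hc : 0 < c) :
    Integrable fun x : ℝ => Real.exp (-(c * |x|)) := by
  set k := min 1 (c ^ 2 / 2) with hk
  have hk0 : 0 < k := by positivity
  refine (integrable_inv_one_add_sq.const_mul k⁻¹).mono' (by fun_prop) (ae_of_all _ fun x => ?_)
  rw [Real.norm_of_nonneg (Real.exp_pos _).le, Real.exp_neg, ← mul_inv]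
  have h1 := Real.quadratic_le_exp_of_nonneg (mul_nonneg hc.le (abs_nonneg x))
  have h2 : (c * |x|) ^ 2 / 2 = c ^ 2 / 2 * x ^ 2 := by rw [mul_pow, sq_abs]; ring
  have h3 : k * (1 + x ^ 2) ≤ Real.exp (c * |x|) := by
    have h4 : k * 1 ≤ 1 * 1 := by gcongr; exact min_le_left _ _
    have h5 : k * x ^ 2 ≤ c ^ 2 / 2 * x ^ 2 := by gcongr; exact min_le_right _ _
    have h6 : 0 ≤ c * |x| := by positivity
    linarith
  exact inv_anti₀ (by positivity) h3

lemma tendsto_sqrt_natCast : Tendsto (fun N : ℕ => √(N : ℝ)) atTop atTop :=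
  Real.tendsto_sqrt_atTop.comp tendsto_natCast_atTop_atTop

lemma eventually_site_arg_nonneg {b : ℝ} (hb : 0 < b) (s x : ℝ) :
    ∀ᶠ N : ℕ in atTop, 0 ≤ b * N + s * x * √(N : ℝ) := by
  have h := (tendsto_sqrt_natCast.const_mul_atTop hb).eventually_ge_atTop (-(s * x))
  filter_upwards [h] with N hN
  have h1 : b * N + s * x * √(N : ℝ) = √(N : ℝ) * (b * √N + s * x) := by
    nth_rewrite 1 [← Real.mul_self_sqrt N.cast_nonneg]
    ring
  rw [h1]
  exact mul_nonneg (Real.sqrt_nonneg _) (by linarith)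

lemma abs_site_sub_le {b s x : ℝ} {N : ℕ} (h : 0 ≤ b * N + s * x * √(N : ℝ)) :
    |(site b s N x : ℝ) - b * N - s * x * √N| ≤ 1 := by
  have h1 := Nat.floor_le h
  have h2 := Nat.lt_floor_add_one (b * N + s * x * √(N : ℝ))
  rw [abs_le, site]
  constructor <;> linarith

lemma tendsto_site_diff {b : ℝ} (hb : 0 < b) (s x : ℝ) :
    Tendsto (fun N : ℕ => ((site b s N x : ℝ) - b * N) / √N) atTop (𝓝 (s * x)) := by
  have h0 : Tendsto (fun N : ℕ => 1 / √(N : ℝ)) atTop (𝓝 0) :=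
    tendsto_sqrt_natCast.const_div_atTop 1
  rw [tendsto_iff_norm_sub_tendsto_zero]
  refine squeeze_zero' (Eventually.of_forall fun _ => norm_nonneg _) ?_ h0
  filter_upwards [eventually_site_arg_nonneg hb s x, eventually_gt_atTop 0] with N hN hN0
  have hsN : 0 < √(N : ℝ) := Real.sqrt_pos.2 (by exact_mod_cast hN0)
  have e : ((site b s N x : ℝ) - b * N) / √N - s * x =
      ((site b s N x : ℝ) - b * N - s * x * √N) / √N := by field_simp
  rw [e, norm_div, Real.norm_of_nonneg hsN.le]
  gcongr
  exact abs_site_sub_le hN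

lemma tendsto_site_div {b : ℝ} (hb : 0 < b) (s x : ℝ) :
    Tendsto (fun N : ℕ => (site b s N x : ℝ) / N) atTop (𝓝 b) := by
  have h := ((tendsto_site_diff hb s x).div_atTop tendsto_sqrt_natCast).const_add b
  rw [add_zero] at h
  refine h.congr' ?_
  filter_upwards [eventually_gt_atTop 0] with N hN
  have hN0 : (0 : ℝ) < N := by exact_mod_cast hN
  rw [div_div, Real.mul_self_sqrt hN0.le]
  field_simp
  ring

/-- Sequences of weights on the integers that concentrate around `u N` on the scale `√N`, with a
Gaussian profile. -/
structure GaussianProfile (A : ℕ → ℕ → ℝ) (u κ S : ℝ) : Prop where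
  u_pos : 0 < u
  κ_pos : 0 < κ
  S_pos : 0 < S
  nonneg : ∀ N l, 0 ≤ A N l
  zero : ∀ᶠ N in atTop, A N 0 = 0
  bound : ∃ C c : ℝ, 0 < C ∧ 0 < c ∧ ∀ᶠ N : ℕ in atTop, ∀ l : ℕ, 0 < l →
    √N * A N l ≤ C * Real.exp (-(c * (|(l : ℝ) - u * N| / √N)))
  tendsto : ∀ s x : ℝ, (s = 1 ∨ s = -1) → Tendsto (fun N : ℕ => √N * A N (site u s N x)) atTop
    (𝓝 (κ * Real.exp (-(x ^ 2 / (2 * S)))))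

/-- Transfers the tail bound from the lattice to the rescaled variable; rounding moves x by at most
1/√N ≤ 1, which costs the factor e^c. -/
lemma GaussianProfile.exists_bound {A : ℕ → ℕ → ℝ} {u κ S : ℝ} (hA : GaussianProfile A u κ S)
    {s : ℝ} (hs : s = 1 ∨ s = -1) :
    ∃ C c : ℝ, 0 < C ∧ 0 < c ∧ ∀ᶠ N : ℕ in atTop, ∀ x : ℝ,
      √N * A N (site u s N x) ≤ C * Real.exp (-(c * |x|)) := by
  obtain ⟨C, c, hC, hc, hb⟩ := hA.bound
  refine ⟨C * Real.exp c, c, by positivity, hc, ?_⟩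
  filter_upwards [hb, hA.zero, eventually_ge_atTop 1] with N hN h0 hN1 x
  have hsN : 1 ≤ √(N : ℝ) := Real.one_le_sqrt.2 (by exact_mod_cast hN1)
  rcases Nat.eq_zero_or_pos (site u s N x) with h | h
  · rw [h, h0, mul_zero]; positivity
  · refine (hN _ h).trans ?_
    rw [mul_assoc, ← Real.exp_add]
    refine mul_le_mul_of_nonneg_left (Real.exp_le_exp.2 ?_) hC.le
    have h1 : 0 ≤ u * N + s * x * √(N : ℝ) := by
      by_contra! hneg
      rw [site, Nat.floor_of_nonpos hneg.le] at h
      exact lt_irrefl _ h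
    have h2 := abs_site_sub_le h1
    have h3 : |x| * √N ≤ |(site u s N x : ℝ) - u * N| + 1 := by
      have e : |s * x * √N| = |x| * √N := by
        rw [abs_mul, abs_mul, abs_of_nonneg (Real.sqrt_nonneg _)]
        rcases hs with rfl | rfl <;> simp
      have := abs_sub_abs_le_abs_sub (s * x * √N) ((site u s N x : ℝ) - u * N)
      rw [e, abs_sub_comm (s * x * √(N : ℝ))] at this
      linarith
    have h4 : |x| ≤ |(site u s N x : ℝ) - u * N| / √N + 1 := by
      rw [← sub_le_iff_le_add, le_div_iff₀ (by linarith)]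
      linarith
    nlinarith

/-- Sums against the product of two Gaussian profiles converge to Gaussian integrals. -/
theorem GaussianProfile.tendsto_sum {A B : ℕ → ℕ → ℝ} {u w κ κ' S S' : ℝ}
    (hA : GaussianProfile A u κ S) (hB : GaussianProfile B w κ' S') (huw : u + w < 1)
    {ζ : ℕ → ℝ} {C₀ : ℝ} (hζ : Tendsto ζ atTop (𝓝 C₀)) {F : ℕ → ℕ → ℕ → ℝ} {K : ℝ}
    (hF : ∀ N l k, |F N l k| ≤ K) {f : ℝ × ℝ → ℝ}
    (hFf : ∀ x x' : ℝ, Tendsto (fun N => F N (site u 1 N x) (site w (-1) N x')) atTop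
      (𝓝 (f (x, x')))) :
    Tendsto (fun N : ℕ => ∑ l ∈ Finset.Icc 1 N, ∑ k ∈ Finset.Icc 1 N,
      if l + k ≤ N then F N l k * (A N l * ζ (N - l - k) * B N k) else 0) atTop
      (𝓝 (C₀ * κ * κ' * ∫ z : ℝ × ℝ, f z *
        (Real.exp (-(z.1 ^ 2 / (2 * S))) * Real.exp (-(z.2 ^ 2 / (2 * S')))))) := by
  obtain ⟨C, c, hC, hc, hbA⟩ := hA.exists_bound (s := 1) (Or.inl rfl)
  obtain ⟨C', c', hC', hc', hbB⟩ := hB.exists_bound (s := -1) (Or.inr rfl)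
  obtain ⟨Z, hZ⟩ := hζ.abs.bddAbove_range
  have hZb : ∀ n, |ζ n| ≤ Z := fun n => hZ ⟨n, rfl⟩
  have hZ0 : 0 ≤ Z := (abs_nonneg _).trans (hZb 0)
  have hK0 : 0 ≤ K := (abs_nonneg _).trans (hF 0 0 0)
  set g : ℕ → ℕ → ℕ → ℝ := fun N l k =>
    if l + k ≤ N then F N l k * (A N l * ζ (N - l - k) * B N k) else 0 with hg
  have hsum : ∀ᶠ N in atTop, ∫ z : ℝ × ℝ, N * g N (site u 1 N z.1) (site w (-1) N z.2) =
      ∑ l ∈ Finset.Icc 1 N, ∑ k ∈ Finset.Icc 1 N, g N l k := by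
    filter_upwards [hA.zero, hB.zero, eventually_gt_atTop 0] with N h1 h2 hN
    rw [sum_eq_integral_site (Or.inl rfl) (Or.inr rfl) hN]
    intro l k hlk
    simp only [hg]
    split_ifs with h
    · have h3 : l = 0 ∨ k = 0 := by
        by_contra! h'
        exact hlk ⟨Finset.mem_Icc.2 ⟨by omega, by omega⟩, Finset.mem_Icc.2 ⟨by omega, by omega⟩⟩
      rcases h3 with rfl | rfl
      · rw [h1]; ring
      · rw [h2]; ring
    · rfl
  have hlim : C₀ * κ * κ' * ∫ z : ℝ × ℝ, f z *
        (Real.exp (-(z.1 ^ 2 / (2 * S))) * Real.exp (-(z.2 ^ 2 / (2 * S')))) =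
      ∫ z : ℝ × ℝ, f z * ((κ * Real.exp (-(z.1 ^ 2 / (2 * S)))) * C₀ *
        (κ' * Real.exp (-(z.2 ^ 2 / (2 * S'))))) := by
    rw [← integral_const_mul]
    congr 1
    funext z
    ring
  rw [hlim]
  refine Tendsto.congr' hsum (tendsto_integral_filter_of_dominated_convergence
    (fun z => (K * Z * C * C') * (Real.exp (-(c * |z.1|)) * Real.exp (-(c' * |z.2|)))) ?_ ?_ ?_ ?_)
  · refine Eventually.of_forall fun N => Measurable.aestronglyMeasurable ?_
    have hm : Measurable fun z : ℝ × ℝ => (site u 1 N z.1, site w (-1) N z.2) :=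
      ((measurable_site u 1 N).comp measurable_fst).prodMk
        ((measurable_site w (-1) N).comp measurable_snd)
    exact measurable_const.mul
      ((measurable_of_countable fun p : ℕ × ℕ => g N p.1 p.2).comp hm)
  · filter_upwards [hbA, hbB] with N h1 h2
    refine ae_of_all _ fun z => ?_
    have hA0 := hA.nonneg N (site u 1 N z.1)
    have hB0 := hB.nonneg N (site w (-1) N z.2)
    have hbd : ‖N * g N (site u 1 N z.1) (site w (-1) N z.2)‖ ≤
        K * Z * ((√N * A N (site u 1 N z.1)) * (√N * B N (site w (-1) N z.2))) := by
      have hNN : (N : ℝ) = √N * √N := (Real.mul_self_sqrt N.cast_nonneg).symm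
      rw [norm_mul, Real.norm_natCast, Real.norm_eq_abs]
      simp only [hg]
      split_ifs with h
      · rw [abs_mul, abs_mul, abs_mul, abs_of_nonneg hA0, abs_of_nonneg hB0]
        calc (N : ℝ) * (|F N (site u 1 N z.1) (site w (-1) N z.2)| * (A N (site u 1 N z.1) *
              |ζ (N - site u 1 N z.1 - site w (-1) N z.2)| * B N (site w (-1) N z.2)))
            ≤ N * (K * (A N (site u 1 N z.1) * Z * B N (site w (-1) N z.2))) := by
              gcongr
              · exact hF _ _ _
              · exact hZb _
          _ = _ := by
              nth_rewrite 1 [hNN]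
              ring
      · rw [abs_zero, mul_zero]
        have := Real.sqrt_nonneg (N : ℝ)
        positivity
    refine hbd.trans ?_
    have h3 := h1 z.1
    have h4 := h2 z.2
    calc _ ≤ K * Z * ((C * Real.exp (-(c * |z.1|))) * (C' * Real.exp (-(c' * |z.2|)))) := by
          refine mul_le_mul_of_nonneg_left (mul_le_mul h3 h4 ?_ (by positivity)) (by positivity)
          exact mul_nonneg (Real.sqrt_nonneg _) hB0
      _ = _ := by ring
  · exact ((integrable_exp_neg_mul_abs hc).mul_prod (integrable_exp_neg_mul_abs hc')).const_mul _
  · refine ae_of_all _ fun z => ?_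
    have hu := tendsto_site_div hA.u_pos 1 z.1
    have hw := tendsto_site_div hB.u_pos (-1) z.2
    -- As u + w < 1 the middle stretch becomes infinitely long, so its normalized weight tends to
    -- C₀.
    have hgap : Tendsto (fun N : ℕ => (1 - (site u 1 N z.1 : ℝ) / N - (site w (-1) N z.2 : ℝ) / N) * N)
        atTop atTop :=
      (((hu.const_sub 1).sub hw)).pos_mul_atTop (by linarith) tendsto_natCast_atTop_atTop
    have hgap' : Tendsto (fun N : ℕ => N - site u 1 N z.1 - site w (-1) N z.2) atTop atTop := by
      rw [← tendsto_natCast_atTop_iff (R := ℝ)]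
      refine tendsto_atTop_mono' _ ?_ hgap
      filter_upwards [eventually_gt_atTop 0] with N hN
      have hN0 : (N : ℝ) ≠ 0 := by positivity
      rw [sub_mul, sub_mul, one_mul, div_mul_cancel₀ _ hN0, div_mul_cancel₀ _ hN0, Nat.sub_sub,
        sub_sub, ← Nat.cast_add, sub_le_iff_le_add, ← Nat.cast_add]
      exact_mod_cast (by omega)
    have hle : ∀ᶠ N in atTop, site u 1 N z.1 + site w (-1) N z.2 ≤ N := by
      filter_upwards [hgap'.eventually_gt_atTop 0] with N hN
      omega
    have h := (hFf z.1 z.2).mul (((hA.tendsto 1 z.1 (Or.inl rfl)).mul (hζ.comp hgap')).mul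
      (hB.tendsto (-1) z.2 (Or.inr rfl)))
    refine h.congr' ?_
    filter_upwards [hle] with N hN
    simp only [hg, if_pos hN, Function.comp]
    have hNN : (N : ℝ) = √N * √N := (Real.mul_self_sqrt N.cast_nonneg).symm
    calc _ = (√N * √N) * (F N (site u 1 N z.1) (site w (-1) N z.2) * (A N (site u 1 N z.1) *
          ζ (N - site u 1 N z.1 - site w (-1) N z.2) * B N (site w (-1) N z.2))) := by ring
      _ = _ := by rw [← hNN]

/-- Gaussian integrals in the plane. -/
lemma integral_mul_exp_eq_gaussian {σ τ : ℝ} (hσ : 0 < σ) (hτ : 0 < τ) (f : ℝ × ℝ → ℝ) :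
    ∫ z : ℝ × ℝ, f z *
      (Real.exp (-(z.1 ^ 2 / (2 * σ ^ 2))) * Real.exp (-(z.2 ^ 2 / (2 * τ ^ 2)))) =
    2 * Real.pi * σ * τ * ∫ z, f z ∂((gaussianReal 0 (Real.toNNReal (σ ^ 2))).prod
      (gaussianReal 0 (Real.toNNReal (τ ^ 2)))) := by
  have hne : ∀ x : ℝ, 0 < x → Real.toNNReal (x ^ 2) ≠ 0 := fun x hx => by
    rw [Ne, Real.toNNReal_eq_zero, not_le]; positivity
  have hpdf : ∀ ρ : ℝ, 0 < ρ → ∀ x : ℝ, gaussianPDFReal 0 (Real.toNNReal (ρ ^ 2)) x =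
      (√(2 * Real.pi) * ρ)⁻¹ * Real.exp (-(x ^ 2 / (2 * ρ ^ 2))) := by
    intro ρ hρ x
    rw [gaussianPDFReal, Real.coe_toNNReal _ (sq_nonneg ρ), sub_zero, neg_div,
      Real.sqrt_mul (by positivity), Real.sqrt_sq hρ.le]
  rw [gaussianReal_of_var_ne_zero _ (hne σ hσ), gaussianReal_of_var_ne_zero _ (hne τ hτ),
    prod_withDensity (by fun_prop) (by fun_prop), ← Measure.volume_eq_prod,
    integral_withDensity_eq_integral_toReal_smul (by fun_prop)
      (ae_of_all _ fun z => ENNReal.mul_lt_top (by simp [gaussianPDF]) (by simp [gaussianPDF])),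
    ← integral_const_mul]
  congr 1
  funext z
  rw [ENNReal.toReal_mul, toReal_gaussianPDF, toReal_gaussianPDF, hpdf σ hσ, hpdf τ hτ, smul_eq_mul]
  have h2 : √(2 * Real.pi) ≠ 0 := by positivity
  have h3 : √(2 * Real.pi) * √(2 * Real.pi) = 2 * Real.pi := Real.mul_self_sqrt (by positivity)
  field_simp
  rw [sq, h3]
  ring

end

/-! ### The legs as Gaussian profiles, and the localized regime. -/

section

variable {Ω : Type*} [MeasurableSpace Ω] {X : ℕ → Ω → ℤ} {P : Measure Ω}

lemma posProb_zero_of_pos {d : ℤ} (hd : 0 < d) : posProb X P 0 d = 0 := by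
  simp [posProb, walk_zero, hd.ne]

lemma eventually_depth_pos {a : ℝ} (ha : 0 < a) : ∀ᶠ N : ℕ in atTop, 0 < depth a N := by
  filter_upwards [(tendsto_natCast_atTop_atTop.const_mul_atTop ha).eventually_ge_atTop 1] with N hN
  exact Int.floor_pos.2 hN

/-- At distance x√N from the mean the quadratic term has a limit, while the errors N|δ|³ + |δ| + 1/N
vanish. -/
lemma tendsto_site_mul_legRate [IsProbabilityMeasure P] (hap : Aperiodic X P) {t : ℝ} (ht0 : 0 < t)
    (ht : t ∈ interior (integrableExpSet (upStep X) P))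
    {a u : ℝ} (hu : 0 < u) (hua : u * deriv (cgf (upStep X) P) t = a) {s : ℝ}
    (hs : s = 1 ∨ s = -1) (x : ℝ) :
    Tendsto (fun N : ℕ => site u s N x * legRate (upStep X) P t (depth a N / site u s N x)) atTop
      (𝓝 (x ^ 2 * (deriv (cgf (upStep X) P) t ^ 2 /
        (2 * iteratedDeriv 2 (cgf (upStep X) P) t * u)))) := by
  obtain ⟨C, ε, hC, hε, hb⟩ := exists_legRate_bound hap ht0 ht hu hua
  set κ := deriv (cgf (upStep X) P) t ^ 2 / (2 * iteratedDeriv 2 (cgf (upStep X) P) t * u)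
  have hδ : Tendsto (fun N : ℕ => |(site u s N x : ℝ) / N - u|) atTop (𝓝 0) := by
    simpa using ((tendsto_site_div hu s x).sub_const u).abs
  have hNδ : Tendsto (fun N : ℕ => N * ((site u s N x : ℝ) / N - u) ^ 2) atTop (𝓝 (x ^ 2)) := by
    have h := (tendsto_site_diff hu s x).pow 2
    have e : (s * x) ^ 2 = x ^ 2 := by rcases hs with rfl | rfl <;> ring
    rw [e] at h
    refine h.congr' ?_
    filter_upwards [eventually_gt_atTop 0] with N hN
    have hN0 : (0 : ℝ) < N := by exact_mod_cast hN
    rw [div_pow, Real.sq_sqrt hN0.le]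
    field_simp
  have herr : Tendsto (fun N : ℕ => C * (N * |(site u s N x : ℝ) / N - u| ^ 3 +
      |(site u s N x : ℝ) / N - u| + 1 / N)) atTop (𝓝 0) := by
    have h := (((hNδ.mul hδ).add hδ).add tendsto_one_div_atTop_nhds_zero_nat).const_mul C
    simp only [mul_zero, add_zero] at h
    refine h.congr fun N => ?_
    rw [← sq_abs]
    ring
  have hmain := hNδ.mul_const κ
  have hdiff : Tendsto (fun N : ℕ => site u s N x * legRate (upStep X) P t (depth a N / site u s N x) -
      N * ((site u s N x : ℝ) / N - u) ^ 2 * κ) atTop (𝓝 0) := by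
    refine squeeze_zero_norm' ?_ herr
    filter_upwards [hb, hδ.eventually_le_const hε] with N h1 h2
    exact h1 _ h2
  simpa using hdiff.add hmain

lemma deriv_cgf_pos [IsProbabilityMeasure P] {Y : Ω → ℝ}
    (h0 : 0 ∈ interior (integrableExpSet Y P)) {t : ℝ} (ht0 : 0 < t)
    (ht : t ∈ interior (integrableExpSet Y P)) (hM : 0 < cgf Y P t) : 0 < deriv (cgf Y P) t :=
  (div_pos hM ht0).trans_le (cgf_div_le_deriv_cgf h0 ht ht0)

lemma one_le_mgf_of_cgf_pos {Y : Ω → ℝ} {t : ℝ} (h : 0 < cgf Y P t) : 1 ≤ mgf Y P t := by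
  by_contra! h1
  exact absurd h (not_lt.2 (Real.log_nonpos mgf_nonneg h1.le))

/-- Combines the sharp asymptotics, the exponential tails and the quadratic expansion of the rate.
An upward atom of the step is what makes the escape probability positive. -/
lemma gaussianProfile_legWeight [IsProbabilityMeasure P] (hX : IIDSteps X P)
    (hap : Aperiodic X P) (h0 : 0 ∈ interior (integrableExpSet (upStep X) P))
    {b : ℕ} (hb : 0 < b) (hμb : stepLaw X P b ≠ 0) {t : ℝ} (ht0 : 0 < t)
    (ht : t ∈ interior (integrableExpSet (upStep X) P)) (hM : 0 < cgf (upStep X) P t)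
    {a : ℝ} (ha : 0 < a) :
    GaussianProfile (legWeight X P t a) (a / deriv (cgf (upStep X) P) t)
      (escapeProb X P t / √(2 * Real.pi * iteratedDeriv 2 (cgf (upStep X) P) t) /
        √(a / deriv (cgf (upStep X) P) t))
      ((a / deriv (cgf (upStep X) P) t) * iteratedDeriv 2 (cgf (upStep X) P) t /
        deriv (cgf (upStep X) P) t ^ 2) := by
  have hD := deriv_cgf_pos h0 ht0 ht hM
  have hv := iteratedDeriv_two_cgf_pos hap ht
  have hu : 0 < a / deriv (cgf (upStep X) P) t := by positivity
  have hua : a / deriv (cgf (upStep X) P) t * deriv (cgf (upStep X) P) t = a :=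
    div_mul_cancel₀ _ hD.ne'
  have hesc := escapeProb_pos hX (interior_subset ht) ht0 (one_le_mgf_of_cgf_pos hM)
    (k := b) (by exact_mod_cast hb) hμb
  refine ⟨hu, by positivity, by positivity, fun N l => legWeight_nonneg t a N l, ?_,
    exists_sqrt_mul_legWeight_le hX hap ht hu hD hua, ?_⟩
  · filter_upwards [eventually_depth_pos ha] with N hN
    rw [legWeight, posProb_zero_of_pos hN, mul_zero]
  · intro s x hs
    have h1 := tendsto_sqrt_mul_legWeight hX hap ht0 ht hM hu hua tendsto_id
      (tendsto_site_div hu s x)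
    have h2 := Real.continuous_exp.continuousAt.tendsto.comp
      (tendsto_site_mul_legRate hap ht0 ht hu hua hs x).neg
    have e : x ^ 2 / (2 * ((a / deriv (cgf (upStep X) P) t) *
        iteratedDeriv 2 (cgf (upStep X) P) t / deriv (cgf (upStep X) P) t ^ 2)) =
        x ^ 2 * (deriv (cgf (upStep X) P) t ^ 2 / (2 * iteratedDeriv 2 (cgf (upStep X) P) t *
          (a / deriv (cgf (upStep X) P) t))) := by
      field_simp
    rw [e]
    refine (h1.mul h2).congr fun N => ?_
    simp only [Function.comp, id, mul_assoc]
    rw [← Real.exp_add, add_neg_cancel, Real.exp_zero, mul_one]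

/-- Reindexing of the positions of the first and of the last contact by the lengths of the first
and of the last excursion. -/
lemma sum_Icc_Icc_eq (N : ℕ) (g : ℕ → ℕ → ℝ) (hg : ∀ l, g l N = 0) :
    ∑ l ∈ Finset.Icc 1 N, ∑ r ∈ Finset.Icc l N, g l r =
      ∑ l ∈ Finset.Icc 1 N, ∑ k ∈ Finset.Icc 1 N, if l + k ≤ N then g l (N - k) else 0 := by
  refine Finset.sum_congr rfl fun l hl => ?_
  have hl := Finset.mem_Icc.1 hl
  rw [← Finset.sum_filter]
  have h1 : ∑ r ∈ Finset.Icc l N, g l r = ∑ r ∈ Finset.Ico l N, g l r := by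
    rw [← Finset.Ico_insert_right hl.2, Finset.sum_insert (by simp), hg, zero_add]
  rw [h1]
  refine Finset.sum_nbij' (fun r => N - r) (fun k => N - k) ?_ ?_ ?_ ?_ ?_
  · intro r hr
    simp only [Finset.mem_Ico, Finset.mem_filter, Finset.mem_Icc] at hr ⊢
    omega
  · intro k hk
    simp only [Finset.mem_Ico, Finset.mem_filter, Finset.mem_Icc] at hk ⊢
    omega
  · intro r hr
    simp only [Finset.mem_Ico] at hr
    omega
  · intro k hk
    simp only [Finset.mem_filter, Finset.mem_Icc] at hk
    omega
  · intro r hr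
    simp only [Finset.mem_Ico] at hr
    congr 1
    omega

/-- The standing assumptions on the random walk. -/
structure CenteredWalk (X : ℕ → Ω → ℤ) (P : Measure Ω) : Prop where
  steps : IIDSteps X P
  aper : Aperiodic X P
  exp_up : 0 ∈ interior (integrableExpSet (upStep X) P)
  exp_down : 0 ∈ interior (integrableExpSet (downStep X) P)
  mean : ∫ ω, upStep X ω ∂P = 0

lemma integrable_of_zero_mem_interior {Y : Ω → ℝ} (h : 0 ∈ interior (integrableExpSet Y P)) :
    Integrable Y P := by
  simpa using integrable_pow_mul_exp_of_mem_interior_integrableExpSet h 1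

lemma CenteredWalk.neg (hX : CenteredWalk X P) : CenteredWalk (negStep X) P where
  steps := hX.steps.neg
  aper := hX.aper.neg
  exp_up := by rw [upStep_negStep]; exact hX.exp_down
  exp_down := by
    have : downStep (negStep X) = upStep X := by funext ω; simp [downStep, upStep]
    rw [this]; exact hX.exp_up
  mean := by
    have : upStep (negStep X) = fun ω => -upStep X ω := by funext ω; simp [upStep]
    rw [this, integral_neg, hX.mean, neg_zero]

lemma CenteredWalk.exists_stepLaw_ne_zero [IsProbabilityMeasure P] (hX : CenteredWalk X P) :
    ∃ b : ℕ, 0 < b ∧ stepLaw X P b ≠ 0 :=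
  WettingWell.exists_stepLaw_ne_zero hX.aper (integrable_of_zero_mem_interior hX.exp_up) hX.mean

lemma CenteredWalk.exists_stepLaw_neg_ne_zero [IsProbabilityMeasure P] (hX : CenteredWalk X P) :
    ∃ c : ℕ, 0 < c ∧ stepLaw X P (-c) ≠ 0 := by
  obtain ⟨c, hc, h⟩ := hX.neg.exists_stepLaw_ne_zero
  refine ⟨c, hc, ?_⟩
  simpa only [stepLaw, neg_eq_iff_eq_neg] using h

lemma CenteredWalk.eventually_wettingZ_pos [IsProbabilityMeasure P] (hX : CenteredWalk X P)
    {lam : ℝ} (hlam : 0 < lam) : ∀ᶠ n in atTop, 0 < wettingZ X P lam n := by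
  obtain ⟨b, hb, hμb⟩ := hX.exists_stepLaw_ne_zero
  obtain ⟨c, hc, hμc⟩ := hX.exists_stepLaw_neg_ne_zero
  exact WettingWell.eventually_wettingZ_pos hX.steps hX.aper hb hc hμb hμc hlam

lemma CenteredWalk.exists_measure_walk_le [IsProbabilityMeasure P] (hX : CenteredWalk X P) :
    ∃ C : ℝ, 0 < C ∧ ∀ n : ℕ, 0 < n → √n * P.real {ω | walk X n ω = 0} ≤ C := by
  obtain ⟨C, hC, h⟩ := exists_tiltProb_le hX.steps hX.aper (a := 0) (b := 0)
    (by simpa using interior_subset hX.exp_up)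
  refine ⟨C, hC, fun n hn => ?_⟩
  simpa [tiltProb] using h 0 (by simp) n hn 0

lemma CenteredWalk.tendsto_measure_walk [IsProbabilityMeasure P] (hX : CenteredWalk X P) :
    Tendsto (fun n : ℕ => P.real {ω | walk X n ω = 0}) atTop (𝓝 0) := by
  obtain ⟨C, hC, h⟩ := hX.exists_measure_walk_le
  refine squeeze_zero' (Eventually.of_forall fun _ => measureReal_nonneg) ?_
    (tendsto_sqrt_natCast.const_div_atTop C)
  filter_upwards [eventually_gt_atTop 0] with n hn
  rw [le_div_iff₀ (by positivity), mul_comm]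
  exact h n hn

/-- The parameters of the localized regime: `y` is the free energy of the wetting model with pinning
parameter `lam`, and `tm`, `tp` are the points where the log-moment generating functions of the
downward and upward increments reach `y`. -/
structure LocalizedRegime (X : ℕ → Ω → ℤ) (P : Measure Ω) (lam a y tm tp : ℝ) : Prop where
  lam_pos : 0 < lam
  a_pos : 0 < a
  y_pos : 0 < y
  gf : lam * returnGF X P y = 1
  tm_pos : 0 < tm
  tp_pos : 0 < tp
  tm_mem : tm ∈ interior (integrableExpSet (downStep X) P)
  tp_mem : tp ∈ interior (integrableExpSet (upStep X) P)
  cgf_tm : cgf (downStep X) P tm = y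
  cgf_tp : cgf (upStep X) P tp = y
  le : a * (tm + tp) ≤ y

/-- The lengths l, N - l - k and k add up to N and both legs climb to the same depth, so the product
of the three exponential factors depends on N alone. -/
lemma contactZ_eq {lam a y tm tp : ℝ} (hr : LocalizedRegime X P lam a y tm tp) {N l k : ℕ}
    (h : l + k ≤ N) :
    contactZ X P lam a N l (N - k) = Real.exp (y * N - (tm + tp) * depth a N) * (lam *
      (legWeight (negStep X) P tm a N l * (wettingZ X P lam (N - l - k) *
        Real.exp (-(y * (N - l - k : ℕ)))) * legWeight X P tp a N k)) := by
  have h1 : ((N - l - k : ℕ) : ℝ) = N - l - k := by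
    rw [Nat.sub_sub, Nat.cast_sub h]; push_cast; ring
  have hE : Real.exp (y * N - (tm + tp) * depth a N) * (Real.exp (tm * depth a N - y * l) *
      Real.exp (-(y * (N - l - k : ℝ))) * Real.exp (tp * depth a N - y * k)) = 1 := by
    rw [← Real.exp_add, ← Real.exp_add, ← Real.exp_add, Real.exp_eq_one_iff]
    ring
  rw [contactZ, legWeight, legWeight, upStep_negStep, hr.cgf_tm, hr.cgf_tp, h1,
    show N - k - l = N - l - k by omega, show N - (N - k) = k by omega]
  linear_combination (-(lam * posProb (negStep X) P l (depth a N) * wettingZ X P lam (N - l - k) *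
    posProb X P k (depth a N))) * hE

lemma contactZ_self {lam a : ℝ} {N : ℕ} (hd : 0 < depth a N) (l : ℕ) :
    contactZ X P lam a N l N = 0 := by
  rw [contactZ, Nat.sub_self, posProb_zero_of_pos hd, mul_zero]

end

/-! ### Limits of sums over the first and last contacts. -/

section

variable {Ω : Type*} [MeasurableSpace Ω] {X : ℕ → Ω → ℤ} {P : Measure Ω}

/-- Strict convexity: Λ(t)/t is the slope at an intermediate point, and Λ' increases strictly
because Λ'' > 0. -/
lemma cgf_div_lt_deriv_cgf [IsProbabilityMeasure P] (hX : CenteredWalk X P) {t : ℝ} (ht0 : 0 < t)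
    (ht : t ∈ interior (integrableExpSet (upStep X) P)) :
    cgf (upStep X) P t / t < deriv (cgf (upStep X) P) t := by
  have hmem : ∀ x ∈ Set.Icc 0 t, x ∈ interior (integrableExpSet (upStep X) P) := fun x hx =>
    (convex_integrableExpSet.interior).ordConnected.out hX.exp_up ht hx
  obtain ⟨ξ, hξ, h1⟩ := exists_deriv_eq_slope (cgf (upStep X) P) ht0
    (fun x hx => (analyticAt_cgf (hmem x hx)).continuousAt.continuousWithinAt)
    fun x hx => (analyticAt_cgf (hmem x ⟨hx.1.le, hx.2.le⟩)).differentiableAt.differentiableWithinAt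
  have hsub : ∀ x ∈ Set.Icc ξ t, x ∈ Set.Icc 0 t := fun x hx => ⟨hξ.1.le.trans hx.1, hx.2⟩
  obtain ⟨η, hη, h2⟩ := exists_deriv_eq_slope (deriv (cgf (upStep X) P)) hξ.2
    (fun x hx => (continuousAt_deriv_cgf (hmem x (hsub x hx))).continuousWithinAt)
    fun x hx => (analyticAt_cgf
      (hmem x (hsub x ⟨hx.1.le, hx.2.le⟩))).deriv.differentiableAt.differentiableWithinAt
  have h3 := iteratedDeriv_two_cgf_pos hX.aper (hmem η (hsub η ⟨hη.1.le, hη.2.le⟩))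
  rw [iteratedDeriv_succ, iteratedDeriv_one, h2, div_pos_iff_of_pos_right (by linarith [hξ.2])] at h3
  rw [cgf_zero, sub_zero, sub_zero] at h1
  linarith

/-- The asymptotic fraction of time taken by the first passage at the bottom of the well. -/
noncomputable def legMean (X : ℕ → Ω → ℤ) (P : Measure Ω) (t a : ℝ) : ℝ :=
  a / deriv (cgf (upStep X) P) t

/-- The asymptotic variance of the first passage time at the bottom of the well. -/
noncomputable def legVar (X : ℕ → Ω → ℤ) (P : Measure Ω) (t a : ℝ) : ℝ :=
  legMean X P t a * iteratedDeriv 2 (cgf (upStep X) P) t / deriv (cgf (upStep X) P) t ^ 2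

/-- The limit of the normalized weight of the first passage time at the bottom of the well. -/
noncomputable def legConst (X : ℕ → Ω → ℤ) (P : Measure Ω) (t a : ℝ) : ℝ :=
  escapeProb X P t / √(2 * Real.pi * iteratedDeriv 2 (cgf (upStep X) P) t) / √(legMean X P t a)

section

variable [IsProbabilityMeasure P] {lam a y tm tp : ℝ}

lemma LocalizedRegime.profile_up (hr : LocalizedRegime X P lam a y tm tp)
    (hX : CenteredWalk X P) : GaussianProfile (legWeight X P tp a) (legMean X P tp a)
      (legConst X P tp a) (legVar X P tp a) := by
  obtain ⟨b, hb, hμb⟩ := hX.exists_stepLaw_ne_zero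
  exact gaussianProfile_legWeight hX.steps hX.aper hX.exp_up hb hμb hr.tp_pos hr.tp_mem
    (by rw [hr.cgf_tp]; exact hr.y_pos) hr.a_pos

lemma LocalizedRegime.profile_down (hr : LocalizedRegime X P lam a y tm tp)
    (hX : CenteredWalk X P) : GaussianProfile (legWeight (negStep X) P tm a)
      (legMean (negStep X) P tm a) (legConst (negStep X) P tm a) (legVar (negStep X) P tm a) := by
  obtain ⟨b, hb, hμb⟩ := hX.neg.exists_stepLaw_ne_zero
  refine gaussianProfile_legWeight hX.neg.steps hX.neg.aper hX.neg.exp_up hb hμb hr.tm_pos ?_ ?_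
    hr.a_pos
  · rw [upStep_negStep]; exact hr.tm_mem
  · rw [upStep_negStep, hr.cgf_tm]; exact hr.y_pos

lemma legMean_lt (hX : CenteredWalk X P) (ha : 0 < a) (hy : 0 < y) {t : ℝ} (ht0 : 0 < t)
    (ht : t ∈ interior (integrableExpSet (upStep X) P)) (hty : cgf (upStep X) P t = y) :
    legMean X P t a < a * t / y := by
  have h := cgf_div_lt_deriv_cgf hX ht0 ht
  rw [hty] at h
  have h1 : 0 < y / t := by positivity
  rw [legMean, show a * t / y = a / (y / t) by field_simp]
  gcongr

/-- By strict convexity each leg takes less than the fraction at/y of the time, and these fractions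
add up to at most 1. The inequality stays strict at criticality, where a(t₋ + t₊) = y. -/
lemma LocalizedRegime.legMean_add_lt_one (hr : LocalizedRegime X P lam a y tm tp)
    (hX : CenteredWalk X P) : legMean (negStep X) P tm a + legMean X P tp a < 1 := by
  have h1 := legMean_lt hX hr.a_pos hr.y_pos hr.tp_pos hr.tp_mem hr.cgf_tp
  have h2 := legMean_lt hX.neg hr.a_pos hr.y_pos hr.tm_pos
    (by rw [upStep_negStep]; exact hr.tm_mem) (by rw [upStep_negStep]; exact hr.cgf_tm)
  have h3 : a * tm / y + a * tp / y ≤ 1 := by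
    rw [← add_div, ← mul_add, div_le_one hr.y_pos]
    exact hr.le
  linarith

/-- The normalization is at least 1 because depth ≤ aN and a(t₋ + t₊) ≤ y. At criticality it stays
bounded, so the decay must come from P(S_N = 0) → 0. -/
lemma LocalizedRegime.tendsto_noContactZ (hr : LocalizedRegime X P lam a y tm tp)
    (hX : CenteredWalk X P) : Tendsto (fun N : ℕ => noContactZ X P lam a N /
      Real.exp (y * N - (tm + tp) * depth a N)) atTop (𝓝 0) := by
  refine squeeze_zero (fun N => div_nonneg (noContactZ_nonneg hr.lam_pos.le a N)
    (Real.exp_pos _).le) (fun N => ?_) hX.tendsto_measure_walk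
  have h1 : (0 : ℝ) ≤ y * N - (tm + tp) * depth a N := by
    have h2 : (tm + tp) * depth a N ≤ (tm + tp) * (a * N) :=
      mul_le_mul_of_nonneg_left (depth_le N) (by linarith [hr.tm_pos, hr.tp_pos])
    have h3 : a * (tm + tp) * N ≤ y * N := mul_le_mul_of_nonneg_right hr.le N.cast_nonneg
    linarith
  exact (div_le_self (noContactZ_nonneg hr.lam_pos.le a N) (Real.one_le_exp h1)).trans
    (noContactZ_le hX.steps hr.lam_pos.le a N)

/-- After reindexing by the length k = N - r of the last leg, the contact terms are a sum against
two Gaussian profiles; the term without contact is negligible since F is bounded. -/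
theorem LocalizedRegime.tendsto_integral_functional (hr : LocalizedRegime X P lam a y tm tp)
    (hX : CenteredWalk X P) {C₀ : ℝ}
    (hζ : Tendsto (fun n : ℕ => wettingZ X P lam n * Real.exp (-(y * n))) atTop (𝓝 C₀))
    {F : ℕ → ℕ∞ → ℕ∞ → ℝ} {K : ℝ} (hF : ∀ N l r, |F N l r| ≤ K) {f : ℝ × ℝ → ℝ}
    (hFf : ∀ x x' : ℝ, Tendsto (fun N : ℕ => F N (site (legMean (negStep X) P tm a) 1 N x : ℕ)
      (N - site (legMean X P tp a) (-1) N x' : ℕ)) atTop (𝓝 (f (x, x')))) :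
    Tendsto (fun N : ℕ => (∫ ω, F N (leftContact X a N ω) (rightContact X a N ω) *
      weight X lam a N ω ∂P) / Real.exp (y * N - (tm + tp) * depth a N)) atTop
      (𝓝 (lam * (C₀ * legConst (negStep X) P tm a * legConst X P tp a * ∫ z : ℝ × ℝ, f z *
        (Real.exp (-(z.1 ^ 2 / (2 * legVar (negStep X) P tm a))) *
          Real.exp (-(z.2 ^ 2 / (2 * legVar X P tp a))))))) := by
  have hsum := ((hr.profile_down hX).tendsto_sum (hr.profile_up hX) (hr.legMean_add_lt_one hX) hζ
    (F := fun N l k => F N (l : ℕ) ((N - k : ℕ) : ℕ∞)) (fun N l k => hF N _ _) hFf).const_mul lam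
  have hno : Tendsto (fun N : ℕ => F N ⊤ ⊤ * (noContactZ X P lam a N /
      Real.exp (y * N - (tm + tp) * depth a N))) atTop (𝓝 0) :=
    bdd_le_mul_tendsto_zero' K (Eventually.of_forall fun N => hF N _ _) (hr.tendsto_noContactZ hX)
  have hadd := hno.add hsum
  rw [zero_add] at hadd
  refine hadd.congr' ?_
  filter_upwards [eventually_depth_pos hr.a_pos] with N hd
  have hE := Real.exp_pos (y * N - (tm + tp) * depth a N)
  rw [integral_functional_mul_weight hX.steps hr.lam_pos hd, add_div, mul_div_assoc,
    sum_Icc_Icc_eq N _ fun l => by rw [contactZ_self hd, mul_zero], Finset.mul_sum, Finset.sum_div]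
  congr 1
  refine Finset.sum_congr rfl fun l _ => ?_
  rw [Finset.mul_sum, Finset.sum_div]
  refine Finset.sum_congr rfl fun k _ => ?_
  split_ifs with h
  · rw [contactZ_eq hr h]
    field_simp
  · simp

end

end

/-! ### Partition function, free energy and weak convergence. -/

section

variable {Ω : Type*} [MeasurableSpace Ω] {X : ℕ → Ω → ℤ} {P : Measure Ω}

section

variable [IsProbabilityMeasure P] {lam a y tm tp C₀ : ℝ}

/-- The limit of the partition function divided by its exponential order. -/
noncomputable def amplitude (X : ℕ → Ω → ℤ) (P : Measure Ω) (lam a tm tp C₀ : ℝ) : ℝ :=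
  lam * C₀ * legConst (negStep X) P tm a * legConst X P tp a *
    (2 * Real.pi * √(legVar (negStep X) P tm a) * √(legVar X P tp a))

lemma LocalizedRegime.amplitude_pos (hr : LocalizedRegime X P lam a y tm tp)
    (hX : CenteredWalk X P) (hC₀ : 0 < C₀) : 0 < amplitude X P lam a tm tp C₀ := by
  have h1 := hr.profile_down hX
  have h2 := hr.profile_up hX
  have := hr.lam_pos
  have := h1.κ_pos
  have := h2.κ_pos
  have := h1.S_pos
  have := h2.S_pos
  unfold amplitude
  positivity

theorem LocalizedRegime.tendsto_functional_gaussian (hr : LocalizedRegime X P lam a y tm tp)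
    (hX : CenteredWalk X P)
    (hζ : Tendsto (fun n : ℕ => wettingZ X P lam n * Real.exp (-(y * n))) atTop (𝓝 C₀))
    {F : ℕ → ℕ∞ → ℕ∞ → ℝ} {K : ℝ} (hF : ∀ N l r, |F N l r| ≤ K) {f : ℝ × ℝ → ℝ}
    (hFf : ∀ x x' : ℝ, Tendsto (fun N : ℕ => F N (site (legMean (negStep X) P tm a) 1 N x : ℕ)
      (N - site (legMean X P tp a) (-1) N x' : ℕ)) atTop (𝓝 (f (x, x')))) :
    Tendsto (fun N : ℕ => (∫ ω, F N (leftContact X a N ω) (rightContact X a N ω) *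
      weight X lam a N ω ∂P) / Real.exp (y * N - (tm + tp) * depth a N)) atTop
      (𝓝 (amplitude X P lam a tm tp C₀ * ∫ z, f z
        ∂((gaussianReal 0 (Real.toNNReal (√(legVar (negStep X) P tm a) ^ 2))).prod
          (gaussianReal 0 (Real.toNNReal (√(legVar X P tp a) ^ 2)))))) := by
  have h := hr.tendsto_integral_functional hX hζ hF hFf
  have h1 := (hr.profile_down hX).S_pos
  have h2 := (hr.profile_up hX).S_pos
  have h3 := integral_mul_exp_eq_gaussian (Real.sqrt_pos.2 h1) (Real.sqrt_pos.2 h2) f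
  rw [Real.sq_sqrt h1.le, Real.sq_sqrt h2.le] at h3 ⊢
  rw [h3] at h
  convert h using 2
  rw [amplitude]
  ring

lemma LocalizedRegime.tendsto_partitionFn (hr : LocalizedRegime X P lam a y tm tp)
    (hX : CenteredWalk X P)
    (hζ : Tendsto (fun n : ℕ => wettingZ X P lam n * Real.exp (-(y * n))) atTop (𝓝 C₀)) :
    Tendsto (fun N : ℕ => partitionFn X P lam a N / Real.exp (y * N - (tm + tp) * depth a N)) atTop
      (𝓝 (amplitude X P lam a tm tp C₀)) := by
  have h := hr.tendsto_functional_gaussian hX hζ (F := fun _ _ _ => 1) (K := 1) (f := fun _ => 1)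
    (by simp) (fun _ _ => tendsto_const_nhds)
  simpa [partitionFn] using h

lemma LocalizedRegime.tendsto_integral_gibbs (hr : LocalizedRegime X P lam a y tm tp)
    (hX : CenteredWalk X P) (hC₀ : 0 < C₀)
    (hζ : Tendsto (fun n : ℕ => wettingZ X P lam n * Real.exp (-(y * n))) atTop (𝓝 C₀))
    {F : ℕ → ℕ∞ → ℕ∞ → ℝ} {K : ℝ} (hF : ∀ N l r, |F N l r| ≤ K) {f : ℝ × ℝ → ℝ}
    (hFf : ∀ x x' : ℝ, Tendsto (fun N : ℕ => F N (site (legMean (negStep X) P tm a) 1 N x : ℕ)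
      (N - site (legMean X P tp a) (-1) N x' : ℕ)) atTop (𝓝 (f (x, x')))) :
    Tendsto (fun N : ℕ => ∫ ω, F N (leftContact X a N ω) (rightContact X a N ω)
      ∂(gibbs X P lam a N)) atTop (𝓝 (∫ z, f z
        ∂((gaussianReal 0 (Real.toNNReal (√(legVar (negStep X) P tm a) ^ 2))).prod
          (gaussianReal 0 (Real.toNNReal (√(legVar X P tp a) ^ 2)))))) := by
  have hA := hr.amplitude_pos hX hC₀
  have h := (hr.tendsto_functional_gaussian hX hζ hF hFf).div (hr.tendsto_partitionFn hX hζ) hA.ne'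
  rw [mul_div_cancel_left₀ _ hA.ne'] at h
  refine h.congr fun N => ?_
  rw [integral_gibbs hX.steps hr.lam_pos.le, Pi.div_apply,
    div_div_div_cancel_right₀ (Real.exp_pos _).ne']

lemma tendsto_log_div {Z e : ℕ → ℝ} {A f : ℝ} (hA : 0 < A)
    (h : Tendsto (fun N => Z N / Real.exp (e N)) atTop (𝓝 A))
    (he : Tendsto (fun N : ℕ => e N / N) atTop (𝓝 f)) :
    Tendsto (fun N : ℕ => 1 / (N : ℝ) * Real.log (Z N)) atTop (𝓝 f) := by
  have h1 := ((h.log hA.ne').div_atTop tendsto_natCast_atTop_atTop).add he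
  rw [zero_add] at h1
  refine h1.congr' ?_
  filter_upwards [h.eventually_const_lt hA] with N hN
  have hZ : 0 < Z N := (div_pos_iff_of_pos_right (Real.exp_pos _)).1 hN
  rw [Real.log_div hZ.ne' (Real.exp_pos _).ne', Real.log_exp]
  ring

lemma LocalizedRegime.freeEnergy_eq (hr : LocalizedRegime X P lam a y tm tp)
    (hX : CenteredWalk X P) (hC₀ : 0 < C₀)
    (hζ : Tendsto (fun n : ℕ => wettingZ X P lam n * Real.exp (-(y * n))) atTop (𝓝 C₀)) :
    freeEnergy X P lam a = y - (tm + tp) * a := by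
  refine (tendsto_log_div (hr.amplitude_pos hX hC₀) (hr.tendsto_partitionFn hX hζ) ?_).limUnder_eq
  refine (((tendsto_depth_div (a := a) tendsto_id).const_mul (tm + tp)).const_sub y).congr' ?_
  filter_upwards [eventually_gt_atTop 0] with N hN
  have : (N : ℝ) ≠ 0 := by positivity
  simp only [id]
  field_simp

lemma LocalizedRegime.isEquivalent_partitionFn (hr : LocalizedRegime X P lam a y tm tp)
    (hX : CenteredWalk X P) (hC₀ : 0 < C₀)
    (hζ : Tendsto (fun n : ℕ => wettingZ X P lam n * Real.exp (-(y * n))) atTop (𝓝 C₀)) :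
    Asymptotics.IsEquivalent atTop (fun N : ℕ => partitionFn X P lam a N)
      (fun N : ℕ => amplitude X P lam a tm tp C₀ *
        Real.exp (freeEnergy X P lam a * N + (tm + tp) * Int.fract (a * N))) := by
  have hA := hr.amplitude_pos hX hC₀
  have hE : ∀ N : ℕ, Real.exp (freeEnergy X P lam a * N + (tm + tp) * Int.fract (a * N)) =
      Real.exp (y * N - (tm + tp) * depth a N) := fun N => by
    rw [hr.freeEnergy_eq hX hC₀ hζ, depth_eq]
    ring_nf
  simp only [hE]
  rw [Asymptotics.isEquivalent_iff_tendsto_one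
    (Eventually.of_forall fun N => (mul_pos hA (Real.exp_pos _)).ne')]
  have h := (hr.tendsto_partitionFn hX hζ).div_const (amplitude X P lam a tm tp C₀)
  rw [div_self hA.ne'] at h
  refine h.congr fun N => ?_
  rw [Pi.div_apply, div_div, mul_comm]

lemma rescale_natCast (c : ℝ) (N n : ℕ) :
    rescale c N (n : ℕ∞) = (((n - c * N) / √N : ℝ) : EReal) := by
  rw [rescale, EReal.coe_div, EReal.coe_sub, ENat.toENNReal_coe,
    ← EReal.coe_ennreal_toReal (ENNReal.natCast_ne_top n), ENNReal.toReal_natCast]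

/-- The last leg is sampled with sign -1, so that the last contact N - k sits at +x'√N from its
mean. The value ∞ of a missing contact plays no role in the limit. -/
lemma LocalizedRegime.tendsto_integral_rescale (hr : LocalizedRegime X P lam a y tm tp)
    (hX : CenteredWalk X P) (hC₀ : 0 < C₀)
    (hζ : Tendsto (fun n : ℕ => wettingZ X P lam n * Real.exp (-(y * n))) atTop (𝓝 C₀))
    (φ : (EReal × EReal) →ᵇ ℝ) :
    Tendsto (fun N : ℕ => ∫ ω, φ (rescale (legMean (negStep X) P tm a) N (leftContact X a N ω),
        rescale (1 - legMean X P tp a) N (rightContact X a N ω)) ∂(gibbs X P lam a N)) atTop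
      (𝓝 (∫ z : ℝ × ℝ, φ ((z.1 : EReal), (z.2 : EReal))
        ∂((gaussianReal 0 (Real.toNNReal (√(legVar (negStep X) P tm a) ^ 2))).prod
          (gaussianReal 0 (Real.toNNReal (√(legVar X P tp a) ^ 2)))))) := by
  have hu := (hr.profile_down hX).u_pos
  have hw := (hr.profile_up hX).u_pos
  have huw := hr.legMean_add_lt_one hX
  refine hr.tendsto_integral_gibbs hX hC₀ hζ
    (F := fun N L R => φ (rescale (legMean (negStep X) P tm a) N L,
      rescale (1 - legMean X P tp a) N R)) (K := ‖φ‖) (fun N l r => φ.norm_coe_le_norm _) ?_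
  intro x x'
  refine (φ.continuous.tendsto _).comp (Tendsto.prodMk_nhds ?_ ?_)
  · have h := tendsto_site_diff hu 1 x
    rw [one_mul] at h
    refine ((continuous_coe_real_ereal.tendsto x).comp h).congr' ?_
    filter_upwards [eventually_gt_atTop 0] with N hN
    rw [rescale_natCast, Function.comp]
  · have h := (tendsto_site_diff hw (-1) x').neg
    rw [neg_one_mul, neg_neg] at h
    refine ((continuous_coe_real_ereal.tendsto x').comp h).congr' ?_
    filter_upwards [eventually_gt_atTop 0,
      (tendsto_site_div hw (-1) x').eventually_le_const
        (show legMean X P tp a < 1 by linarith)] with N hN h1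
    have hN0 : (0 : ℝ) < N := by exact_mod_cast hN
    have h2 : site (legMean X P tp a) (-1) N x' ≤ N := by
      rw [div_le_one hN0] at h1
      exact_mod_cast h1
    rw [rescale_natCast, Function.comp, Nat.cast_sub h2]
    congr 1
    ring

end

end

/-! ### The uniform local limit theorem. -/

section

variable {Ω : Type*} [MeasurableSpace Ω] {X : ℕ → Ω → ℤ} {P : Measure Ω}

/-- An error proportional to `δ * B`, up to `η`, can be absorbed in a factor `1 + δ * θ`. -/
lemma exists_abs_le_relative_error {A B c δ η : ℝ} (hc : 0 ≤ c) (hδ : 0 ≤ δ) (hB : 0 ≤ B)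
    (hη : 0 ≤ η) (h : |A - B| ≤ c * (δ * B) + η) :
    ∃ θ, |θ| ≤ c ∧ |A - B * (1 + δ * θ)| ≤ η := by
  have hq : 0 ≤ δ * B := mul_nonneg hδ hB
  have e : ∀ θ, A - B * (1 + δ * θ) = A - B - δ * B * θ := fun θ => by ring
  simp only [e]
  generalize δ * B = q at *
  generalize A - B = x at *
  rw [abs_le] at h
  by_cases h1 : c * q < x
  · exact ⟨c, by rw [abs_of_nonneg hc], by rw [abs_le]; constructor <;> nlinarith⟩
  by_cases h2 : x < -(c * q)
  · exact ⟨-c, by rw [abs_neg, abs_of_nonneg hc], by rw [abs_le]; constructor <;> nlinarith⟩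
  rcases hq.eq_or_lt with h3 | h3
  · exact ⟨0, by simpa using hc, by rw [abs_le]; constructor <;> nlinarith⟩
  · refine ⟨x / q, ?_, ?_⟩
    · rw [abs_le, le_div_iff₀ h3, div_le_iff₀ h3]
      constructor <;> linarith
    · rw [mul_div_cancel₀ _ h3.ne', sub_self, abs_zero]
      exact hη

lemma abs_mul_exp_sub_one_le {o e η E : ℝ} (ho : |o| ≤ η) (he : |e| ≤ E) :
    |(1 + o) * Real.exp e - 1| ≤ η * Real.exp E + (Real.exp E - 1) := by
  have h1 : Real.exp e ≤ Real.exp E := Real.exp_le_exp.2 ((le_abs_self e).trans he)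
  have h2 : |Real.exp e - 1| ≤ Real.exp E - 1 := by
    have h3 : Real.exp (-E) ≤ Real.exp e := Real.exp_le_exp.2 (by linarith [neg_abs_le e])
    have h4 : Real.exp E * Real.exp (-E) = 1 := by rw [← Real.exp_add, add_neg_cancel, Real.exp_zero]
    rw [abs_le]
    constructor
    · nlinarith [sq_nonneg (Real.exp E - 1), Real.exp_pos (-E), Real.exp_pos E]
    · linarith
  have h5 : (1 + o) * Real.exp e - 1 = o * Real.exp e + (Real.exp e - 1) := by ring
  rw [h5]
  refine (abs_add_le _ _).trans (add_le_add ?_ h2)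
  rw [abs_mul, abs_of_pos (Real.exp_pos e)]
  gcongr
  exact (abs_nonneg o).trans ho

/-- The quadratic expansion of the exponential weight of a leg, with a relative error. -/
lemma exists_legRate_relative_error [IsProbabilityMeasure P] (hX : CenteredWalk X P) {t a : ℝ}
    (ht0 : 0 < t) (ht : t ∈ interior (integrableExpSet (upStep X) P))
    (hM : 0 < cgf (upStep X) P t) (ha : 0 < a) :
    ∃ C ε : ℝ, 0 < C ∧ 0 < ε ∧ ∀ᶠ N : ℕ in atTop, ∀ l : ℕ, |(l : ℝ) / N - legMean X P t a| ≤ ε →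
      ∃ θ, |θ| ≤ C ∧ |l * legRate (upStep X) P t (depth a N / l) -
        (l - legMean X P t a * N) ^ 2 / (2 * legVar X P t a * N) *
          (1 + |(l : ℝ) / N - legMean X P t a| * θ)| ≤
        C * (|(l : ℝ) / N - legMean X P t a| + 1 / N) := by
  have hD := deriv_cgf_pos hX.exp_up ht0 ht hM
  have hv := iteratedDeriv_two_cgf_pos hX.aper ht
  have hu : 0 < legMean X P t a := div_pos ha hD
  have hua : legMean X P t a * deriv (cgf (upStep X) P) t = a := div_mul_cancel₀ _ hD.ne'
  have hS : 0 < legVar X P t a := by unfold legVar; positivity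
  obtain ⟨C, ε, hC, hε, hb⟩ := exists_legRate_bound hX.aper ht0 ht hu hua
  have hκ : deriv (cgf (upStep X) P) t ^ 2 / (2 * iteratedDeriv 2 (cgf (upStep X) P) t *
      legMean X P t a) = 1 / (2 * legVar X P t a) := by
    rw [legVar]
    field_simp
  refine ⟨max C (2 * legVar X P t a * C), ε, by positivity, hε, ?_⟩
  filter_upwards [hb, eventually_gt_atTop 0] with N hN hN0 l hl
  have hN0 : (0 : ℝ) < N := by exact_mod_cast hN0
  have h := hN l hl
  rw [hκ] at h
  have hB : N * ((l : ℝ) / N - legMean X P t a) ^ 2 * (1 / (2 * legVar X P t a)) =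
      (l - legMean X P t a * N) ^ 2 / (2 * legVar X P t a * N) := by
    field_simp
  set δ := |(l : ℝ) / N - legMean X P t a| with hδ
  have hδ0 : 0 ≤ δ := abs_nonneg _
  have hB3 : 2 * legVar X P t a * C *
      (δ * ((l - legMean X P t a * N) ^ 2 / (2 * legVar X P t a * N))) = C * (N * δ ^ 3) := by
    rw [← hB, ← sq_abs ((l : ℝ) / N - _), ← hδ]
    field_simp
  rw [hB] at h
  obtain ⟨θ, h1, h2⟩ := exists_abs_le_relative_error (A := l * legRate (upStep X) P t (depth a N / l))
    (B := (l - legMean X P t a * N) ^ 2 / (2 * legVar X P t a * N))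
    (c := 2 * legVar X P t a * C) (δ := δ) (η := C * (δ + 1 / N)) (by positivity) hδ0
    (by positivity) (by positivity) (by rw [hB3]; linarith)
  refine ⟨θ, h1.trans (le_max_right _ _), h2.trans ?_⟩
  gcongr
  exact le_max_left _ _

section

variable [IsProbabilityMeasure P] {lam a y tm tp C₀ : ℝ}

/-- The quotient of one contact term by the partition function: the limits of the two legs and of
the wetting part cancel against the amplitude. The filter is arbitrary so that it can be restricted
to a subset of the integers. -/
theorem LocalizedRegime.tendsto_gibbs_contactEvent (hr : LocalizedRegime X P lam a y tm tp)
    (hX : CenteredWalk X P) (hC₀ : 0 < C₀)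
    (hζ : Tendsto (fun n : ℕ => wettingZ X P lam n * Real.exp (-(y * n))) atTop (𝓝 C₀))
    {ι : Type*} {F : Filter ι} [F.IsCountablyGenerated] {N l r : ι → ℕ} (hN : Tendsto N F atTop)
    (hl : Tendsto (fun i => (l i : ℝ) / N i) F (𝓝 (legMean (negStep X) P tm a)))
    (hr' : Tendsto (fun i => (r i : ℝ) / N i) F (𝓝 (1 - legMean X P tp a))) :
    Tendsto (fun i => 2 * Real.pi * N i * √(legVar (negStep X) P tm a) * √(legVar X P tp a) *
      (gibbs X P lam a (N i)).real (contactEvent X a (N i) (l i) (r i)) *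
      Real.exp (l i * legRate (upStep (negStep X)) P tm (depth a (N i) / l i) +
        (N i - r i : ℕ) * legRate (upStep X) P tp (depth a (N i) / (N i - r i : ℕ)))) F (𝓝 1) := by
  have hm := hr.profile_down hX
  have hp := hr.profile_up hX
  have huw := hr.legMean_add_lt_one hX
  have hA := hr.amplitude_pos hX hC₀
  have hmD := deriv_cgf_pos hX.neg.exp_up hr.tm_pos (by rw [upStep_negStep]; exact hr.tm_mem)
    (by rw [upStep_negStep, hr.cgf_tm]; exact hr.y_pos)
  have hpD := deriv_cgf_pos hX.exp_up hr.tp_pos hr.tp_mem (by rw [hr.cgf_tp]; exact hr.y_pos)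
  have hNr : ∀ᶠ i in F, 0 < N i := hN.eventually_gt_atTop 0
  have hrN : ∀ᶠ i in F, r i ≤ N i := by
    filter_upwards [hr'.eventually_le_const (show 1 - legMean X P tp a < 1 by linarith [hp.u_pos]),
      hNr] with i hi h0
    rw [div_le_one (by exact_mod_cast h0)] at hi
    exact_mod_cast hi
  have hlr : ∀ᶠ i in F, l i ≤ r i := by
    filter_upwards [(hl.sub hr').eventually_le_const (u := 0) (by linarith), hNr] with i hi h0
    have h0 : (0 : ℝ) < N i := by exact_mod_cast h0
    rw [← sub_div, div_le_iff₀ h0, zero_mul, sub_nonpos] at hi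
    exact_mod_cast hi
  have hl0 : ∀ᶠ i in F, 0 < l i := (tendsto_atTop_of_div hm.u_pos hN hl).eventually_gt_atTop 0
  have hk : Tendsto (fun i => ((N i - r i : ℕ) : ℝ) / N i) F (𝓝 (legMean X P tp a)) := by
    have h := hr'.const_sub 1
    rw [sub_sub_cancel] at h
    refine h.congr' ?_
    filter_upwards [hrN, hNr] with i h1 h2
    have h2 : (N i : ℝ) ≠ 0 := by positivity
    rw [Nat.cast_sub h1]
    field_simp
  have hgap : Tendsto (fun i => r i - l i) F atTop := by
    refine tendsto_atTop_of_div (u := 1 - legMean X P tp a - legMean (negStep X) P tm a)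
      (by linarith) hN ((hr'.sub hl).congr' ?_)
    filter_upwards [hlr] with i h1
    rw [Nat.cast_sub h1, sub_div]
  have h1 := tendsto_sqrt_mul_legWeight hX.neg.steps hX.neg.aper hr.tm_pos
    (by rw [upStep_negStep]; exact hr.tm_mem) (by rw [upStep_negStep, hr.cgf_tm]; exact hr.y_pos)
    hm.u_pos (a := a) (div_mul_cancel₀ _ hmD.ne') hN hl
  have h2 := tendsto_sqrt_mul_legWeight hX.steps hX.aper hr.tp_pos hr.tp_mem
    (by rw [hr.cgf_tp]; exact hr.y_pos) hp.u_pos (a := a) (div_mul_cancel₀ _ hpD.ne') hN hk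
  have h3 := (hr.tendsto_partitionFn hX hζ).comp hN
  have h4 := ((((h1.mul (hζ.comp hgap)).mul h2).const_mul (lam * (2 * Real.pi *
    √(legVar (negStep X) P tm a) * √(legVar X P tp a)))).div h3 hA.ne')
  have e1 : lam * (2 * Real.pi * √(legVar (negStep X) P tm a) * √(legVar X P tp a)) *
      (legConst (negStep X) P tm a * C₀ * legConst X P tp a) = amplitude X P lam a tm tp C₀ := by
    rw [amplitude]; ring
  have e2 : lam * (2 * Real.pi * √(legVar (negStep X) P tm a) * √(legVar X P tp a)) *
      (legConst (negStep X) P tm a * C₀ * legConst X P tp a) / amplitude X P lam a tm tp C₀ = 1 := by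
    rw [e1, div_self hA.ne']
  refine (e2 ▸ h4).congr' ?_
  filter_upwards [hrN, hlr, hl0, hNr, hN.eventually (eventually_depth_pos hr.a_pos)]
    with i hi1 hi2 hi3 hi4 hi5
  have hE := (Real.exp_pos (y * N i - (tm + tp) * depth a (N i))).ne'
  rw [gibbs_contactEvent hX.steps hr.lam_pos hi5 hi3 hi2 hi1,
    show contactZ X P lam a (N i) (l i) (r i) = contactZ X P lam a (N i) (l i) (N i - (N i - r i)) by
      congr 1; omega, contactZ_eq hr (by omega), show N i - l i - (N i - r i) = r i - l i by omega,
    Real.exp_add]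
  simp only [Function.comp, Pi.div_apply]
  have hNN : (N i : ℝ) = √(N i : ℝ) * √(N i : ℝ) := (Real.mul_self_sqrt (N i).cast_nonneg).symm
  rw [div_div_eq_mul_div]
  calc _ = (√(N i : ℝ) * √(N i : ℝ)) * (lam * (2 * Real.pi * √(legVar (negStep X) P tm a) *
        √(legVar X P tp a)) * (legWeight (negStep X) P tm a (N i) (l i) *
        Real.exp (l i * legRate (upStep (negStep X)) P tm (depth a (N i) / l i)) *
        (wettingZ X P lam (r i - l i) * Real.exp (-(y * (r i - l i : ℕ)))) *
        (legWeight X P tp a (N i) (N i - r i) *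
        Real.exp ((N i - r i : ℕ) * legRate (upStep X) P tp (depth a (N i) / (N i - r i : ℕ))))) *
        Real.exp (y * N i - (tm + tp) * depth a (N i)) / partitionFn X P lam a (N i)) := by ring
    _ = _ := by rw [← hNN]; ring

/-- Convergence along all choices of points in the windows `W N` is uniform over the windows. -/
lemma exists_uniform_bound {α : Type*} [Nonempty α] {W : ℕ → Set α} {G : ℕ → α → ℝ} {c : ℝ}
    (h : ∀ (z : ℕ → α) (S : Set ℕ), (∀ N ∈ S, z N ∈ W N) →
      Tendsto (fun N => G N (z N)) (atTop ⊓ 𝓟 S) (𝓝 c)) :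
    ∃ η : ℕ → ℝ, Tendsto η atTop (𝓝 0) ∧ ∀ᶠ N in atTop, ∀ z ∈ W N, |G N z - c| ≤ η N := by
  have key : ∀ δ : ℝ, 0 < δ → ∀ᶠ N in atTop, ∀ z ∈ W N, |G N z - c| ≤ δ := by
    intro δ hδ
    by_contra hcon
    rw [not_eventually] at hcon
    -- If uniformity failed, a bad point could be chosen for each N in this set; the set is
    -- unbounded, and along it the hypothesis would be violated.
    set S : Set ℕ := {N | ¬ ∀ z ∈ W N, |G N z - c| ≤ δ} with hS
    have hch : ∀ N, ∃ z, N ∈ S → z ∈ W N ∧ δ < |G N z - c| := by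
      intro N
      by_cases hN : N ∈ S
      · have hN' : ¬ ∀ z ∈ W N, |G N z - c| ≤ δ := hN
        push Not at hN'
        obtain ⟨z, h1, h2⟩ := hN'
        exact ⟨z, fun _ => ⟨h1, h2⟩⟩
      · exact ⟨Classical.arbitrary α, fun h => absurd h hN⟩
    choose z hz using hch
    have hne : (atTop ⊓ 𝓟 S : Filter ℕ).NeBot := by
      rwa [← frequently_mem_iff_neBot]
    have h1 := (h z S fun N hN => (hz N hN).1).sub_const c
    rw [sub_self] at h1
    have h2 := h1.abs
    rw [abs_zero] at h2
    have h3 : ∀ᶠ N in atTop ⊓ 𝓟 S, N ∈ S := Eventually.filter_mono inf_le_right (mem_principal_self S)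
    obtain ⟨N, h4, h5⟩ := ((h2.eventually_lt_const hδ).and h3).exists
    exact absurd h4 (not_lt.2 (hz N h5).2.le)
  -- An empty window gives supremum 0; for large N the values are bounded by `key` at level 1.
  refine ⟨fun N => sSup ((fun z => |G N z - c|) '' W N), ?_, ?_⟩
  · rw [Metric.tendsto_atTop']
    intro δ hδ
    obtain ⟨N₀, hN₀⟩ := eventually_atTop.1 (key (δ / 2) (by linarith))
    refine ⟨N₀, fun N hN => ?_⟩
    have h1 : 0 ≤ sSup ((fun z => |G N z - c|) '' W N) := Real.sSup_nonneg (by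
      rintro _ ⟨z, -, rfl⟩
      exact abs_nonneg _)
    have h2 : sSup ((fun z => |G N z - c|) '' W N) ≤ δ / 2 := Real.sSup_le (by
      rintro _ ⟨z, hz, rfl⟩
      exact hN₀ N hN.le z hz) (by linarith)
    rw [Real.dist_0_eq_abs, abs_of_nonneg h1]
    linarith
  · filter_upwards [key 1 one_pos] with N hN z hz
    refine le_csSup ⟨1, ?_⟩ ⟨z, hz, rfl⟩
    rintro _ ⟨z, hz, rfl⟩
    exact hN z hz

/-- The asymptotics of the contact probability are exact with the true rates in the exponent.
Convergence along all choices in the window makes them uniform, and the rates are then replaced by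
their quadratic expansions. -/
theorem LocalizedRegime.local_limit (hr : LocalizedRegime X P lam a y tm tp)
    (hX : CenteredWalk X P) (hC₀ : 0 < C₀)
    (hζ : Tendsto (fun n : ℕ => wettingZ X P lam n * Real.exp (-(y * n))) atTop (𝓝 C₀))
    {ε : ℕ → ℝ} (hε : Tendsto ε atTop (𝓝 0)) :
    ∃ (C : ℝ) (η : ℕ → ℝ), Tendsto η atTop (𝓝 0) ∧
      ∀ᶠ N : ℕ in atTop, ∀ l r : ℕ,
        |(l : ℝ) / N - legMean (negStep X) P tm a| ≤ ε N →
        |(r : ℝ) / N - (1 - legMean X P tp a)| ≤ ε N →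
        ∃ o θ₁ θ₂ : ℝ, |o| ≤ η N ∧ |θ₁| ≤ C ∧ |θ₂| ≤ C ∧
          (gibbs X P lam a N).real (contactEvent X a N l r) =
            (1 + o) / (2 * Real.pi * N * √(legVar (negStep X) P tm a) * √(legVar X P tp a)) *
              Real.exp (-(((l : ℝ) - legMean (negStep X) P tm a * N) ^ 2 /
                (2 * √(legVar (negStep X) P tm a) ^ 2 * N)) *
                (1 + |(l : ℝ) / N - legMean (negStep X) P tm a| * θ₁)) *
              Real.exp (-(((r : ℝ) - (1 - legMean X P tp a) * N) ^ 2 /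
                (2 * √(legVar X P tp a) ^ 2 * N)) *
                (1 + |(r : ℝ) / N - (1 - legMean X P tp a)| * θ₂)) := by
  have hS₁ := (hr.profile_down hX).S_pos
  have hS₂ := (hr.profile_up hX).S_pos
  have hw := (hr.profile_up hX).u_pos
  rw [Real.sq_sqrt hS₁.le, Real.sq_sqrt hS₂.le]
  obtain ⟨C₁, ε₁, hC₁, hε₁, hb₁⟩ := exists_legRate_relative_error hX.neg hr.tm_pos
    (by rw [upStep_negStep]; exact hr.tm_mem) (by rw [upStep_negStep, hr.cgf_tm]; exact hr.y_pos)
    hr.a_pos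
  obtain ⟨C₂, ε₂, hC₂, hε₂, hb₂⟩ := exists_legRate_relative_error hX hr.tp_pos hr.tp_mem
    (by rw [hr.cgf_tp]; exact hr.y_pos) hr.a_pos
  obtain ⟨η, hη, hb⟩ := exists_uniform_bound
    (W := fun N => {z : ℕ × ℕ | |(z.1 : ℝ) / N - legMean (negStep X) P tm a| ≤ ε N ∧
      |(z.2 : ℝ) / N - (1 - legMean X P tp a)| ≤ ε N})
    (G := fun N z => 2 * Real.pi * N * √(legVar (negStep X) P tm a) * √(legVar X P tp a) *
      (gibbs X P lam a N).real (contactEvent X a N z.1 z.2) *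
      Real.exp (z.1 * legRate (upStep (negStep X)) P tm (depth a N / z.1) +
        (N - z.2 : ℕ) * legRate (upStep X) P tp (depth a N / (N - z.2 : ℕ)))) (c := 1) (by
    intro z S hz
    have hε' : Tendsto ε (atTop ⊓ 𝓟 S) (𝓝 0) := hε.mono_left inf_le_left
    have hS : ∀ᶠ N in atTop ⊓ 𝓟 S, N ∈ S := Eventually.filter_mono inf_le_right (mem_principal_self S)
    refine hr.tendsto_gibbs_contactEvent hX hC₀ hζ (N := fun N => N)
      (tendsto_id.mono_left inf_le_left) ?_ ?_ <;> rw [tendsto_iff_norm_sub_tendsto_zero]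
    · exact squeeze_zero' (Eventually.of_forall fun _ => norm_nonneg _)
        (hS.mono fun N hN => (hz N hN).1) hε'
    · exact squeeze_zero' (Eventually.of_forall fun _ => norm_nonneg _)
        (hS.mono fun N hN => (hz N hN).2) hε')
  set E : ℕ → ℝ := fun N => C₁ * (ε N + 1 / N) + C₂ * (ε N + 1 / N) with hE
  have hE0 : Tendsto E atTop (𝓝 0) := by
    have h1 := hε.add tendsto_one_div_atTop_nhds_zero_nat
    have h2 := (h1.const_mul C₁).add (h1.const_mul C₂)
    simp only [add_zero, mul_zero] at h2
    exact h2
  have hexp : Tendsto (fun N => Real.exp (E N)) atTop (𝓝 1) := by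
    have h1 := (Real.continuous_exp.tendsto 0).comp hE0
    rw [Real.exp_zero] at h1
    exact h1
  refine ⟨max C₁ C₂, fun N => η N * Real.exp (E N) + (Real.exp (E N) - 1), ?_, ?_⟩
  · simpa using (hη.mul hexp).add (hexp.sub_const 1)
  filter_upwards [hb, hb₁, hb₂, hε.eventually_le_const hε₁, hε.eventually_le_const hε₂,
    eventually_gt_atTop 0, hε.eventually_le_const hw] with N h h₁ h₂ hN₁ hN₂ hN hNw l r hl hr'
  have hN0 : (0 : ℝ) < N := by exact_mod_cast hN
  have hrN : r ≤ N := by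
    have h3 := (abs_le.1 hr').2
    have h4 : (r : ℝ) / N ≤ 1 := by linarith
    rw [div_le_one hN0] at h4
    exact_mod_cast h4
  have hk : ((N - r : ℕ) : ℝ) / N - legMean X P tp a = -((r : ℝ) / N - (1 - legMean X P tp a)) := by
    rw [Nat.cast_sub hrN]
    field_simp
    ring
  have hk2 : (((N - r : ℕ) : ℝ) - legMean X P tp a * N) ^ 2 =
      (r - (1 - legMean X P tp a) * N) ^ 2 := by
    rw [Nat.cast_sub hrN]
    ring
  obtain ⟨θ₁, hθ₁, he₁⟩ := h₁ l (hl.trans hN₁)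
  obtain ⟨θ₂, hθ₂, he₂⟩ := h₂ (N - r) (by rw [hk, abs_neg]; exact hr'.trans hN₂)
  rw [hk, abs_neg, hk2] at he₂
  have hG := h (l, r) ⟨hl, hr'⟩
  simp only at hG
  generalize hA₁ : l * legRate (upStep (negStep X)) P tm (depth a N / l) = A₁ at he₁ hG
  generalize hA₂ : ((N - r : ℕ) : ℝ) * legRate (upStep X) P tp (depth a N / (N - r : ℕ)) = A₂
    at he₂ hG
  generalize hB₁ : (l - legMean (negStep X) P tm a * N) ^ 2 /
    (2 * legVar (negStep X) P tm a * N) = B₁ at he₁ ⊢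
  generalize hB₂ : (r - (1 - legMean X P tp a) * N) ^ 2 / (2 * legVar X P tp a * N) = B₂ at he₂ ⊢
  set δ₁ := |(l : ℝ) / N - legMean (negStep X) P tm a| with hδ₁
  set δ₂ := |(r : ℝ) / N - (1 - legMean X P tp a)| with hδ₂
  set c := 2 * Real.pi * N * √(legVar (negStep X) P tm a) * √(legVar X P tp a) with hc
  have hc0 : 0 < c := by positivity
  set p := (gibbs X P lam a N).real (contactEvent X a N l r) with hp
  set o := c * p * Real.exp (A₁ + A₂) - 1 with ho
  set e := B₁ * (1 + δ₁ * θ₁) - A₁ + (B₂ * (1 + δ₂ * θ₂) - A₂) with he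
  have heE : |e| ≤ E N := by
    refine (abs_add_le _ _).trans ?_
    rw [abs_sub_comm, abs_sub_comm (B₂ * _)]
    refine add_le_add (he₁.trans ?_) (he₂.trans ?_) <;> gcongr
  -- The relative errors of the exponents are carried by θ₁ and θ₂; the remaining additive error e
  -- tends to 0 uniformly and goes into the prefactor.
  refine ⟨(1 + o) * Real.exp e - 1, θ₁, θ₂, abs_mul_exp_sub_one_le hG heE,
    hθ₁.trans (le_max_left _ _), hθ₂.trans (le_max_right _ _), ?_⟩
  have h3 : Real.exp (A₁ + A₂) * Real.exp e * Real.exp (-B₁ * (1 + δ₁ * θ₁)) *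
      Real.exp (-B₂ * (1 + δ₂ * θ₂)) = 1 := by
    rw [← Real.exp_add, ← Real.exp_add, ← Real.exp_add, Real.exp_eq_one_iff, he]
    ring
  have h4 : 1 + ((1 + o) * Real.exp e - 1) = c * p * Real.exp (A₁ + A₂) * Real.exp e := by
    rw [ho]; ring
  rw [h4, div_mul_eq_mul_div, div_mul_eq_mul_div, eq_div_iff hc0.ne']
  linear_combination (-(c * p)) * h3

end

end

/-! ### The free energy at height zero, and its vanishing in the well outside the localized regime.
-/

section

variable {Ω : Type*} [MeasurableSpace Ω] {X : ℕ → Ω → ℤ} {P : Measure Ω}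

lemma ofReal_weight_zero {Ω : Type*} (X : ℕ → Ω → ℤ) {lam : ℝ} (hlam : 0 < lam) (N : ℕ) (ω : Ω) :
    ENNReal.ofReal (weight X lam 0 N ω) =
      (∏ i ∈ Finset.range N, wetWeight (ENNReal.ofReal lam) (0 + walk X (i + 1) ω)) *
        (Pi.single 0 1 : ℤ → ℝ≥0∞) (0 + walk X N ω) := by
  have hd : depth 0 N = 0 := by simp [depth]
  simp only [zero_add]
  by_cases hω : ω ∈ wellEvent X 0 N
  · have h1 := hω.1
    rw [weight, Set.indicator_of_mem hω, hω.2, Pi.single_eq_same, mul_one,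
      ENNReal.ofReal_pow hlam.le, contacts, ← prod_range_contact]
    refine Finset.prod_congr rfl fun i hi => ?_
    have h2 := h1 (i + 1) (Finset.mem_Icc.2 ⟨by omega, Finset.mem_range.1 hi⟩)
    rw [hd, neg_zero] at h2 ⊢
    rw [wetWeight]
    rcases h2.eq_or_lt with h3 | h3
    · simp [← h3]
    · simp [h3, h3.ne']
  · rw [weight, Set.indicator_of_notMem hω, ENNReal.ofReal_zero]
    symm
    by_contra hne
    obtain ⟨hprod, hend⟩ := mul_ne_zero_iff.1 hne
    refine hω ⟨fun n hn => ?_, ?_⟩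
    · have hn := Finset.mem_Icc.1 hn
      have h1 := Finset.prod_ne_zero_iff.1 hprod (n - 1) (Finset.mem_range.2 (by omega))
      rw [show n - 1 + 1 = n by omega, wetWeight] at h1
      rw [hd, neg_zero]
      by_contra! h2
      exact h1 (by rw [if_neg (by omega), if_neg (by omega)])
    · by_contra h
      exact hend (by simp [h])

/-- At a = 0 the well has depth zero and the constraint is the one built into the wetting weights.
-/
lemma partitionFn_zero [IsProbabilityMeasure P] (hX : IIDSteps X P) {lam : ℝ} (hlam : 0 < lam)
    (N : ℕ) : partitionFn X P lam 0 N = wettingZ X P lam N := by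
  rw [partitionFn, integral_eq_lintegral_of_nonneg_ae
    (ae_of_all _ fun ω => weight_nonneg hlam.le 0 N ω)
    (measurable_weight hX lam 0 N).aestronglyMeasurable]
  simp_rw [ofReal_weight_zero X hlam N]
  rw [hX.lintegral_prod_walk N (fun _ => wetWeight (ENNReal.ofReal lam)) (Pi.single 0 1) 0,
    pathSum_const, wettingZ]

lemma freeEnergy_zero [IsProbabilityMeasure P] (hX : CenteredWalk X P) {lam y : ℝ}
    (hlam : 0 < lam) (hy : 0 < y) (h : lam * returnGF X P y = 1) : freeEnergy X P lam 0 = y := by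
  obtain ⟨C, hC, hlim⟩ := exists_tendsto_wettingZ hX.steps hlam hy h
    (hX.eventually_wettingZ_pos hlam)
  refine (tendsto_log_div (e := fun N => y * N) hC ?_ ?_).limUnder_eq
  · refine hlim.congr fun n => ?_
    rw [partitionFn_zero hX.steps hlam, Real.exp_neg, div_eq_mul_inv]
  · refine tendsto_const_nhds.congr' ?_
    filter_upwards [eventually_gt_atTop 0] with N hN
    have : (N : ℝ) ≠ 0 := by positivity
    field_simp

lemma measure_le_walk_le [IsProbabilityMeasure P] (hX : IIDSteps X P) {t : ℝ} (ht0 : 0 ≤ t)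
    (ht : t ∈ integrableExpSet (upStep X) P) (n : ℕ) (x : ℝ) :
    P.real {ω | x ≤ (walk X n ω : ℝ)} ≤ Real.exp (-t * x + n * cgf (upStep X) P t) := by
  have h := measure_ge_le_exp_mul_mgf (X := fun ω => (walk X n ω : ℝ)) x ht0
    (integrable_exp_walk hX ht n)
  rwa [mgf_walk hX, ← exp_cgf ht, ← Real.exp_nat_mul, ← Real.exp_add] at h

lemma posProb_le_measure [IsProbabilityMeasure P] (n : ℕ) (d : ℤ) :
    posProb X P n d ≤ P.real {ω | (d : ℝ) ≤ (walk X n ω : ℝ)} := by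
  refine measureReal_mono fun ω hω => ?_
  have : walk X n ω = d := hω.2
  simp [this]

/-- The Chernoff bound at the left-continuous inverse of the log-moment generating function. -/
lemma posProb_le_exp_cgfInv [IsProbabilityMeasure P] (hX : IIDSteps X P) {y : ℝ} (hy : 0 ≤ y)
    (n : ℕ) (d : ℤ) :
    posProb X P n d ≤ Real.exp (-cgfInv (upStep X) P y * d + n * y) := by
  set T := cgfInv (upStep X) P y with hT
  have hT0 : 0 ≤ T := Real.sInf_nonneg fun t ht => ht.1
  -- For T = 0 the trivial bound suffices. Otherwise every t < T has Λ(t) finite and below y, so the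
  -- Chernoff bound holds at t, and t increases to T.
  rcases hT0.eq_or_lt with h0 | h0
  · rw [← h0, neg_zero, zero_mul, zero_add]
    exact measureReal_le_one.trans (Real.one_le_exp (by positivity))
  · have hlim : Tendsto (fun t : ℝ => Real.exp (-t * d + n * y)) (𝓝[<] T)
        (𝓝 (Real.exp (-T * d + n * y))) :=
      tendsto_nhdsWithin_of_tendsto_nhds (Continuous.tendsto (by fun_prop) T)
    refine ge_of_tendsto hlim ?_
    filter_upwards [Ioo_mem_nhdsLT h0] with t ht
    have h1 : t ∉ {t : ℝ | 0 ≤ t ∧ (FiniteExpMoment (upStep X) P t → y ≤ cgf (upStep X) P t)} :=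
      notMem_of_lt_csInf ht.2 ⟨0, fun t ht => ht.1⟩
    rw [Set.mem_ofPred] at h1
    push Not at h1
    obtain ⟨h2, h3⟩ := h1 ht.1.le
    refine (posProb_le_measure n d).trans ((measure_le_walk_le hX ht.1.le h2 n d).trans ?_)
    gcongr

lemma exists_wettingZ_le [IsProbabilityMeasure P] (hX : CenteredWalk X P) {lam y : ℝ}
    (hlam : 0 < lam) (hy : 0 < y) (h : lam * returnGF X P y = 1) :
    ∃ C, 0 < C ∧ ∀ n : ℕ, wettingZ X P lam n ≤ C * Real.exp (y * n) := by
  obtain ⟨C₀, hC₀, hlim⟩ := exists_tendsto_wettingZ hX.steps hlam hy h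
    (hX.eventually_wettingZ_pos hlam)
  obtain ⟨C, hC⟩ := hlim.bddAbove_range
  refine ⟨max C 1, by positivity, fun n => ?_⟩
  have h1 : wettingZ X P lam n * Real.exp (-(y * n)) ≤ max C 1 :=
    (hC ⟨n, rfl⟩).trans (le_max_left _ _)
  rwa [Real.exp_neg, ← div_eq_mul_inv, div_le_iff₀ (Real.exp_pos _)] at h1

/-- Outside of the localized regime, the weights of the contact events are bounded. -/
lemma exists_contactZ_le [IsProbabilityMeasure P] (hX : CenteredWalk X P) {lam a : ℝ}
    (hlam : 0 < lam)
    (h : ∀ y, 0 < y → lam * returnGF X P y = 1 →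
      y ≤ a * (cgfInv (downStep X) P y + cgfInv (upStep X) P y)) :
    ∃ K, 0 < K ∧ ∀ N l r, l ≤ r → r ≤ N → 0 ≤ depth a N → contactZ X P lam a N l r ≤ K := by
  by_cases hy : ∃ y, 0 < y ∧ lam * returnGF X P y = 1
  · obtain ⟨y, hy, hgf⟩ := hy
    obtain ⟨C, hC, hb⟩ := exists_wettingZ_le hX hlam hy hgf
    have h := h y hy hgf
    set Tm := cgfInv (downStep X) P y with hTm
    set Tp := cgfInv (upStep X) P y with hTp
    have hTm0 : 0 ≤ Tm := Real.sInf_nonneg fun t ht => ht.1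
    have hTp0 : 0 ≤ Tp := Real.sInf_nonneg fun t ht => ht.1
    refine ⟨lam * C * Real.exp (Tm + Tp), by positivity, fun N l r hlr hrN hd => ?_⟩
    have h1 := posProb_le_exp_cgfInv hX.neg.steps hy.le l (depth a N)
    rw [upStep_negStep, ← hTm] at h1
    have h2 := posProb_le_exp_cgfInv hX.steps hy.le (N - r) (depth a N)
    rw [← hTp] at h2
    have h3 : (Tm + Tp) * (a * N) ≤ (Tm + Tp) * (depth a N + 1) :=
      mul_le_mul_of_nonneg_left (lt_depth_add_one N).le (by linarith)
    have h4 : y * N ≤ a * (Tm + Tp) * N := mul_le_mul_of_nonneg_right h N.cast_nonneg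
    have h5 : -Tm * depth a N + l * y + y * (r - l : ℕ) + (-Tp * depth a N + (N - r : ℕ) * y) ≤
        Tm + Tp := by
      rw [Nat.cast_sub hlr, Nat.cast_sub hrN]
      linarith
    have h6 : (0 : ℝ) ≤ posProb X P (N - r) (depth a N) := measureReal_nonneg
    have h7 := wettingZ_nonneg (X := X) (P := P) lam (r - l)
    calc contactZ X P lam a N l r
        ≤ lam * Real.exp (-Tm * depth a N + l * y) * (C * Real.exp (y * (r - l : ℕ))) *
          Real.exp (-Tp * depth a N + (N - r : ℕ) * y) := by
          rw [contactZ]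
          gcongr
          exact hb _
      _ = lam * C * Real.exp (-Tm * depth a N + l * y + y * (r - l : ℕ) +
          (-Tp * depth a N + (N - r : ℕ) * y)) := by
          rw [Real.exp_add (_ + _), Real.exp_add (_ + _)]
          ring
      _ ≤ _ := by gcongr
  -- With no solution y the generating function stays below 1/λ, and the wetting partition functions
  -- are at most 1.
  · refine ⟨lam, hlam, fun N l r _ _ _ => ?_⟩
    have h1 : ∀ y, 0 < y → lam * returnGF X P y ≤ 1 := by
      intro y hy0
      by_contra! h2
      obtain ⟨z, hz, hz1⟩ := exists_returnGF_eq hX.steps hlam hy0 h2.le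
      exact hy ⟨z, hy0.trans_le hz, hz1⟩
    have h2 := wettingZ_le_one hX.steps hlam h1 (r - l)
    have h3 := wettingZ_nonneg (X := X) (P := P) lam (r - l)
    have h4 : posProb (negStep X) P l (depth a N) ≤ 1 := measureReal_le_one
    have h5 : posProb X P (N - r) (depth a N) ≤ 1 := measureReal_le_one
    have h6 : 0 ≤ posProb (negStep X) P l (depth a N) := measureReal_nonneg
    have h7 : 0 ≤ posProb X P (N - r) (depth a N) := measureReal_nonneg
    calc contactZ X P lam a N l r ≤ lam * 1 * 1 * 1 := by rw [contactZ]; gcongr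
      _ = lam := by ring

/-- There are at most N² contact terms, each bounded. -/
lemma exists_partitionFn_le [IsProbabilityMeasure P] (hX : CenteredWalk X P) {lam a : ℝ}
    (hlam : 0 < lam) (ha : 0 < a)
    (h : ∀ y, 0 < y → lam * returnGF X P y = 1 →
      y ≤ a * (cgfInv (downStep X) P y + cgfInv (upStep X) P y)) :
    ∃ K, 0 < K ∧ ∀ᶠ N : ℕ in atTop, partitionFn X P lam a N ≤ K * N ^ 2 := by
  obtain ⟨K, hK, hb⟩ := exists_contactZ_le hX hlam h
  refine ⟨1 + K, by positivity, ?_⟩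
  filter_upwards [eventually_depth_pos ha, eventually_ge_atTop 1] with N hd hN
  rw [partitionFn_eq hX.steps hlam hd]
  have h1 : noContactZ X P lam a N ≤ 1 := (noContactZ_le hX.steps hlam.le a N).trans measureReal_le_one
  have h2 : ∑ l ∈ Finset.Icc 1 N, ∑ r ∈ Finset.Icc l N, contactZ X P lam a N l r ≤
      ∑ l ∈ Finset.Icc 1 N, N * K := by
    refine Finset.sum_le_sum fun l hl => ?_
    have hl := Finset.mem_Icc.1 hl
    refine (Finset.sum_le_card_nsmul _ _ K fun r hr => ?_).trans ?_
    · have hr := Finset.mem_Icc.1 hr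
      exact hb N l r hr.1 hr.2 hd.le
    · rw [nsmul_eq_mul, Nat.card_Icc]
      gcongr
      omega
  rw [Finset.sum_const, Nat.card_Icc, Nat.add_sub_cancel, nsmul_eq_mul] at h2
  have h3 : (1 : ℝ) ≤ (N : ℝ) ^ 2 := one_le_pow₀ (by exact_mod_cast hN)
  nlinarith

/-- Small exponential tilts have a small cost. -/
lemma exists_cgf_lt_mul [IsProbabilityMeasure P] (hX : CenteredWalk X P) {b : ℝ} (hb : 0 < b) :
    ∀ᶠ t in 𝓝[>] (0 : ℝ), t ∈ interior (integrableExpSet (upStep X) P) ∧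
      cgf (upStep X) P t < b * t := by
  have h1 : HasDerivAt (cgf (upStep X) P) 0 0 := by
    have h := (analyticAt_cgf hX.exp_up).differentiableAt.hasDerivAt
    rwa [deriv_cgf_zero hX.exp_up, hX.mean, zero_div] at h
  have h2 := (hasDerivAt_iff_tendsto_slope.1 h1).mono_left
    (nhdsWithin_mono 0 fun x (hx : 0 < x) => hx.ne')
  filter_upwards [h2.eventually_lt_const hb, self_mem_nhdsWithin,
    nhdsWithin_le_nhds (isOpen_interior.mem_nhds hX.exp_up)] with t ht ht0 hmem
  have ht0 : 0 < t := ht0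
  refine ⟨hmem, ?_⟩
  rwa [slope_def_field, cgf_zero, sub_zero, sub_zero, div_lt_iff₀ ht0] at ht

/-- Paths that return to zero and never reach the bottom have weight 1. Those that do reach it are
discarded by a union bound over times and Chernoff's bound for the downward walk. -/
lemma le_partitionFn [IsProbabilityMeasure P] (hX : CenteredWalk X P) {lam a : ℝ}
    (hlam : 0 < lam) {N : ℕ} {t : ℝ} (ht0 : 0 ≤ t)
    (ht : t ∈ integrableExpSet (downStep X) P) :
    P.real {ω | walk X N ω = 0} -
      (N + 1) * Real.exp (-t * depth a N + N * cgf (downStep X) P t) ≤ partitionFn X P lam a N := by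
  set A : Set Ω := {ω | walk X N ω = 0 ∧ ∀ n ≤ N, -depth a N < walk X n ω} with hA
  have hAm : MeasurableSet A := by
    refine measurableSet_setOfPred.2 (hX.steps.measurable_of_walk_eq N fun ω ω' h => ?_)
    rw [h N le_rfl]
    exact propext (and_congr_right fun _ => forall₂_congr fun n hn => by rw [h n hn])
  have h1 : P.real A ≤ partitionFn X P lam a N := by
    rw [← integral_indicator_one hAm]
    refine integral_mono ((integrable_const 1).indicator hAm)
      (integrable_weight hX.steps hlam.le a N) fun ω => ?_
    by_cases hω : ω ∈ A
    · rw [Set.indicator_of_mem hω, weight_eq_of_noContact]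
      · rfl
      · rw [leftContact_eq_top_iff, Finset.eq_empty_iff_forall_notMem]
        intro n hn
        obtain ⟨hn1, hn2⟩ := mem_contactTimes.1 hn
        exact absurd hn2 (hω.2 n hn1).ne'
      · exact ⟨fun n hn => (hω.2 n (Finset.mem_Icc.1 hn).2).le, hω.1⟩
    · rw [Set.indicator_of_notMem hω]
      exact weight_nonneg hlam.le a N ω
  have h2 : {ω | walk X N ω = 0} ⊆
      A ∪ ⋃ n ∈ Finset.range (N + 1), {ω | (depth a N : ℝ) ≤ (walk (negStep X) n ω : ℝ)} := by
    intro ω hω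
    by_cases h : ∀ n ≤ N, -depth a N < walk X n ω
    · exact Or.inl ⟨hω, h⟩
    · push Not at h
      obtain ⟨n, hn, h3⟩ := h
      refine Or.inr (Set.mem_iUnion₂.2 ⟨n, Finset.mem_range.2 (by omega), ?_⟩)
      rw [Set.mem_ofPred, walk_neg]
      exact_mod_cast (by linarith : depth a N ≤ -walk X n ω)
  have h0 := cgf_nonneg hX.neg.exp_up hX.neg.mean (by rwa [upStep_negStep])
  have h3 : ∀ n ∈ Finset.range (N + 1),
      P.real {ω | (depth a N : ℝ) ≤ (walk (negStep X) n ω : ℝ)} ≤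
        Real.exp (-t * depth a N + N * cgf (downStep X) P t) := by
    intro n hn
    refine (measure_le_walk_le hX.neg.steps ht0 (by rwa [upStep_negStep]) n _).trans ?_
    rw [upStep_negStep] at h0 ⊢
    have hn : (n : ℝ) ≤ N := by exact_mod_cast Nat.lt_succ_iff.1 (Finset.mem_range.1 hn)
    gcongr
  have h4 := (measureReal_mono (μ := P) h2).trans (measureReal_union_le _ _)
  have h5 := (measureReal_biUnion_finset_le (μ := P) (Finset.range (N + 1))
    fun n => {ω | (depth a N : ℝ) ≤ (walk (negStep X) n ω : ℝ)}).trans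
    (Finset.sum_le_card_nsmul _ _ _ h3)
  rw [Finset.card_range, nsmul_eq_mul, Nat.cast_succ] at h5
  linarith

lemma CenteredWalk.tendsto_sqrt_mul_measure_walk [IsProbabilityMeasure P]
    (hX : CenteredWalk X P) : Tendsto (fun n : ℕ => √n * P.real {ω | walk X n ω = 0}) atTop
      (𝓝 (1 / √(2 * Real.pi * iteratedDeriv 2 (cgf (upStep X) P) 0))) := by
  have h := tendsto_sqrt_mul_tiltProb hX.steps hX.aper hX.exp_up (n := fun n : ℕ => n)
    (s := fun _ => 0) (k := fun _ => 0) tendsto_id tendsto_const_nhds (by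
      simp [deriv_cgf_zero hX.exp_up, hX.mean])
  simpa [tiltProb] using h

/-- A tilt with Λ₋(t) < (a/2)t makes the discarded paths exponentially rare, while P(S_N = 0) is of
order 1/√N. -/
lemma exists_le_sqrt_mul_partitionFn [IsProbabilityMeasure P] (hX : CenteredWalk X P) {lam a : ℝ}
    (hlam : 0 < lam) (ha : 0 < a) :
    ∃ c, 0 < c ∧ ∀ᶠ N : ℕ in atTop, c ≤ √N * partitionFn X P lam a N := by
  have hv := iteratedDeriv_two_cgf_pos hX.aper hX.exp_up
  obtain ⟨t, ⟨ht, hcgf⟩, ht0⟩ := ((exists_cgf_lt_mul hX.neg (half_pos ha)).and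
    self_mem_nhdsWithin).exists
  have ht0 : 0 < t := ht0
  rw [upStep_negStep] at ht hcgf
  set c := 1 / √(2 * Real.pi * iteratedDeriv 2 (cgf (upStep X) P) 0) with hc
  have hc0 : 0 < c := by positivity
  have herr : Tendsto (fun N : ℕ => √(N : ℝ) * ((N + 1) *
      Real.exp (-t * depth a N + N * cgf (downStep X) P t))) atTop (𝓝 0) := by
    have hlim : Tendsto (fun N : ℕ => 2 * Real.exp t *
        ((N : ℝ) ^ 2 * Real.exp (-(a * t / 2) * N))) atTop (𝓝 0) := by
      have h1 := tendsto_pow_const_mul_const_pow_of_abs_lt_one 2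
        (show |Real.exp (-(a * t / 2))| < 1 by
          rw [abs_of_pos (Real.exp_pos _), Real.exp_lt_one_iff]
          linarith [mul_pos ha ht0])
      have h2 := h1.const_mul (2 * Real.exp t)
      rw [mul_zero] at h2
      refine h2.congr fun N => ?_
      rw [← Real.exp_nat_mul, mul_comm (N : ℝ) (-(a * t / 2))]
    refine squeeze_zero' (Eventually.of_forall fun N => by positivity) ?_ hlim
    filter_upwards [eventually_ge_atTop 1] with N hN
    have hN1 : (1 : ℝ) ≤ N := by exact_mod_cast hN
    have h1 : √(N : ℝ) ≤ N := by
      rw [Real.sqrt_le_left (by linarith)]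
      nlinarith
    have h2 : -t * depth a N + N * cgf (downStep X) P t ≤ t + -(a * t / 2) * N := by
      have h3 := mul_le_mul_of_nonneg_left (lt_depth_add_one (a := a) N).le ht0.le
      have h4 := mul_le_mul_of_nonneg_left hcgf.le (N.cast_nonneg (α := ℝ))
      linarith
    calc _ ≤ (N : ℝ) * ((N + N) * Real.exp (t + -(a * t / 2) * N)) := by gcongr
      _ = _ := by rw [Real.exp_add]; ring
  refine ⟨c / 2, by positivity, ?_⟩
  have hlim := hX.tendsto_sqrt_mul_measure_walk.sub herr
  rw [sub_zero] at hlim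
  filter_upwards [hlim.eventually_const_le (show c / 2 < c by linarith)] with N h1
  have h3 := mul_le_mul_of_nonneg_left (le_partitionFn (a := a) (N := N) hX hlam ht0.le (interior_subset ht))
    (Real.sqrt_nonneg (N : ℝ))
  rw [mul_sub] at h3
  exact h1.trans h3

/-- Outside of the localized regime the free energy vanishes. -/
lemma freeEnergy_eq_zero [IsProbabilityMeasure P] (hX : CenteredWalk X P) {lam a : ℝ}
    (hlam : 0 < lam) (ha : 0 < a)
    (h : ∀ y, 0 < y → lam * returnGF X P y = 1 →
      y ≤ a * (cgfInv (downStep X) P y + cgfInv (upStep X) P y)) :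
    freeEnergy X P lam a = 0 := by
  obtain ⟨K, hK, hup⟩ := exists_partitionFn_le hX hlam ha h
  obtain ⟨c, hc, hlow⟩ := exists_le_sqrt_mul_partitionFn hX hlam ha
  have hlog : Tendsto (fun N : ℕ => Real.log N / N) atTop (𝓝 0) := by
    have := (Real.isLittleO_log_id_atTop.tendsto_div_nhds_zero).comp tendsto_natCast_atTop_atTop
    exact this
  have hinv := tendsto_one_div_atTop_nhds_zero_nat (𝕜 := ℝ)
  have h1 : Tendsto (fun N : ℕ => Real.log c * (1 / (N : ℝ)) - 1 / 2 * (Real.log N / N)) atTop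
      (𝓝 0) := by
    have h := (hinv.const_mul (Real.log c)).sub (hlog.const_mul (1 / 2))
    rwa [mul_zero, mul_zero, sub_zero] at h
  have h2 : Tendsto (fun N : ℕ => Real.log K * (1 / (N : ℝ)) + 2 * (Real.log N / N)) atTop
      (𝓝 0) := by
    simpa using (hinv.const_mul (Real.log K)).add (hlog.const_mul 2)
  refine (tendsto_of_tendsto_of_tendsto_of_le_of_le' h1 h2 ?_ ?_).limUnder_eq
  · filter_upwards [hlow, eventually_gt_atTop 0] with N hN hN0
    have hN0 : (0 : ℝ) < N := by exact_mod_cast hN0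
    have hs := Real.sqrt_pos.2 hN0
    have hZ : 0 < partitionFn X P lam a N := pos_of_mul_pos_right (hc.trans_le hN) hs.le
    have h3 := Real.log_le_log hc hN
    rw [Real.log_mul hs.ne' hZ.ne', Real.log_sqrt hN0.le] at h3
    rw [show Real.log c * (1 / (N : ℝ)) - 1 / 2 * (Real.log N / N) =
      1 / N * (Real.log c - Real.log N / 2) by ring]
    gcongr
    linarith
  · filter_upwards [hlow, hup, eventually_gt_atTop 0] with N hN hN' hN0
    have hN0 : (0 : ℝ) < N := by exact_mod_cast hN0
    have hs := Real.sqrt_pos.2 hN0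
    have hZ : 0 < partitionFn X P lam a N := pos_of_mul_pos_right (hc.trans_le hN) hs.le
    have h3 := Real.log_le_log hZ hN'
    rw [Real.log_mul hK.ne' (by positivity), Real.log_pow] at h3
    rw [show Real.log K * (1 / (N : ℝ)) + 2 * (Real.log N / N) =
      1 / N * (Real.log K + (2 : ℕ) * Real.log N) by push_cast; ring]
    gcongr

end

/-! ### From the hypotheses on λ to the localized regime. -/

section

variable {Ω : Type*} [MeasurableSpace Ω] {X : ℕ → Ω → ℤ} {P : Measure Ω}

section

variable [IsProbabilityMeasure P]

lemma exists_of_freeEnergy_pos (hX : CenteredWalk X P) {lam a : ℝ} (hlam : 0 < lam) (ha : 0 < a)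
    (h : 0 < freeEnergy X P lam a) : ∃ y, 0 < y ∧ lam * returnGF X P y = 1 ∧
      a * (cgfInv (downStep X) P y + cgfInv (upStep X) P y) < y := by
  by_contra! hcon
  exact h.ne' (freeEnergy_eq_zero hX hlam ha hcon)

/-- Λ is nonnegative at t/2 and has positive slope there, so its tangent is positive at t. -/
lemma cgf_pos (hX : CenteredWalk X P) {t : ℝ} (ht0 : 0 < t)
    (ht : t ∈ integrableExpSet (upStep X) P) : 0 < cgf (upStep X) P t := by
  have hs := mem_interior_of_lt hX.exp_up ht (half_pos ht0).le (half_lt_self ht0)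
  have h1 := cgf_nonneg hX.exp_up hX.mean (interior_subset hs)
  have h2 := cgf_div_lt_deriv_cgf hX (half_pos ht0) hs
  have h3 := cgf_add_deriv_mul_le hs ht
  have h4 : 0 < deriv (cgf (upStep X) P) (t / 2) := lt_of_le_of_lt (by positivity) h2
  nlinarith

lemma CenteredWalk.measure_one_le_pos (hX : CenteredWalk X P) :
    0 < P.real {ω | 1 ≤ upStep X ω} := by
  obtain ⟨b, hb, hμ⟩ := hX.exists_stepLaw_ne_zero
  refine ENNReal.toReal_pos (fun h => hμ ?_) (measure_ne_top _ _)
  refine measure_mono_null (fun ω (hω : X 0 ω = b) => ?_) h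
  rw [Set.mem_ofPred, upStep, hω]
  exact_mod_cast hb

/-- Needed for lower bounds on `cgfInv`, as the infimum of an empty set would be 0. If the set were
empty, Λ would be finite and below y on the whole half line, contradicting its growth. -/
lemma cgfInv_set_nonempty (hX : CenteredWalk X P) (y : ℝ) :
    {t : ℝ | 0 ≤ t ∧ (FiniteExpMoment (upStep X) P t → y ≤ cgf (upStep X) P t)}.Nonempty := by
  by_contra hne
  have h : ∀ t : ℝ, 0 ≤ t → FiniteExpMoment (upStep X) P t ∧ cgf (upStep X) P t < y := by
    intro t ht
    by_contra hcon
    exact hne ⟨t, ht, fun h1 => not_lt.1 fun h2 => hcon ⟨h1, h2⟩⟩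
  obtain ⟨r, hr, -, hyr⟩ := exists_lt_cgf hX.exp_up hX.measure_one_le_pos (y := y)
    fun t ht htr _ => by
      have h1 : ((t + 1 : ℝ) : EReal) ≤ expRadius (upStep X) P :=
        le_sSup ⟨t + 1, ⟨by linarith, (h _ (by linarith)).1⟩, rfl⟩
      rw [← htr, EReal.coe_le_coe_iff] at h1
      linarith
  exact absurd hyr (not_lt.2 (h r hr.le).2.le)

/-- By convexity every r < t has Λ(r) finite and below y, so no such r belongs to the set defining
the inverse. -/
lemma le_cgfInv (hX : CenteredWalk X P) {t y : ℝ} (ht0 : 0 < t)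
    (ht : t ∈ integrableExpSet (upStep X) P) (hy : 0 < y) (h : cgf (upStep X) P t ≤ y) :
    t ≤ cgfInv (upStep X) P y := by
  refine le_csInf (cgfInv_set_nonempty hX y) fun r hr => ?_
  by_contra! hlt
  have h1 := cgf_le_div_mul_cgf hX.exp_up ht hr.1 hlt
  have h2 := hr.2 (integrable_exp_of_mem_interior (mem_interior_of_lt hX.exp_up ht hr.1 hlt))
  have h3 : r / t < 1 := (div_lt_one ht0).2 hlt
  have h4 : 0 ≤ r / t := div_nonneg hr.1 ht0.le
  nlinarith

/-- The concavity of Λ⁻¹ in the form that Λ⁻¹(z)/z decreases with z. -/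
lemma mul_le_cgfInv_mul (hX : CenteredWalk X P) {t z : ℝ} (ht0 : 0 < t)
    (ht : t ∈ integrableExpSet (upStep X) P) (hz : 0 < z) (h : z ≤ cgf (upStep X) P t) :
    t * z ≤ cgfInv (upStep X) P z * cgf (upStep X) P t := by
  rcases h.eq_or_lt with rfl | h
  · rw [cgfInv_cgf hX.exp_up ht ht0 hz]
  · obtain ⟨s, hs0, hs, rfl⟩ := exists_interior_cgf_eq hX.exp_up ht ht0 hz h
    rw [cgfInv_cgf hX.exp_up (interior_subset hs) hs0 hz]
    rcases lt_trichotomy s t with hst | rfl | hst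
    · have h1 := cgf_le_div_mul_cgf hX.exp_up ht hs0.le hst
      rw [div_mul_eq_mul_div, le_div_iff₀ ht0] at h1
      linarith
    · exact absurd h (lt_irrefl _)
    · have h1 := cgf_le_div_mul_cgf hX.exp_up (interior_subset hs) ht0.le hst
      have h2 : t / s < 1 := (div_lt_one hs0).2 hst
      nlinarith

/-- The wetting free energy of a localized model is bounded below. -/
lemma le_of_mul_cgfInv_lt (hX : CenteredWalk X P) {a τ y : ℝ} (ha : 0 < a) (hτ0 : 0 < τ)
    (hτ : τ ∈ integrableExpSet (upStep X) P) (hcgf : cgf (upStep X) P τ < a * τ) (hy : 0 < y)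
    (h : a * cgfInv (upStep X) P y < y) : a * τ ≤ y := by
  rcases le_total (cgf (upStep X) P τ) y with h1 | h1
  · exact (mul_le_mul_of_nonneg_left (le_cgfInv hX hτ0 hτ hy h1) ha.le).trans h.le
  · exfalso
    have h2 := mul_le_cgfInv_mul hX hτ0 hτ hy h1
    have h3 : 0 ≤ cgfInv (upStep X) P y := Real.sInf_nonneg fun t ht => ht.1
    have h4 : τ * y ≤ cgfInv (upStep X) P y * (a * τ) :=
      h2.trans (mul_le_mul_of_nonneg_left hcgf.le h3)
    nlinarith

lemma CenteredWalk.exists_returnProb_pos (hX : CenteredWalk X P) : ∃ j, 0 < returnProb X P j := by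
  obtain ⟨b, hb, hμb⟩ := hX.exists_stepLaw_ne_zero
  obtain ⟨c, hc, hμc⟩ := hX.exists_stepLaw_neg_ne_zero
  have h := setGcd_returnProb hX.steps hX.aper hb hc hμb hμc
  by_contra! hcon
  rw [show {j | 0 < returnProb X P j} = ∅ from
    Set.eq_empty_of_forall_notMem fun j hj => absurd hj (not_lt.2 (hcon j))] at h
  exact zero_ne_one (Nat.setGcd_eq_zero_iff.2 (Set.empty_subset _) ▸ h)

lemma returnGF_pos (hX : CenteredWalk X P) {y : ℝ} (hy : 0 < y) : 0 < returnGF X P y := by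
  have h1 := returnGF_strictAnti hX.steps hy (lt_add_one y) hX.exists_returnProb_pos
  have h2 : 0 ≤ returnGF X P (y + 1) :=
    tsum_nonneg fun j => mul_nonneg (returnProb_nonneg j) (Real.exp_pos _).le
  linarith

lemma le_of_returnGF_eq (hX : CenteredWalk X P) {l m y z : ℝ} (hz : 0 < z)
    (hl : 0 < l) (hlm : l ≤ m) (h : l * returnGF X P y = 1) (h' : m * returnGF X P z = 1) :
    y ≤ z := by
  by_contra! hlt
  have h1 := returnGF_strictAnti hX.steps hz hlt hX.exists_returnProb_pos
  have h2 := returnGF_pos hX hz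
  nlinarith

/-- Below the saturation point the exponential moments reach the free energy. -/
lemma lt_cgf_of_lt_saturationPoint (hX : CenteredWalk X P) {Y : Ω → ℝ}
    (hY : ∀ t, 0 < t → t ∈ integrableExpSet Y P → 0 < cgf Y P t) {lam y : ℝ} (hlam : 0 < lam)
    (hgf : lam * returnGF X P y = 1)
    (hsat : (lam : EReal) < saturationPoint X P Y) (t : ℝ) (ht0 : 0 < t)
    (htr : (t : EReal) = expRadius Y P) (ht : FiniteExpMoment Y P t) : y < cgf Y P t := by
  by_contra! hle
  have hpos := hY t ht0 ht
  have hG := returnGF_pos hX hpos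
  have hl : 0 < (returnGF X P (cgf Y P t))⁻¹ := inv_pos.2 hG
  have hl1 : (returnGF X P (cgf Y P t))⁻¹ * returnGF X P (cgf Y P t) = 1 := inv_mul_cancel₀ hG.ne'
  -- The inverse of the generating function at Λ(t₀) is the pinning strength whose free energy is
  -- Λ(t₀), hence a competitor for the saturation point. Λ(t₀) ≤ y would force `lam` to be at least
  -- as large.
  have h1 : saturationPoint X P Y ≤ ((returnGF X P (cgf Y P t))⁻¹ : ℝ) :=
    sInf_le ⟨_, ⟨hl, t, ht0, htr, ht, freeEnergy_zero hX hl hpos hl1⟩, rfl⟩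
  have h2 : lam < (returnGF X P (cgf Y P t))⁻¹ := by exact_mod_cast hsat.trans_le h1
  have h3 := returnGF_anti hX.steps hpos hle
  have h4 : lam * returnGF X P (cgf Y P t) < 1 := by
    rw [← hl1]
    exact mul_lt_mul_of_pos_right h2 hG
  nlinarith

/-- Positive free energy is only known for parameters arbitrarily close to `lam` or below it, not at
`lam` itself, so the solution y and the inequality a(t₋ + t₊) ≤ y are both obtained by approximation
from larger parameters. -/
theorem exists_localizedRegime (hX : CenteredWalk X P) {a lam : ℝ} (ha : 0 < a) (hlam : 0 < lam)
    (hcrit : criticalPoint X P a ≤ (lam : EReal))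
    (hsat : (lam : EReal) <
      min (saturationPoint X P (upStep X)) (saturationPoint X P (downStep X))) :
    ∃ y tm tp, LocalizedRegime X P lam a y tm tp := by
  have hloc : ∀ m, lam < m → ∃ l y, 0 < l ∧ l < m ∧ 0 < y ∧ l * returnGF X P y = 1 ∧
      a * (cgfInv (downStep X) P y + cgfInv (upStep X) P y) < y := by
    intro m hm
    obtain ⟨_, ⟨l, ⟨hl, hf⟩, rfl⟩, hlm⟩ := sInf_lt_iff.1
      (hcrit.trans_lt (EReal.coe_lt_coe_iff.2 hm))
    obtain ⟨y, hy⟩ := exists_of_freeEnergy_pos hX hl ha hf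
    exact ⟨l, y, hl, EReal.coe_lt_coe_iff.1 hlm, hy⟩
  have hcm : ∀ y, 0 ≤ cgfInv (downStep X) P y := fun y => Real.sInf_nonneg fun t ht => ht.1
  have hcp : ∀ y, 0 ≤ cgfInv (upStep X) P y := fun y => Real.sInf_nonneg fun t ht => ht.1
  -- Since Λ₊(τ) < aτ, every localized solution is at least aτ. This keeps the solutions away from 0
  -- in the limit and produces a positive y at `lam` itself.
  obtain ⟨τ, ⟨hτ, hτa⟩, hτ0⟩ := ((exists_cgf_lt_mul hX ha).and self_mem_nhdsWithin).exists
  have hτ0 : 0 < τ := hτ0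
  have haτ : 0 < a * τ := by positivity
  have hG : 1 ≤ lam * returnGF X P (a * τ) := by
    by_contra! hlt
    have hpos := returnGF_pos hX haτ
    obtain ⟨l, z, hl, hlm, hz, hlz, h⟩ := hloc (returnGF X P (a * τ))⁻¹ (by
      rwa [← one_div, lt_div_iff₀ hpos])
    have h1 := hcm z
    have h2 := le_of_mul_cgfInv_lt hX ha hτ0 (interior_subset hτ) hτa hz (by nlinarith)
    have h3 := mul_le_mul_of_nonneg_left (returnGF_anti hX.steps haτ h2) hl.le
    rw [← one_div, lt_div_iff₀ hpos] at hlm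
    linarith
  obtain ⟨y, hyτ, hgf⟩ := exists_returnGF_eq hX.steps hlam haτ hG
  have hy : 0 < y := haτ.trans_le hyτ
  obtain ⟨rp, hrp0, hrp, hyrp⟩ := exists_lt_cgf hX.exp_up hX.measure_one_le_pos
    (lt_cgf_of_lt_saturationPoint hX (fun t => cgf_pos hX) hlam hgf
      (hsat.trans_le (min_le_left _ _)))
  obtain ⟨tp, htp0, htp, hcgfp⟩ := exists_interior_cgf_eq hX.exp_up hrp hrp0 hy hyrp
  have hposm := hX.neg.measure_one_le_pos
  have hcgfpos := fun t => cgf_pos hX.neg (t := t)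
  rw [upStep_negStep] at hposm hcgfpos
  obtain ⟨rm, hrm0, hrm, hyrm⟩ := exists_lt_cgf hX.exp_down hposm
    (lt_cgf_of_lt_saturationPoint hX hcgfpos hlam hgf (hsat.trans_le (min_le_right _ _)))
  obtain ⟨tm, htm0, htm, hcgfm⟩ := exists_interior_cgf_eq hX.exp_down hrm hrm0 hy hyrm
  refine ⟨y, tm, tp, hlam, ha, hy, hgf, htm0, htp0, htm, htp, hcgfm, hcgfp, ?_⟩
  -- A value y' > y belongs to a pinning strength above `lam`, below which there is a localized
  -- parameter, with solution z ≤ y'.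
  refine le_of_forall_gt_imp_ge_of_dense fun y' hy' => ?_
  have hm : lam < (returnGF X P y')⁻¹ := by
    have h1 := returnGF_strictAnti hX.steps hy hy' hX.exists_returnProb_pos
    rw [lt_inv_comm₀ hlam (returnGF_pos hX (hy.trans hy')), ← one_div, lt_div_iff₀ hlam]
    nlinarith
  obtain ⟨l, z, hl, hlm, hz, hlz, hlt⟩ := hloc _ hm
  have hzy' : z ≤ y' := le_of_returnGF_eq hX (hy.trans hy') hl hlm.le hlz
    (inv_mul_cancel₀ (returnGF_pos hX (hy.trans hy')).ne')
  -- For z ≤ y, concavity of Λ⁻¹ scales the strict inequality at z up to y; for z ≥ y, monotonicity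
  -- gives t_± ≤ Λ_±⁻¹(z) and hence the bound y'.
  rcases le_total z y with hzy | hzy
  · have h1 := mul_le_cgfInv_mul hX htp0 (interior_subset htp) hz (by rwa [hcgfp])
    have h2 := mul_le_cgfInv_mul hX.neg htm0 (by rw [upStep_negStep]; exact interior_subset htm) hz
      (by rwa [upStep_negStep, hcgfm])
    rw [upStep_negStep, hcgfm] at h2
    rw [hcgfp] at h1
    have h3 : a * (tm + tp) * z ≤ y * z := by nlinarith
    exact (le_of_mul_le_mul_right h3 hz).trans hy'.le
  · have h1 := le_cgfInv hX htp0 (interior_subset htp) hz (by rwa [hcgfp])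
    have h2 := le_cgfInv hX.neg htm0 (by rw [upStep_negStep]; exact interior_subset htm) hz
      (by rwa [upStep_negStep, hcgfm])
    rw [upStep_negStep] at h2
    have h3 : a * (tm + tp) ≤ a * (cgfInv (downStep X) P z + cgfInv (upStep X) P z) := by gcongr
    linarith

end

end

/-! ### Identification of the means and variances. -/

section

variable {Ω : Type*} [MeasurableSpace Ω] {X : ℕ → Ω → ℤ} {P : Measure Ω}

lemma zero_mem_interior_integrableExpSet {Y : Ω → ℝ}
    (h : ∃ t₀ : ℝ, 0 < t₀ ∧ ∀ t : ℝ, |t| < t₀ → FiniteExpMoment Y P t) :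
    0 ∈ interior (integrableExpSet Y P) := by
  obtain ⟨t₀, ht₀, h⟩ := h
  refine mem_interior.2 ⟨Set.Ioo (-t₀) t₀, fun t ht => h t (abs_lt.2 ht), isOpen_Ioo, ?_⟩
  exact ⟨by linarith, ht₀⟩

lemma centeredWalk_of_cramer (hX : IIDSteps X P) (hap : Aperiodic X P)
    (h : ∃ t₀ : ℝ, 0 < t₀ ∧ ∀ t : ℝ, |t| < t₀ → FiniteExpMoment (upStep X) P t)
    (hmean : ∫ ω, upStep X ω ∂P = 0) : CenteredWalk X P where
  steps := hX
  aper := hap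
  exp_up := zero_mem_interior_integrableExpSet h
  exp_down := by
    obtain ⟨t₀, ht₀, h⟩ := h
    refine zero_mem_interior_integrableExpSet ⟨t₀, ht₀, fun t ht => ?_⟩
    have h1 := h (-t) (by rwa [abs_neg])
    simpa only [FiniteExpMoment, upStep, downStep, neg_mul, mul_neg] using h1
  mean := hmean

lemma wStar_cgf [IsProbabilityMeasure P] (hX : CenteredWalk X P) {t : ℝ} (ht0 : 0 < t)
    (ht : t ∈ interior (integrableExpSet (upStep X) P)) (a : ℝ) :
    wStar (upStep X) P a (cgf (upStep X) P t) = legMean X P t a := by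
  rw [wStar, cgfInv_cgf hX.exp_up (interior_subset ht) ht0 (cgf_pos hX ht0 (interior_subset ht)),
    legMean]

/-- Legendre duality: a divided by the mean is Λ'(t), and I''(Λ'(t)) = 1/Λ''(t). -/
lemma legVar_eq [IsProbabilityMeasure P] (hX : CenteredWalk X P) {t : ℝ} (ht0 : 0 < t)
    (ht : t ∈ interior (integrableExpSet (upStep X) P)) {a : ℝ} (ha : 0 < a) :
    legVar X P t a = legMean X P t a ^ 3 /
      (a ^ 2 * rateFnSecondDeriv (upStep X) P (a / legMean X P t a)) := by
  have hD := deriv_cgf_pos hX.exp_up ht0 ht (cgf_pos hX ht0 (interior_subset ht))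
  have hv := iteratedDeriv_two_cgf_pos hX.aper ht
  have h1 : a / legMean X P t a = deriv (cgf (upStep X) P) t := by
    rw [legMean]
    field_simp
  rw [h1, (exists_deriv_cgf_inverse ht0 ht hv).2.1, legVar, legMean]
  field_simp

end

end WettingWell

/-! ### The theorem. -/

open WettingWell in
theorem theorem3p11 {Ω : Type*} [MeasurableSpace Ω] (P : Measure Ω) [IsProbabilityMeasure P]
    (X : ℕ → Ω → ℤ) (hmeas : ∀ i, Measurable (X i)) (hindep : iIndepFun X P)
    (hident : ∀ i, IdentDistrib (X i) (X 0) P P)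
    (haper : Aperiodic X P)
    (hcramer : ∃ t₀ : ℝ, 0 < t₀ ∧ ∀ t : ℝ, |t| < t₀ → FiniteExpMoment (upStep X) P t)
    (hcentered : ∫ ω, upStep X ω ∂P = 0)
    (a lam : ℝ) (ha : 0 < a) (hlam : 0 < lam)
    (hcrit : criticalPoint X P a ≤ (lam : EReal))
    (hsat : (lam : EReal) < min (saturationPoint X P (upStep X)) (saturationPoint X P (downStep X))) :
    -- (i) sharp asymptotics of the partition function
    (∃ c₀ c₁ : ℝ, 0 < c₀ ∧ 0 < c₁ ∧
      Asymptotics.IsEquivalent atTop (fun N : ℕ => partitionFn X P lam a N)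
        (fun N : ℕ => c₁ * Real.exp (freeEnergy X P lam a * N + c₀ * Int.fract (a * N)))) ∧
    -- (ii) local central limit theorem, and its integrated version
    (∃ σ₁ σ₂ : ℝ, 0 < σ₁ ∧ 0 < σ₂ ∧
      σ₁ ^ 2 = uStar X P lam a ^ 3 /
        (a ^ 2 * rateFnSecondDeriv (downStep X) P (a / uStar X P lam a)) ∧
      σ₂ ^ 2 = (1 - vStar X P lam a) ^ 3 /
        (a ^ 2 * rateFnSecondDeriv (upStep X) P (a / (1 - vStar X P lam a))) ∧
      (∀ ε : ℕ → ℝ, Tendsto ε atTop (𝓝 0) →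
        ∃ (C : ℝ) (η : ℕ → ℝ), Tendsto η atTop (𝓝 0) ∧
          ∀ᶠ N : ℕ in atTop, ∀ l r : ℕ,
            |(l : ℝ) / N - uStar X P lam a| ≤ ε N → |(r : ℝ) / N - vStar X P lam a| ≤ ε N →
            ∃ o θ₁ θ₂ : ℝ, |o| ≤ η N ∧ |θ₁| ≤ C ∧ |θ₂| ≤ C ∧
              (gibbs X P lam a N).real
                  {ω | leftContact X a N ω = (l : ℕ∞) ∧ rightContact X a N ω = (r : ℕ∞)} =
                (1 + o) / (2 * Real.pi * N * σ₁ * σ₂) *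
                  Real.exp (-(((l : ℝ) - uStar X P lam a * N) ^ 2 / (2 * σ₁ ^ 2 * N)) *
                    (1 + |(l : ℝ) / N - uStar X P lam a| * θ₁)) *
                  Real.exp (-(((r : ℝ) - vStar X P lam a * N) ^ 2 / (2 * σ₂ ^ 2 * N)) *
                    (1 + |(r : ℝ) / N - vStar X P lam a| * θ₂))) ∧
      (∀ φ : (EReal × EReal) →ᵇ ℝ,
        Tendsto (fun N : ℕ => ∫ ω, φ (rescale (uStar X P lam a) N (leftContact X a N ω),
            rescale (vStar X P lam a) N (rightContact X a N ω)) ∂(gibbs X P lam a N)) atTop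
          (𝓝 (∫ z : ℝ × ℝ, φ ((z.1 : EReal), (z.2 : EReal))
            ∂((gaussianReal 0 (Real.toNNReal (σ₁ ^ 2))).prod
              (gaussianReal 0 (Real.toNNReal (σ₂ ^ 2)))))))) := by

  have hX : CenteredWalk X P :=
    centeredWalk_of_cramer ⟨hmeas, hindep, hident⟩ haper hcramer hcentered
  obtain ⟨y, tm, tp, hr⟩ := exists_localizedRegime hX ha hlam hcrit hsat
  obtain ⟨C₀, hC₀, hζ⟩ := exists_tendsto_wettingZ hX.steps hlam hr.y_pos hr.gf
    (hX.eventually_wettingZ_pos hlam)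
  have hf : freeEnergy X P lam 0 = y := freeEnergy_zero hX hlam hr.y_pos hr.gf
  have htm : tm ∈ interior (integrableExpSet (upStep (negStep X)) P) := by
    rw [upStep_negStep]; exact hr.tm_mem
  have hu : uStar X P lam a = legMean (negStep X) P tm a := by
    rw [uStar, hf, ← hr.cgf_tm, ← upStep_negStep, wStar_cgf hX.neg hr.tm_pos htm]
  have hv : vStar X P lam a = 1 - legMean X P tp a := by
    rw [vStar, hf, ← hr.cgf_tp, wStar_cgf hX hr.tp_pos hr.tp_mem]
  have hS₁ := (hr.profile_down hX).S_pos
  have hS₂ := (hr.profile_up hX).S_pos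
  -- The constant c₀ is t₋ + t₊, because the depth enters the exponent as -(t₋ + t₊)(aN - {aN}).
  refine ⟨⟨tm + tp, amplitude X P lam a tm tp C₀, add_pos hr.tm_pos hr.tp_pos,
    hr.amplitude_pos hX hC₀, hr.isEquivalent_partitionFn hX hC₀ hζ⟩,
    √(legVar (negStep X) P tm a), √(legVar X P tp a), Real.sqrt_pos.2 hS₁, Real.sqrt_pos.2 hS₂,
    ?_, ?_, ?_, ?_⟩
  · rw [Real.sq_sqrt hS₁.le, hu, legVar_eq hX.neg hr.tm_pos htm ha, upStep_negStep]
  · rw [Real.sq_sqrt hS₂.le, hv, sub_sub_cancel, legVar_eq hX hr.tp_pos hr.tp_mem ha]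
  · intro ε hε
    rw [hu, hv]
    exact hr.local_limit hX hC₀ hζ hε
  · intro φ
    rw [hu, hv]
    exact hr.tendsto_integral_rescale hX hC₀ hζ φ
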